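/- **Setting.** $\mathbf{Prof}$ is the monoidal bicategory of small categories, profunctors $P\colon A\nrightarrow B$ (covariant in $A$, contravariant in $B$, with values in sets, composed by coends) and natural transformations, with tensor product $\times$ and unit the terminal category $1$. The *rotational left $⅋$-traced $*$-autonomous pseudomonoid presentation* has * one generating object $C$; * generating 1-cells $m\colon C\otimes C\to C$, $u\colon 1\to C$, $d\colon C\to C\otimes C$, $e\colon C\to 1$, and right adjoints $m\dashv m^{R}$, $u\dashv u^{R}$ (with units and counits as generating 2-cells, subject to the triangle equations); * invertible 2-cells making $(m,u)$ a pseudomonoid and $(d,e)$ a pseudocomonoid (pentagon and triangle equations), and invertible Frobenius 2-cells (in diagrammatic order) $(d\otimes 1)(1\otimes m)\cong m\,d\cong(1\otimes d)(m\otimes 1)$, coherent with the associators, the coassociators, the units and the counits; * a 2-cell $\mathrm{Tr}\colon L\Rightarrow 1_C$, where $L\colon C\to C$ is the partial trace over the left wire of "$m$, then $m^{R}$", its loop being closed by the Frobenius copairing $u\,d\colon 1\to C\otimes C$ (whose two outputs are exchanged by the symmetry) and the Frobenius pairing $m\,e\colon C\otimes C\to 1$; it is subject to the vanishing equations for $u$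 and for $m$ and to the superposing equation, where loops are straightened by the snake isomorphism of the Frobenius duality. An *interpretation* on a small category $C$ in $\mathbf{Prof}$ is a choice of cells of $\mathbf{Prof}$ for the generators, with underlying object $C$, satisfying the equations. A *$*$-autonomous category* (not necessarily symmetric) is a category with monoidal structures $(\otimes,I)$ and $(⅋,\bot)$ and natural, coherent linear distributors $A\otimes(B⅋C)\to(A\otimes B)⅋C$ and $(A⅋B)\otimes C\to A⅋(B\otimes C)$ in which every object has a right and a left negation. *$⅋$ is traced on the left* means: there are functions $\mathrm{tr}^X_{A,B}\colon \mathrm{Hom}(X⅋A,X⅋B)\to \mathrm{Hom}(A,B)$ which are natural in $A$ and $B$ and dinatural in $X$ and satisfy the vanishing axioms for $\bot$ and for $⅋$ and the superposing axiom $\mathrm{tr}^X(\alpha^{-1};(f⅋D);\alpha)=\mathrm{tr}^X(f)⅋D$. An interpretation is *represented* by such a structure if its 1-cells are identified with $$m(X,Y;Z)=\mathrm{Hom}(Z,X⅋Y),\quad u(Z)=\mathrm{Hom}(Z,\bot),\quad d(Z;X,Y)=\mathrm{Hom}(X\otimes Y,Z),\quad e(Z)=\mathrm{Hom}(I,Z),$$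 $$m^{R}(Z;X,Y)=\mathrm{Hom}(X⅋Y,Z),\quad u^{R}(Z)=\mathrm{Hom}(\bot,Z)$$ in such a way that its generating 2-cells are given by the associators and unitors of $⅋$ and $\otimes$, the linear distributors, composition of morphisms, and the trace. **Proposition 3.** Let $C$ be a small Cauchy complete category (all idempotents split). Every interpretation on $C$ of the rotational left $⅋$-traced $*$-autonomous pseudomonoid presentation in $\mathbf{Prof}$ is represented by a $*$-autonomous structure on $C$ in which $⅋$ is traced on the left, and every such structure represents an interpretation. Moreover, whenever $S$ represents $I$ and $S'$ represents $I'$ (with given identifications), compatibility with the identifications is a bijection between the isomorphisms of interpretations $I\cong I'$ (invertible 2-cells between the generating 1-cells which commute with the generating 2-cells) and the isomorphisms of traced $*$-autonomous structures $S\cong S'$ over the identity functor of $C$. -/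

import Mathlib

open CategoryTheory Opposite

universe u

namespace TracedStar

/-! ## Profunctors between small categories

A profunctor from `A` to `B` is Mathlib's `Profunctor.{u} A B = A ⥤ Bᵒᵖ ⥤ Type u`: covariant in the
input, contravariant in the output.  The 2-cells are natural transformations.  Mathlib has the
identities (`Profunctor.id`), the two profunctors of a functor (`Functor.toProfunctor`,
`Functor.toProfunctorRev`) and the restriction along functors on both sides
(`Profunctor.whiskerLeft₂`, used here for the re-bracketings, the symmetry and the unitors);
composition (by coends) and the tensor product (by cartesian products) are defined below. -/

section Prof

variable {A B E A' B' : Type u} [SmallCategory A] [SmallCategory B] [SmallCategory E]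
  [SmallCategory A'] [SmallCategory B']

/-- The elements of a profunctor with input `a` and output `b`. -/
abbrev El (P : Profunctor.{u} A B) (a : A) (b : B) : Type u := (P.obj a).obj (op b)

/-- The action of morphisms on the elements of a profunctor. -/
def act (P : Profunctor.{u} A B) {a a' : A} {b b' : B} (f : a ⟶ a') (g : b' ⟶ b)
    (x : El P a b) : El P a' b' :=
  ((P.map f).app (op b')) ((P.obj a).map g.op x)

lemma act_id (P : Profunctor.{u} A B) {a : A} {b : B} (x : El P a b) :
    act P (𝟙 a) (𝟙 b) x = x := by
  simp [act]

lemma act_act (P : Profunctor.{u} A B) {a a' a'' : A} {b b' b'' : B} (f : a ⟶ a') (g : b' ⟶ b)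
    (f' : a' ⟶ a'') (g' : b'' ⟶ b') (x : El P a b) :
    act P f' g' (act P f g x) = act P (f ≫ f') (g' ≫ g) x := by
  simp only [act, op_comp, Functor.map_comp, NatTrans.comp_app, types_comp_apply]
  rw [← NatTrans.naturality_apply]

/-- The function on elements of a 2-cell. -/
def app₂ {P Q : Profunctor.{u} A B} (θ : P ⟶ Q) {a : A} {b : B} (x : El P a b) : El Q a b :=
  ((θ.app a).app (op b)) x

/-- The relation which defines the coend `∫^b P(a, b) × Q(b, e)`: morphisms slide along the
internal wire. -/
inductive CompRel (P : Profunctor.{u} A B) (Q : Profunctor.{u} B E) (a : A) (e : E) :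
    (Σ b : B, El P a b × El Q b e) → (Σ b : B, El P a b × El Q b e) → Prop
  | slide {b b' : B} (g : b ⟶ b') (x : El P a b') (y : El Q b e) :
      CompRel P Q a e ⟨b, act P (𝟙 a) g x, y⟩ ⟨b', x, act Q g (𝟙 e) y⟩

/-- Composition of profunctors in diagrammatic order (first `P`, then `Q`), by the coend
`∫^b P(a, b) × Q(b, e)`. -/
def comp (P : Profunctor.{u} A B) (Q : Profunctor.{u} B E) : Profunctor.{u} A E :=
  Profunctor.ofCore
    { obj := fun a e => Quot (CompRel P Q a e)
      map := fun {a a' e' e} f g => TypeCat.ofHom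
        (Quot.map (fun z => ⟨z.1, act P f (𝟙 z.1) z.2.1, act Q (𝟙 z.1) g z.2.2⟩) (by
          rintro _ _ ⟨h, x, y⟩
          have key := CompRel.slide (P := P) (Q := Q) (a := a') (e := e') h
            (act P f (𝟙 _) x) (act Q (𝟙 _) g y)
          simp only [act_act, Category.id_comp, Category.comp_id] at key ⊢
          exact key))
      map_id := by
        intro a e
        ext z
        induction z using Quot.inductionOn with
        | h z => exact congrArg (Quot.mk _) (by simp [act_id])
      map_comp := by
        intros
        ext z
        induction z using Quot.inductionOn with
        | h z => exact congrArg (Quot.mk _) (by simp [act_act]) }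

/-- The element of a composite which is represented by a pair of elements with a common
intermediate object.  Every element of a composite is of this form. -/
def glue {P : Profunctor.{u} A B} {Q : Profunctor.{u} B E} {a : A} {b : B} {e : E}
    (x : El P a b) (y : El Q b e) : El (comp P Q) a e :=
  Quot.mk _ ⟨b, x, y⟩

/-- The tensor product of profunctors. -/
def tens (P : Profunctor.{u} A B) (Q : Profunctor.{u} A' B') :
    Profunctor.{u} (A × A') (B × B') :=
  Profunctor.ofCore
    { obj := fun a b => El P a.1 b.1 × El Q a.2 b.2
      map := fun f g => TypeCat.ofHom (fun z => (act P f.1 g.1 z.1, act Q f.2 g.2 z.2))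
      map_id := by
        intros
        apply ConcreteCategory.hom_ext
        intro z
        exact congrArg₂ Prod.mk (act_id P z.1) (act_id Q z.2)
      map_comp := by
        intros
        apply ConcreteCategory.hom_ext
        intro z
        exact congrArg₂ Prod.mk (act_act P _ _ _ _ z.1).symm (act_act Q _ _ _ _ z.2).symm }

/-- The element of a tensor product which is given by a pair of elements. -/
def pair {P : Profunctor.{u} A B} {Q : Profunctor.{u} A' B'} {a : A} {b : B} {a' : A'} {b' : B'}
    (x : El P a b) (y : El Q a' b') : El (tens P Q) (a, a') (b, b') := (x, y)

/-- The identity profunctor, whose elements are the morphisms from the output to the input. -/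
abbrev idP (A : Type u) [SmallCategory A] : Profunctor.{u} A A := Profunctor.id

/-- A morphism, as an element of the identity profunctor. -/
abbrev wire {a b : A} (f : b ⟶ a) : El (idP A) a b := f

/-- A right adjoint of the profunctor `P` in the bicategory of profunctors: a 1-cell `R` with unit
and counit 2-cells which satisfy the two triangle equations (on elements). -/
structure RightAdjoint (P : Profunctor.{u} A B) where
  R : Profunctor.{u} B A
  η : idP A ⟶ comp P R
  ε : comp R P ⟶ idP B
  triangle_left : ∀ {a : A} {b b' : B} (x : El P a b) (p : El P a b') (r : El R b' a),
    app₂ η (wire (𝟙 a)) = glue p r →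
      act P (𝟙 a) (show b ⟶ b' from app₂ ε (glue r x)) p = x
  triangle_right : ∀ {a : A} {b b' : B} (y : El R b a) (p : El P a b') (r : El R b' a),
    app₂ η (wire (𝟙 a)) = glue p r →
      act R (show b' ⟶ b from app₂ ε (glue y p)) (𝟙 a) r = y

/-- The value of the counit of an adjunction of profunctors, as a morphism. -/
def RightAdjoint.counit {P : Profunctor.{u} A B} (h : RightAdjoint P) {a : A} {b b' : B}
    (y : El h.R b a) (x : El P a b') : b' ⟶ b :=
  app₂ h.ε (glue y x)

/-- `h.IsUnit p r`: the pair `(p, r)` represents the value of the unit at the identity. -/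
def RightAdjoint.IsUnit {P : Profunctor.{u} A B} (h : RightAdjoint P) {a : A} {b : B}
    (p : El P a b) (r : El h.R b a) : Prop :=
  app₂ h.η (wire (𝟙 a)) = glue p r

end Prof

/-- The unit 0-cell: the terminal category. -/
abbrev Unit₀ : Type u := Discrete PUnit.{u + 1}

/-- The only object of the unit 0-cell. -/
abbrev pt : Unit₀.{u} := ⟨PUnit.unit⟩

/-! ## The presentation, interpreted in the monoidal bicategory of profunctors

An interpretation assigns to each generator of the presentation a cell of the same shape, such that
the equations hold.  The equations between pasting diagrams are written on elements: a 2-cell acts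
on a part of a diagram by replacing a representing tuple by another one, and since every element
of a composite 1-cell has a representing tuple, the equations below determine (and are determined
by) the equality of the pasted 2-cells.  Wires which carry an identity are not displayed. -/

section Presentation

variable (C : Type u) [SmallCategory C]

/-- Pseudomonoid: the generators. -/
structure PseudomonoidData where
  mul : Profunctor.{u} (C × C) C
  one : Profunctor.{u} Unit₀.{u} C
  assoc : comp (tens mul (idP C)) mul ≅
    (comp (tens (idP C) mul) mul).whiskerLeft₂ (prod.associator C C C) (𝟭 C)
  leftUnit : (comp (tens one (idP C)) mul).whiskerLeft₂ (prod.leftInverseUnitor C) (𝟭 C) ≅ idP C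
  rightUnit : (comp (tens (idP C) one) mul).whiskerLeft₂ (prod.rightInverseUnitor C) (𝟭 C) ≅ idP C

/-- Pseudocomonoid: the generators. -/
structure PseudocomonoidData where
  comul : Profunctor.{u} C (C × C)
  counit : Profunctor.{u} C Unit₀.{u}
  coassoc : comp comul (tens comul (idP C)) ≅
    (comp comul (tens (idP C) comul)).whiskerLeft₂ (𝟭 C) (prod.associator C C C)
  leftCounit :
    (comp comul (tens counit (idP C))).whiskerLeft₂ (𝟭 C) (prod.leftInverseUnitor C) ≅ idP C
  rightCounit :
    (comp comul (tens (idP C) counit)).whiskerLeft₂ (𝟭 C) (prod.rightInverseUnitor C) ≅ idP C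

variable {C}

section Monoid

variable (M : PseudomonoidData C)

/-- The associator 2-cell sends the left-bracketed pair `(a, b)` to the right-bracketed pair
`(p, q)`. -/
def PseudomonoidData.Assoc {X Y Z V U W : C} (a : El M.mul (X, Y) V) (b : El M.mul (V, Z) W)
    (p : El M.mul (Y, Z) U) (q : El M.mul (X, U) W) : Prop :=
  app₂ M.assoc.hom (a := ((X, Y), Z)) (b := W) (glue (pair a (wire (𝟙 Z))) b) =
    glue (pair (wire (𝟙 X)) p) q

/-- The value of the left unit 2-cell, as a morphism. -/
def PseudomonoidData.lam {X W P : C} (p : El M.one pt P) (a : El M.mul (P, X) W) : W ⟶ X :=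
  app₂ M.leftUnit.hom (a := X) (b := W) (glue (pair p (wire (𝟙 X))) a)

/-- The value of the right unit 2-cell, as a morphism. -/
def PseudomonoidData.rho {X W P : C} (p : El M.one pt P) (a : El M.mul (X, P) W) : W ⟶ X :=
  app₂ M.rightUnit.hom (a := X) (b := W) (glue (pair (wire (𝟙 X)) p) a)

end Monoid

section Comonoid

variable (K : PseudocomonoidData C)

/-- The coassociator 2-cell sends the left-bracketed pair `(a, b)` to the right-bracketed pair
`(p, q)`. -/
def PseudocomonoidData.Coassoc {X Y Z V U W : C} (a : El K.comul W (V, Z))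
    (b : El K.comul V (X, Y)) (p : El K.comul W (X, U)) (q : El K.comul U (Y, Z)) : Prop :=
  app₂ K.coassoc.hom (a := W) (b := ((X, Y), Z)) (glue a (pair b (wire (𝟙 Z)))) =
    glue p (pair (wire (𝟙 X)) q)

/-- The value of the left counit 2-cell, as a morphism. -/
def PseudocomonoidData.colam {X W P : C} (a : El K.comul W (P, X)) (t : El K.counit P pt) :
    X ⟶ W :=
  app₂ K.leftCounit.hom (a := W) (b := X) (glue a (pair t (wire (𝟙 X))))

/-- The value of the right counit 2-cell, as a morphism. -/
def PseudocomonoidData.corho {X W P : C} (a : El K.comul W (X, P)) (t : El K.counit P pt) :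
    X ⟶ W :=
  app₂ K.rightCounit.hom (a := W) (b := X) (glue a (pair (wire (𝟙 X)) t))

end Comonoid

variable (C)

/-- Pseudomonoid: generators, pentagon and triangle. -/
structure Pseudomonoid extends PseudomonoidData C where
  pentagon : ∀ {X Y Z T V V' W U Q U' Q' R : C}
    {a : El mul (X, Y) V} {b : El mul (V, Z) V'} {c : El mul (V', T) W}
    {p : El mul (Z, T) U} {q : El mul (V, U) W} {r : El mul (Y, U) Q} {s : El mul (X, Q) W}
    {p' : El mul (Y, Z) U'} {q' : El mul (X, U') V'} {p'' : El mul (U', T) Q'}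
    {q'' : El mul (X, Q') W} {r' : El mul (Z, T) R} {s' : El mul (Y, R) Q'},
    toPseudomonoidData.Assoc b c p q → toPseudomonoidData.Assoc a q r s →
    toPseudomonoidData.Assoc a b p' q' → toPseudomonoidData.Assoc q' c p'' q'' →
    toPseudomonoidData.Assoc p' p'' r' s' →
    (glue (pair (wire (𝟙 X)) (pair (wire (𝟙 Y)) p)) (glue (pair (wire (𝟙 X)) r) s) :
      El (comp (tens (idP C) (tens (idP C) mul)) (comp (tens (idP C) mul) mul))
        (X, (Y, (Z, T))) W) =
    glue (pair (wire (𝟙 X)) (pair (wire (𝟙 Y)) r')) (glue (pair (wire (𝟙 X)) s') q'')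
  triangle : ∀ {X Z P V U W : C} {p : El one pt P} {a : El mul (X, P) V} {b : El mul (V, Z) W}
    {r : El mul (P, Z) U} {s : El mul (X, U) W}, toPseudomonoidData.Assoc a b r s →
    act mul (show (V, Z) ⟶ (X, Z) from (toPseudomonoidData.rho p a, 𝟙 Z)) (𝟙 W) b =
      act mul (show (X, U) ⟶ (X, Z) from (𝟙 X, toPseudomonoidData.lam p r)) (𝟙 W) s

/-- Pseudocomonoid: generators, pentagon and triangle. -/
structure Pseudocomonoid extends PseudocomonoidData C where
  copentagon : ∀ {X Y Z T V V' W U Q U' Q' R : C}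
    {a : El comul V (X, Y)} {b : El comul V' (V, Z)} {c : El comul W (V', T)}
    {p : El comul U (Z, T)} {q : El comul W (V, U)} {r : El comul Q (Y, U)} {s : El comul W (X, Q)}
    {p' : El comul U' (Y, Z)} {q' : El comul V' (X, U')} {p'' : El comul Q' (U', T)}
    {q'' : El comul W (X, Q')} {r' : El comul R (Z, T)} {s' : El comul Q' (Y, R)},
    toPseudocomonoidData.Coassoc c b q p → toPseudocomonoidData.Coassoc q a s r →
    toPseudocomonoidData.Coassoc b a q' p' → toPseudocomonoidData.Coassoc c q' q'' p'' →
    toPseudocomonoidData.Coassoc p'' p' s' r' →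
    (glue s (glue (pair (wire (𝟙 X)) r) (pair (wire (𝟙 X)) (pair (wire (𝟙 Y)) p))) :
      El (comp comul (comp (tens (idP C) comul) (tens (idP C) (tens (idP C) comul))))
        W (X, (Y, (Z, T)))) =
    glue q'' (glue (pair (wire (𝟙 X)) s') (pair (wire (𝟙 X)) (pair (wire (𝟙 Y)) r')))
  cotriangle : ∀ {X Z P V U W : C} {t : El counit P pt} {a : El comul V (X, P)}
    {b : El comul W (V, Z)} {r : El comul U (P, Z)} {s : El comul W (X, U)},
    toPseudocomonoidData.Coassoc b a s r →
    act comul (𝟙 W) (show (X, Z) ⟶ (V, Z) from (toPseudocomonoidData.corho a t, 𝟙 Z)) b =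
      act comul (𝟙 W) (show (X, Z) ⟶ (X, U) from (𝟙 X, toPseudocomonoidData.colam r t)) s

/-- Frobenius pseudomonoid: a pseudomonoid and a pseudocomonoid on the same object, and the two
invertible Frobenius 2-cells. -/
structure FrobeniusData extends Pseudomonoid C, Pseudocomonoid C where
  frobL : comp (tens comul (idP C))
      ((tens (idP C) mul).whiskerLeft₂ (prod.associator C C C) (𝟭 (C × C))) ≅ comp mul comul
  frobR : comp (tens (idP C) comul)
      ((tens mul (idP C)).whiskerLeft₂ (prod.inverseAssociator C C C) (𝟭 (C × C))) ≅ comp mul comul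

variable {C}

/-- The left Frobenius 2-cell sends the pair `(c, a)` to the pair `(r, s)`. -/
def FrobeniusData.FrobL (F : FrobeniusData C) {X Y X' Y' V S : C} (c : El F.comul X (X', V))
    (a : El F.mul (V, Y) Y') (r : El F.mul (X, Y) S) (s : El F.comul S (X', Y')) : Prop :=
  app₂ F.frobL.hom (a := (X, Y)) (b := (X', Y'))
    (glue (b := ((X', V), Y)) (pair c (wire (𝟙 Y))) (pair (wire (𝟙 X')) a)) = glue r s

/-- The right Frobenius 2-cell sends the pair `(c, a)` to the pair `(r, s)`. -/
def FrobeniusData.FrobR (F : FrobeniusData C) {X Y X' Y' V S : C} (c : El F.comul Y (V, Y'))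
    (a : El F.mul (X, V) X') (r : El F.mul (X, Y) S) (s : El F.comul S (X', Y')) : Prop :=
  app₂ F.frobR.hom (a := (X, Y)) (b := (X', Y'))
    (glue (b := (X, (V, Y'))) (pair (wire (𝟙 X)) c) (pair a (wire (𝟙 Y')))) = glue r s

variable (C)

/-- Frobenius pseudomonoid: the equations which make the Frobenius 2-cells coherent.  They are
compatible with the associator (`L_assoc`, `R_assoc`, `LR_assoc`), with the coassociator
(`L_coassoc`, `R_coassoc`, `LR_coassoc`), with the units and with the counits. -/
structure FrobeniusPseudomonoid extends FrobeniusData C where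
  L_assoc : ∀ {X Y Z X' Y' V W R S N M S' : C} {c : El comul X (X', V)} {a : El mul (V, Y) W}
    {b : El mul (W, Z) Y'} {p : El mul (X, Y) R} {q : El comul R (X', W)} {r : El mul (R, Z) S}
    {s : El comul S (X', Y')} {p' : El mul (Y, Z) N} {r' : El mul (X, N) S}
    {a' : El mul (Y, Z) M} {b' : El mul (V, M) Y'} {t : El mul (X, M) S'}
    {s' : El comul S' (X', Y')},
    toFrobeniusData.FrobL c a p q → toFrobeniusData.FrobL q b r s →
    toPseudomonoidData.Assoc p r p' r' →
    toPseudomonoidData.Assoc a b a' b' → toFrobeniusData.FrobL c b' t s' →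
    (glue (pair (wire (𝟙 X)) p') (glue r' s) :
      El (comp (tens (idP C) mul) (comp mul comul)) (X, (Y, Z)) (X', Y')) =
    glue (pair (wire (𝟙 X)) a') (glue t s')
  R_assoc : ∀ {X Y Z X' Y' V W R S N M S' : C} {c : El comul Z (V, Y')} {a : El mul (Y, V) W}
    {b : El mul (X, W) X'} {p : El mul (Y, Z) R} {q : El comul R (W, Y')} {r : El mul (X, R) S}
    {s : El comul S (X', Y')} {p' : El mul (X, Y) N} {r' : El mul (N, Z) S}
    {a' : El mul (X, Y) M} {b' : El mul (M, V) X'} {t : El mul (M, Z) S'}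
    {s' : El comul S' (X', Y')},
    toFrobeniusData.FrobR c a p q → toFrobeniusData.FrobR q b r s →
    toPseudomonoidData.Assoc p' r' p r →
    toPseudomonoidData.Assoc a' b' a b → toFrobeniusData.FrobR c b' t s' →
    (glue (pair p' (wire (𝟙 Z))) (glue r' s) :
      El (comp (tens mul (idP C)) (comp mul comul)) ((X, Y), Z) (X', Y')) =
    glue (pair a' (wire (𝟙 Z))) (glue t s')
  LR_assoc : ∀ {X Y Z X' Y' U V R S N N' S' : C} {c : El comul Y (U, V)} {a : El mul (X, U) X'}
    {b : El mul (V, Z) Y'} {p : El mul (X, Y) R} {q : El comul R (X', V)} {r : El mul (R, Z) S}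
    {s : El comul S (X', Y')} {p' : El mul (Y, Z) N} {r' : El mul (X, N) S}
    {a' : El mul (Y, Z) N'} {q' : El comul N' (U, Y')} {t : El mul (X, N') S'}
    {s' : El comul S' (X', Y')},
    toFrobeniusData.FrobR c a p q → toFrobeniusData.FrobL q b r s →
    toPseudomonoidData.Assoc p r p' r' →
    toFrobeniusData.FrobL c b a' q' → toFrobeniusData.FrobR q' a t s' →
    (glue (pair (wire (𝟙 X)) p') (glue r' s) :
      El (comp (tens (idP C) mul) (comp mul comul)) (X, (Y, Z)) (X', Y')) =
    glue (pair (wire (𝟙 X)) a') (glue t s')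
  L_coassoc : ∀ {X Y X₁ X₂ Y' U V R S T S' R' : C} {c : El comul X (X₁, U)}
    {c' : El comul U (X₂, V)} {a : El mul (V, Y) Y'} {p : El mul (U, Y) R}
    {q : El comul R (X₂, Y')} {r : El mul (X, Y) S} {s : El comul S (X₁, R)}
    {f : El comul X (T, V)} {f' : El comul T (X₁, X₂)} {r' : El mul (X, Y) S'}
    {s' : El comul S' (T, Y')} {t : El comul S' (X₁, R')} {q' : El comul R' (X₂, Y')},
    toFrobeniusData.FrobL c' a p q → toFrobeniusData.FrobL c p r s →
    toPseudocomonoidData.Coassoc f f' c c' →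
    toFrobeniusData.FrobL f a r' s' → toPseudocomonoidData.Coassoc s' f' t q' →
    (glue r (glue s (pair (wire (𝟙 X₁)) q)) :
      El (comp mul (comp comul (tens (idP C) comul))) (X, Y) (X₁, (X₂, Y'))) =
    glue r' (glue t (pair (wire (𝟙 X₁)) q'))
  R_coassoc : ∀ {X Y Y₁ Y₂ X' U V R S T S' R' : C} {c : El comul Y (U, Y₂)}
    {c' : El comul U (V, Y₁)} {a : El mul (X, V) X'} {p : El mul (X, U) R}
    {q : El comul R (X', Y₁)} {r : El mul (X, Y) S} {s : El comul S (R, Y₂)}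
    {f : El comul Y (V, T)} {f' : El comul T (Y₁, Y₂)} {r' : El mul (X, Y) S'}
    {s' : El comul S' (X', T)} {t : El comul S' (R', Y₂)} {q' : El comul R' (X', Y₁)},
    toFrobeniusData.FrobR c' a p q → toFrobeniusData.FrobR c p r s →
    toPseudocomonoidData.Coassoc c c' f f' →
    toFrobeniusData.FrobR f a r' s' → toPseudocomonoidData.Coassoc t q' s' f' →
    (glue r (glue s (pair q (wire (𝟙 Y₂)))) :
      El (comp mul (comp comul (tens comul (idP C)))) (X, Y) ((X', Y₁), Y₂)) =
    glue r' (glue t (pair q' (wire (𝟙 Y₂))))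
  LR_coassoc : ∀ {X Y X' Y' V W M R S N N' S' : C} {c : El comul X (X', V)} {f : El comul Y (W, Y')}
    {a : El mul (V, W) M} {p : El mul (X, W) R} {q : El comul R (X', M)} {r : El mul (X, Y) S}
    {s : El comul S (R, Y')} {s' : El comul S (X', N)} {q' : El comul N (M, Y')}
    {p' : El mul (V, Y) N'} {g : El comul N' (M, Y')} {r' : El mul (X, Y) S'}
    {t : El comul S' (X', N')},
    toFrobeniusData.FrobL c a p q → toFrobeniusData.FrobR f p r s →
    toPseudocomonoidData.Coassoc s q s' q' →
    toFrobeniusData.FrobR f a p' g → toFrobeniusData.FrobL c p' r' t →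
    (glue r (glue s' (pair (wire (𝟙 X')) q')) :
      El (comp mul (comp comul (tens (idP C) comul))) (X, Y) (X', (M, Y'))) =
    glue r' (glue t (pair (wire (𝟙 X')) g))
  L_unit : ∀ {X X' Y' V P S : C} {p : El one pt P} {c : El comul X (X', V)} {a : El mul (V, P) Y'}
    {r : El mul (X, P) S} {s : El comul S (X', Y')}, toFrobeniusData.FrobL c a r s →
    act comul (𝟙 X) (show (X', Y') ⟶ (X', V) from (𝟙 X', toPseudomonoidData.rho p a)) c =
      act comul (toPseudomonoidData.rho p r) (𝟙 (X', Y')) s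
  R_unit : ∀ {Y X' Y' V P S : C} {p : El one pt P} {c : El comul Y (V, Y')} {a : El mul (P, V) X'}
    {r : El mul (P, Y) S} {s : El comul S (X', Y')}, toFrobeniusData.FrobR c a r s →
    act comul (𝟙 Y) (show (X', Y') ⟶ (V, Y') from (toPseudomonoidData.lam p a, 𝟙 Y')) c =
      act comul (toPseudomonoidData.lam p r) (𝟙 (X', Y')) s
  L_counit : ∀ {X Y Y' V P S : C} {t : El counit P pt} {c : El comul X (P, V)}
    {a : El mul (V, Y) Y'} {r : El mul (X, Y) S} {s : El comul S (P, Y')},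
    toFrobeniusData.FrobL c a r s →
    act mul (show (V, Y) ⟶ (X, Y) from (toPseudocomonoidData.colam c t, 𝟙 Y)) (𝟙 Y') a =
      act mul (𝟙 (X, Y)) (toPseudocomonoidData.colam s t) r
  R_counit : ∀ {X Y X' V P S : C} {t : El counit P pt} {c : El comul Y (V, P)}
    {a : El mul (X, V) X'} {r : El mul (X, Y) S} {s : El comul S (X', P)},
    toFrobeniusData.FrobR c a r s →
    act mul (show (X, V) ⟶ (X, Y) from (𝟙 X, toPseudocomonoidData.corho c t)) (𝟙 X') a =
      act mul (𝟙 (X, Y)) (toPseudocomonoidData.corho s t) r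

/-- Right-adjoint Frobenius pseudomonoid: right adjoints of the multiplication and of the unit are
added. -/
structure RightAdjointFrobenius extends FrobeniusPseudomonoid C where
  mulAdj : RightAdjoint mul
  oneAdj : RightAdjoint one

variable {C}

namespace RightAdjointFrobenius

/-- The copairing of the Frobenius duality. -/
def copairing (F : RightAdjointFrobenius C) : Profunctor.{u} Unit₀.{u} (C × C) := comp F.one F.comul

/-- The pairing of the Frobenius duality. -/
def pairing (F : RightAdjointFrobenius C) : Profunctor.{u} (C × C) Unit₀.{u} := comp F.mul F.counit

/-- The re-ordering `((x, y), z) ↦ (y, (x, z))` of three wires. -/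
def reorder (C : Type u) [SmallCategory C] : (C × C) × C ⥤ C × (C × C) :=
  (CategoryTheory.Prod.swap C C).prod (𝟭 C) ⋙ prod.associator C C C

/-- The 1-cell which is the source of the trace: the partial trace over the left wire of
"multiply, then apply the right adjoint of the multiplication", where the loop on the left is
closed by the copairing and the pairing of the Frobenius duality (instead of a cup and a cap of a
compact structure). -/
def loopCell (F : RightAdjointFrobenius C) : Profunctor.{u} C C :=
  (comp (tens F.copairing (idP C))
    (comp ((tens (idP C) F.mul).whiskerLeft₂ (reorder C) (𝟭 (C × C)))
      (comp (tens (idP C) F.mulAdj.R)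
        ((tens F.pairing (idP C)).whiskerLeft₂ (prod.inverseAssociator C C C)
          (𝟭 (Unit₀.{u} × C)))))).whiskerLeft₂
    (prod.leftInverseUnitor C) (prod.leftInverseUnitor C)

/-- A representative of an element of the loop: the copairing with outputs `X`, `Y` and the pairing
with inputs `Y`, `X'`. -/
structure Loop (F : RightAdjointFrobenius C) (X X' : C) where
  {P Y Q : C}
  p : El F.one pt P
  c : El F.comul P (X, Y)
  s : El F.mul (Y, X') Q
  t : El F.counit Q pt

/-- The snake isomorphism of the Frobenius duality straightens the loop `ℓ` to the morphism `h`. -/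
def Loop.Snake {F : RightAdjointFrobenius C} {X X' : C} (ℓ : F.Loop X X') (h : X ⟶ X') : Prop :=
  ∃ (R : C) (a : El F.mul (ℓ.P, X') R) (b : El F.comul R (X, ℓ.Q)), F.FrobL ℓ.c ℓ.s a b ∧
    h = F.corho b ℓ.t ≫ F.lam ℓ.p a

/-- The element of the source of the trace with a given loop and given elements of the
multiplication and of its right adjoint. -/
def loopMk (F : RightAdjointFrobenius C) {X X' A B Z : C} (ℓ : F.Loop X X')
    (v : El F.mul (X, B) Z) (w : El F.mulAdj.R Z (X', A)) : El F.loopCell B A :=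
  glue (P := tens F.copairing (idP C)) (a := (pt, B)) (b := ((X, ℓ.Y), B)) (e := (pt, A))
    (pair (glue ℓ.p ℓ.c) (wire (𝟙 B)))
    (glue (b := (ℓ.Y, Z)) (pair (wire (𝟙 ℓ.Y)) v)
      (glue (b := (ℓ.Y, (X', A))) (pair (wire (𝟙 ℓ.Y)) w)
        (pair (P := F.pairing) (glue ℓ.s ℓ.t) (wire (𝟙 A)))))

end RightAdjointFrobenius

/-- The value of a 2-cell from the loop 1-cell to the identity, as a morphism. -/
def trVal {F : RightAdjointFrobenius C} (τ : F.loopCell ⟶ idP C) {X X' A B Z : C}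
    (ℓ : F.Loop X X') (v : El F.mul (X, B) Z) (w : El F.mulAdj.R Z (X', A)) : A ⟶ B :=
  app₂ τ (F.loopMk ℓ v w)

variable (C)

/-- An interpretation, with underlying category `C`, of the rotational left `⅋`-traced
`*`-autonomous pseudomonoid presentation: a right-adjoint Frobenius pseudomonoid with a 2-cell from
the loop 1-cell to the identity, which satisfies the vanishing equations (for the unit and for the
multiplication) and the superposing equation. -/
structure Interpretation extends RightAdjointFrobenius C where
  trace : toRightAdjointFrobenius.loopCell ⟶ idP C
  vanishing_unit : ∀ {A B X X' Z X₀ : C} (x : El one pt X) (y : El oneAdj.R X' pt)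
    (v : El mul (X, B) Z) (w : El mulAdj.R Z (X', A)) (ℓ : toRightAdjointFrobenius.Loop X X')
    (x₀ : El one pt X₀) (a₀ : El mul (X₀, A) A),
    ℓ.Snake (oneAdj.counit y x) → toPseudomonoidData.lam x₀ a₀ = 𝟙 A →
    trVal trace ℓ v w =
      mulAdj.counit w
        (act mul (show (X₀, A) ⟶ (X', A) from (oneAdj.counit y x₀, 𝟙 A)) (𝟙 A) a₀) ≫
      toPseudomonoidData.lam x v
  vanishing_mul : ∀ {A B X X' Y Y' A₁ Z₁ Z₂ V V' U U' : C}
    {hX : X ⟶ X'} {hY : Y ⟶ Y'} {ℓX : toRightAdjointFrobenius.Loop X X'}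
    {ℓY : toRightAdjointFrobenius.Loop Y Y'} {ℓV : toRightAdjointFrobenius.Loop V V'}
    {v₁ : El mul (Y, B) Z₁} {v₂ : El mul (X, Z₁) Z₂}
    {w₂ : El mulAdj.R Z₂ (X', A₁)} {w₁ : El mulAdj.R A₁ (Y', A)}
    {q : El mul (X, Y) V} {r : El mul (V, B) Z₂}
    {a : El mul (X', Y') V'} {q' : El mulAdj.R V' (X', Y')}
    {b : El mul (V', A) U} {r₀ : El mulAdj.R U (V', A)}
    {b' : El mul (Y', A) U'} {a' : El mul (X', U') U},
    ℓX.Snake hX → ℓY.Snake hY → toPseudomonoidData.Assoc q r v₁ v₂ →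
    mulAdj.IsUnit a q' → mulAdj.IsUnit b r₀ → toPseudomonoidData.Assoc a b b' a' →
    ℓV.Snake (mulAdj.counit q'
      (act mul (show (X, Y) ⟶ (X', Y') from (hX, hY)) (𝟙 V) q)) →
    trVal trace ℓV r
        (act mulAdj.R (mulAdj.counit w₂
          (act mul (show (X', U') ⟶ (X', A₁) from (𝟙 X', mulAdj.counit w₁ b')) (𝟙 U) a'))
          (𝟙 (V', A)) r₀) =
      trVal trace ℓY (act mul (𝟙 (Y, B)) (trVal trace ℓX v₂ w₂) v₁) w₁
  superposing : ∀ {A B D E E' X X' Z Z' U V : C} {ℓ : toRightAdjointFrobenius.Loop X X'}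
    {v : El mul (X, B) Z} {w : El mulAdj.R Z (X', A)} {g : El mul (A, D) E}
    {k : El mul (Z, D) Z'} {k' : El mulAdj.R Z' (Z, D)}
    {n : El mul (B, D) E'} {v' : El mul (X, E') Z'}
    {b : El mul (X', E) U} {r₀ : El mulAdj.R U (X', E)}
    {a : El mul (X', A) V} {b' : El mul (V, D) U},
    mulAdj.IsUnit k k' → toPseudomonoidData.Assoc v k n v' →
    mulAdj.IsUnit b r₀ → toPseudomonoidData.Assoc a b' g b →
    act mul (𝟙 (B, D))
        (trVal trace ℓ v'
          (act mulAdj.R (mulAdj.counit k'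
            (act mul (show (V, D) ⟶ (Z, D) from (mulAdj.counit w a, 𝟙 D)) (𝟙 U) b'))
            (𝟙 (X', E)) r₀)) n =
      act mul (show (A, D) ⟶ (B, D) from (trVal trace ℓ v w, 𝟙 D)) (𝟙 E) g

variable {C}

/-- An isomorphism of interpretations with the same underlying category: invertible 2-cells between
the generating 1-cells which commute with the generating 2-cells. -/
structure InterpretationIso (I I' : Interpretation C) where
  mul : I.mul ≅ I'.mul
  one : I.one ≅ I'.one
  comul : I.comul ≅ I'.comul
  counit : I.counit ≅ I'.counit
  mulR : I.mulAdj.R ≅ I'.mulAdj.R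
  oneR : I.oneAdj.R ≅ I'.oneAdj.R
  assoc : ∀ {X Y Z V U W : C} {a : El I.mul (X, Y) V} {b : El I.mul (V, Z) W}
    {p : El I.mul (Y, Z) U} {q : El I.mul (X, U) W}, I.Assoc a b p q →
    I'.Assoc (app₂ mul.hom a) (app₂ mul.hom b) (app₂ mul.hom p) (app₂ mul.hom q)
  lam : ∀ {X W P : C} (p : El I.one pt P) (a : El I.mul (P, X) W),
    I'.lam (app₂ one.hom p) (app₂ mul.hom a) = I.lam p a
  rho : ∀ {X W P : C} (p : El I.one pt P) (a : El I.mul (X, P) W),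
    I'.rho (app₂ one.hom p) (app₂ mul.hom a) = I.rho p a
  coassoc : ∀ {X Y Z V U W : C} {a : El I.comul W (V, Z)} {b : El I.comul V (X, Y)}
    {p : El I.comul W (X, U)} {q : El I.comul U (Y, Z)}, I.Coassoc a b p q →
    I'.Coassoc (app₂ comul.hom a) (app₂ comul.hom b) (app₂ comul.hom p) (app₂ comul.hom q)
  colam : ∀ {X W P : C} (a : El I.comul W (P, X)) (t : El I.counit P pt),
    I'.colam (app₂ comul.hom a) (app₂ counit.hom t) = I.colam a t
  corho : ∀ {X W P : C} (a : El I.comul W (X, P)) (t : El I.counit P pt),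
    I'.corho (app₂ comul.hom a) (app₂ counit.hom t) = I.corho a t
  frobL : ∀ {X Y X' Y' V S : C} {c : El I.comul X (X', V)} {a : El I.mul (V, Y) Y'}
    {r : El I.mul (X, Y) S} {s : El I.comul S (X', Y')}, I.FrobL c a r s →
    I'.FrobL (app₂ comul.hom c) (app₂ mul.hom a) (app₂ mul.hom r) (app₂ comul.hom s)
  frobR : ∀ {X Y X' Y' V S : C} {c : El I.comul Y (V, Y')} {a : El I.mul (X, V) X'}
    {r : El I.mul (X, Y) S} {s : El I.comul S (X', Y')}, I.FrobR c a r s →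
    I'.FrobR (app₂ comul.hom c) (app₂ mul.hom a) (app₂ mul.hom r) (app₂ comul.hom s)
  mul_unit : ∀ {X Y Z : C} {a : El I.mul (X, Y) Z} {q : El I.mulAdj.R Z (X, Y)},
    I.mulAdj.IsUnit a q → I'.mulAdj.IsUnit (app₂ mul.hom a) (app₂ mulR.hom q)
  mul_counit : ∀ {X Y Z Z' : C} (w : El I.mulAdj.R Z (X, Y)) (v : El I.mul (X, Y) Z'),
    I'.mulAdj.counit (app₂ mulR.hom w) (app₂ mul.hom v) = I.mulAdj.counit w v
  one_unit : ∀ {Z : C} {x : El I.one pt Z} {y : El I.oneAdj.R Z pt},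
    I.oneAdj.IsUnit x y → I'.oneAdj.IsUnit (app₂ one.hom x) (app₂ oneR.hom y)
  one_counit : ∀ {Z Z' : C} (y : El I.oneAdj.R Z pt) (x : El I.one pt Z'),
    I'.oneAdj.counit (app₂ oneR.hom y) (app₂ one.hom x) = I.oneAdj.counit y x
  trace : ∀ {A B X X' Z : C} (ℓ : I.Loop X X') (v : El I.mul (X, B) Z)
    (w : El I.mulAdj.R Z (X', A)),
    trVal I'.trace ⟨app₂ one.hom ℓ.p, app₂ comul.hom ℓ.c, app₂ mul.hom ℓ.s, app₂ counit.hom ℓ.t⟩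
      (app₂ mul.hom v) (app₂ mulR.hom w) = trVal I.trace ℓ v w

end Presentation

/-! ## Traced `*`-autonomous categories -/

section StarAutonomous

universe v w

/-- A left trace on a monoidal category: the trace over `X` of a morphism `X ⊗ A ⟶ X ⊗ B`. -/
structure LeftTrace (C : Type w) [Category.{v} C] [MonoidalCategory C] where
  tr : ∀ (X : C) {A B : C},
    (MonoidalCategory.tensorObj X A ⟶ MonoidalCategory.tensorObj X B) → (A ⟶ B)
  naturality : ∀ (X : C) {A A' B B' : C} (g : A' ⟶ A)
    (f : MonoidalCategory.tensorObj X A ⟶ MonoidalCategory.tensorObj X B) (h : B ⟶ B'),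
    tr X (MonoidalCategory.whiskerLeft X g ≫ f ≫ MonoidalCategory.whiskerLeft X h) = g ≫ tr X f ≫ h
  sliding : ∀ {X X' : C} {A B : C} (k : X' ⟶ X)
    (f : MonoidalCategory.tensorObj X A ⟶ MonoidalCategory.tensorObj X' B),
    tr X (f ≫ MonoidalCategory.whiskerRight k B) = tr X' (MonoidalCategory.whiskerRight k A ≫ f)
  vanishing_unit : ∀ {A B : C} (f : MonoidalCategory.tensorObj (MonoidalCategory.tensorUnit C) A ⟶
      MonoidalCategory.tensorObj (MonoidalCategory.tensorUnit C) B),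
    tr (MonoidalCategory.tensorUnit C) f =
      (MonoidalCategory.leftUnitor A).inv ≫ f ≫ (MonoidalCategory.leftUnitor B).hom
  vanishing_tensor : ∀ (X Y : C) {A B : C}
    (f : MonoidalCategory.tensorObj (MonoidalCategory.tensorObj X Y) A ⟶
      MonoidalCategory.tensorObj (MonoidalCategory.tensorObj X Y) B),
    tr (MonoidalCategory.tensorObj X Y) f =
      tr Y (tr X ((MonoidalCategory.associator X Y A).inv ≫ f ≫
        (MonoidalCategory.associator X Y B).hom))
  superposing : ∀ (X : C) {A B : C} (D : C)
    (f : MonoidalCategory.tensorObj X A ⟶ MonoidalCategory.tensorObj X B),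
    tr X ((MonoidalCategory.associator X A D).inv ≫ MonoidalCategory.whiskerRight f D ≫
        (MonoidalCategory.associator X B D).hom) = MonoidalCategory.whiskerRight (tr X f) D

/-- Two monoidal structures `(⊗, I)` and `(⅋, ⊥)` on the same category. -/
structure TwoMonoidal (C : Type w) [Category.{v} C] where
  tensor : MonoidalCategory C
  par : MonoidalCategory C

namespace TwoMonoidal

variable {C : Type w} [Category.{v} C] (S : TwoMonoidal C)

/-- `A ⊗ B` -/
abbrev t (A B : C) : C := S.tensor.tensorObj A B
/-- `A ⅋ B` -/
abbrev p (A B : C) : C := S.par.tensorObj A B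
/-- The unit `I` of `⊗`. -/
abbrev tI : C := S.tensor.tensorUnit
/-- The unit `⊥` of `⅋`. -/
abbrev bot : C := S.par.tensorUnit
/-- `A ⊗ f` -/
abbrev tL (A : C) {B B' : C} (f : B ⟶ B') : S.t A B ⟶ S.t A B' := S.tensor.whiskerLeft A f
/-- `f ⊗ B` -/
abbrev tR {A A' : C} (f : A ⟶ A') (B : C) : S.t A B ⟶ S.t A' B := S.tensor.whiskerRight f B
/-- `A ⅋ f` -/
abbrev pL (A : C) {B B' : C} (f : B ⟶ B') : S.p A B ⟶ S.p A B' := S.par.whiskerLeft A f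
/-- `f ⅋ B` -/
abbrev pR {A A' : C} (f : A ⟶ A') (B : C) : S.p A B ⟶ S.p A' B := S.par.whiskerRight f B
/-- `(A ⊗ B) ⊗ C ≅ A ⊗ (B ⊗ C)` -/
abbrev ta (A B D : C) : S.t (S.t A B) D ≅ S.t A (S.t B D) := S.tensor.associator A B D
/-- `(A ⅋ B) ⅋ C ≅ A ⅋ (B ⅋ C)` -/
abbrev pa (A B D : C) : S.p (S.p A B) D ≅ S.p A (S.p B D) := S.par.associator A B D
/-- `I ⊗ A ≅ A` -/
abbrev tlam (A : C) : S.t S.tI A ≅ A := S.tensor.leftUnitor A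
/-- `A ⊗ I ≅ A` -/
abbrev trho (A : C) : S.t A S.tI ≅ A := S.tensor.rightUnitor A
/-- `⊥ ⅋ A ≅ A` -/
abbrev plam (A : C) : S.p S.bot A ≅ A := S.par.leftUnitor A
/-- `A ⅋ ⊥ ≅ A` -/
abbrev prho (A : C) : S.p A S.bot ≅ A := S.par.rightUnitor A

end TwoMonoidal

/-- A linearly distributive category: two monoidal structures with natural linear distributors
`A ⊗ (B ⅋ C) ⟶ (A ⊗ B) ⅋ C` and `(A ⅋ B) ⊗ C ⟶ A ⅋ (B ⊗ C)`, subject to the four coherence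
triangles and the six coherence pentagons. -/
structure LinearlyDistributive (C : Type w) [Category.{v} C] extends TwoMonoidal C where
  δL : ∀ A B D : C, toTwoMonoidal.t A (toTwoMonoidal.p B D) ⟶
    toTwoMonoidal.p (toTwoMonoidal.t A B) D
  δR : ∀ A B D : C, toTwoMonoidal.t (toTwoMonoidal.p A B) D ⟶
    toTwoMonoidal.p A (toTwoMonoidal.t B D)
  δL_natural : ∀ {A A' B B' D D' : C} (f : A ⟶ A') (g : B ⟶ B') (h : D ⟶ D'),
    tensor.tensorHom f (par.tensorHom g h) ≫ δL A' B' D' =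
      δL A B D ≫ par.tensorHom (tensor.tensorHom f g) h
  δR_natural : ∀ {A A' B B' D D' : C} (f : A ⟶ A') (g : B ⟶ B') (h : D ⟶ D'),
    tensor.tensorHom (par.tensorHom f g) h ≫ δR A' B' D' =
      δR A B D ≫ par.tensorHom f (tensor.tensorHom g h)
  δL_tensor_unit : ∀ A B : C,
    δL toTwoMonoidal.tI A B ≫ toTwoMonoidal.pR (toTwoMonoidal.tlam A).hom B =
      (toTwoMonoidal.tlam (toTwoMonoidal.p A B)).hom
  δR_tensor_unit : ∀ A B : C,
    δR A B toTwoMonoidal.tI ≫ toTwoMonoidal.pL A (toTwoMonoidal.trho B).hom =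
      (toTwoMonoidal.trho (toTwoMonoidal.p A B)).hom
  δL_par_unit : ∀ A B : C,
    δL A B toTwoMonoidal.bot ≫ (toTwoMonoidal.prho (toTwoMonoidal.t A B)).hom =
      toTwoMonoidal.tL A (toTwoMonoidal.prho B).hom
  δR_par_unit : ∀ A B : C,
    δR toTwoMonoidal.bot A B ≫ (toTwoMonoidal.plam (toTwoMonoidal.t A B)).hom =
      toTwoMonoidal.tR (toTwoMonoidal.plam A).hom B
  δL_tensor_assoc : ∀ A B D E : C,
    (toTwoMonoidal.ta A B (toTwoMonoidal.p D E)).hom ≫ toTwoMonoidal.tL A (δL B D E) ≫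
        δL A (toTwoMonoidal.t B D) E =
      δL (toTwoMonoidal.t A B) D E ≫ toTwoMonoidal.pR (toTwoMonoidal.ta A B D).hom E
  δR_tensor_assoc : ∀ A B D E : C,
    toTwoMonoidal.tR (δR A B D) E ≫ δR A (toTwoMonoidal.t B D) E ≫
        toTwoMonoidal.pL A (toTwoMonoidal.ta B D E).hom =
      (toTwoMonoidal.ta (toTwoMonoidal.p A B) D E).hom ≫ δR A B (toTwoMonoidal.t D E)
  δL_par_assoc : ∀ A B D E : C,
    δL A (toTwoMonoidal.p B D) E ≫ toTwoMonoidal.pR (δL A B D) E ≫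
        (toTwoMonoidal.pa (toTwoMonoidal.t A B) D E).hom =
      toTwoMonoidal.tL A (toTwoMonoidal.pa B D E).hom ≫ δL A B (toTwoMonoidal.p D E)
  δR_par_assoc : ∀ A B D E : C,
    δR (toTwoMonoidal.p A B) D E ≫ (toTwoMonoidal.pa A B (toTwoMonoidal.t D E)).hom =
      toTwoMonoidal.tR (toTwoMonoidal.pa A B D).hom E ≫ δR A (toTwoMonoidal.p B D) E ≫
        toTwoMonoidal.pL A (δR B D E)
  δ_tensor_assoc : ∀ A B D E : C,
    toTwoMonoidal.tR (δL A B D) E ≫ δR (toTwoMonoidal.t A B) D E =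
      (toTwoMonoidal.ta A (toTwoMonoidal.p B D) E).hom ≫ toTwoMonoidal.tL A (δR B D E) ≫
        δL A B (toTwoMonoidal.t D E)
  δ_par_assoc : ∀ A B D E : C,
    δL (toTwoMonoidal.p A B) D E ≫ toTwoMonoidal.pR (δR A B D) E ≫
        (toTwoMonoidal.pa A (toTwoMonoidal.t B D) E).hom =
      δR A B (toTwoMonoidal.p D E) ≫ toTwoMonoidal.pL A (δL B D E)

/-- `B` is a right linear dual of `A`: there are `A ⊗ B ⟶ ⊥` and `I ⟶ B ⅋ A` which satisfy the two
snake equations. -/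
def LinearlyDistributive.IsLinearDual {C : Type w} [Category.{v} C] (S : LinearlyDistributive C)
    (A B : C) : Prop :=
  ∃ (τ : S.t A B ⟶ S.bot) (γ : S.tI ⟶ S.p B A),
    (S.trho A).inv ≫ S.tL A γ ≫ S.δL A B A ≫ S.pR τ A ≫ (S.plam A).hom = 𝟙 A ∧
    (S.tlam B).inv ≫ S.tR γ B ≫ S.δR B A B ≫ S.pL B τ ≫ (S.prho B).hom = 𝟙 B

/-- A (non-symmetric) `*`-autonomous category: a linearly distributive category in which every
object has a right and a left negation.  As duals are unique up to a unique isomorphism, their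
existence is a property. -/
structure StarAutonomous (C : Type w) [Category.{v} C] extends LinearlyDistributive C where
  exists_right_dual : ∀ A : C, ∃ B : C, toLinearlyDistributive.IsLinearDual A B
  exists_left_dual : ∀ A : C, ∃ B : C, toLinearlyDistributive.IsLinearDual B A

/-- A `*`-autonomous category in which `⅋` is traced on the left. -/
structure TracedStarAutonomous (C : Type w) [Category.{v} C] extends StarAutonomous C where
  trace : @LeftTrace C _ par

/-- The trace over `X` of a morphism `X ⅋ A ⟶ X ⅋ B`. -/
def TracedStarAutonomous.tr {C : Type w} [Category.{v} C] (S : TracedStarAutonomous C) (X : C)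
    {A B : C} (f : S.p X A ⟶ S.p X B) : A ⟶ B :=
  @LeftTrace.tr C _ S.par S.trace X A B f

/-- An isomorphism of traced `*`-autonomous structures on the same category: isomorphisms between
the tensor products, the pars and the units which are natural and commute with the associators, the
unitors, the linear distributors and the traces.  (In other words, the identity functor is an
isomorphism of such structures.) -/
structure StructureIso {C : Type w} [Category.{v} C] (S S' : TracedStarAutonomous C) where
  t : ∀ A B : C, S.t A B ≅ S'.t A B
  tI : S.tI ≅ S'.tI
  p : ∀ A B : C, S.p A B ≅ S'.p A B
  bot : S.bot ≅ S'.bot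
  t_natural : ∀ {A A' B B' : C} (f : A ⟶ A') (g : B ⟶ B'),
    S.tensor.tensorHom f g ≫ (t A' B').hom = (t A B).hom ≫ S'.tensor.tensorHom f g
  p_natural : ∀ {A A' B B' : C} (f : A ⟶ A') (g : B ⟶ B'),
    S.par.tensorHom f g ≫ (p A' B').hom = (p A B).hom ≫ S'.par.tensorHom f g
  t_assoc : ∀ A B D : C, (S.ta A B D).hom ≫ (t A (S.t B D)).hom ≫ S'.tL A (t B D).hom =
    (t (S.t A B) D).hom ≫ S'.tR (t A B).hom D ≫ (S'.ta A B D).hom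
  p_assoc : ∀ A B D : C, (S.pa A B D).hom ≫ (p A (S.p B D)).hom ≫ S'.pL A (p B D).hom =
    (p (S.p A B) D).hom ≫ S'.pR (p A B).hom D ≫ (S'.pa A B D).hom
  t_left : ∀ A : C, (t S.tI A).hom ≫ S'.tR tI.hom A ≫ (S'.tlam A).hom = (S.tlam A).hom
  t_right : ∀ A : C, (t A S.tI).hom ≫ S'.tL A tI.hom ≫ (S'.trho A).hom = (S.trho A).hom
  p_left : ∀ A : C, (p S.bot A).hom ≫ S'.pR bot.hom A ≫ (S'.plam A).hom = (S.plam A).hom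
  p_right : ∀ A : C, (p A S.bot).hom ≫ S'.pL A bot.hom ≫ (S'.prho A).hom = (S.prho A).hom
  δL : ∀ A B D : C, S.δL A B D ≫ (p (S.t A B) D).hom ≫ S'.pR (t A B).hom D =
    (t A (S.p B D)).hom ≫ S'.tL A (p B D).hom ≫ S'.δL A B D
  δR : ∀ A B D : C, S.δR A B D ≫ (p A (S.t B D)).hom ≫ S'.pL A (t B D).hom =
    (t (S.p A B) D).hom ≫ S'.tR (p A B).hom D ≫ S'.δR A B D
  trace : ∀ (X : C) {A B : C} (f : S.p X A ⟶ S.p X B),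
    S'.tr X ((p X A).inv ≫ f ≫ (p X B).hom) = S.tr X f

end StarAutonomous

/-! ## The correspondence -/

section Correspondence

variable {C : Type u} [SmallCategory C]

/-- Identifications of the generating 1-cells of an interpretation `I` with the profunctors of a
traced `*`-autonomous structure `S`: the multiplication and the unit are represented by `⅋` and `⊥`,
the comultiplication and the counit are corepresented by `⊗` and `I`, and the right adjoints of the
multiplication and of the unit are corepresented by `⅋` and `⊥`. -/
structure RepresentingData (I : Interpretation C) (S : TracedStarAutonomous C) where
  mul : I.mul ≅ (@MonoidalCategory.tensor C _ S.par).toProfunctor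
  one : I.one ≅ (Functor.fromPUnit.{u} S.bot).toProfunctor
  comul : I.comul ≅ (@MonoidalCategory.tensor C _ S.tensor).toProfunctorRev
  counit : I.counit ≅ (Functor.fromPUnit.{u} S.tI).toProfunctorRev
  mulR : I.mulAdj.R ≅ (@MonoidalCategory.tensor C _ S.par).toProfunctorRev
  oneR : I.oneAdj.R ≅ (Functor.fromPUnit.{u} S.bot).toProfunctorRev

namespace RepresentingData

variable {I : Interpretation C} {S : TracedStarAutonomous C} (R : RepresentingData I S)

/-- The morphism of an element of the multiplication. -/
def m {X Y Z : C} (a : El I.mul (X, Y) Z) : Z ⟶ S.p X Y := app₂ R.mul.hom a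
/-- The morphism of an element of the unit. -/
def u {Z : C} (x : El I.one pt Z) : Z ⟶ S.bot := app₂ R.one.hom x
/-- The morphism of an element of the comultiplication. -/
def d {X Y Z : C} (c : El I.comul Z (X, Y)) : S.t X Y ⟶ Z := app₂ R.comul.hom c
/-- The morphism of an element of the counit. -/
def e {Z : C} (t : El I.counit Z pt) : S.tI ⟶ Z := app₂ R.counit.hom t
/-- The morphism of an element of the right adjoint of the multiplication. -/
def mR {X Y Z : C} (w : El I.mulAdj.R Z (X, Y)) : S.p X Y ⟶ Z := app₂ R.mulR.hom w
/-- The morphism of an element of the right adjoint of the unit. -/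
def uR {Z : C} (y : El I.oneAdj.R Z pt) : S.bot ⟶ Z := app₂ R.oneR.hom y

end RepresentingData

/-- The interpretation `I` is represented by the traced `*`-autonomous structure `S`: under
identifications of the generating 1-cells with the profunctors of `S`, the generating 2-cells are
given by the structure morphisms of `S`. -/
structure Represents (I : Interpretation C) (S : TracedStarAutonomous C)
    extends RepresentingData I S where
  assoc : ∀ {X Y Z V U W : C} {a : El I.mul (X, Y) V} {b : El I.mul (V, Z) W}
    {p : El I.mul (Y, Z) U} {q : El I.mul (X, U) W}, I.Assoc a b p q →
    toRepresentingData.m b ≫ S.pR (toRepresentingData.m a) Z ≫ (S.pa X Y Z).hom =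
      toRepresentingData.m q ≫ S.pL X (toRepresentingData.m p)
  lam : ∀ {X W P : C} (p : El I.one pt P) (a : El I.mul (P, X) W),
    I.lam p a = toRepresentingData.m a ≫ S.pR (toRepresentingData.u p) X ≫ (S.plam X).hom
  rho : ∀ {X W P : C} (p : El I.one pt P) (a : El I.mul (X, P) W),
    I.rho p a = toRepresentingData.m a ≫ S.pL X (toRepresentingData.u p) ≫ (S.prho X).hom
  coassoc : ∀ {X Y Z V U W : C} {a : El I.comul W (V, Z)} {b : El I.comul V (X, Y)}
    {p : El I.comul W (X, U)} {q : El I.comul U (Y, Z)}, I.Coassoc a b p q →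
    S.tR (toRepresentingData.d b) Z ≫ toRepresentingData.d a =
      (S.ta X Y Z).hom ≫ S.tL X (toRepresentingData.d q) ≫ toRepresentingData.d p
  colam : ∀ {X W P : C} (a : El I.comul W (P, X)) (t : El I.counit P pt),
    I.colam a t = (S.tlam X).inv ≫ S.tR (toRepresentingData.e t) X ≫ toRepresentingData.d a
  corho : ∀ {X W P : C} (a : El I.comul W (X, P)) (t : El I.counit P pt),
    I.corho a t = (S.trho X).inv ≫ S.tL X (toRepresentingData.e t) ≫ toRepresentingData.d a
  frobL : ∀ {X Y X' Y' V Q : C} {c : El I.comul X (X', V)} {a : El I.mul (V, Y) Y'}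
    {r : El I.mul (X, Y) Q} {s : El I.comul Q (X', Y')}, I.FrobL c a r s →
    S.tL X' (toRepresentingData.m a) ≫ S.δL X' V Y ≫ S.pR (toRepresentingData.d c) Y =
      toRepresentingData.d s ≫ toRepresentingData.m r
  frobR : ∀ {X Y X' Y' V Q : C} {c : El I.comul Y (V, Y')} {a : El I.mul (X, V) X'}
    {r : El I.mul (X, Y) Q} {s : El I.comul Q (X', Y')}, I.FrobR c a r s →
    S.tR (toRepresentingData.m a) Y' ≫ S.δR X V Y' ≫ S.pL X (toRepresentingData.d c) =
      toRepresentingData.d s ≫ toRepresentingData.m r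
  mul_unit : ∀ {X Y Z : C} {a : El I.mul (X, Y) Z} {q : El I.mulAdj.R Z (X, Y)},
    I.mulAdj.IsUnit a q → toRepresentingData.mR q ≫ toRepresentingData.m a = 𝟙 (S.p X Y)
  mul_counit : ∀ {X Y Z Z' : C} (w : El I.mulAdj.R Z (X, Y)) (v : El I.mul (X, Y) Z'),
    I.mulAdj.counit w v = toRepresentingData.m v ≫ toRepresentingData.mR w
  one_unit : ∀ {Z : C} {x : El I.one pt Z} {y : El I.oneAdj.R Z pt},
    I.oneAdj.IsUnit x y → toRepresentingData.uR y ≫ toRepresentingData.u x = 𝟙 S.bot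
  one_counit : ∀ {Z Z' : C} (y : El I.oneAdj.R Z pt) (x : El I.one pt Z'),
    I.oneAdj.counit y x = toRepresentingData.u x ≫ toRepresentingData.uR y
  /-- The trace 2-cell is the trace of the morphism `X ⅋ A ⟶ X' ⅋ A ⟶ Z ⟶ X ⅋ B`, where
  `X ⟶ X'` is the value of the loop: the copairing `X ⊗ Y ⟶ ⊥` and the pairing `I ⟶ Y ⅋ X'` are
  contracted by the linear distributor. -/
  trace : ∀ {A B X X' Z : C} (ℓ : I.Loop X X') (v : El I.mul (X, B) Z)
    (w : El I.mulAdj.R Z (X', A)),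
    trVal I.trace ℓ v w = S.tr X
      (S.pR ((S.trho X).inv ≫
          S.tL X (toRepresentingData.e ℓ.t ≫ toRepresentingData.m ℓ.s) ≫ S.δL X ℓ.Y X' ≫
          S.pR (toRepresentingData.d ℓ.c ≫ toRepresentingData.u ℓ.p) X' ≫ (S.plam X').hom) A ≫
        toRepresentingData.mR w ≫ toRepresentingData.m v)

/-- An isomorphism of interpretations and an isomorphism of traced `*`-autonomous structures
correspond to each other under given representations. -/
structure Compatible {I I' : Interpretation C} {S S' : TracedStarAutonomous C}
    (R : Represents I S) (R' : Represents I' S') (f : InterpretationIso I I')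
    (g : StructureIso S S') : Prop where
  mul : ∀ {X Y Z : C} (a : El I.mul (X, Y) Z), R'.m (app₂ f.mul.hom a) = R.m a ≫ (g.p X Y).hom
  one : ∀ {Z : C} (x : El I.one pt Z), R'.u (app₂ f.one.hom x) = R.u x ≫ g.bot.hom
  comul : ∀ {X Y Z : C} (c : El I.comul Z (X, Y)),
    R'.d (app₂ f.comul.hom c) = (g.t X Y).inv ≫ R.d c
  counit : ∀ {Z : C} (t : El I.counit Z pt), R'.e (app₂ f.counit.hom t) = g.tI.inv ≫ R.e t
  mulR : ∀ {X Y Z : C} (w : El I.mulAdj.R Z (X, Y)),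
    R'.mR (app₂ f.mulR.hom w) = (g.p X Y).inv ≫ R.mR w
  oneR : ∀ {Z : C} (y : El I.oneAdj.R Z pt), R'.uR (app₂ f.oneR.hom y) = g.bot.inv ≫ R.uR y

end Correspondence

end TracedStar

namespace TracedStar

/-! ### Elements of composites and tensor products of profunctors -/

section Prof

variable {A B E A' B' : Type u} [SmallCategory A] [SmallCategory B] [SmallCategory E]
  [SmallCategory A'] [SmallCategory B']

/-! Everything rests on Yoneda. A 2-cell between represented (or corepresented) profunctors is a
natural transformation between the representing functors, and a class in a coend with a
(co)represented factor is determined by a single morphism (`glue_eq_iff_rep`, `glue_eq_iff_corep`,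
`glue_eq_iff_mixed`). Once the generating 1-cells are known to be Hom-profunctors, the equations of
the presentation and the axioms of a traced `*`-autonomous category translate into each other: one
evaluates at universal elements in one direction, and computes with the corresponding morphisms in
the other.

From an interpretation to a structure, the real work is representability. For `m` and `u` it comes
from the right adjoints: a pair representing the unit of the adjunction exhibits `P(a, -)` as a
retract of a representable, and idempotents split (`RightAdjoint.exists_representing`). The 1-cells
`d` and `e` have no given adjoints; there the Frobenius 2-cells do the work. Read as strengths `d(X;
X', V) → d(X ⅋ Y; X', V ⅋ Y)` and `d(Y; V, Y') → d(X ⅋ Y; X ⅋ V, Y')`, they yield, since they are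
invertible, for each `X` an object `V`, an element of `d(⊥; X, V)` and an element of `e(V ⅋ X)`
satisfying one snake equation (`exists_left_copairing`). Hence `d(-; X, Y)` is a retract of `Hom(Y,
V ⅋ -)`, which is a retract of some `e(W ⅋ -)`, which is a retract of a corepresentable
(`act_strL_colam_strR`, `exists_retract_counit`). Splitting the resulting idempotent corepresents
`d`; the case `W = ⊥` corepresents `e`.

The linear distributors are the strengths of the universal elements of `d`, and their coherence is
the coherence of the Frobenius 2-cells at universal elements (`FrobDict.toLinearlyDistributive`).
Surjectivity of the Frobenius 2-cells produces pairings and copairings with one of the two snake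
equations; the other composite is then idempotent, and splitting it gives the negations
(`exists_isLinearDual_of_snake`, `exists_isLinearDual_of_cosnake`).

From a structure to an interpretation, the Frobenius 2-cells must be shown invertible: both sides
are compared with `Hom(X' ⊗ Y', X ⅋ Y)`, and transposition along a dual of `X'` (or of `Y'`) brings
every representative into a normal form depending only on its value (`leftFrobMk_curry`,
`rightFrobMk_curry`). The adjunctions are those of representables, and the coherence equations are
diagram chases with the axioms of the distributors.

For the trace, a dual of `X` shows that an element of the loop 1-cell depends on its loop only
through the straightening `X ⟶ X'`, and that it equals one built from a single morphism `X ⅋ A ⟶ X ⅋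
B` (`loopMk_eq_of_dual`). A 2-cell from the loop 1-cell to the identity is therefore read off as a
family of functions on such morphisms: naturality is the naturality of the 2-cell, dinaturality is
the coend relation, and vanishing and superposing are the equations of the presentation. Conversely,
naturality and dinaturality of a trace are what is needed to descend through the three nested coends
of the loop 1-cell (`cellTr`).

For isomorphisms, Yoneda turns invertible 2-cells between generating 1-cells into natural
isomorphisms of the operations and back; `CompatibleIso` holds both at once, and each preservation
condition on one side is shown to imply its counterpart on the other. The components for the right
adjoints are forced by those for `m` and `u`, because the counits must be preserved. Evaluation at
universal elements gives uniqueness. -/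

lemma app₂_act {P Q : Profunctor.{u} A B} (θ : P ⟶ Q) {a a' : A} {b b' : B} (f : a ⟶ a')
    (g : b' ⟶ b) (x : El P a b) : app₂ θ (act P f g x) = act Q f g (app₂ θ x) := by
  simp only [act, app₂]
  have h1 := congrArg (fun t => t.app (op b')) (θ.naturality f)
  have h2 := (θ.app a).naturality g.op
  have h1' := ConcreteCategory.congr_hom h1 ((P.obj a).map g.op x)
  have h2' := ConcreteCategory.congr_hom h2 x
  exact h1'.trans (congrArg _ h2')

@[simp] lemma app₂_hom_inv {P Q : Profunctor.{u} A B} (θ : P ≅ Q) {a : A} {b : B} (x : El P a b) :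
    app₂ θ.inv (app₂ θ.hom x) = x := by
  have h := congrArg (fun t => (t.app a).app (op b)) θ.hom_inv_id
  exact ConcreteCategory.congr_hom h x

@[simp] lemma app₂_inv_hom {P Q : Profunctor.{u} A B} (θ : P ≅ Q) {a : A} {b : B} (x : El Q a b) :
    app₂ θ.hom (app₂ θ.inv x) = x := by
  have h := congrArg (fun t => (t.app a).app (op b)) θ.inv_hom_id
  exact ConcreteCategory.congr_hom h x

lemma app₂_injective {P Q : Profunctor.{u} A B} (θ : P ≅ Q) {a : A} {b : B} {x y : El P a b}
    (h : app₂ θ.hom x = app₂ θ.hom y) : x = y := by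
  rw [← app₂_hom_inv θ x, h, app₂_hom_inv]

lemma hom_ext₂ {P Q : Profunctor.{u} A B} {θ θ' : P ⟶ Q}
    (h : ∀ (a : A) (b : B) (x : El P a b), app₂ θ x = app₂ θ' x) : θ = θ' := by
  ext a b x
  exact h a (unop b) x

/-- A 2-cell from its action on elements. -/
def mkHom (P Q : Profunctor.{u} A B) (F : ∀ (a : A) (b : B), El P a b → El Q a b)
    (h : ∀ {a a' : A} {b b' : B} (f : a ⟶ a') (g : b' ⟶ b) (x : El P a b),
      F a' b' (act P f g x) = act Q f g (F a b x)) : P ⟶ Q where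
  app a :=
    { app := fun b => TypeCat.ofHom (F a (unop b))
      naturality := by
        intro b b' g
        ext x
        have := h (𝟙 a) g.unop x
        simpa [act] using this }
  naturality := by
    intro a a' f
    ext b x
    have := h f (𝟙 (unop b)) x
    simpa [act] using this

/-- An invertible 2-cell from its action on elements. -/
noncomputable def mkIso (P Q : Profunctor.{u} A B) (F : ∀ (a : A) (b : B), El P a b → El Q a b)
    (h : ∀ {a a' : A} {b b' : B} (f : a ⟶ a') (g : b' ⟶ b) (x : El P a b),
      F a' b' (act P f g x) = act Q f g (F a b x))
    (hF : ∀ a b, Function.Bijective (F a b)) : P ≅ Q where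
  hom := mkHom P Q F h
  inv := mkHom Q P (fun a b => (Equiv.ofBijective _ (hF a b)).symm) (by
    intro a a' b b' f g x
    rw [Equiv.symm_apply_eq]
    refine Eq.trans ?_ (h f g _).symm
    exact congrArg _ (Equiv.ofBijective_apply_symm_apply _ (hF a b) x).symm)
  hom_inv_id := hom_ext₂ fun a b x => (Equiv.ofBijective_symm_apply_apply _ (hF a b) x)
  inv_hom_id := hom_ext₂ fun a b x => (Equiv.ofBijective_apply_symm_apply _ (hF a b) x)

lemma glue_slide {P : Profunctor.{u} A B} {Q : Profunctor.{u} B E} {a : A} {b b' : B} {e : E}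
    (g : b ⟶ b') (x : El P a b') (y : El Q b e) :
    (glue (act P (𝟙 a) g x) y : El (comp P Q) a e) = glue x (act Q g (𝟙 e) y) :=
  Quot.sound (CompRel.slide g x y)

lemma exists_glue {P : Profunctor.{u} A B} {Q : Profunctor.{u} B E} {a : A} {e : E}
    (z : El (comp P Q) a e) : ∃ (b : B) (x : El P a b) (y : El Q b e), z = glue x y := by
  induction z using Quot.inductionOn with
  | h z => exact ⟨z.1, z.2.1, z.2.2, rfl⟩

lemma act_glue {P : Profunctor.{u} A B} {Q : Profunctor.{u} B E} {a a' : A} {b : B} {e e' : E}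
    (f : a ⟶ a') (g : e' ⟶ e) (x : El P a b) (y : El Q b e) :
    act (comp P Q) f g (glue x y) = glue (act P f (𝟙 b) x) (act Q (𝟙 b) g y) := by
  change (glue (act P f (𝟙 b) (act P (𝟙 a) (𝟙 b) x)) (act Q (𝟙 b) (𝟙 e') (act Q (𝟙 b) g y)) :
    El (comp P Q) a' e') = _
  simp [act_id]

/-- Functions out of a composite. -/
def compLift {P : Profunctor.{u} A B} {Q : Profunctor.{u} B E} {a : A} {e : E} {T : Sort*}
    (F : ∀ b : B, El P a b → El Q b e → T)
    (h : ∀ {b b' : B} (g : b ⟶ b') (x : El P a b') (y : El Q b e),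
      F b (act P (𝟙 a) g x) y = F b' x (act Q g (𝟙 e) y)) : El (comp P Q) a e → T :=
  Quot.lift (fun z => F z.1 z.2.1 z.2.2) (by
    rintro _ _ ⟨g, x, y⟩
    exact h g x y)

@[simp] lemma compLift_glue {P : Profunctor.{u} A B} {Q : Profunctor.{u} B E} {a : A} {e : E}
    {T : Sort*} (F : ∀ b : B, El P a b → El Q b e → T) (h) {b : B} (x : El P a b) (y : El Q b e) :
    compLift F h (glue x y) = F b x y := rfl

lemma act_pair {P : Profunctor.{u} A B} {Q : Profunctor.{u} A' B'} {a c : A} {b d : B} {a' c' : A'}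
    {b' d' : B'} (f : (a, a') ⟶ (c, c')) (g : (d, d') ⟶ (b, b')) (x : El P a b) (y : El Q a' b') :
    act (tens P Q) f g (pair x y) = pair (act P f.1 g.1 x) (act Q f.2 g.2 y) := by
  change (act P f.1 (𝟙 _) (act P (𝟙 _) g.1 x), act Q f.2 (𝟙 _) (act Q (𝟙 _) g.2 y)) = _
  simp only [act_act, Category.id_comp]
  rfl

lemma act_wire {a b a' b' : A} (f : a ⟶ a') (g : b' ⟶ b) (h : b ⟶ a) :
    act (idP A) f g (wire h) = wire (g ≫ h ≫ f) := by
  change (g ≫ h) ≫ f = _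
  simp

/-! ### Representable and corepresentable profunctors -/

/-- The morphism of an element of a represented profunctor. -/
def val {P : Profunctor.{u} A B} {F : A ⥤ B} (φ : P ≅ F.toProfunctor) {a : A} {b : B}
    (x : El P a b) : b ⟶ F.obj a := app₂ φ.hom x

/-- The element of a represented profunctor with a given morphism. -/
def elt {P : Profunctor.{u} A B} {F : A ⥤ B} (φ : P ≅ F.toProfunctor) {a : A} {b : B}
    (f : b ⟶ F.obj a) : El P a b := app₂ φ.inv (show El F.toProfunctor a b from f)

/-- The morphism of an element of a corepresented profunctor. -/
def coval {P : Profunctor.{u} A B} {F : B ⥤ A} (φ : P ≅ F.toProfunctorRev) {a : A} {b : B}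
    (x : El P a b) : F.obj b ⟶ a := app₂ φ.hom x

/-- The element of a corepresented profunctor with a given morphism. -/
def coelt {P : Profunctor.{u} A B} {F : B ⥤ A} (φ : P ≅ F.toProfunctorRev) {a : A} {b : B}
    (f : F.obj b ⟶ a) : El P a b := app₂ φ.inv (show El F.toProfunctorRev a b from f)

section

variable {P : Profunctor.{u} A B} {F : A ⥤ B} (φ : P ≅ F.toProfunctor)

@[simp] lemma val_elt {a : A} {b : B} (f : b ⟶ F.obj a) : val φ (elt φ f) = f :=
  app₂_inv_hom φ _

@[simp] lemma elt_val {a : A} {b : B} (x : El P a b) : elt φ (val φ x) = x :=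
  app₂_hom_inv φ _

lemma val_injective {a : A} {b : B} {x y : El P a b} (h : val φ x = val φ y) : x = y :=
  app₂_injective φ h

lemma act_toProfunctor (F : A ⥤ B) {a a' : A} {b b' : B} (f : a ⟶ a') (g : b' ⟶ b)
    (x : b ⟶ F.obj a) : act F.toProfunctor f g x = g ≫ x ≫ F.map f :=
  Category.assoc _ _ _

lemma val_act {a a' : A} {b b' : B} (f : a ⟶ a') (g : b' ⟶ b) (x : El P a b) :
    val φ (act P f g x) = g ≫ val φ x ≫ F.map f := by
  rw [val, app₂_act]
  exact act_toProfunctor F f g _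

lemma act_elt {a a' : A} {b b' : B} (f : a ⟶ a') (g : b' ⟶ b) (h : b ⟶ F.obj a) :
    act P f g (elt φ h) = elt φ (g ≫ h ≫ F.map f) :=
  val_injective φ (by rw [val_act, val_elt, val_elt])

lemma act_val {a : A} {b : B} (x : El P a b) : act P (𝟙 a) (val φ x) (elt φ (𝟙 _)) = x := by
  rw [act_elt]; simp

/-- Co-Yoneda: the first component is the restriction of the universal element along its own value,
and that value slides to the second component. -/
lemma glue_rep {Q : Profunctor.{u} B E} {a : A} {b : B} {e : E} (x : El P a b) (y : El Q b e) :
    (glue x y : El (comp P Q) a e) = glue (elt φ (𝟙 _)) (act Q (val φ x) (𝟙 e) y) := by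
  conv_lhs => rw [← act_val φ x]
  exact glue_slide _ _ _

/-- An element of a composite whose first factor is represented. -/
def compRep {Q : Profunctor.{u} B E} {a : A} {e : E} : El (comp P Q) a e → El Q (F.obj a) e :=
  compLift (fun _ x y => act Q (val φ x) (𝟙 e) y) (by
    intro b b' g x y
    rw [val_act, act_act]; simp)

/-- The coend is a quotient by a generated equivalence relation, so equality of classes is not
directly decidable from representatives. `compRep` is an invariant, and it is complete because every
class has a representative with universal first component. -/
lemma glue_eq_iff_rep {Q : Profunctor.{u} B E} {a : A} {b b' : B} {e : E} (x : El P a b)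
    (y : El Q b e) (x' : El P a b') (y' : El Q b' e) :
    (glue x y : El (comp P Q) a e) = glue x' y' ↔
      act Q (val φ x) (𝟙 e) y = act Q (val φ x') (𝟙 e) y' := by
  constructor
  · intro h
    exact congrArg (compRep φ) h
  · intro h
    rw [glue_rep φ x y, glue_rep φ x' y', h]

end

section

variable {P : Profunctor.{u} A B} {F : B ⥤ A} (φ : P ≅ F.toProfunctorRev)

@[simp] lemma coval_coelt {a : A} {b : B} (f : F.obj b ⟶ a) : coval φ (coelt φ f) = f :=
  app₂_inv_hom φ _

@[simp] lemma coelt_coval {a : A} {b : B} (x : El P a b) : coelt φ (coval φ x) = x :=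
  app₂_hom_inv φ _

lemma coval_injective {a : A} {b : B} {x y : El P a b} (h : coval φ x = coval φ y) : x = y :=
  app₂_injective φ h

lemma act_toProfunctorRev (F : B ⥤ A) {a a' : A} {b b' : B} (f : a ⟶ a') (g : b' ⟶ b)
    (x : F.obj b ⟶ a) : act F.toProfunctorRev f g x = F.map g ≫ x ≫ f :=
  Category.assoc _ _ _

lemma coval_act {a a' : A} {b b' : B} (f : a ⟶ a') (g : b' ⟶ b) (x : El P a b) :
    coval φ (act P f g x) = F.map g ≫ coval φ x ≫ f := by
  rw [coval, app₂_act]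
  exact act_toProfunctorRev F f g _

lemma act_coelt {a a' : A} {b b' : B} (f : a ⟶ a') (g : b' ⟶ b) (h : F.obj b ⟶ a) :
    act P f g (coelt φ h) = coelt φ (F.map g ≫ h ≫ f) :=
  coval_injective φ (by rw [coval_act, coval_coelt, coval_coelt])

lemma act_coval {a : A} {b : B} (x : El P a b) : act P (coval φ x) (𝟙 b) (coelt φ (𝟙 _)) = x := by
  rw [act_coelt]; simp

end

section

variable {P : Profunctor.{u} A B} {Q : Profunctor.{u} B E} {F : E ⥤ B}
    (φ : Q ≅ F.toProfunctorRev)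

lemma glue_corep {a : A} {b : B} {e : E} (x : El P a b) (y : El Q b e) :
    (glue x y : El (comp P Q) a e) = glue (act P (𝟙 a) (coval φ y) x) (coelt φ (𝟙 _)) := by
  conv_lhs => rw [← act_coval φ y]
  exact (glue_slide _ _ _).symm

/-- An element of a composite whose second factor is corepresented. -/
def compCorep {a : A} {e : E} : El (comp P Q) a e → El P a (F.obj e) :=
  compLift (fun _ x y => act P (𝟙 a) (coval φ y) x) (by
    intro b b' g x y
    rw [coval_act, act_act]; simp)

lemma glue_eq_iff_corep {a : A} {b b' : B} {e : E} (x : El P a b)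
    (y : El Q b e) (x' : El P a b') (y' : El Q b' e) :
    (glue x y : El (comp P Q) a e) = glue x' y' ↔
      act P (𝟙 a) (coval φ y) x = act P (𝟙 a) (coval φ y') x' := by
  constructor
  · intro h
    exact congrArg (compCorep φ) h
  · intro h
    rw [glue_corep φ x y, glue_corep φ x' y', h]

/-- The middle object is contracted between a represented and a corepresented factor, so the class
is just a composite morphism. This reads off elements of `m d`, of the copairing `u d`, of the
pairing `m e` and of the units of the adjunctions. -/
lemma glue_eq_iff_mixed {G : A ⥤ B} (ψ : P ≅ G.toProfunctor) {a : A} {b b' : B} {e : E}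
    (x : El P a b) (y : El Q b e) (x' : El P a b') (y' : El Q b' e) :
    (glue x y : El (comp P Q) a e) = glue x' y' ↔
      coval φ y ≫ val ψ x = coval φ y' ≫ val ψ x' := by
  rw [glue_eq_iff_corep φ]
  constructor
  · intro h
    have := congrArg (val ψ) h
    simpa [val_act] using this
  · intro h
    apply val_injective ψ
    simpa [val_act] using h

end

section

/-- The identity profunctor is represented by the identity functor. -/
def idIso : idP A ≅ (𝟭 A).toProfunctor := Iso.refl _

/-- The identity profunctor is corepresented by the identity functor. -/
def idIsoRev : idP A ≅ (𝟭 A).toProfunctorRev := Iso.refl _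

variable {P : Profunctor.{u} A B} {Q : Profunctor.{u} B E} {P' : Profunctor.{u} A' B'}

/-- A composite of represented profunctors is represented. -/
noncomputable def compIso {F : A ⥤ B} {G : B ⥤ E} (φ : P ≅ F.toProfunctor)
    (ψ : Q ≅ G.toProfunctor) : comp P Q ≅ (F ⋙ G).toProfunctor :=
  mkIso _ _ (fun _ _ z => val ψ (compRep φ z)) (by
      intro a a' e e' f g z
      obtain ⟨b, x, y, rfl⟩ := exists_glue z
      rw [act_glue]
      refine Eq.trans ?_ (act_toProfunctor (F ⋙ G) f g _).symm
      simp [compRep, val_act]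
      rfl)
    (by
      intro a e
      constructor
      · intro z z' h
        obtain ⟨b, x, y, rfl⟩ := exists_glue z
        obtain ⟨b', x', y', rfl⟩ := exists_glue z'
        exact (glue_eq_iff_rep φ _ _ _ _).2 (val_injective ψ h)
      · intro f
        refine ⟨glue (elt φ (𝟙 _)) (elt ψ f), ?_⟩
        simp only [compRep, compLift_glue, val_act, val_elt]
        simp
        exact val_elt ψ f)

@[simp] lemma val_compIso_glue {F : A ⥤ B} {G : B ⥤ E} (φ : P ≅ F.toProfunctor)
    (ψ : Q ≅ G.toProfunctor) {a : A} {b : B} {e : E} (x : El P a b) (y : El Q b e) :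
    val (compIso φ ψ) (glue x y) = val ψ y ≫ G.map (val φ x) := by
  change val ψ (act Q (val φ x) (𝟙 e) y) = _
  simp [val_act]

/-- A composite of corepresented profunctors is corepresented. -/
noncomputable def compIsoRev {F : B ⥤ A} {G : E ⥤ B} (φ : P ≅ F.toProfunctorRev)
    (ψ : Q ≅ G.toProfunctorRev) : comp P Q ≅ (G ⋙ F).toProfunctorRev :=
  mkIso _ _ (fun _ _ z => coval φ (compCorep ψ z)) (by
      intro a a' e e' f g z
      obtain ⟨b, x, y, rfl⟩ := exists_glue z
      rw [act_glue]
      refine Eq.trans ?_ (act_toProfunctorRev (G ⋙ F) f g _).symm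
      simp [compCorep, coval_act]
      rfl)
    (by
      intro a e
      constructor
      · intro z z' h
        obtain ⟨b, x, y, rfl⟩ := exists_glue z
        obtain ⟨b', x', y', rfl⟩ := exists_glue z'
        exact (glue_eq_iff_corep ψ _ _ _ _).2 (coval_injective φ h)
      · intro f
        refine ⟨glue (coelt φ f) (coelt ψ (𝟙 _)), ?_⟩
        simp only [compCorep, compLift_glue, coval_act, coval_coelt]
        simp
        exact coval_coelt φ f)

@[simp] lemma coval_compIsoRev_glue {F : B ⥤ A} {G : E ⥤ B} (φ : P ≅ F.toProfunctorRev)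
    (ψ : Q ≅ G.toProfunctorRev) {a : A} {b : B} {e : E} (x : El P a b) (y : El Q b e) :
    coval (compIsoRev φ ψ) (glue x y) = F.map (coval ψ y) ≫ coval φ x := by
  change coval φ (act P (𝟙 a) (coval ψ y) x) = _
  simp [coval_act]

/-- A tensor product of represented profunctors is represented. -/
noncomputable def tensIso {F : A ⥤ B} {G : A' ⥤ B'} (φ : P ≅ F.toProfunctor)
    (ψ : P' ≅ G.toProfunctor) : tens P P' ≅ (F.prod G).toProfunctor :=
  mkIso _ _ (fun _ _ z => (val φ z.1, val ψ z.2)) (by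
      rintro ⟨a₁, a₂⟩ ⟨a₁', a₂'⟩ ⟨b₁, b₂⟩ ⟨b₁', b₂'⟩ f g ⟨x, y⟩
      refine Eq.trans ?_ (act_toProfunctor (F.prod G) f g _).symm
      erw [act_pair]
      exact congrArg₂ Prod.mk (val_act φ _ _ _) (val_act ψ _ _ _))
    (by
      intro a e
      constructor
      · rintro ⟨x, y⟩ ⟨x', y'⟩ h
        exact Prod.ext (val_injective φ (congrArg Prod.fst h))
          (val_injective ψ (congrArg Prod.snd h))
      · rintro ⟨f, g⟩
        exact ⟨(elt φ f, elt ψ g), Prod.ext (val_elt φ f) (val_elt ψ g)⟩)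

/-- A tensor product of corepresented profunctors is corepresented. -/
noncomputable def tensIsoRev {F : B ⥤ A} {G : B' ⥤ A'} (φ : P ≅ F.toProfunctorRev)
    (ψ : P' ≅ G.toProfunctorRev) : tens P P' ≅ (F.prod G).toProfunctorRev :=
  mkIso _ _ (fun _ _ z => (coval φ z.1, coval ψ z.2)) (by
      rintro ⟨a₁, a₂⟩ ⟨a₁', a₂'⟩ ⟨b₁, b₂⟩ ⟨b₁', b₂'⟩ f g ⟨x, y⟩
      refine Eq.trans ?_ (act_toProfunctorRev (F.prod G) f g _).symm
      erw [act_pair]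
      exact congrArg₂ Prod.mk (coval_act φ _ _ _) (coval_act ψ _ _ _))
    (by
      intro a e
      constructor
      · rintro ⟨x, y⟩ ⟨x', y'⟩ h
        exact Prod.ext (coval_injective φ (congrArg Prod.fst h))
          (coval_injective ψ (congrArg Prod.snd h))
      · rintro ⟨f, g⟩
        exact ⟨(coelt φ f, coelt ψ g), Prod.ext (coval_coelt φ f) (coval_coelt ψ g)⟩)

/-- Restricting a represented profunctor along a functor on its input. -/
def whiskIso {F : A ⥤ B} (φ : P ≅ F.toProfunctor) (H : A' ⥤ A) :
    P.whiskerLeft₂ H (𝟭 B) ≅ (H ⋙ F).toProfunctor :=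
  Functor.isoWhiskerLeft H φ

/-- Restricting a corepresented profunctor along a functor on its output. -/
def whiskIsoRev {F : B ⥤ A} (φ : P ≅ F.toProfunctorRev) (H : B' ⥤ B) :
    P.whiskerLeft₂ (𝟭 A) H ≅ (H ⋙ F).toProfunctorRev :=
  (((Functor.whiskeringLeft₂ _).obj (𝟭 A)).obj H.op).mapIso φ

end

/-! ### 2-cells between Hom-profunctors as natural transformations -/

section

variable {P Q : Profunctor.{u} A B}

/-- Natural transformations between functors from 2-cells of the represented profunctors. -/
def natOfCell {F G : A ⥤ B} (φ : P ≅ F.toProfunctor) (ψ : Q ≅ G.toProfunctor) (θ : P ⟶ Q) :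
    F ⟶ G where
  app a := val ψ (app₂ θ (elt φ (𝟙 (F.obj a))))
  naturality a a' f := by
    have h := val_act ψ f (𝟙 (F.obj a)) (app₂ θ (elt φ (𝟙 (F.obj a))))
    rw [← app₂_act, act_elt] at h
    have h' := val_act ψ (𝟙 a') (F.map f) (app₂ θ (elt φ (𝟙 (F.obj a'))))
    rw [← app₂_act, act_elt] at h'
    simp at h h' ⊢
    rw [← h, ← h']

/-- Yoneda: an arbitrary element is a restriction of the universal one, where the 2-cell has by
definition the component of the transformation as its value. -/
lemma val_app₂ {F G : A ⥤ B} (φ : P ≅ F.toProfunctor) (ψ : Q ≅ G.toProfunctor) (θ : P ⟶ Q)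
    {a : A} {b : B} (x : El P a b) :
    val ψ (app₂ θ x) = val φ x ≫ (natOfCell φ ψ θ).app a := by
  conv_lhs => rw [← act_val φ x, app₂_act, val_act]
  simp [natOfCell]

/-- Isomorphisms of functors from invertible 2-cells of the represented profunctors. -/
def natIsoOfCell {F G : A ⥤ B} (φ : P ≅ F.toProfunctor) (ψ : Q ≅ G.toProfunctor) (θ : P ≅ Q) :
    F ≅ G where
  hom := natOfCell φ ψ θ.hom
  inv := natOfCell ψ φ θ.inv
  hom_inv_id := by
    ext a
    change val ψ (app₂ θ.hom (elt φ (𝟙 (F.obj a)))) ≫ _ = _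
    rw [← val_app₂]; simp
  inv_hom_id := by
    ext a
    change val φ (app₂ θ.inv (elt ψ (𝟙 (G.obj a)))) ≫ _ = _
    rw [← val_app₂]; simp

lemma val_app₂_iso {F G : A ⥤ B} (φ : P ≅ F.toProfunctor) (ψ : Q ≅ G.toProfunctor) (θ : P ≅ Q)
    {a : A} {b : B} (x : El P a b) :
    val ψ (app₂ θ.hom x) = val φ x ≫ (natIsoOfCell φ ψ θ).hom.app a := val_app₂ φ ψ θ.hom x

/-- Natural transformations between functors from 2-cells of the corepresented profunctors. -/
def natOfCellRev {F G : B ⥤ A} (φ : P ≅ F.toProfunctorRev) (ψ : Q ≅ G.toProfunctorRev)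
    (θ : P ⟶ Q) : G ⟶ F where
  app b := coval ψ (app₂ θ (coelt φ (𝟙 (F.obj b))))
  naturality b b' g := by
    have h := coval_act ψ (𝟙 (F.obj b')) g (app₂ θ (coelt φ (𝟙 (F.obj b'))))
    rw [← app₂_act, act_coelt] at h
    have h' := coval_act ψ (F.map g) (𝟙 b) (app₂ θ (coelt φ (𝟙 (F.obj b))))
    rw [← app₂_act, act_coelt] at h'
    simp at h h' ⊢
    rw [← h, ← h']

lemma coval_app₂ {F G : B ⥤ A} (φ : P ≅ F.toProfunctorRev) (ψ : Q ≅ G.toProfunctorRev) (θ : P ⟶ Q)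
    {a : A} {b : B} (x : El P a b) :
    coval ψ (app₂ θ x) = (natOfCellRev φ ψ θ).app b ≫ coval φ x := by
  conv_lhs => rw [← act_coval φ x, app₂_act, coval_act]
  simp [natOfCellRev]

/-- Isomorphisms of functors from invertible 2-cells of the corepresented profunctors. -/
def natIsoOfCellRev {F G : B ⥤ A} (φ : P ≅ F.toProfunctorRev) (ψ : Q ≅ G.toProfunctorRev)
    (θ : P ≅ Q) : G ≅ F where
  hom := natOfCellRev φ ψ θ.hom
  inv := natOfCellRev ψ φ θ.inv
  hom_inv_id := by
    ext b
    change _ ≫ coval φ (app₂ θ.inv (coelt ψ (𝟙 (G.obj b)))) = _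
    rw [← coval_app₂]; simp
  inv_hom_id := by
    ext b
    change _ ≫ coval ψ (app₂ θ.hom (coelt φ (𝟙 (F.obj b)))) = _
    rw [← coval_app₂]; simp

lemma coval_app₂_iso {F G : B ⥤ A} (φ : P ≅ F.toProfunctorRev) (ψ : Q ≅ G.toProfunctorRev)
    (θ : P ≅ Q) {a : A} {b : B} (x : El P a b) :
    coval ψ (app₂ θ.hom x) = (natIsoOfCellRev φ ψ θ).hom.app b ≫ coval φ x := coval_app₂ φ ψ θ.hom x

/-- The represented profunctors of isomorphic functors. -/
def toProfunctorIso {F G : A ⥤ B} (α : F ≅ G) : F.toProfunctor ≅ G.toProfunctor :=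
  Functor.isoWhiskerRight α yoneda

lemma val_toProfunctorIso {F G : A ⥤ B} (φ : P ≅ F.toProfunctor) (ψ : Q ≅ G.toProfunctor)
    (α : F ≅ G) {a : A} {b : B} (x : El P a b) :
    val ψ (app₂ (φ ≪≫ toProfunctorIso α ≪≫ ψ.symm).hom x) = val φ x ≫ α.hom.app a := by
  change app₂ ψ.hom (app₂ ψ.inv (app₂ (toProfunctorIso α).hom (app₂ φ.hom x))) = _
  rw [app₂_inv_hom]
  rfl

/-- The corepresented profunctors of isomorphic functors. -/
def toProfunctorRevIso {F G : B ⥤ A} (α : G ≅ F) : F.toProfunctorRev ≅ G.toProfunctorRev :=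
  Functor.isoWhiskerLeft yoneda ((Functor.whiskeringLeft _ _ _).mapIso
    (NatIso.op α))

lemma coval_toProfunctorRevIso {F G : B ⥤ A} (φ : P ≅ F.toProfunctorRev)
    (ψ : Q ≅ G.toProfunctorRev) (α : G ≅ F) {a : A} {b : B} (x : El P a b) :
    coval ψ (app₂ (φ ≪≫ toProfunctorRevIso α ≪≫ ψ.symm).hom x) = α.hom.app b ≫ coval φ x := by
  change app₂ ψ.hom (app₂ ψ.inv (app₂ (toProfunctorRevIso α).hom (app₂ φ.hom x))) = _
  rw [app₂_inv_hom]
  rfl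

end

end Prof

/-! ### Representability from adjunctions and split idempotents -/

section Representability

variable {A B : Type u} [SmallCategory A] [SmallCategory B]

/-- Pointwise representability suffices: the action on morphisms is forced by universality, and
functoriality and naturality follow from uniqueness. -/
lemma exists_representing_of_universal (P : Profunctor.{u} A B) (o : A → B)
    (x : ∀ a, El P a (o a))
    (h : ∀ (a : A) (b : B) (y : El P a b), ∃! f : b ⟶ o a, act P (𝟙 a) f (x a) = y) :
    ∃ F : A ⥤ B, Nonempty (P ≅ F.toProfunctor) := by
  choose v hv hu using h
  have hu' : ∀ (a : A) (b : B) (f g : b ⟶ o a),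
      act P (𝟙 a) f (x a) = act P (𝟙 a) g (x a) → f = g := fun a b f g e =>
    (hu a b _ f e).trans (hu a b _ g rfl).symm
  have hv' : ∀ (a : A) (b : B) (y : El P a b), act P (𝟙 a) (v a b y) (x a) = y := fun a b y =>
    hv a b y
  -- Transporting the universal element at `a` along `f` agrees with restricting the one at `a'`
  -- along the morphism that will be `F.map f`; this single identity yields both `map_comp` and the
  -- naturality of the comparison.
  have key : ∀ {a a' : A} (f : a ⟶ a') {b : B} (g : b ⟶ o a),
      act P f g (x a) = act P (𝟙 a') (g ≫ v a' (o a) (act P f (𝟙 _) (x a))) (x a') := by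
    intro a a' f b g
    have : act P (𝟙 a') (g ≫ v a' (o a) (act P f (𝟙 _) (x a))) (x a') =
        act P (𝟙 a') g (act P (𝟙 a') (v a' (o a) (act P f (𝟙 _) (x a))) (x a')) := by
      rw [act_act]; simp
    rw [this, hv', act_act]; simp
  let F : A ⥤ B :=
    { obj := o
      map := fun {a a'} f => v a' (o a) (act P f (𝟙 _) (x a))
      map_id := fun a => hu' _ _ _ _ (by rw [hv'])
      map_comp := fun {a a' a''} f g => hu' _ _ _ _ (by
        rw [hv', ← key]
        have := act_act P f (𝟙 _) g (𝟙 _) (x a)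
        rw [← hv' _ _ (act P f (𝟙 (o a)) (x a)), act_act] at this
        simpa using this.symm) }
  refine ⟨F, ⟨(mkIso F.toProfunctor P (fun a b (f : b ⟶ o a) => act P (𝟙 a) f (x a))
    ?_ ?_).symm⟩⟩
  · intro a a' b b' f g (y : b ⟶ o a)
    have e : act P (𝟙 a') (g ≫ y ≫ v a' (o a) (act P f (𝟙 _) (x a))) (x a') =
        act P f g (act P (𝟙 a) y (x a)) := by
      rw [← Category.assoc, ← key, act_act]
      simp
    exact (congrArg (fun z : b' ⟶ o a' => act P (𝟙 a') z (x a'))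
      (act_toProfunctor F f g y)).trans e
  · intro a b
    exact ⟨fun f g e => hu' _ _ _ _ e, fun y => ⟨v a b y, hv' a b y⟩⟩

lemma exists_corepresenting_of_universal (P : Profunctor.{u} A B) (o : B → A)
    (x : ∀ b, El P (o b) b)
    (h : ∀ (b : B) (a : A) (y : El P a b), ∃! f : o b ⟶ a, act P f (𝟙 b) (x b) = y) :
    ∃ F : B ⥤ A, Nonempty (P ≅ F.toProfunctorRev) := by
  choose v hv hu using h
  have hu' : ∀ (b : B) (a : A) (f g : o b ⟶ a),
      act P f (𝟙 b) (x b) = act P g (𝟙 b) (x b) → f = g := fun a b f g e =>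
    (hu a b _ f e).trans (hu a b _ g rfl).symm
  have hv' : ∀ (b : B) (a : A) (y : El P a b), act P (v b a y) (𝟙 b) (x b) = y := fun a b y =>
    hv a b y
  have key : ∀ {b b' : B} (g : b ⟶ b') {a : A} (f : o b' ⟶ a),
      act P f g (x b') = act P (v b (o b') (act P (𝟙 _) g (x b')) ≫ f) (𝟙 b) (x b) := by
    intro b b' g a f
    have : act P (v b (o b') (act P (𝟙 _) g (x b')) ≫ f) (𝟙 b) (x b) =
        act P f (𝟙 b) (act P (v b (o b') (act P (𝟙 _) g (x b'))) (𝟙 b) (x b)) := by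
      rw [act_act]; simp
    rw [this, hv', act_act]; simp
  let F : B ⥤ A :=
    { obj := o
      map := fun {b b'} g => v b (o b') (act P (𝟙 _) g (x b'))
      map_id := fun a => hu' _ _ _ _ (by rw [hv'])
      map_comp := fun {b b' b''} f g => hu' _ _ _ _ (by
        rw [hv', ← key]
        have := act_act P (𝟙 _) g (𝟙 _) f (x b'')
        rw [← hv' _ _ (act P (𝟙 _) g (x b'')), act_act] at this
        simpa using this.symm) }
  refine ⟨F, ⟨(mkIso F.toProfunctorRev P (fun a b (f : o b ⟶ a) => act P f (𝟙 b) (x b))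
    ?_ ?_).symm⟩⟩
  · intro a a' b b' f g (y : o b ⟶ a)
    have e : act P (v b' (o b) (act P (𝟙 _) g (x b)) ≫ y ≫ f) (𝟙 b') (x b') =
        act P f g (act P y (𝟙 b) (x b)) := by
      rw [← key, act_act]
      simp
    exact (congrArg (fun z : o b' ⟶ a' => act P z (𝟙 b') (x b'))
      (act_toProfunctorRev F f g y)).trans e
  · intro a b
    exact ⟨fun f g e => hu' _ _ _ _ e, fun y => ⟨v b a y, hv' b a y⟩⟩

/-- The hypotheses say that `s` is a natural section of the map `Hom(-, b₀) → P(a, -)` determined by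
`x₀`. Thus `P(a, -)` is a retract of a representable, and in an idempotent complete category such a
retract is representable. -/
lemma exists_universal_of_retract [IsIdempotentComplete B] (P : Profunctor.{u} A B) (a : A) (b₀ : B)
    (x₀ : El P a b₀) (s : ∀ b, El P a b → (b ⟶ b₀))
    (hs : ∀ {b b' : B} (g : b' ⟶ b) (x : El P a b), s b' (act P (𝟙 a) g x) = g ≫ s b x)
    (h : ∀ {b : B} (x : El P a b), act P (𝟙 a) (s b x) x₀ = x) :
    ∃ (o : B) (x : El P a o), ∀ (b : B) (y : El P a b), ∃! f : b ⟶ o, act P (𝟙 a) f x = y := by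
  -- The endomorphism of `b₀` which corresponds to the retraction is `s b₀ x₀`; it is idempotent by
  -- naturality of `s`, and the splitting object carries the restriction of `x₀` as universal
  -- element.
  obtain ⟨o, i, e, h₁, h₂⟩ := IsIdempotentComplete.idempotents_split b₀ (s b₀ x₀)
    (by rw [← hs, h])
  refine ⟨o, act P (𝟙 a) i x₀, fun b y => ⟨s b y ≫ e, ?_, ?_⟩⟩
  · change act P (𝟙 a) (s b y ≫ e) (act P (𝟙 a) i x₀) = y
    rw [act_act, Category.assoc, h₂, ← hs, h]
    simpa using h y
  · intro f hf
    rw [← hf, hs, hs, ← h₂]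
    simp [h₁]

lemma exists_couniversal_of_retract [IsIdempotentComplete A] (P : Profunctor.{u} A B) (b : B)
    (a₀ : A) (x₀ : El P a₀ b) (s : ∀ a, El P a b → (a₀ ⟶ a))
    (hs : ∀ {a a' : A} (g : a ⟶ a') (x : El P a b), s a' (act P g (𝟙 b) x) = s a x ≫ g)
    (h : ∀ {a : A} (x : El P a b), act P (s a x) (𝟙 b) x₀ = x) :
    ∃ (o : A) (x : El P o b), ∀ (a : A) (y : El P a b), ∃! f : o ⟶ a, act P f (𝟙 b) x = y := by
  obtain ⟨o, i, e, h₁, h₂⟩ := IsIdempotentComplete.idempotents_split a₀ (s a₀ x₀)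
    (by rw [← hs, h])
  refine ⟨o, act P e (𝟙 b) x₀, fun a y => ⟨i ≫ s a y, ?_, ?_⟩⟩
  · change act P (i ≫ s a y) (𝟙 b) (act P e (𝟙 b) x₀) = y
    rw [act_act, ← Category.assoc, h₂, ← hs, h]
    simpa using h y
  · intro f hf
    rw [← hf, hs, hs, ← h₂]
    simp [reassoc_of% h₁]

lemma RightAdjoint.counit_act_left {P : Profunctor.{u} A B} (h : RightAdjoint P) {a : A}
    {b b' c : B} (y : El h.R b a) (x : El P a b') (f : b ⟶ c) :
    h.counit (act h.R f (𝟙 a) y) x = h.counit y x ≫ f := by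
  have := app₂_act h.ε f (𝟙 b') (glue y x)
  rw [act_glue, act_id] at this
  refine this.trans ((act_wire f (𝟙 b') (h.counit y x)).trans ?_)
  rw [Category.id_comp]

lemma RightAdjoint.counit_act_right {P : Profunctor.{u} A B} (h : RightAdjoint P) {a : A}
    {b b' c : B} (y : El h.R b a) (x : El P a b') (f : c ⟶ b') :
    h.counit y (act P (𝟙 a) f x) = f ≫ h.counit y x := by
  have := app₂_act h.ε (𝟙 b) f (glue y x)
  rw [act_glue, act_id] at this
  refine this.trans ((act_wire (𝟙 b) f (h.counit y x)).trans ?_)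
  rw [Category.comp_id]

lemma RightAdjoint.counit_act_mid {P : Profunctor.{u} A B} (h : RightAdjoint P) {a a' : A}
    {b b' : B} (y : El h.R b a') (x : El P a b') (f : a ⟶ a') :
    h.counit (act h.R (𝟙 b) f y) x = h.counit y (act P f (𝟙 b') x) :=
  congrArg (fun z => (app₂ h.ε z : b' ⟶ b)) (glue_slide f y x)

/-- A profunctor with a right adjoint and with values in an idempotent complete category is
represented by a functor. -/
lemma RightAdjoint.exists_representing [IsIdempotentComplete B] {P : Profunctor.{u} A B}
    (h : RightAdjoint P) : ∃ F : A ⥤ B, Nonempty (P ≅ F.toProfunctor) := by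
  have H : ∀ a : A, ∃ (o : B) (x : El P a o), ∀ (b : B) (y : El P a b),
      ∃! f : b ⟶ o, act P (𝟙 a) f x = y := by
    intro a
    -- A representing pair of the unit at `a` supplies all the data of the retract: base point `p`,
    -- section `counit r`, and the retraction law is the left triangle equation.
    obtain ⟨b₀, p, r, hpr⟩ := exists_glue (app₂ h.η (wire (𝟙 a)))
    exact exists_universal_of_retract P a b₀ p (fun b x => h.counit r x)
      (fun g x => h.counit_act_right r x g) (fun x => h.triangle_left x p r hpr)
  choose o x hx using H
  exact exists_representing_of_universal P o x hx

/-- This is the left triangle equation tested on the universal element. -/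
lemma RightAdjoint.isUnit_comp {P : Profunctor.{u} A B} (h : RightAdjoint P) {F : A ⥤ B}
    (φ : P ≅ F.toProfunctor) {a : A} {b : B} {p : El P a b} {r : El h.R b a} (hpr : h.IsUnit p r) :
    h.counit r (elt φ (𝟙 _)) ≫ val φ p = 𝟙 _ := by
  have e : act P (𝟙 a) (h.counit r (elt φ (𝟙 (F.obj a)))) p = elt φ (𝟙 (F.obj a)) :=
    h.triangle_left _ p r hpr
  simpa [val_act] using congrArg (val φ) e

lemma RightAdjoint.counit_eq_comp {P : Profunctor.{u} A B} (h : RightAdjoint P) {F : A ⥤ B}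
    (φ : P ≅ F.toProfunctor) {a : A} {b b' : B} (w : El h.R b a) (v : El P a b') :
    h.counit w v = val φ v ≫ h.counit w (elt φ (𝟙 _)) := by
  rw [← h.counit_act_right, act_val]

lemma RightAdjoint.counit_act {P : Profunctor.{u} A B} (h : RightAdjoint P) {F : A ⥤ B}
    (φ : P ≅ F.toProfunctor) {a a' : A} {b b' : B} (f : b ⟶ b') (g : a' ⟶ a) (w : El h.R b a) :
    h.counit (act h.R f g w) (elt φ (𝟙 _)) = F.map g ≫ h.counit w (elt φ (𝟙 _)) ≫ f := by
  have e : act h.R f g w = act h.R f (𝟙 _) (act h.R (𝟙 _) g w) := by rw [act_act]; simp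
  rw [e, h.counit_act_left, h.counit_act_mid, act_elt, h.counit_eq_comp φ]
  simp

/-- The right adjoint of a represented profunctor is corepresented by the same functor. -/
noncomputable def RightAdjoint.corep {P : Profunctor.{u} A B} (h : RightAdjoint P) {F : A ⥤ B}
    (φ : P ≅ F.toProfunctor) : h.R ≅ F.toProfunctorRev :=
  mkIso _ _ (fun _ _ w => h.counit w (elt φ (𝟙 _)))
    (fun f g w => (h.counit_act φ f g w).trans (act_toProfunctorRev F f g _).symm)
    (by
      intro b a
      -- The inverse of `w ↦ counit w (universal element)` is built from the unit: it sends `f` to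
      -- the transport of `r` along `val φ p ≫ f`. The right triangle equation gives injectivity,
      -- the left one surjectivity.
      obtain ⟨b₀, p, r, hpr⟩ := exists_glue (app₂ h.η (wire (𝟙 a)))
      have t₂ : ∀ {c : B} (y : El h.R c a), act h.R (h.counit y p) (𝟙 a) r = y :=
        fun y => h.triangle_right y p r hpr
      constructor
      · intro w w' e
        rw [← t₂ w, ← t₂ w', h.counit_eq_comp φ w, h.counit_eq_comp φ w']
        exact congrArg (fun z => act h.R (val φ p ≫ z) (𝟙 a) r) e
      · intro (f : F.obj a ⟶ b)
        refine ⟨act h.R (val φ p ≫ f) (𝟙 a) r, ?_⟩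
        have e : (h.counit r (elt φ (𝟙 (F.obj a))) ≫ val φ p ≫ f) = f := by
          rw [reassoc_of% (h.isUnit_comp φ hpr)]
        exact (h.counit_act_left _ _ _).trans e)

lemma RightAdjoint.counit_eq {P : Profunctor.{u} A B} (h : RightAdjoint P) {F : A ⥤ B}
    (φ : P ≅ F.toProfunctor) {a : A} {b b' : B} (w : El h.R b a) (v : El P a b') :
    h.counit w v = val φ v ≫ coval (h.corep φ) w :=
  h.counit_eq_comp φ w v

lemma RightAdjoint.isUnit_eq {P : Profunctor.{u} A B} (h : RightAdjoint P) {F : A ⥤ B}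
    (φ : P ≅ F.toProfunctor) {a : A} {b : B} {p : El P a b} {r : El h.R b a} (hpr : h.IsUnit p r) :
    coval (h.corep φ) r ≫ val φ p = 𝟙 _ :=
  h.isUnit_comp φ hpr

end Representability

open MonoidalCategory

/-! ### Pseudomonoids represented by a monoidal structure -/

section Monoid

variable {C : Type u} [SmallCategory C]

section

variable (M : PseudomonoidData C) {par : C × C ⥤ C} (φ : M.mul ≅ par.toProfunctor)

/-- A composite of represented profunctors is represented by the composite functor, so both classes
are compared by their values there. -/
lemma PseudomonoidData.glue_right_iff {X Y Z W U U' : C} (p : El M.mul (Y, Z) U)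
    (q : El M.mul (X, U) W) (p' : El M.mul (Y, Z) U') (q' : El M.mul (X, U') W) :
    (glue (pair (wire (𝟙 X)) p) q : El (comp (tens (idP C) M.mul) M.mul) (X, (Y, Z)) W) =
      glue (pair (wire (𝟙 X)) p') q' ↔
    val φ q ≫ par.map (Prod.mkHom (𝟙 X) (val φ p)) =
      val φ q' ≫ par.map (Prod.mkHom (𝟙 X) (val φ p')) := by
  have key : ∀ {U : C} (p : El M.mul (Y, Z) U) (q : El M.mul (X, U) W),
      val (compIso (tensIso idIso φ) φ) (a := (X, (Y, Z))) (b := W)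
        (glue (b := (X, U)) (pair (wire (𝟙 X)) p) q) =
      val φ q ≫ par.map (Prod.mkHom (𝟙 X) (val φ p)) := fun p q => val_compIso_glue _ _ _ _
  rw [← key, ← key]
  exact ⟨congrArg _, val_injective _⟩

lemma PseudomonoidData.glue_right_iff₂ {X Y Z T W U Q U' Q' : C} (p : El M.mul (Z, T) U)
    (r : El M.mul (Y, U) Q) (s : El M.mul (X, Q) W) (p' : El M.mul (Z, T) U')
    (r' : El M.mul (Y, U') Q') (s' : El M.mul (X, Q') W) :
    (glue (pair (wire (𝟙 X)) (pair (wire (𝟙 Y)) p)) (glue (pair (wire (𝟙 X)) r) s) :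
      El (comp (tens (idP C) (tens (idP C) M.mul)) (comp (tens (idP C) M.mul) M.mul))
        (X, (Y, (Z, T))) W) =
      glue (pair (wire (𝟙 X)) (pair (wire (𝟙 Y)) p')) (glue (pair (wire (𝟙 X)) r') s') ↔
    (val φ s ≫ par.map (Prod.mkHom (𝟙 X) (val φ r))) ≫
        par.map (Prod.mkHom (𝟙 X) (par.map (Prod.mkHom (𝟙 Y) (val φ p)))) =
      (val φ s' ≫ par.map (Prod.mkHom (𝟙 X) (val φ r'))) ≫
        par.map (Prod.mkHom (𝟙 X) (par.map (Prod.mkHom (𝟙 Y) (val φ p')))) := by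
  let θ := compIso (tensIso idIso (tensIso idIso φ)) (compIso (tensIso idIso φ) φ)
  have key : ∀ {U Q : C} (p : El M.mul (Z, T) U) (r : El M.mul (Y, U) Q) (s : El M.mul (X, Q) W),
      val θ (glue (pair (wire (𝟙 X)) (pair (wire (𝟙 Y)) p)) (glue (pair (wire (𝟙 X)) r) s)) =
      (val φ s ≫ par.map (Prod.mkHom (𝟙 X) (val φ r))) ≫
        par.map (Prod.mkHom (𝟙 X) (par.map (Prod.mkHom (𝟙 Y) (val φ p)))) := by
    intro U Q p r s
    exact (val_compIso_glue _ _ _ _).trans (congrArg (· ≫ _) (val_compIso_glue _ _ _ _))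
  exact ⟨fun h => (key p r s).symm.trans ((congrArg _ h).trans (key p' r' s')),
    fun h => val_injective θ ((key p r s).trans (h.trans (key p' r' s').symm))⟩

end

/-- Identifications of the 1-cells of a pseudomonoid with those of a monoidal structure. -/
structure MonDictData (M : PseudomonoidData C) (T : MonoidalCategory C) where
  mul : M.mul ≅ (@MonoidalCategory.tensor C _ T).toProfunctor
  one : M.one ≅ (Functor.fromPUnit.{u} T.tensorUnit).toProfunctor

namespace MonDictData

variable {M : PseudomonoidData C} {T : MonoidalCategory C} (D : MonDictData M T)

/-- The morphism of an element of the multiplication. -/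
def m {X Y Z : C} (a : El M.mul (X, Y) Z) : Z ⟶ X ⊗ Y := val D.mul a

/-- The morphism of an element of the unit. -/
def u {Z : C} (x : El M.one pt Z) : Z ⟶ 𝟙_ C := val D.one x

/-- The element of the multiplication with a given morphism. -/
def mElt {X Y Z : C} (f : Z ⟶ X ⊗ Y) : El M.mul (X, Y) Z := elt D.mul f

/-- The element of the unit with a given morphism. -/
def uElt {Z : C} (f : Z ⟶ 𝟙_ C) : El M.one pt Z := elt D.one f

@[simp] lemma m_mElt {X Y Z : C} (f : Z ⟶ X ⊗ Y) : D.m (D.mElt f) = f :=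
  val_elt D.mul (a := (X, Y)) f
@[simp] lemma u_uElt {Z : C} (f : Z ⟶ 𝟙_ C) : D.u (D.uElt f) = f :=
  val_elt D.one (a := pt) f

lemma m_injective {X Y Z : C} {a b : El M.mul (X, Y) Z} (h : D.m a = D.m b) : a = b :=
  val_injective D.mul h

lemma m_act {X Y X' Y' Z Z' : C} (f : (X, Y) ⟶ (X', Y')) (g : Z' ⟶ Z) (a : El M.mul (X, Y) Z) :
    D.m (act M.mul f g a) = g ≫ D.m a ≫ (f.1 ⊗ₘ f.2) := val_act D.mul f g a

lemma u_act {Z Z' : C} (g : Z' ⟶ Z) (x : El M.one pt Z) :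
    D.u (act M.one (𝟙 pt) g x) = g ≫ D.u x :=
  (val_act D.one (𝟙 pt) g x).trans (congrArg (g ≫ ·) (Category.comp_id (D.u x)))

lemma glue_right {X Y Z W : C} {U U' : C} (p : El M.mul (Y, Z) U) (q : El M.mul (X, U) W)
    (p' : El M.mul (Y, Z) U') (q' : El M.mul (X, U') W) :
    (glue (pair (wire (𝟙 X)) p) q : El (comp (tens (idP C) M.mul) M.mul) (X, (Y, Z)) W) =
      glue (pair (wire (𝟙 X)) p') q' ↔ D.m q ≫ X ◁ D.m p = D.m q' ≫ X ◁ D.m p' := by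
  rw [← id_tensorHom, ← id_tensorHom]
  exact M.glue_right_iff D.mul p q p' q'

lemma glue_right₂ {X Y Z T W U Q U' Q' : C} (p : El M.mul (Z, T) U) (r : El M.mul (Y, U) Q)
    (s : El M.mul (X, Q) W) (p' : El M.mul (Z, T) U') (r' : El M.mul (Y, U') Q')
    (s' : El M.mul (X, Q') W) :
    (glue (pair (wire (𝟙 X)) (pair (wire (𝟙 Y)) p)) (glue (pair (wire (𝟙 X)) r) s) :
      El (comp (tens (idP C) (tens (idP C) M.mul)) (comp (tens (idP C) M.mul) M.mul))
        (X, (Y, (Z, T))) W) =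
      glue (pair (wire (𝟙 X)) (pair (wire (𝟙 Y)) p')) (glue (pair (wire (𝟙 X)) r') s') ↔
    (D.m s ≫ X ◁ D.m r) ≫ X ◁ Y ◁ D.m p = (D.m s' ≫ X ◁ D.m r') ≫ X ◁ Y ◁ D.m p' := by
  simp only [← id_tensorHom]
  exact M.glue_right_iff₂ D.mul p r s p' r' s'

end MonDictData

/-- Identifications of a pseudomonoid in profunctors with a monoidal structure. -/
structure MonDict (M : PseudomonoidData C) (T : MonoidalCategory C) extends MonDictData M T where
  assoc : ∀ {X Y Z V U W : C} {a : El M.mul (X, Y) V} {b : El M.mul (V, Z) W}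
    {p : El M.mul (Y, Z) U} {q : El M.mul (X, U) W}, M.Assoc a b p q →
    toMonDictData.m b ≫ toMonDictData.m a ▷ Z ≫ (α_ X Y Z).hom =
      toMonDictData.m q ≫ X ◁ toMonDictData.m p
  lam : ∀ {X W P : C} (p : El M.one pt P) (a : El M.mul (P, X) W),
    M.lam p a = toMonDictData.m a ≫ toMonDictData.u p ▷ X ≫ (λ_ X).hom
  rho : ∀ {X W P : C} (p : El M.one pt P) (a : El M.mul (X, P) W),
    M.rho p a = toMonDictData.m a ≫ X ◁ toMonDictData.u p ≫ (ρ_ X).hom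

namespace MonDict

variable {M : PseudomonoidData C} {T : MonoidalCategory C} (D : MonDict M T)

/-- A dictionary records only that the 2-cell implies the equation. The converse holds because the
2-cell has some value, whose morphism is known by the dictionary, and elements are determined by
their morphisms. -/
lemma assoc_iff {X Y Z V U W : C} {a : El M.mul (X, Y) V} {b : El M.mul (V, Z) W}
    {p : El M.mul (Y, Z) U} {q : El M.mul (X, U) W} : M.Assoc a b p q ↔
    D.m b ≫ D.m a ▷ Z ≫ (α_ X Y Z).hom = D.m q ≫ X ◁ D.m p := by
  refine ⟨D.assoc, fun h => ?_⟩
  obtain ⟨⟨X', U'⟩, ⟨(f : X' ⟶ X), (p' : El M.mul (Y, Z) U')⟩, q', e⟩ :=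
    exists_glue (app₂ M.assoc.hom (a := ((X, Y), Z)) (b := W) (glue (pair a (wire (𝟙 Z))) b))
  -- The representative need not have an identity on the passive wire; the morphism `f` found there
  -- is slid into `q'`.
  have e₁ : (pair (wire f) p' : El (tens (idP C) M.mul) (X, (Y, Z)) (X', U')) =
      act (tens (idP C) M.mul) (𝟙 (X, (Y, Z))) (Prod.mkHom f (𝟙 U'))
        (pair (wire (𝟙 X)) p') := by
    rw [act_pair]
    exact congrArg₂ Prod.mk ((by simp : f = f ≫ 𝟙 X ≫ 𝟙 X).trans (act_wire _ _ _).symm)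
      (act_id M.mul p').symm
  have e₂ : M.Assoc a b p' (act M.mul (Prod.mkHom f (𝟙 U')) (𝟙 W) q') :=
    e.trans ((congrArg (fun z => glue z q') e₁).trans (glue_slide _ _ _))
  exact e₂.trans ((D.glue_right _ _ _ _).2 ((D.assoc e₂).symm.trans h))

end MonDict

section FromPseudomonoid

/-- All structural 2-cells go between composites of represented profunctors, so they are natural
isomorphisms of functors. Pentagon and triangle are the given equations evaluated at elements whose
morphisms are identities. -/
lemma exists_monDict_of_pseudomonoid (M : Pseudomonoid C) {par : C × C ⥤ C} {bot : C}
    (φ : M.mul ≅ par.toProfunctor) (ψ : M.one ≅ (Functor.fromPUnit.{u} bot).toProfunctor) :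
    ∃ T : MonoidalCategory C, Nonempty (MonDict M.toPseudomonoidData T) := by
  -- The three structural isomorphisms are obtained at the level of functors, so that their
  -- naturality comes for free.
  let αN : (par.prod (𝟭 C)) ⋙ par ≅ prod.associator C C C ⋙ ((𝟭 C).prod par) ⋙ par :=
    natIsoOfCell (compIso (tensIso φ idIso) φ) (whiskIso (compIso (tensIso idIso φ) φ) _) M.assoc
  let lN : prod.leftInverseUnitor C ⋙ ((Functor.fromPUnit.{u} bot).prod (𝟭 C)) ⋙ par ≅ 𝟭 C :=
    natIsoOfCell (whiskIso (compIso (tensIso ψ idIso) φ) _) idIso M.leftUnit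
  let rN : prod.rightInverseUnitor C ⋙ ((𝟭 C).prod (Functor.fromPUnit.{u} bot)) ⋙ par ≅ 𝟭 C :=
    natIsoOfCell (whiskIso (compIso (tensIso idIso ψ) φ) _) idIso M.rightUnit
  let al : ∀ X Y Z : C, par.obj (par.obj (X, Y), Z) ≅ par.obj (X, par.obj (Y, Z)) :=
    fun X Y Z => αN.app ((X, Y), Z)
  let la : ∀ X : C, par.obj (bot, X) ≅ X := fun X => lN.app X
  let ra : ∀ X : C, par.obj (X, bot) ≅ X := fun X => rN.app X
  let m : ∀ {X Y Z : C}, El M.mul (X, Y) Z → (Z ⟶ par.obj (X, Y)) := fun a => val φ a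
  let m' : ∀ {X Y Z : C}, (Z ⟶ par.obj (X, Y)) → El M.mul (X, Y) Z := fun a => elt φ a
  have mm' : ∀ {X Y Z : C} (f : Z ⟶ par.obj (X, Y)), m (m' f) = f := fun f => val_elt φ f
  let um : ∀ {Z : C}, El M.one pt Z → (Z ⟶ bot) := fun a => val ψ a
  -- With this equivalence, a hypothesis `M.Assoc` can be verified for chosen elements by a
  -- computation of morphisms.
  have hα : ∀ {X Y Z V U W : C} (a : El M.mul (X, Y) V) (b : El M.mul (V, Z) W)
      (p : El M.mul (Y, Z) U) (q : El M.mul (X, U) W), M.Assoc a b p q ↔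
      m b ≫ par.map (Prod.mkHom (m a) (𝟙 Z)) ≫ (al X Y Z).hom =
        m q ≫ par.map (Prod.mkHom (𝟙 X) (m p)) := by
    intro X Y Z V U W a b p q
    have h := val_app₂_iso (compIso (tensIso φ idIso) φ)
      (whiskIso (compIso (tensIso idIso φ) φ) _) M.assoc (a := ((X, Y), Z)) (b := W)
      (glue (pair a (wire (𝟙 Z))) b)
    have h₁ := val_compIso_glue (tensIso φ idIso) φ (a := ((X, Y), Z)) (pair a (wire (𝟙 Z))) b
    have h' : val (whiskIso (compIso (tensIso idIso φ) φ) (prod.associator C C C))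
      (a := ((X, Y), Z)) (b := W) (glue (b := (X, U)) (pair (wire (𝟙 X)) p) q) =
        m q ≫ par.map (Prod.mkHom (𝟙 X) (m p)) := val_compIso_glue _ _ _ _
    have h₂ := h.trans ((congrArg (· ≫ (al X Y Z).hom) h₁).trans (Category.assoc _ _ _))
    exact ⟨fun e => h₂.symm.trans ((congrArg _ e).trans h'),
      fun e => val_injective _ (h₂.trans (e.trans h'.symm))⟩
  have hl : ∀ {X W P : C} (p : El M.one pt P) (a : El M.mul (P, X) W),
      M.lam p a = m a ≫ par.map (Prod.mkHom (um p) (𝟙 X)) ≫ (la X).hom := by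
    intro X W P p a
    have h := val_app₂_iso (whiskIso (compIso (tensIso ψ idIso) φ) _) idIso M.leftUnit
      (a := X) (b := W) (glue (b := (P, X)) (pair p (wire (𝟙 X))) a)
    have h' : val (whiskIso (compIso (tensIso ψ idIso) φ) (prod.leftInverseUnitor C))
      (a := X) (b := W) (glue (b := (P, X)) (pair p (wire (𝟙 X))) a) =
        m a ≫ par.map (Prod.mkHom (um p) (𝟙 X)) :=
      val_compIso_glue _ _ _ _
    exact h.trans ((congrArg (· ≫ (la X).hom) h').trans (Category.assoc _ _ _))
  have hr : ∀ {X W P : C} (p : El M.one pt P) (a : El M.mul (X, P) W),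
      M.rho p a = m a ≫ par.map (Prod.mkHom (𝟙 X) (um p)) ≫ (ra X).hom := by
    intro X W P p a
    have h := val_app₂_iso (whiskIso (compIso (tensIso idIso ψ) φ) _) idIso M.rightUnit
      (a := X) (b := W) (glue (b := (X, P)) (pair (wire (𝟙 X)) p) a)
    have h' : val (whiskIso (compIso (tensIso idIso ψ) φ) (prod.rightInverseUnitor C))
      (a := X) (b := W) (glue (b := (X, P)) (pair (wire (𝟙 X)) p) a) =
        m a ≫ par.map (Prod.mkHom (𝟙 X) (um p)) :=
      val_compIso_glue _ _ _ _
    exact h.trans ((congrArg (· ≫ (ra X).hom) h').trans (Category.assoc _ _ _))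
  have pcomp : ∀ {X Y X' Y' X'' Y'' : C} (f : X ⟶ X') (g : Y ⟶ Y') (f' : X' ⟶ X'')
      (g' : Y' ⟶ Y''), par.map (Prod.mkHom f g) ≫ par.map (Prod.mkHom f' g') =
      par.map (Prod.mkHom (f ≫ f') (g ≫ g')) := fun f g f' g' =>
    (par.map_comp (Prod.mkHom f g) (Prod.mkHom f' g')).symm
  have pid : ∀ X Y : C, par.map (Prod.mkHom (𝟙 X) (𝟙 Y)) = 𝟙 (par.obj (X, Y)) :=
    fun X Y => par.map_id (X, Y)
  have m_act : ∀ {X Y X' Y' Z Z' : C} (f : X ⟶ X') (g : Y ⟶ Y') (h : Z' ⟶ Z)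
      (a : El M.mul (X, Y) Z), m (act M.mul (Prod.mkHom f g) h a) =
      h ≫ m a ≫ par.map (Prod.mkHom f g) := fun f g h a => val_act φ _ _ _
  have hpent : ∀ X Y Z T : C, par.map (Prod.mkHom (al X Y Z).hom (𝟙 T)) ≫
      (al X (par.obj (Y, Z)) T).hom ≫ par.map (Prod.mkHom (𝟙 X) (al Y Z T).hom) =
      (al (par.obj (X, Y)) Z T).hom ≫ (al X Y (par.obj (Z, T))).hom := by
    intro X Y Z T
    -- Every first factor is given by an identity; the remaining elements are then forced to be
    -- composites of associators.
    have := M.pentagon (a := m' (𝟙 (par.obj (X, Y)))) (b := m' (𝟙 (par.obj (_, Z))))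
      (c := m' (𝟙 (par.obj (_, T)))) (p := m' (𝟙 (par.obj (Z, T))))
      (q := m' (al _ Z T).hom) (r := m' (𝟙 (par.obj (Y, _))))
      (s := m' ((al _ Z T).hom ≫ (al X Y _).hom)) (p' := m' (𝟙 (par.obj (Y, Z))))
      (q' := m' (al X Y Z).hom) (p'' := m' (𝟙 (par.obj (_, T))))
      (q'' := m' (par.map (Prod.mkHom (al X Y Z).hom (𝟙 T)) ≫ (al X _ T).hom))
      (r' := m' (𝟙 _)) (s' := m' (al Y Z T).hom)
      ((hα _ _ _ _).2 (by simp [mm', pid])) ((hα _ _ _ _).2 (by simp [mm', pid]))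
      ((hα _ _ _ _).2 (by simp [mm', pid])) ((hα _ _ _ _).2 (by simp [mm', pid]))
      ((hα _ _ _ _).2 (by simp [mm', pid]))
    have h := (M.glue_right_iff₂ φ _ _ _ _ _ _).1 this
    change (m (m' _) ≫ par.map (Prod.mkHom (𝟙 X) (m (m' _)))) ≫
        par.map (Prod.mkHom (𝟙 X) (par.map (Prod.mkHom (𝟙 Y) (m (m' _))))) =
      (m (m' _) ≫ par.map (Prod.mkHom (𝟙 X) (m (m' _)))) ≫
        par.map (Prod.mkHom (𝟙 X) (par.map (Prod.mkHom (𝟙 Y) (m (m' _))))) at h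
    simp only [mm', pid, Category.comp_id, Category.assoc] at h
    exact h.symm
  have htri : ∀ X Z : C, (al X bot Z).hom ≫ par.map (Prod.mkHom (𝟙 X) (la Z).hom) =
      par.map (Prod.mkHom (ra X).hom (𝟙 Z)) := by
    intro X Z
    have h := M.triangle (p := elt ψ (a := pt) (𝟙 bot)) (a := m' (𝟙 (par.obj (X, bot))))
      (b := m' (𝟙 (par.obj (_, Z)))) (r := m' (𝟙 (par.obj (bot, Z)))) (s := m' (al X bot Z).hom)
      ((hα _ _ _ _).2 (by simp [mm', pid]))
    have h' := congrArg m h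
    have hu : um (elt ψ (a := pt) (𝟙 bot)) = 𝟙 bot := val_elt ψ _
    rw [m_act, m_act, hr, hl] at h'
    simp only [mm', hu, pid, Category.id_comp] at h'
    exact h'.symm
  let MS : MonoidalCategoryStruct C :=
    { tensorObj := fun X Y => par.obj (X, Y)
      whiskerLeft := fun X _ _ f => par.map (Prod.mkHom (𝟙 X) f)
      whiskerRight := fun f Y => par.map (Prod.mkHom f (𝟙 Y))
      tensorHom := fun f g => par.map (Prod.mkHom f g)
      tensorUnit := bot
      associator := al
      leftUnitor := la
      rightUnitor := ra }
  let T : MonoidalCategory C := @MonoidalCategory.ofTensorHom C _ MS pid (fun _ _ _ _ => rfl)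
    (fun _ _ => rfl) pcomp
    (fun {X₁ X₂ X₃ Y₁ Y₂ Y₃} f₁ f₂ f₃ => αN.hom.naturality (X := ((X₁, X₂), X₃))
      (Y := ((Y₁, Y₂), Y₃)) (Prod.mkHom (Prod.mkHom f₁ f₂) f₃))
    (fun {X Y} f => lN.hom.naturality f) (fun {X Y} f => rN.hom.naturality f)
    hpent htri
  exact ⟨T, ⟨{ mul := φ, one := ψ, assoc := fun {X Y Z V U W a b p q} h => (hα a b p q).1 h,
               lam := hl, rho := hr }⟩⟩

end FromPseudomonoid

end Monoid

/-! ### Pseudocomonoids corepresented by a monoidal structure -/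

section Comonoid

variable {C : Type u} [SmallCategory C]

lemma PseudocomonoidData.colam_act (K : PseudocomonoidData C) {X X' W W' P : C}
    (a : El K.comul W (P, X)) (t : El K.counit P pt) (f : W ⟶ W') (g : X' ⟶ X) :
    K.colam (act K.comul f (Prod.mkHom (𝟙 P) g) a) t = g ≫ K.colam a t ≫ f := by
  have h := app₂_act K.leftCounit.hom (b := X) (b' := X') f g
    (glue (b := (P, X)) a (pair t (wire (𝟙 X))))
  have h' := act_glue (P := K.comul) (Q := tens K.counit (idP C)) (e := (pt, X)) (e' := (pt, X'))
    f (Prod.mkHom (𝟙 pt) g) a (pair t (wire (𝟙 X)))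
  have h₁ : (act (tens K.counit (idP C)) (b := (pt, X)) (b' := (pt, X')) (𝟙 (P, X))
      (Prod.mkHom (𝟙 pt) g) (pair t (wire (𝟙 X)))) =
      act (tens K.counit (idP C)) (Prod.mkHom (𝟙 P) g) (𝟙 (pt, X')) (pair t (wire (𝟙 X'))) := by
    rw [act_pair, act_pair]
    refine congrArg₂ Prod.mk rfl ?_
    exact (act_wire _ _ _).trans ((by simp : _ = _).trans (act_wire _ _ _).symm)
  rw [h₁, ← glue_slide, act_act, Category.comp_id, Category.comp_id] at h'
  exact ((congrArg (app₂ K.leftCounit.hom (a := W') (b := X')) h').symm.trans h).trans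
    (act_wire f g (K.colam a t))

lemma PseudocomonoidData.corho_act (K : PseudocomonoidData C) {X X' W W' P : C}
    (a : El K.comul W (X, P)) (t : El K.counit P pt) (f : W ⟶ W') (g : X' ⟶ X) :
    K.corho (act K.comul f (Prod.mkHom g (𝟙 P)) a) t = g ≫ K.corho a t ≫ f := by
  have h := app₂_act K.rightCounit.hom (b := X) (b' := X') f g
    (glue (b := (X, P)) a (pair (wire (𝟙 X)) t))
  have h' := act_glue (P := K.comul) (Q := tens (idP C) K.counit) (e := (X, pt)) (e' := (X', pt))
    f (Prod.mkHom g (𝟙 pt)) a (pair (wire (𝟙 X)) t)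
  have h₁ : (act (tens (idP C) K.counit) (b := (X, pt)) (b' := (X', pt)) (𝟙 (X, P))
      (Prod.mkHom g (𝟙 pt)) (pair (wire (𝟙 X)) t)) =
      act (tens (idP C) K.counit) (Prod.mkHom g (𝟙 P)) (𝟙 (X', pt)) (pair (wire (𝟙 X')) t) := by
    rw [act_pair, act_pair]
    refine congrArg₂ Prod.mk ?_ rfl
    exact (act_wire _ _ _).trans ((by simp : _ = _).trans (act_wire _ _ _).symm)
  rw [h₁, ← glue_slide, act_act, Category.comp_id, Category.comp_id] at h'
  exact ((congrArg (app₂ K.rightCounit.hom (a := W') (b := X')) h').symm.trans h).trans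
    (act_wire f g (K.corho a t))

lemma PseudocomonoidData.colam_slide (K : PseudocomonoidData C) {X W P P' : C}
    (a : El K.comul W (P', X)) (t : El K.counit P pt) (f : P ⟶ P') :
    K.colam (act K.comul (𝟙 W) (Prod.mkHom f (𝟙 X)) a) t = K.colam a (act K.counit f (𝟙 pt) t) := by
  refine congrArg (app₂ K.leftCounit.hom (a := W) (b := X)) ((glue_slide _ _ _).trans ?_)
  refine congrArg (glue a) ?_
  erw [act_pair]
  exact congrArg₂ Prod.mk rfl (act_id (idP C) _)

lemma PseudocomonoidData.corho_slide (K : PseudocomonoidData C) {X W P P' : C}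
    (a : El K.comul W (X, P')) (t : El K.counit P pt) (f : P ⟶ P') :
    K.corho (act K.comul (𝟙 W) (Prod.mkHom (𝟙 X) f) a) t = K.corho a (act K.counit f (𝟙 pt) t) := by
  refine congrArg (app₂ K.rightCounit.hom (a := W) (b := X)) ((glue_slide _ _ _).trans ?_)
  refine congrArg (glue a) ?_
  erw [act_pair]
  exact congrArg₂ Prod.mk (act_id (idP C) _) rfl

section

variable (K : PseudocomonoidData C) {ten : C × C ⥤ C} (φ : K.comul ≅ ten.toProfunctorRev)

lemma PseudocomonoidData.glue_right_iff {X Y Z W U U' : C} (p : El K.comul W (X, U))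
    (q : El K.comul U (Y, Z)) (p' : El K.comul W (X, U')) (q' : El K.comul U' (Y, Z)) :
    (glue p (pair (wire (𝟙 X)) q) : El (comp K.comul (tens (idP C) K.comul)) W (X, (Y, Z))) =
      glue p' (pair (wire (𝟙 X)) q') ↔
    ten.map (Prod.mkHom (𝟙 X) (coval φ q)) ≫ coval φ p =
      ten.map (Prod.mkHom (𝟙 X) (coval φ q')) ≫ coval φ p' := by
  have key : ∀ {U : C} (p : El K.comul W (X, U)) (q : El K.comul U (Y, Z)),
      coval (compIsoRev φ (tensIsoRev idIsoRev φ)) (a := W) (b := (X, (Y, Z)))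
        (glue (b := (X, U)) p (pair (wire (𝟙 X)) q)) =
      ten.map (Prod.mkHom (𝟙 X) (coval φ q)) ≫ coval φ p :=
    fun p q => coval_compIsoRev_glue _ _ _ _
  rw [← key, ← key]
  exact ⟨congrArg _, coval_injective _⟩

lemma PseudocomonoidData.glue_right_iff₂ {X Y Z T W U Q U' Q' : C} (p : El K.comul U (Z, T))
    (r : El K.comul Q (Y, U)) (s : El K.comul W (X, Q)) (p' : El K.comul U' (Z, T))
    (r' : El K.comul Q' (Y, U')) (s' : El K.comul W (X, Q')) :
    (glue s (glue (pair (wire (𝟙 X)) r) (pair (wire (𝟙 X)) (pair (wire (𝟙 Y)) p))) :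
      El (comp K.comul (comp (tens (idP C) K.comul) (tens (idP C) (tens (idP C) K.comul))))
        W (X, (Y, (Z, T)))) =
      glue s' (glue (pair (wire (𝟙 X)) r') (pair (wire (𝟙 X)) (pair (wire (𝟙 Y)) p'))) ↔
    ten.map (Prod.mkHom (𝟙 X) (ten.map (Prod.mkHom (𝟙 Y) (coval φ p)) ≫ coval φ r)) ≫
        coval φ s =
      ten.map (Prod.mkHom (𝟙 X) (ten.map (Prod.mkHom (𝟙 Y) (coval φ p')) ≫ coval φ r')) ≫
        coval φ s' := by
  let θ := compIsoRev φ (compIsoRev (tensIsoRev idIsoRev φ)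
    (tensIsoRev idIsoRev (tensIsoRev idIsoRev φ)))
  have key : ∀ {U Q : C} (p : El K.comul U (Z, T)) (r : El K.comul Q (Y, U))
      (s : El K.comul W (X, Q)),
      coval θ (glue s (glue (pair (wire (𝟙 X)) r) (pair (wire (𝟙 X)) (pair (wire (𝟙 Y)) p)))) =
      ten.map (Prod.mkHom (𝟙 X) (ten.map (Prod.mkHom (𝟙 Y) (coval φ p)) ≫ coval φ r)) ≫
        coval φ s := by
    intro U Q p r s
    have e : ∀ {X₁ X₂ X₃ : C} (f : X₂ ⟶ X₃) (g : X₁ ⟶ X₂),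
        ten.map (Prod.mkHom (𝟙 X ≫ 𝟙 X) (g ≫ f)) = ten.map (Prod.mkHom (𝟙 X) (g ≫ f)) := by
      intros; simp
    exact (coval_compIsoRev_glue _ _ _ _).trans (congrArg (· ≫ _)
      ((congrArg (fun z => ten.map z) (coval_compIsoRev_glue _ _ _ _)).trans (e _ _)))
  exact ⟨fun h => (key p r s).symm.trans ((congrArg _ h).trans (key p' r' s')),
    fun h => coval_injective θ ((key p r s).trans (h.trans (key p' r' s').symm))⟩

end

/-- Identifications of the 1-cells of a pseudocomonoid with those of a monoidal structure. -/
structure ComonDictData (K : PseudocomonoidData C) (T : MonoidalCategory C) where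
  comul : K.comul ≅ (@MonoidalCategory.tensor C _ T).toProfunctorRev
  counit : K.counit ≅ (Functor.fromPUnit.{u} T.tensorUnit).toProfunctorRev

namespace ComonDictData

variable {K : PseudocomonoidData C} {T : MonoidalCategory C} (D : ComonDictData K T)

/-- The morphism of an element of the comultiplication. -/
def d {X Y Z : C} (a : El K.comul Z (X, Y)) : X ⊗ Y ⟶ Z := coval D.comul a

/-- The morphism of an element of the counit. -/
def e {Z : C} (x : El K.counit Z pt) : 𝟙_ C ⟶ Z := coval D.counit x

/-- The element of the comultiplication with a given morphism. -/
def dElt {X Y Z : C} (f : X ⊗ Y ⟶ Z) : El K.comul Z (X, Y) := coelt D.comul f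

/-- The element of the counit with a given morphism. -/
def eElt {Z : C} (f : 𝟙_ C ⟶ Z) : El K.counit Z pt := coelt D.counit f

@[simp] lemma d_dElt {X Y Z : C} (f : X ⊗ Y ⟶ Z) : D.d (D.dElt f) = f :=
  coval_coelt D.comul (b := (X, Y)) f
@[simp] lemma e_eElt {Z : C} (f : 𝟙_ C ⟶ Z) : D.e (D.eElt f) = f :=
  coval_coelt D.counit (b := pt) f

lemma d_injective {X Y Z : C} {a b : El K.comul Z (X, Y)} (h : D.d a = D.d b) : a = b :=
  coval_injective D.comul h

lemma d_act {X Y X' Y' Z Z' : C} (f : Z ⟶ Z') (g : (X', Y') ⟶ (X, Y)) (a : El K.comul Z (X, Y)) :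
    D.d (act K.comul f g a) = (g.1 ⊗ₘ g.2) ≫ D.d a ≫ f := coval_act D.comul f g a

lemma e_act {Z Z' : C} (f : Z ⟶ Z') (x : El K.counit Z pt) :
    D.e (act K.counit f (𝟙 pt) x) = D.e x ≫ f :=
  (coval_act D.counit f (𝟙 pt) x).trans (Category.id_comp (D.e x ≫ f))

lemma glue_right {X Y Z W U U' : C} (p : El K.comul W (X, U))
    (q : El K.comul U (Y, Z)) (p' : El K.comul W (X, U')) (q' : El K.comul U' (Y, Z)) :
    (glue p (pair (wire (𝟙 X)) q) : El (comp K.comul (tens (idP C) K.comul)) W (X, (Y, Z))) =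
      glue p' (pair (wire (𝟙 X)) q') ↔ X ◁ D.d q ≫ D.d p = X ◁ D.d q' ≫ D.d p' := by
  rw [← id_tensorHom, ← id_tensorHom]
  exact K.glue_right_iff D.comul p q p' q'

lemma glue_right₂ {X Y Z T W U Q U' Q' : C} (p : El K.comul U (Z, T))
    (r : El K.comul Q (Y, U)) (s : El K.comul W (X, Q)) (p' : El K.comul U' (Z, T))
    (r' : El K.comul Q' (Y, U')) (s' : El K.comul W (X, Q')) :
    (glue s (glue (pair (wire (𝟙 X)) r) (pair (wire (𝟙 X)) (pair (wire (𝟙 Y)) p))) :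
      El (comp K.comul (comp (tens (idP C) K.comul) (tens (idP C) (tens (idP C) K.comul))))
        W (X, (Y, (Z, T)))) =
      glue s' (glue (pair (wire (𝟙 X)) r') (pair (wire (𝟙 X)) (pair (wire (𝟙 Y)) p'))) ↔
    X ◁ (Y ◁ D.d p ≫ D.d r) ≫ D.d s = X ◁ (Y ◁ D.d p' ≫ D.d r') ≫ D.d s' := by
  simp only [← id_tensorHom]
  exact K.glue_right_iff₂ D.comul p r s p' r' s'

end ComonDictData

/-- Identifications of a pseudocomonoid in profunctors with a monoidal structure. -/
structure ComonDict (K : PseudocomonoidData C) (T : MonoidalCategory C) extends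
    ComonDictData K T where
  coassoc : ∀ {X Y Z V U W : C} {a : El K.comul W (V, Z)} {b : El K.comul V (X, Y)}
    {p : El K.comul W (X, U)} {q : El K.comul U (Y, Z)}, K.Coassoc a b p q →
    toComonDictData.d b ▷ Z ≫ toComonDictData.d a =
      (α_ X Y Z).hom ≫ X ◁ toComonDictData.d q ≫ toComonDictData.d p
  colam : ∀ {X W P : C} (a : El K.comul W (P, X)) (t : El K.counit P pt),
    K.colam a t = (λ_ X).inv ≫ toComonDictData.e t ▷ X ≫ toComonDictData.d a
  corho : ∀ {X W P : C} (a : El K.comul W (X, P)) (t : El K.counit P pt),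
    K.corho a t = (ρ_ X).inv ≫ X ◁ toComonDictData.e t ≫ toComonDictData.d a

namespace ComonDict

variable {K : PseudocomonoidData C} {T : MonoidalCategory C} (D : ComonDict K T)

lemma coassoc_iff {X Y Z V U W : C} {a : El K.comul W (V, Z)} {b : El K.comul V (X, Y)}
    {p : El K.comul W (X, U)} {q : El K.comul U (Y, Z)} : K.Coassoc a b p q ↔
    D.d b ▷ Z ≫ D.d a = (α_ X Y Z).hom ≫ X ◁ D.d q ≫ D.d p := by
  refine ⟨D.coassoc, fun h => ?_⟩
  obtain ⟨⟨X', U'⟩, p', ⟨(f : X ⟶ X'), (q' : El K.comul U' (Y, Z))⟩, e⟩ :=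
    exists_glue (app₂ K.coassoc.hom (a := W) (b := ((X, Y), Z)) (glue a (pair b (wire (𝟙 Z)))))
  have e₁ : (pair (wire f) q' : El (tens (idP C) K.comul) (X', U') (X, (Y, Z))) =
      act (tens (idP C) K.comul) (Prod.mkHom f (𝟙 U')) (𝟙 (X, (Y, Z)))
        (pair (wire (𝟙 X)) q') := by
    rw [act_pair]
    exact congrArg₂ Prod.mk ((by simp : f = 𝟙 X ≫ 𝟙 X ≫ f).trans (act_wire _ _ _).symm)
      (act_id K.comul q').symm
  have e₂ : K.Coassoc a b (act K.comul (𝟙 W) (Prod.mkHom f (𝟙 U')) p') q' :=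
    e.trans ((congrArg (fun z => glue p' z) e₁).trans (glue_slide _ _ _).symm)
  refine e₂.trans ((D.glue_right _ _ _ _).2 ?_)
  rw [← cancel_epi (α_ X Y Z).hom]
  exact (D.coassoc e₂).symm.trans h

end ComonDict

/-- This is the argument of `exists_monDict_of_pseudomonoid` with the variance reversed: passing
from corepresented profunctors to functors is contravariant, so the given 2-cells yield the inverses
of the associator and of the unitors. -/
lemma exists_comonDict_of_pseudocomonoid (K : Pseudocomonoid C) {ten : C × C ⥤ C} {un : C}
    (φ : K.comul ≅ ten.toProfunctorRev)
    (ψ : K.counit ≅ (Functor.fromPUnit.{u} un).toProfunctorRev) :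
    ∃ T : MonoidalCategory C, Nonempty (ComonDict K.toPseudocomonoidData T) := by
  let αN : prod.associator C C C ⋙ ((𝟭 C).prod ten) ⋙ ten ≅ (ten.prod (𝟭 C)) ⋙ ten :=
    natIsoOfCellRev (compIsoRev φ (tensIsoRev φ idIsoRev))
      (whiskIsoRev (compIsoRev φ (tensIsoRev idIsoRev φ)) _) K.coassoc
  let lN : 𝟭 C ≅ prod.leftInverseUnitor C ⋙ ((Functor.fromPUnit.{u} un).prod (𝟭 C)) ⋙ ten :=
    natIsoOfCellRev (whiskIsoRev (compIsoRev φ (tensIsoRev ψ idIsoRev)) _) idIsoRev K.leftCounit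
  let rN : 𝟭 C ≅ prod.rightInverseUnitor C ⋙ ((𝟭 C).prod (Functor.fromPUnit.{u} un)) ⋙ ten :=
    natIsoOfCellRev (whiskIsoRev (compIsoRev φ (tensIsoRev idIsoRev ψ)) _) idIsoRev K.rightCounit
  -- The coassociator 2-cell goes from the left to the right bracketing, hence the transformation it
  -- induces goes from the right to the left one and has to be inverted.
  let al : ∀ X Y Z : C, ten.obj (ten.obj (X, Y), Z) ≅ ten.obj (X, ten.obj (Y, Z)) :=
    fun X Y Z => (αN.app ((X, Y), Z)).symm
  let la : ∀ X : C, ten.obj (un, X) ≅ X := fun X => (lN.app X).symm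
  let ra : ∀ X : C, ten.obj (X, un) ≅ X := fun X => (rN.app X).symm
  let d : ∀ {X Y Z : C}, El K.comul Z (X, Y) → (ten.obj (X, Y) ⟶ Z) := fun a => coval φ a
  let d' : ∀ {X Y Z : C}, (ten.obj (X, Y) ⟶ Z) → El K.comul Z (X, Y) := fun a => coelt φ a
  have dd' : ∀ {X Y Z : C} (f : ten.obj (X, Y) ⟶ Z), d (d' f) = f := fun f => coval_coelt φ f
  let en : ∀ {Z : C}, El K.counit Z pt → (un ⟶ Z) := fun a => coval ψ a
  have hα : ∀ {X Y Z V U W : C} (a : El K.comul W (V, Z)) (b : El K.comul V (X, Y))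
      (p : El K.comul W (X, U)) (q : El K.comul U (Y, Z)), K.Coassoc a b p q ↔
      ten.map (Prod.mkHom (d b) (𝟙 Z)) ≫ d a =
        (al X Y Z).hom ≫ ten.map (Prod.mkHom (𝟙 X) (d q)) ≫ d p := by
    intro X Y Z V U W a b p q
    have h := coval_app₂_iso (compIsoRev φ (tensIsoRev φ idIsoRev))
      (whiskIsoRev (compIsoRev φ (tensIsoRev idIsoRev φ)) _) K.coassoc (a := W) (b := ((X, Y), Z))
      (glue a (pair b (wire (𝟙 Z))))
    have h₁ := coval_compIsoRev_glue φ (tensIsoRev φ idIsoRev) (e := ((X, Y), Z))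
      a (pair b (wire (𝟙 Z)))
    have h' : coval (whiskIsoRev (compIsoRev φ (tensIsoRev idIsoRev φ)) (prod.associator C C C))
      (a := W) (b := ((X, Y), Z)) (glue (b := (X, U)) p (pair (wire (𝟙 X)) q)) =
        ten.map (Prod.mkHom (𝟙 X) (d q)) ≫ d p := coval_compIsoRev_glue _ _ _ _
    have h₂ := h.trans (congrArg ((al X Y Z).inv ≫ ·) h₁)
    rw [← Iso.inv_comp_eq]
    exact ⟨fun e => h₂.symm.trans ((congrArg _ e).trans h'),
      fun e => coval_injective _ (h₂.trans (e.trans h'.symm))⟩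
  have hl : ∀ {X W P : C} (a : El K.comul W (P, X)) (p : El K.counit P pt),
      K.colam a p = (la X).inv ≫ ten.map (Prod.mkHom (en p) (𝟙 X)) ≫ d a := by
    intro X W P a p
    have h := coval_app₂_iso (whiskIsoRev (compIsoRev φ (tensIsoRev ψ idIsoRev)) _) idIsoRev
      K.leftCounit (a := W) (b := X) (glue (b := (P, X)) a (pair p (wire (𝟙 X))))
    have h' : coval (whiskIsoRev (compIsoRev φ (tensIsoRev ψ idIsoRev))
      (prod.leftInverseUnitor C)) (a := W) (b := X) (glue (b := (P, X)) a (pair p (wire (𝟙 X)))) =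
        ten.map (Prod.mkHom (en p) (𝟙 X)) ≫ d a :=
      coval_compIsoRev_glue _ _ _ _
    exact h.trans (congrArg ((la X).inv ≫ ·) h')
  have hr : ∀ {X W P : C} (a : El K.comul W (X, P)) (p : El K.counit P pt),
      K.corho a p = (ra X).inv ≫ ten.map (Prod.mkHom (𝟙 X) (en p)) ≫ d a := by
    intro X W P a p
    have h := coval_app₂_iso (whiskIsoRev (compIsoRev φ (tensIsoRev idIsoRev ψ)) _) idIsoRev
      K.rightCounit (a := W) (b := X) (glue (b := (X, P)) a (pair (wire (𝟙 X)) p))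
    have h' : coval (whiskIsoRev (compIsoRev φ (tensIsoRev idIsoRev ψ))
      (prod.rightInverseUnitor C)) (a := W) (b := X) (glue (b := (X, P)) a (pair (wire (𝟙 X)) p)) =
        ten.map (Prod.mkHom (𝟙 X) (en p)) ≫ d a :=
      coval_compIsoRev_glue _ _ _ _
    exact h.trans (congrArg ((ra X).inv ≫ ·) h')
  have pcomp : ∀ {X Y X' Y' X'' Y'' : C} (f : X ⟶ X') (g : Y ⟶ Y') (f' : X' ⟶ X'')
      (g' : Y' ⟶ Y''), ten.map (Prod.mkHom f g) ≫ ten.map (Prod.mkHom f' g') =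
      ten.map (Prod.mkHom (f ≫ f') (g ≫ g')) := fun f g f' g' =>
    (ten.map_comp (Prod.mkHom f g) (Prod.mkHom f' g')).symm
  have pid : ∀ X Y : C, ten.map (Prod.mkHom (𝟙 X) (𝟙 Y)) = 𝟙 (ten.obj (X, Y)) :=
    fun X Y => ten.map_id (X, Y)
  let tIso : ∀ {X Y X' Y' : C} (f : X ≅ X') (g : Y ≅ Y'), ten.obj (X, Y) ≅ ten.obj (X', Y') :=
    fun f g => ten.mapIso (Iso.prod f g)
  have d_act : ∀ {X Y X' Y' Z Z' : C} (f : Z ⟶ Z') (g : X' ⟶ X) (h : Y' ⟶ Y)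
      (a : El K.comul Z (X, Y)), d (act K.comul f (Prod.mkHom g h) a) =
      ten.map (Prod.mkHom g h) ≫ d a ≫ f := fun f g h a => coval_act φ _ _ _
  have hpent : ∀ X Y Z T : C, ten.map (Prod.mkHom (al X Y Z).hom (𝟙 T)) ≫
      (al X (ten.obj (Y, Z)) T).hom ≫ ten.map (Prod.mkHom (𝟙 X) (al Y Z T).hom) =
      (al (ten.obj (X, Y)) Z T).hom ≫ (al X Y (ten.obj (Z, T))).hom := by
    intro X Y Z T
    have := K.copentagon (a := d' (𝟙 (ten.obj (X, Y)))) (b := d' (𝟙 (ten.obj (_, Z))))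
      (c := d' (𝟙 (ten.obj (_, T)))) (p := d' (𝟙 (ten.obj (Z, T))))
      (q := d' (al _ Z T).inv) (r := d' (𝟙 (ten.obj (Y, _))))
      (s := d' ((al X Y _).inv ≫ (al _ Z T).inv)) (p' := d' (𝟙 (ten.obj (Y, Z))))
      (q' := d' (al X Y Z).inv) (p'' := d' (𝟙 (ten.obj (_, T))))
      (q'' := d' ((al X _ T).inv ≫ ten.map (Prod.mkHom (al X Y Z).inv (𝟙 T))))
      (r' := d' (𝟙 _)) (s' := d' (al Y Z T).inv)
      ((hα _ _ _ _).2 (by simp [dd', pid])) ((hα _ _ _ _).2 (by simp [dd', pid]))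
      ((hα _ _ _ _).2 (by simp [dd', pid])) ((hα _ _ _ _).2 (by simp [dd', pid]))
      ((hα _ _ _ _).2 (by simp [dd', pid]))
    have h := (K.glue_right_iff₂ φ _ _ _ _ _ _).1 this
    change ten.map (Prod.mkHom (𝟙 X) (ten.map (Prod.mkHom (𝟙 Y) (d (d' _))) ≫ d (d' _))) ≫
        d (d' _) =
      ten.map (Prod.mkHom (𝟙 X) (ten.map (Prod.mkHom (𝟙 Y) (d (d' _))) ≫ d (d' _))) ≫
        d (d' _) at h
    simp only [dd', pid, Category.comp_id, Category.id_comp] at h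
    -- The equation obtained is the pentagon for the inverses; writing the whiskered associators as
    -- components of isomorphisms `tIso` lets it be inverted as a whole.
    change (al X Y _).inv ≫ (al _ Z T).inv = (tIso (Iso.refl X) (al Y Z T)).inv ≫ (al X _ T).inv ≫
      (tIso (al X Y Z) (Iso.refl T)).inv at h
    change (tIso (al X Y Z) (Iso.refl T)).hom ≫ (al X _ T).hom ≫
      (tIso (Iso.refl X) (al Y Z T)).hom = _
    have e : ((al X Y _).inv ≫ (al _ Z T).inv) ≫ (al _ Z T).hom ≫ (al X Y _).hom = 𝟙 _ := by
      simp
    rw [← cancel_epi ((al X Y (ten.obj (Z, T))).inv ≫ (al (ten.obj (X, Y)) Z T).inv), e, h]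
    simp
  have htri : ∀ X Z : C, (al X un Z).hom ≫ ten.map (Prod.mkHom (𝟙 X) (la Z).hom) =
      ten.map (Prod.mkHom (ra X).hom (𝟙 Z)) := by
    intro X Z
    have h := K.cotriangle (t := coelt ψ (b := pt) (𝟙 un)) (a := d' (𝟙 (ten.obj (X, un))))
      (b := d' (𝟙 (ten.obj (_, Z)))) (r := d' (𝟙 (ten.obj (un, Z)))) (s := d' (al X un Z).inv)
      ((hα _ _ _ _).2 (by simp [dd', pid]))
    have h' := congrArg d h
    have hu : en (coelt ψ (b := pt) (𝟙 un)) = 𝟙 un := coval_coelt ψ _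
    rw [d_act, d_act, hr, hl] at h'
    simp only [dd', hu, pid, Category.comp_id] at h'
    change (tIso (ra X) (Iso.refl Z)).inv = (tIso (Iso.refl X) (la Z)).inv ≫ (al X un Z).inv at h'
    change _ ≫ (tIso (Iso.refl X) (la Z)).hom = (tIso (ra X) (Iso.refl Z)).hom
    rw [← cancel_epi (tIso (ra X) (Iso.refl Z)).inv, Iso.inv_hom_id, h']
    simp
  let MS : MonoidalCategoryStruct C :=
    { tensorObj := fun X Y => ten.obj (X, Y)
      whiskerLeft := fun X _ _ f => ten.map (Prod.mkHom (𝟙 X) f)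
      whiskerRight := fun f Y => ten.map (Prod.mkHom f (𝟙 Y))
      tensorHom := fun f g => ten.map (Prod.mkHom f g)
      tensorUnit := un
      associator := al
      leftUnitor := la
      rightUnitor := ra }
  let T : MonoidalCategory C := @MonoidalCategory.ofTensorHom C _ MS pid (fun _ _ _ _ => rfl)
    (fun _ _ => rfl) pcomp
    (fun {X₁ X₂ X₃ Y₁ Y₂ Y₃} f₁ f₂ f₃ => αN.inv.naturality (X := ((X₁, X₂), X₃))
      (Y := ((Y₁, Y₂), Y₃)) (Prod.mkHom (Prod.mkHom f₁ f₂) f₃))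
    (fun {X Y} f => lN.inv.naturality f) (fun {X Y} f => rN.inv.naturality f)
    hpent htri
  exact ⟨T, ⟨{ comul := φ, counit := ψ, coassoc := fun {X Y Z V U W a b p q} h => (hα a b p q).1 h,
               colam := hl, corho := hr }⟩⟩

end Comonoid

/-! ### Monoidal categories as pseudomonoids and pseudocomonoids -/

section FromMonoidal

variable {C : Type u} [SmallCategory C]

/-- The elements are arbitrary, so naturality of the associator must first move the morphisms `D.m`
past it; what remains is Mac Lane's pentagon. -/
lemma MonDict.pentagon {M : PseudomonoidData C} {T : MonoidalCategory C} (D : MonDict M T)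
    {X Y Z T V V' W U Q U' Q' R : C}
    {a : El M.mul (X, Y) V} {b : El M.mul (V, Z) V'} {c : El M.mul (V', T) W}
    {p : El M.mul (Z, T) U} {q : El M.mul (V, U) W} {r : El M.mul (Y, U) Q} {s : El M.mul (X, Q) W}
    {p' : El M.mul (Y, Z) U'} {q' : El M.mul (X, U') V'} {p'' : El M.mul (U', T) Q'}
    {q'' : El M.mul (X, Q') W} {r' : El M.mul (Z, T) R} {s' : El M.mul (Y, R) Q'}
    (h₁ : M.Assoc b c p q) (h₂ : M.Assoc a q r s) (h₃ : M.Assoc a b p' q')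
    (h₄ : M.Assoc q' c p'' q'') (h₅ : M.Assoc p' p'' r' s') :
    (glue (pair (wire (𝟙 X)) (pair (wire (𝟙 Y)) p)) (glue (pair (wire (𝟙 X)) r) s) :
      El (comp (tens (idP C) (tens (idP C) M.mul)) (comp (tens (idP C) M.mul) M.mul))
        (X, (Y, (Z, T))) W) =
    glue (pair (wire (𝟙 X)) (pair (wire (𝟙 Y)) r')) (glue (pair (wire (𝟙 X)) s') q'') := by
  rw [D.glue_right₂]
  have e₁ := D.assoc h₁
  have e₂ := D.assoc h₂
  have e₃ := D.assoc h₃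
  have e₄ := D.assoc h₄
  have e₅ := D.assoc h₅
  calc (D.m s ≫ X ◁ D.m r) ≫ X ◁ Y ◁ D.m p
      = (D.m q ≫ _ ◁ D.m p) ≫ D.m a ▷ _ ≫ (α_ X Y (Z ⊗ T)).hom := by
        rw [Category.assoc, Category.assoc, whisker_exchange_assoc, associator_naturality_right,
          reassoc_of% e₂]
    _ = (D.m c ≫ (D.m b ≫ D.m a ▷ Z ≫ (α_ X Y Z).hom) ▷ T) ≫ (α_ X (Y ⊗ Z) T).hom ≫
          X ◁ (α_ Y Z T).hom := by
        rw [← e₁]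
        simp
    _ = (D.m q'' ≫ X ◁ D.m p'') ≫ X ◁ (D.m p' ▷ T ≫ (α_ Y Z T).hom) := by
        rw [e₃, ← e₄]; simp
    _ = (D.m q'' ≫ X ◁ D.m s') ≫ X ◁ Y ◁ D.m r' := by
        rw [Category.assoc, ← MonoidalCategory.whiskerLeft_comp, e₅]; simp

lemma MonDict.triangle {M : PseudomonoidData C} {T : MonoidalCategory C} (D : MonDict M T)
    {X Z P V U W : C} {p : El M.one pt P} {a : El M.mul (X, P) V} {b : El M.mul (V, Z) W}
    {r : El M.mul (P, Z) U} {s : El M.mul (X, U) W} (h : M.Assoc a b r s) :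
    act M.mul (Prod.mkHom (M.rho p a) (𝟙 Z)) (𝟙 W) b =
      act M.mul (Prod.mkHom (𝟙 X) (M.lam p r)) (𝟙 W) s := by
  apply D.m_injective
  have e := D.assoc h
  rw [D.m_act, D.m_act, D.rho, D.lam]
  simp only [Category.id_comp, tensorHom_id, id_tensorHom, MonoidalCategory.whiskerLeft_comp,
    comp_whiskerRight]
  rw [← reassoc_of% e]
  simp

lemma ComonDict.copentagon {K : PseudocomonoidData C} {T : MonoidalCategory C} (D : ComonDict K T)
    {X Y Z T V V' W U Q U' Q' R : C}
    {a : El K.comul V (X, Y)} {b : El K.comul V' (V, Z)} {c : El K.comul W (V', T)}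
    {p : El K.comul U (Z, T)} {q : El K.comul W (V, U)} {r : El K.comul Q (Y, U)}
    {s : El K.comul W (X, Q)}
    {p' : El K.comul U' (Y, Z)} {q' : El K.comul V' (X, U')} {p'' : El K.comul Q' (U', T)}
    {q'' : El K.comul W (X, Q')} {r' : El K.comul R (Z, T)} {s' : El K.comul Q' (Y, R)}
    (h₁ : K.Coassoc c b q p) (h₂ : K.Coassoc q a s r) (h₃ : K.Coassoc b a q' p')
    (h₄ : K.Coassoc c q' q'' p'') (h₅ : K.Coassoc p'' p' s' r') :
    (glue s (glue (pair (wire (𝟙 X)) r) (pair (wire (𝟙 X)) (pair (wire (𝟙 Y)) p))) :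
      El (comp K.comul (comp (tens (idP C) K.comul) (tens (idP C) (tens (idP C) K.comul))))
        W (X, (Y, (Z, T)))) =
    glue q'' (glue (pair (wire (𝟙 X)) s') (pair (wire (𝟙 X)) (pair (wire (𝟙 Y)) r'))) := by
  rw [D.glue_right₂]
  have e₁ := D.coassoc h₁
  have e₂ := D.coassoc h₂
  have e₃ := D.coassoc h₃
  have e₄ := D.coassoc h₄
  have e₅ := D.coassoc h₅
  rw [← cancel_epi (α_ X Y (Z ⊗ T)).hom, ← cancel_epi (α_ (X ⊗ Y) Z T).hom]
  calc (α_ (X ⊗ Y) Z T).hom ≫ (α_ X Y (Z ⊗ T)).hom ≫ X ◁ (Y ◁ D.d p ≫ D.d r) ≫ D.d s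
      = (α_ (X ⊗ Y) Z T).hom ≫ _ ◁ D.d p ≫ (α_ X Y _).hom ≫ X ◁ D.d r ≫ D.d s := by
        simp
    _ = D.d a ▷ Z ▷ T ≫ (α_ _ Z T).hom ≫ _ ◁ D.d p ≫ D.d q := by
        rw [← e₂, whisker_exchange_assoc]; simp
    _ = (D.d a ▷ Z ≫ D.d b) ▷ T ≫ D.d c := by
        rw [← e₁]; simp
    _ = (α_ X Y Z).hom ▷ T ≫ (α_ X (Y ⊗ Z) T).hom ≫ X ◁ (D.d p' ▷ T ≫ D.d p'') ≫ D.d q'' := by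
        rw [e₃]
        simp only [comp_whiskerRight, Category.assoc]
        rw [e₄]
        simp
    _ = _ := by
        rw [e₅]
        simp

lemma ComonDict.cotriangle {K : PseudocomonoidData C} {T : MonoidalCategory C} (D : ComonDict K T)
    {X Z P V U W : C} {t : El K.counit P pt} {a : El K.comul V (X, P)}
    {b : El K.comul W (V, Z)} {r : El K.comul U (P, Z)} {s : El K.comul W (X, U)}
    (h : K.Coassoc b a s r) :
    act K.comul (𝟙 W) (Prod.mkHom (K.corho a t) (𝟙 Z)) b =
      act K.comul (𝟙 W) (Prod.mkHom (𝟙 X) (K.colam r t)) s := by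
  apply D.d_injective
  have e := D.coassoc h
  rw [D.d_act, D.d_act, D.corho, D.colam]
  simp only [Category.comp_id, tensorHom_id, id_tensorHom, MonoidalCategory.whiskerLeft_comp,
    comp_whiskerRight, Category.assoc]
  rw [e]
  simp

variable (C)

/-- The associator of a monoidal category, as an isomorphism of functors. -/
def assocNat (T : MonoidalCategory C) : (tensor C).prod (𝟭 C) ⋙ tensor C ≅
    prod.associator C C C ⋙ (𝟭 C).prod (tensor C) ⋙ tensor C :=
  NatIso.ofComponents (fun X => (α_ X.1.1 X.1.2 X.2 :)) (by
    rintro ⟨⟨X, Y⟩, Z⟩ ⟨⟨X', Y'⟩, Z'⟩ ⟨⟨f, g⟩, h⟩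
    exact associator_naturality f g h)

/-- The left unitor of a monoidal category, as an isomorphism of functors. -/
def lamNat (T : MonoidalCategory C) :
    prod.leftInverseUnitor C ⋙ (Functor.fromPUnit.{u} (𝟙_ C)).prod (𝟭 C) ⋙ tensor C ≅ 𝟭 C :=
  NatIso.ofComponents (fun X => (λ_ X :)) (by
    intro X Y f
    exact (congrArg (· ≫ _) (id_tensorHom _ f)).trans (leftUnitor_naturality f))

/-- The right unitor of a monoidal category, as an isomorphism of functors. -/
def rhoNat (T : MonoidalCategory C) :
    prod.rightInverseUnitor C ⋙ (𝟭 C).prod (Functor.fromPUnit.{u} (𝟙_ C)) ⋙ tensor C ≅ 𝟭 C :=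
  NatIso.ofComponents (fun X => (ρ_ X :)) (by
    intro X Y f
    exact (congrArg (· ≫ _) (tensorHom_id f _)).trans (rightUnitor_naturality f))

/-- The pseudomonoid in profunctors which is represented by a monoidal category. -/
noncomputable def monData (T : MonoidalCategory C) : PseudomonoidData C where
  mul := (tensor C).toProfunctor
  one := (Functor.fromPUnit.{u} (𝟙_ C)).toProfunctor
  assoc := compIso (tensIso (Iso.refl _) idIso) (Iso.refl _) ≪≫ toProfunctorIso (assocNat C T) ≪≫
    (whiskIso (compIso (tensIso idIso (Iso.refl _)) (Iso.refl _)) (prod.associator C C C)).symm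
  leftUnit := whiskIso (compIso (tensIso (Iso.refl _) idIso) (Iso.refl _))
      (prod.leftInverseUnitor C) ≪≫ toProfunctorIso (lamNat C T) ≪≫ (idIso (A := C)).symm
  rightUnit := whiskIso (compIso (tensIso idIso (Iso.refl _)) (Iso.refl _))
      (prod.rightInverseUnitor C) ≪≫ toProfunctorIso (rhoNat C T) ≪≫ (idIso (A := C)).symm

/-- The identifications of the pseudomonoid of a monoidal category. -/
noncomputable def monDict (T : MonoidalCategory C) : MonDict (monData C T) T where
  mul := Iso.refl _
  one := Iso.refl _
  assoc {X Y Z V U W a b p q} h := by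
    let D : MonDictData (monData C T) T := ⟨Iso.refl _, Iso.refl _⟩
    have e₁ := val_toProfunctorIso (compIso (tensIso D.mul idIso) D.mul)
      (whiskIso (compIso (tensIso idIso D.mul) D.mul) (prod.associator C C C)) (assocNat C T)
      (a := ((X, Y), Z)) (b := W) (glue (pair a (wire (𝟙 Z))) b)
    have e₂ : _ = (D.m b ≫ (D.m a ⊗ₘ 𝟙 Z)) ≫ (α_ X Y Z).hom :=
      e₁.trans (congrArg (· ≫ (α_ X Y Z).hom) (val_compIso_glue (tensIso D.mul idIso) D.mul
        (a := ((X, Y), Z)) (pair a (wire (𝟙 Z))) b))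
    have e₃ := (congrArg (val (whiskIso (compIso (tensIso idIso D.mul) D.mul)
      (prod.associator C C C))) h.symm).trans e₂
    have e₄ : (D.m q ≫ (𝟙 X ⊗ₘ D.m p)) = (D.m b ≫ (D.m a ⊗ₘ 𝟙 Z)) ≫ (α_ X Y Z).hom :=
      (val_compIso_glue (tensIso idIso D.mul) D.mul (a := (X, (Y, Z)))
        (pair (wire (𝟙 X)) p) q).symm.trans e₃
    rw [id_tensorHom, tensorHom_id, Category.assoc] at e₄
    exact e₄.symm
  lam {X W P} p a := by
    let D : MonDictData (monData C T) T := ⟨Iso.refl _, Iso.refl _⟩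
    have e₁ := val_toProfunctorIso (whiskIso (compIso (tensIso D.one idIso) D.mul)
      (prod.leftInverseUnitor C)) idIso (lamNat C T)
      (a := X) (b := W) (glue (b := (P, X)) (pair p (wire (𝟙 X))) a)
    have e₂ : (monData C T).lam p a = (D.m a ≫ (D.u p ⊗ₘ 𝟙 X)) ≫ (λ_ X).hom :=
      e₁.trans (congrArg (· ≫ (λ_ X).hom)
        (val_compIso_glue (tensIso D.one idIso) D.mul (a := (pt, X)) (pair p (wire (𝟙 X))) a))
    rw [tensorHom_id, Category.assoc] at e₂
    exact e₂
  rho {X W P} p a := by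
    let D : MonDictData (monData C T) T := ⟨Iso.refl _, Iso.refl _⟩
    have e₁ := val_toProfunctorIso (whiskIso (compIso (tensIso idIso D.one) D.mul)
      (prod.rightInverseUnitor C)) idIso (rhoNat C T)
      (a := X) (b := W) (glue (b := (X, P)) (pair (wire (𝟙 X)) p) a)
    have e₂ : (monData C T).rho p a = (D.m a ≫ (𝟙 X ⊗ₘ D.u p)) ≫ (ρ_ X).hom :=
      e₁.trans (congrArg (· ≫ (ρ_ X).hom)
        (val_compIso_glue (tensIso idIso D.one) D.mul (a := (X, pt)) (pair (wire (𝟙 X)) p) a))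
    rw [id_tensorHom, Category.assoc] at e₂
    exact e₂

/-- The pseudocomonoid in profunctors which is corepresented by a monoidal category. -/
noncomputable def comonData (T : MonoidalCategory C) : PseudocomonoidData C where
  comul := (tensor C).toProfunctorRev
  counit := (Functor.fromPUnit.{u} (𝟙_ C)).toProfunctorRev
  coassoc := compIsoRev (Iso.refl _) (tensIsoRev (Iso.refl _) idIsoRev) ≪≫
    toProfunctorRevIso (assocNat C T).symm ≪≫
    (whiskIsoRev (compIsoRev (Iso.refl _) (tensIsoRev idIsoRev (Iso.refl _)))
      (prod.associator C C C)).symm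
  leftCounit := whiskIsoRev (compIsoRev (Iso.refl _) (tensIsoRev (Iso.refl _) idIsoRev))
      (prod.leftInverseUnitor C) ≪≫ toProfunctorRevIso (lamNat C T).symm ≪≫
    (idIsoRev (A := C)).symm
  rightCounit := whiskIsoRev (compIsoRev (Iso.refl _) (tensIsoRev idIsoRev (Iso.refl _)))
      (prod.rightInverseUnitor C) ≪≫ toProfunctorRevIso (rhoNat C T).symm ≪≫
    (idIsoRev (A := C)).symm

/-- The identifications of the pseudocomonoid of a monoidal category. -/
noncomputable def comonDict (T : MonoidalCategory C) : ComonDict (comonData C T) T where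
  comul := Iso.refl _
  counit := Iso.refl _
  coassoc {X Y Z V U W a b p q} h := by
    let D : ComonDictData (comonData C T) T := ⟨Iso.refl _, Iso.refl _⟩
    have e₁ := coval_toProfunctorRevIso (compIsoRev D.comul (tensIsoRev D.comul idIsoRev))
      (whiskIsoRev (compIsoRev D.comul (tensIsoRev idIsoRev D.comul))
        (prod.associator C C C)) (assocNat C T).symm
      (a := W) (b := ((X, Y), Z)) (glue a (pair b (wire (𝟙 Z))))
    have e₂ : _ = (α_ X Y Z).inv ≫ ((D.d b ⊗ₘ 𝟙 Z) ≫ D.d a) :=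
      e₁.trans (congrArg ((α_ X Y Z).inv ≫ ·) (coval_compIsoRev_glue D.comul
        (tensIsoRev D.comul idIsoRev) (e := ((X, Y), Z)) a (pair b (wire (𝟙 Z)))))
    have e₃ := (congrArg (coval (whiskIsoRev (compIsoRev D.comul
      (tensIsoRev idIsoRev D.comul)) (prod.associator C C C))) h.symm).trans e₂
    have e₄ : ((𝟙 X ⊗ₘ D.d q) ≫ D.d p) = (α_ X Y Z).inv ≫ ((D.d b ⊗ₘ 𝟙 Z) ≫ D.d a) :=
      (coval_compIsoRev_glue D.comul (tensIsoRev idIsoRev D.comul) (e := (X, (Y, Z)))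
        p (pair (wire (𝟙 X)) q)).symm.trans e₃
    rw [id_tensorHom, tensorHom_id] at e₄
    have e₅ : D.d b ▷ Z ≫ D.d a = (α_ X Y Z).hom ≫ X ◁ D.d q ≫ D.d p := by
      rw [e₄]; simp
    exact e₅
  colam {X W P} a p := by
    let D : ComonDictData (comonData C T) T := ⟨Iso.refl _, Iso.refl _⟩
    have e₁ := coval_toProfunctorRevIso (whiskIsoRev (compIsoRev D.comul
      (tensIsoRev D.counit idIsoRev)) (prod.leftInverseUnitor C)) idIsoRev (lamNat C T).symm
      (a := W) (b := X) (glue (b := (P, X)) a (pair p (wire (𝟙 X))))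
    have e₂ : (comonData C T).colam a p = (λ_ X).inv ≫ (D.e p ⊗ₘ 𝟙 X) ≫ D.d a :=
      e₁.trans (congrArg ((λ_ X).inv ≫ ·)
      (coval_compIsoRev_glue D.comul (tensIsoRev D.counit idIsoRev) (e := (pt, X)) a
        (pair p (wire (𝟙 X)))))
    rw [tensorHom_id] at e₂
    exact e₂
  corho {X W P} a p := by
    let D : ComonDictData (comonData C T) T := ⟨Iso.refl _, Iso.refl _⟩
    have e₁ := coval_toProfunctorRevIso (whiskIsoRev (compIsoRev D.comul
      (tensIsoRev idIsoRev D.counit)) (prod.rightInverseUnitor C)) idIsoRev (rhoNat C T).symm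
      (a := W) (b := X) (glue (b := (X, P)) a (pair (wire (𝟙 X)) p))
    have e₂ : (comonData C T).corho a p = (ρ_ X).inv ≫ (𝟙 X ⊗ₘ D.e p) ≫ D.d a :=
      e₁.trans (congrArg ((ρ_ X).inv ≫ ·)
      (coval_compIsoRev_glue D.comul (tensIsoRev idIsoRev D.counit) (e := (X, pt)) a
        (pair (wire (𝟙 X)) p)))
    rw [id_tensorHom] at e₂
    exact e₂

end FromMonoidal

/-! ### The Frobenius 2-cells as strengths -/

section

variable {A B E : Type u} [SmallCategory A] [SmallCategory B] [SmallCategory E]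
  {P : Profunctor.{u} A B} {Q : Profunctor.{u} B E} {F : A ⥤ B} (φ : P ≅ F.toProfunctor)

lemma compRep_act {a a' : A} {e e' : E} (f : a ⟶ a') (g : e' ⟶ e) (z : El (comp P Q) a e) :
    compRep φ (act (comp P Q) f g z) = act Q (F.map f) g (compRep φ z) := by
  obtain ⟨b, x, y, rfl⟩ := exists_glue z
  rw [act_glue]
  simp [compRep, val_act, act_act]

lemma compRep_injective {a : A} {e : E} : Function.Injective (compRep φ (Q := Q) (a := a) (e := e)) := by
  intro z z' h
  obtain ⟨b, x, y, rfl⟩ := exists_glue z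
  obtain ⟨b', x', y', rfl⟩ := exists_glue z'
  exact (glue_eq_iff_rep φ _ _ _ _).2 h

end

section Strength

variable {C : Type u} [SmallCategory C] (F : FrobeniusData C) {T : MonoidalCategory C}
  (D : MonDictData F.toPseudomonoidData T)

namespace FrobeniusData

/-- The source of the left Frobenius 2-cell. -/
abbrev frobLDom : Profunctor.{u} (C × C) (C × C) :=
  comp (tens F.comul (idP C))
    ((tens (idP C) F.mul).whiskerLeft₂ (prod.associator C C C) (𝟭 (C × C)))

/-- The source of the right Frobenius 2-cell. -/
abbrev frobRDom : Profunctor.{u} (C × C) (C × C) :=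
  comp (tens (idP C) F.comul)
    ((tens F.mul (idP C)).whiskerLeft₂ (prod.inverseAssociator C C C) (𝟭 (C × C)))

/-- An element of the source of the left Frobenius 2-cell. -/
def frobLMk {X Y X' Y' X₁ Y₁ V : C} (c : El F.comul X (X₁, V)) (g : Y₁ ⟶ Y) (f : X' ⟶ X₁)
    (a : El F.mul (V, Y₁) Y') : El F.frobLDom (X, Y) (X', Y') :=
  glue (b := ((X₁, V), Y₁)) (pair c (wire g)) (pair (wire f) a)

/-- An element of the source of the right Frobenius 2-cell. -/
def frobRMk {X Y X' Y' X₁ Y₁ V : C} (c : El F.comul Y (V, Y₁)) (g : X₁ ⟶ X) (f : Y' ⟶ Y₁)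
    (a : El F.mul (X₁, V) X') : El F.frobRDom (X, Y) (X', Y') :=
  glue (b := (X₁, (V, Y₁))) (pair (wire g) c) (pair a (wire f))

/-- The left Frobenius 2-cell as a strength. -/
noncomputable def strL (Y : C) {X X' V : C} (c : El F.comul X (X', V)) :
    El F.comul (X ⊗ Y) (X', V ⊗ Y) :=
  compRep D.mul (app₂ F.frobL.hom (a := (X, Y)) (b := (X', V ⊗ Y))
    (F.frobLMk c (𝟙 Y) (𝟙 X') (D.mElt (𝟙 (V ⊗ Y)))))

/-- The right Frobenius 2-cell as a strength. -/
noncomputable def strR (X : C) {Y Y' V : C} (c : El F.comul Y (V, Y')) :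
    El F.comul (X ⊗ Y) (X ⊗ V, Y') :=
  compRep D.mul (app₂ F.frobR.hom (a := (X, Y)) (b := (X ⊗ V, Y'))
    (F.frobRMk c (𝟙 X) (𝟙 Y') (D.mElt (𝟙 (X ⊗ V)))))

lemma act_mElt_id {X Y Z : C} (a : El F.mul (X, Y) Z) :
    act F.mul (𝟙 (X, Y)) (D.m a) (D.mElt (𝟙 (X ⊗ Y))) = a := act_val D.mul a

lemma wire_act_right {X Y : C} (f : Y ⟶ X) : act (idP C) (𝟙 X) f (wire (𝟙 X)) = wire f :=
  (act_wire _ _ _).trans (by simp)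

lemma wire_act_left {X Y : C} (f : Y ⟶ X) : act (idP C) f (𝟙 Y) (wire (𝟙 Y)) = wire f :=
  (act_wire _ _ _).trans (by simp)

/-- An arbitrary `a` is the restriction of the universal element of `m(V, Y)` along `D.m a`.
Naturality of the 2-cell therefore reduces its values to the strength. -/
lemma compRep_frobL {X Y X' Y' V : C} (c : El F.comul X (X', V)) (a : El F.mul (V, Y) Y') :
    compRep D.mul (app₂ F.frobL.hom (a := (X, Y)) (b := (X', Y'))
      (F.frobLMk c (𝟙 Y) (𝟙 X') a)) =
    act F.comul (𝟙 (X ⊗ Y)) (Prod.mkHom (𝟙 X') (D.m a)) (F.strL D Y c) := by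
  have h₁ : F.frobLMk c (𝟙 Y) (𝟙 X') a =
      act _ (𝟙 (X, Y)) (Prod.mkHom (𝟙 X') (D.m a))
        (F.frobLMk c (𝟙 Y) (𝟙 X') (D.mElt (𝟙 (V ⊗ Y)))) := by
    refine Eq.trans ?_ (act_glue _ _ _ _).symm
    refine congrArg₂ glue (act_id _ _).symm ?_
    refine Eq.trans ?_ (act_pair (P := idP C) (Q := F.mul) (𝟙 (X', (V, Y)))
      (Prod.mkHom (𝟙 X') (D.m a)) (wire (𝟙 X')) (D.mElt (𝟙 (V ⊗ Y)))).symm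
    exact congrArg₂ Prod.mk (act_id _ _).symm (F.act_mElt_id D a).symm
  rw [h₁, app₂_act, compRep_act]
  exact congrArg (fun z => act F.comul z (Prod.mkHom (𝟙 X') (D.m a)) (F.strL D Y c))
    ((tensor C).map_id (X, Y))

lemma compRep_frobR {X Y X' Y' V : C} (c : El F.comul Y (V, Y')) (a : El F.mul (X, V) X') :
    compRep D.mul (app₂ F.frobR.hom (a := (X, Y)) (b := (X', Y'))
      (F.frobRMk c (𝟙 X) (𝟙 Y') a)) =
    act F.comul (𝟙 (X ⊗ Y)) (Prod.mkHom (D.m a) (𝟙 Y')) (F.strR D X c) := by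
  have h₁ : F.frobRMk c (𝟙 X) (𝟙 Y') a =
      act _ (𝟙 (X, Y)) (Prod.mkHom (D.m a) (𝟙 Y'))
        (F.frobRMk c (𝟙 X) (𝟙 Y') (D.mElt (𝟙 (X ⊗ V)))) := by
    refine Eq.trans ?_ (act_glue _ _ _ _).symm
    refine congrArg₂ glue (act_id _ _).symm ?_
    refine Eq.trans ?_ (act_pair (P := F.mul) (Q := idP C) (𝟙 ((X, V), Y'))
      (Prod.mkHom (D.m a) (𝟙 Y')) (D.mElt (𝟙 (X ⊗ V))) (wire (𝟙 Y'))).symm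
    exact congrArg₂ Prod.mk (F.act_mElt_id D a).symm (act_id _ _).symm
  rw [h₁, app₂_act, compRep_act]
  exact congrArg (fun z => act F.comul z (Prod.mkHom (D.m a) (𝟙 Y')) (F.strR D X c))
    ((tensor C).map_id (X, Y))

/-- `compRep` is injective, so the target `m d` can be replaced by `d(X ⅋ Y; X', Y')`. -/
lemma frobL_iff {X Y X' Y' V S : C} {c : El F.comul X (X', V)}
    {a : El F.mul (V, Y) Y'} {r : El F.mul (X, Y) S} {s : El F.comul S (X', Y')} :
    F.FrobL c a r s ↔ act F.comul (𝟙 (X ⊗ Y)) (Prod.mkHom (𝟙 X') (D.m a)) (F.strL D Y c) =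
      act F.comul (D.m r) (𝟙 (X', Y')) s := by
  rw [← F.compRep_frobL D]
  change app₂ F.frobL.hom (F.frobLMk c (𝟙 Y) (𝟙 X') a) = glue r s ↔ _
  exact ⟨fun h => congrArg (compRep D.mul) h, fun h => compRep_injective D.mul h⟩

lemma frobR_iff {X Y X' Y' V S : C} {c : El F.comul Y (V, Y')}
    {a : El F.mul (X, V) X'} {r : El F.mul (X, Y) S} {s : El F.comul S (X', Y')} :
    F.FrobR c a r s ↔ act F.comul (𝟙 (X ⊗ Y)) (Prod.mkHom (D.m a) (𝟙 Y')) (F.strR D X c) =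
      act F.comul (D.m r) (𝟙 (X', Y')) s := by
  rw [← F.compRep_frobR D]
  change app₂ F.frobR.hom (F.frobRMk c (𝟙 X) (𝟙 Y') a) = glue r s ↔ _
  exact ⟨fun h => congrArg (compRep D.mul) h, fun h => compRep_injective D.mul h⟩

/-- This is where invertibility of the Frobenius 2-cell enters: the preimage of `s` has a
representative, which is normalised to the form of a strength. -/
lemma exists_strL {X Y X' Y' : C} (s : El F.comul (X ⊗ Y) (X', Y')) :
    ∃ (V : C) (c : El F.comul X (X', V)) (f : Y' ⟶ V ⊗ Y),
      s = act F.comul (𝟙 (X ⊗ Y)) (Prod.mkHom (𝟙 X') f) (F.strL D Y c) := by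
  obtain ⟨⟨⟨X₁, V⟩, Y₁⟩, ⟨(c : El F.comul X (X₁, V)), (g : Y₁ ⟶ Y)⟩,
    ⟨(f : X' ⟶ X₁), (a : El F.mul (V, Y₁) Y')⟩, e⟩ :=
    exists_glue (app₂ F.frobL.inv (a := (X, Y)) (b := (X', Y')) (glue (D.mElt (𝟙 (X ⊗ Y))) s))
  -- The morphisms on the two passive wires are absorbed: `f` into the comultiplication element and
  -- `g` into the multiplication element, each by one application of the coend relation.
  have e₁ : F.frobLMk c g f a =
      F.frobLMk (act F.comul (𝟙 X) (Prod.mkHom f (𝟙 V)) c) (𝟙 Y) (𝟙 X')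
        (act F.mul (Prod.mkHom (𝟙 V) g) (𝟙 Y') a) := by
    have e₂ : (pair (wire f) a : El (tens (idP C) F.mul) (X₁, (V, Y₁)) (X', Y')) =
        act (tens (idP C) F.mul) (Prod.mkHom f (Prod.mkHom (𝟙 V) (𝟙 Y₁))) (𝟙 (X', Y'))
          (pair (wire (𝟙 X')) a) := by
      rw [act_pair]
      exact congrArg₂ Prod.mk (wire_act_left f).symm (act_id _ _).symm
    have e₃ : (act (tens F.comul (idP C)) (𝟙 (X, Y)) (Prod.mkHom (Prod.mkHom f (𝟙 V)) (𝟙 Y₁))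
        (pair c (wire g))) =
        act (tens F.comul (idP C)) (𝟙 (X, Y)) (Prod.mkHom (Prod.mkHom (𝟙 X') (𝟙 V)) g)
          (pair (act F.comul (𝟙 X) (Prod.mkHom f (𝟙 V)) c) (wire (𝟙 Y))) := by
      rw [act_pair, act_pair]
      exact congrArg₂ Prod.mk (act_id _ _).symm
        ((act_id _ _).trans (wire_act_right g).symm)
    have e₄ : (act (tens (idP C) F.mul) (Prod.mkHom (𝟙 X') (Prod.mkHom (𝟙 V) g)) (𝟙 (X', Y'))
          (pair (wire (𝟙 X')) a)) =
        pair (wire (𝟙 X')) (act F.mul (Prod.mkHom (𝟙 V) g) (𝟙 Y') a) := by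
      rw [act_pair]
      exact congrArg₂ Prod.mk (act_id _ _) rfl
    refine (congrArg (glue (b := ((X₁, V), Y₁)) (pair c (wire g))) e₂).trans ?_
    refine (glue_slide (b := ((X', V), Y₁)) (b' := ((X₁, V), Y₁))
      (Prod.mkHom (Prod.mkHom f (𝟙 V)) (𝟙 Y₁)) (pair c (wire g)) _).symm.trans ?_
    refine (congrArg (fun z => glue (b := ((X', V), Y₁)) z _) e₃).trans ?_
    refine (glue_slide (b := ((X', V), Y₁)) (b' := ((X', V), Y))
      (Prod.mkHom (Prod.mkHom (𝟙 X') (𝟙 V)) g) _ _).trans ?_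
    exact congrArg (glue (b := ((X', V), Y)) _) e₄
  refine ⟨V, act F.comul (𝟙 X) (Prod.mkHom f (𝟙 V)) c,
    D.m (act F.mul (Prod.mkHom (𝟙 V) g) (𝟙 Y') a), ?_⟩
  rw [← F.compRep_frobL D, ← e₁]
  have e₅ := (congrArg (compRep D.mul) (app₂_inv_hom F.frobL (glue (D.mElt (𝟙 (X ⊗ Y))) s))).symm.trans
    (congrArg (fun z => compRep D.mul (app₂ F.frobL.hom z)) e)
  refine Eq.trans ?_ e₅
  refine Eq.trans ?_ (congrArg (fun z => act F.comul z (𝟙 (X', Y')) s) (D.m_mElt (𝟙 (X ⊗ Y)))).symm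
  exact (act_id _ _).symm

lemma exists_strR {X Y X' Y' : C} (s : El F.comul (X ⊗ Y) (X', Y')) :
    ∃ (V : C) (c : El F.comul Y (V, Y')) (f : X' ⟶ X ⊗ V),
      s = act F.comul (𝟙 (X ⊗ Y)) (Prod.mkHom f (𝟙 Y')) (F.strR D X c) := by
  obtain ⟨⟨X₁, ⟨V, Y₁⟩⟩, ⟨(g : X₁ ⟶ X), (c : El F.comul Y (V, Y₁))⟩,
    ⟨(a : El F.mul (X₁, V) X'), (f : Y' ⟶ Y₁)⟩, e⟩ :=
    exists_glue (app₂ F.frobR.inv (a := (X, Y)) (b := (X', Y')) (glue (D.mElt (𝟙 (X ⊗ Y))) s))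
  have e₁ : F.frobRMk c g f a =
      F.frobRMk (act F.comul (𝟙 Y) (Prod.mkHom (𝟙 V) f) c) (𝟙 X) (𝟙 Y')
        (act F.mul (Prod.mkHom g (𝟙 V)) (𝟙 X') a) := by
    have e₂ : (pair a (wire f) : El (tens F.mul (idP C)) ((X₁, V), Y₁) (X', Y')) =
        act (tens F.mul (idP C)) (Prod.mkHom (Prod.mkHom (𝟙 X₁) (𝟙 V)) f) (𝟙 (X', Y'))
          (pair a (wire (𝟙 Y'))) := by
      rw [act_pair]
      exact congrArg₂ Prod.mk (act_id _ _).symm (wire_act_left f).symm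
    have e₃ : (act (tens (idP C) F.comul) (𝟙 (X, Y)) (Prod.mkHom (𝟙 X₁) (Prod.mkHom (𝟙 V) f))
        (pair (wire g) c)) =
        act (tens (idP C) F.comul) (𝟙 (X, Y)) (Prod.mkHom g (Prod.mkHom (𝟙 V) (𝟙 Y')))
          (pair (wire (𝟙 X)) (act F.comul (𝟙 Y) (Prod.mkHom (𝟙 V) f) c)) := by
      rw [act_pair, act_pair]
      exact congrArg₂ Prod.mk ((act_id _ _).trans (wire_act_right g).symm) (act_id _ _).symm
    have e₄ : (act (tens F.mul (idP C)) (Prod.mkHom (Prod.mkHom g (𝟙 V)) (𝟙 Y')) (𝟙 (X', Y'))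
          (pair a (wire (𝟙 Y')))) =
        pair (act F.mul (Prod.mkHom g (𝟙 V)) (𝟙 X') a) (wire (𝟙 Y')) := by
      rw [act_pair]
      exact congrArg₂ Prod.mk rfl (act_id _ _)
    refine (congrArg (glue (b := (X₁, (V, Y₁))) (pair (wire g) c)) e₂).trans ?_
    refine (glue_slide (b := (X₁, (V, Y'))) (b' := (X₁, (V, Y₁)))
      (Prod.mkHom (𝟙 X₁) (Prod.mkHom (𝟙 V) f)) (pair (wire g) c) _).symm.trans ?_
    refine (congrArg (fun z => glue (b := (X₁, (V, Y'))) z _) e₃).trans ?_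
    refine (glue_slide (b := (X₁, (V, Y'))) (b' := (X, (V, Y')))
      (Prod.mkHom g (Prod.mkHom (𝟙 V) (𝟙 Y'))) _ _).trans ?_
    exact congrArg (glue (b := (X, (V, Y'))) _) e₄
  refine ⟨V, act F.comul (𝟙 Y) (Prod.mkHom (𝟙 V) f) c,
    D.m (act F.mul (Prod.mkHom g (𝟙 V)) (𝟙 X') a), ?_⟩
  rw [← F.compRep_frobR D, ← e₁]
  have e₅ := (congrArg (compRep D.mul) (app₂_inv_hom F.frobR (glue (D.mElt (𝟙 (X ⊗ Y))) s))).symm.trans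
    (congrArg (fun z => compRep D.mul (app₂ F.frobR.hom z)) e)
  refine Eq.trans ?_ e₅
  refine Eq.trans ?_ (congrArg (fun z => act F.comul z (𝟙 (X', Y')) s) (D.m_mElt (𝟙 (X ⊗ Y)))).symm
  exact (act_id _ _).symm

/-- The left strength is natural in the added object. -/
lemma strL_natural {X X' V Y Y' : C} (c : El F.comul X (X', V)) (f : Y ⟶ Y') :
    act F.comul (X ◁ f) (𝟙 (X', V ⊗ Y)) (F.strL D Y c) =
      act F.comul (𝟙 (X ⊗ Y')) (Prod.mkHom (𝟙 X') (V ◁ f)) (F.strL D Y' c) := by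
  have e : D.m (act F.mul (Prod.mkHom (𝟙 V) f) (𝟙 (V ⊗ Y)) (D.mElt (𝟙 (V ⊗ Y)))) = V ◁ f := by
    rw [D.m_act]; simp
  rw [← e, ← F.compRep_frobL D]
  have h₁ := compRep_act D.mul (Prod.mkHom (𝟙 X) f) (𝟙 (X', V ⊗ Y))
    (app₂ F.frobL.hom (a := (X, Y)) (b := (X', V ⊗ Y))
    (F.frobLMk c (𝟙 Y) (𝟙 X') (D.mElt (𝟙 (V ⊗ Y)))))
  have h₂ : act F.comul (𝟙 X ⊗ₘ f) (𝟙 (X', V ⊗ Y)) (F.strL D Y c) = _ := h₁.symm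
  rw [id_tensorHom] at h₂
  rw [h₂, ← app₂_act]
  refine congrArg (fun z => compRep D.mul (app₂ F.frobL.hom z)) ?_
  refine (act_glue _ _ _ _).trans ?_
  have e₃ : act (tens F.comul (idP C)) (Prod.mkHom (𝟙 X) f) (𝟙 ((X', V), Y))
      (pair c (wire (𝟙 Y))) =
      act (tens F.comul (idP C)) (𝟙 (X, Y')) (Prod.mkHom (𝟙 (X', V)) f)
      (pair c (wire (𝟙 Y'))) := by
    rw [act_pair, act_pair]
    exact congrArg₂ Prod.mk rfl ((wire_act_left f).trans (wire_act_right f).symm)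
  refine (congrArg (fun z => glue (b := ((X', V), Y)) z _) e₃).trans ?_
  refine (glue_slide (b := ((X', V), Y)) (b' := ((X', V), Y'))
      (Prod.mkHom (𝟙 (X', V)) f) _ _).trans ?_
  refine congrArg (glue (b := ((X', V), Y')) _) ?_
  refine (congrArg _ (act_id _ _)).trans ?_
  refine (act_pair (P := idP C) (Q := F.mul) (Prod.mkHom (𝟙 X') (Prod.mkHom (𝟙 V) f))
    (𝟙 (X', V ⊗ Y)) (wire (𝟙 X')) (D.mElt (𝟙 (V ⊗ Y)))).trans ?_
  exact congrArg₂ Prod.mk (act_id _ _) rfl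

/-- The right strength is natural in its argument. -/
lemma strR_natural {X Y Z Y' V : C} (c : El F.comul Y (V, Y')) (f : Y ⟶ Z) :
    F.strR D X (act F.comul f (𝟙 (V, Y')) c) =
      act F.comul (X ◁ f) (𝟙 (X ⊗ V, Y')) (F.strR D X c) := by
  have h₁ := compRep_act D.mul (Prod.mkHom (𝟙 X) f) (𝟙 (X ⊗ V, Y'))
    (app₂ F.frobR.hom (a := (X, Y)) (b := (X ⊗ V, Y'))
    (F.frobRMk c (𝟙 X) (𝟙 Y') (D.mElt (𝟙 (X ⊗ V)))))
  have h₂ : act F.comul (𝟙 X ⊗ₘ f) (𝟙 (X ⊗ V, Y')) (F.strR D X c) = _ := h₁.symm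
  rw [id_tensorHom] at h₂
  rw [h₂, ← app₂_act]
  refine congrArg (fun z => compRep D.mul (app₂ F.frobR.hom z)) ?_
  refine Eq.trans ?_ (act_glue _ _ _ _).symm
  refine congrArg₂ glue ?_ (act_id _ _).symm
  refine Eq.trans ?_ (act_pair _ _ _ _).symm
  exact congrArg₂ Prod.mk (act_id _ _).symm rfl

end FrobeniusData

end Strength

/-! ### Lifting identities through the counits, and exchanging the two counits -/

section Comonoid

variable {C : Type u} [SmallCategory C] (K : PseudocomonoidData C)

/-- Surjectivity of the right counit 2-cell at the identity. It supplies concrete elements of `d`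
and `e` before either is known to be corepresented. -/
lemma PseudocomonoidData.exists_corho (X : C) :
    ∃ (Q : C) (b : El K.comul X (X, Q)) (t : El K.counit Q pt), K.corho b t = 𝟙 X := by
  obtain ⟨⟨X₁, Q⟩, b, ⟨(f : X ⟶ X₁), (t : El K.counit Q pt)⟩, e⟩ :=
    exists_glue (app₂ K.rightCounit.inv (a := X) (b := X) (wire (𝟙 X)))
  -- The preimage may carry a morphism `f` on the passive wire, which is moved into the element of
  -- the comultiplication.
  refine ⟨Q, act K.comul (𝟙 X) (Prod.mkHom f (𝟙 Q)) b, t, ?_⟩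
  rw [K.corho_act, Category.comp_id]
  have h₁ : K.corho b t = app₂ K.rightCounit.hom (a := X) (b := X₁)
    (glue (b := (X₁, Q)) b (pair (wire (𝟙 X₁)) t)) := rfl
  have h₂ := app₂_act K.rightCounit.hom (a := X) (b := X₁) (𝟙 X) f
    (glue (b := (X₁, Q)) b (pair (wire (𝟙 X₁)) t))
  have h₃ : act (comp K.comul (tens (idP C) K.counit)) (b := (X₁, pt)) (b' := (X, pt)) (𝟙 X)
      (Prod.mkHom f (𝟙 pt)) (glue (b := (X₁, Q)) b (pair (wire (𝟙 X₁)) t)) =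
      glue (b := (X₁, Q)) b (pair (wire f) t) := by
    rw [act_glue, act_pair]
    refine congrArg₂ glue (act_id _ _) (congrArg₂ Prod.mk ?_ (act_id _ _))
    exact (act_wire _ _ _).trans (by simp)
  have h₄ : act (idP C) (𝟙 X) f (wire (K.corho b t)) = f ≫ K.corho b t :=
    (act_wire _ _ _).trans (by simp)
  refine h₄.symm.trans (h₂.symm.trans ((congrArg (app₂ K.rightCounit.hom) h₃).trans ?_))
  exact (congrArg (app₂ K.rightCounit.hom) e.symm).trans (app₂_inv_hom K.rightCounit _)

lemma PseudocomonoidData.exists_colam (X : C) :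
    ∃ (Q : C) (b : El K.comul X (Q, X)) (t : El K.counit Q pt), K.colam b t = 𝟙 X := by
  obtain ⟨⟨Q, X₁⟩, b, ⟨(t : El K.counit Q pt), (f : X ⟶ X₁)⟩, e⟩ :=
    exists_glue (app₂ K.leftCounit.inv (a := X) (b := X) (wire (𝟙 X)))
  refine ⟨Q, act K.comul (𝟙 X) (Prod.mkHom (𝟙 Q) f) b, t, ?_⟩
  rw [K.colam_act, Category.comp_id]
  have h₂ := app₂_act K.leftCounit.hom (a := X) (b := X₁) (𝟙 X) f
    (glue (b := (Q, X₁)) b (pair t (wire (𝟙 X₁))))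
  have h₃ : act (comp K.comul (tens K.counit (idP C))) (b := (pt, X₁)) (b' := (pt, X)) (𝟙 X)
      (Prod.mkHom (𝟙 pt) f) (glue (b := (Q, X₁)) b (pair t (wire (𝟙 X₁)))) =
      glue (b := (Q, X₁)) b (pair t (wire f)) := by
    rw [act_glue, act_pair]
    refine congrArg₂ glue (act_id _ _) (congrArg₂ Prod.mk (act_id _ _) ?_)
    exact (act_wire _ _ _).trans (by simp)
  have h₄ : act (idP C) (𝟙 X) f (wire (K.colam b t)) = f ≫ K.colam b t :=
    (act_wire _ _ _).trans (by simp)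
  refine h₄.symm.trans (h₂.symm.trans ((congrArg (app₂ K.leftCounit.hom) h₃).trans ?_))
  exact (congrArg (app₂ K.leftCounit.hom) e.symm).trans (app₂_inv_hom K.leftCounit _)

/-- The left counit can be applied to the middle output. -/
lemma PseudocomonoidData.act_colam_congr {W X Y M N N' : C} {s : El K.comul W (X, N)}
    {q : El K.comul N (M, Y)} {s' : El K.comul W (X, N')} {q' : El K.comul N' (M, Y)}
    (t : El K.counit M pt)
    (h : (glue s (pair (wire (𝟙 X)) q) : El (comp K.comul (tens (idP C) K.comul)) W (X, (M, Y))) =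
      glue s' (pair (wire (𝟙 X)) q')) :
    act K.comul (𝟙 W) (Prod.mkHom (𝟙 X) (K.colam q t)) s =
      act K.comul (𝟙 W) (Prod.mkHom (𝟙 X) (K.colam q' t)) s' := by
  -- The operation is defined on the whole composite by descent along the coend relation; equal
  -- classes then have equal images.
  let G : El (comp K.comul (tens (idP C) K.comul)) W (X, (M, Y)) → El K.comul W (X, Y) :=
    compLift (fun b s z => act K.comul (𝟙 W) (b := b) (b' := (X, Y))
      (Prod.mkHom (show X ⟶ b.1 from z.1) (K.colam (show El K.comul b.2 (M, Y) from z.2) t)) s) (by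
      rintro ⟨b₁, b₂⟩ ⟨b₁', b₂'⟩ ⟨(g₁ : b₁ ⟶ b₁'), (g₂ : b₂ ⟶ b₂')⟩ x
        ⟨(y₁ : X ⟶ b₁), (y₂ : El K.comul b₂ (M, Y))⟩
      have e₀ := act_act K.comul (𝟙 W) (Prod.mkHom g₁ g₂) (𝟙 W)
        (Prod.mkHom y₁ (K.colam y₂ t)) x
      have e₁ : act (tens (idP C) K.comul) (Prod.mkHom g₁ g₂) (𝟙 (X, (M, Y)))
          (pair (wire y₁) y₂) = pair (wire (y₁ ≫ g₁)) (act K.comul g₂ (𝟙 (M, Y)) y₂) := by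
        rw [act_pair]
        refine congrArg₂ Prod.mk ?_ rfl
        exact (act_wire _ _ _).trans (by simp)
      have e₂ : K.colam (act K.comul g₂ (𝟙 (M, Y)) y₂) t = K.colam y₂ t ≫ g₂ :=
        (K.colam_act y₂ t g₂ (𝟙 Y)).trans (Category.id_comp _)
      have e₃ : act K.comul (𝟙 W) (Prod.mkHom (y₁ ≫ g₁) (K.colam (act K.comul g₂ (𝟙 (M, Y)) y₂) t))
          x = act K.comul (𝟙 W) (Prod.mkHom y₁ (K.colam y₂ t))
            (act K.comul (𝟙 W) (Prod.mkHom g₁ g₂) x) := by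
        rw [e₀, e₂, Category.comp_id]
        rfl
      refine e₃.symm.trans ?_
      exact congrArg (fun z : El (tens (idP C) K.comul) (b₁', b₂') (X, (M, Y)) =>
        act K.comul (𝟙 W) (b := (b₁', b₂')) (b' := (X, Y))
          (Prod.mkHom (show X ⟶ b₁' from z.1)
            (K.colam (show El K.comul b₂' (M, Y) from z.2) t)) x) e₁.symm)
  exact congrArg G h

/-- For fixed `t`, the expression is dinatural in the wire joining `q` and `t'`, so it is a function
of the class of `(q, t')`. That class is determined by `corho q t'`, since the right counit 2-cell
is injective. -/
lemma PseudocomonoidData.act_colam_eq {W P Q Q' : C} {q : El K.comul W (P, Q)}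
    {t' : El K.counit Q pt} {q₁ : El K.comul W (P, Q')} {t₁ : El K.counit Q' pt}
    (h : K.corho q t' = K.corho q₁ t₁) (t : El K.counit P pt) :
    act K.counit (K.colam q t) (𝟙 pt) t' = act K.counit (K.colam q₁ t) (𝟙 pt) t₁ := by
  let G : El (comp K.comul (tens (idP C) K.counit)) W (P, pt) → El K.counit W pt :=
    compLift (fun b s z => act K.counit (K.colam (P := b.1) (X := b.2) s
      (act K.counit (show P ⟶ b.1 from z.1) (𝟙 pt) t)) (𝟙 pt)
        (show El K.counit b.2 pt from z.2)) (by
      rintro ⟨b₁, b₂⟩ ⟨b₁', b₂'⟩ ⟨(g₁ : b₁ ⟶ b₁'), (g₂ : b₂ ⟶ b₂')⟩ x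
        ⟨(y₁ : P ⟶ b₁), (y₂ : El K.counit b₂ pt)⟩
      have e₁ : act (tens (idP C) K.counit) (Prod.mkHom g₁ g₂) (𝟙 (P, pt))
          (pair (wire y₁) y₂) = pair (wire (y₁ ≫ g₁)) (act K.counit g₂ (𝟙 pt) y₂) := by
        rw [act_pair]
        refine congrArg₂ Prod.mk ?_ rfl
        exact (act_wire _ _ _).trans (by simp)
      have e₂ : act K.comul (𝟙 W) (Prod.mkHom g₁ g₂) x =
          act K.comul (𝟙 W) (Prod.mkHom (𝟙 b₁) g₂) (act K.comul (𝟙 W) (Prod.mkHom g₁ (𝟙 b₂')) x) := by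
        have := act_act K.comul (𝟙 W) (Prod.mkHom g₁ (𝟙 b₂')) (𝟙 W) (Prod.mkHom (𝟙 b₁) g₂) x
        rw [this]
        simp
      have e₃ : act K.counit (K.colam (act K.comul (𝟙 W) (Prod.mkHom g₁ g₂) x)
          (act K.counit y₁ (𝟙 pt) t)) (𝟙 pt) y₂ =
          act K.counit (K.colam x (act K.counit (y₁ ≫ g₁) (𝟙 pt) t)) (𝟙 pt)
            (act K.counit g₂ (𝟙 pt) y₂) := by
        rw [e₂, K.colam_act, K.colam_slide, act_act, act_act]
        simp
      refine e₃.trans ?_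
      exact congrArg (fun z : El (tens (idP C) K.counit) (b₁', b₂') (P, pt) =>
        act K.counit (K.colam (P := b₁') (X := b₂') x
      (act K.counit (show P ⟶ b₁' from z.1) (𝟙 pt) t)) (𝟙 pt)
        (show El K.counit b₂' pt from z.2)) e₁.symm)
  have h₁ := congrArg G (app₂_injective K.rightCounit (a := W) (b := P) h)
  have h₂ : ∀ {Q : C} (q : El K.comul W (P, Q)) (t' : El K.counit Q pt),
      G (glue (b := (P, Q)) q (pair (wire (𝟙 P)) t')) =
        act K.counit (K.colam q t) (𝟙 pt) t' := fun q t' =>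
    congrArg (fun z => act K.counit (K.colam q z) (𝟙 pt) t') (act_id K.counit t)
  exact (h₂ q t').symm.trans (h₁.trans (h₂ q₁ t₁))

/-- The twist of the elements of the counit which exchanges the two counits. -/
lemma PseudocomonoidData.exists_twist {P : C} (t : El K.counit P pt) :
    ∃ t₀ : El K.counit P pt, ∀ {W Q : C} (q : El K.comul W (P, Q)) (t' : El K.counit Q pt),
      act K.counit (K.colam q t) (𝟙 pt) t' = act K.counit (K.corho q t') (𝟙 pt) t₀ := by
  -- Yoneda: by `act_colam_eq` the left-hand side is a natural function of the morphism `corho q t'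
  -- : P ⟶ W`, so `t₀` has to be its value at the identity of `P`. For a corepresented counit `t₀`
  -- would be `t` itself; that is not available here and not needed.
  obtain ⟨Q₀, b, t₁, h⟩ := K.exists_corho P
  refine ⟨act K.counit (K.colam b t) (𝟙 pt) t₁, fun {W Q} q t' => ?_⟩
  have e₁ : K.corho q t' = K.corho (act K.comul (K.corho q t') (𝟙 (P, Q₀)) b) t₁ :=
    ((K.corho_act b t₁ (K.corho q t') (𝟙 P)).trans (by simp [h])).symm
  rw [K.act_colam_eq e₁ t]
  have e₂ : K.colam (act K.comul (K.corho q t') (𝟙 (P, Q₀)) b) t = K.colam b t ≫ K.corho q t' :=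
    (K.colam_act b t (K.corho q t') (𝟙 Q₀)).trans (Category.id_comp _)
  rw [e₂, act_act]
  simp

end Comonoid

/-! ### Copairings, and transposition of comultiplication elements -/

section Frobenius

variable {C : Type u} [SmallCategory C] {F : FrobeniusPseudomonoid C} {T : MonoidalCategory C}
  (D : MonDict F.toPseudomonoidData T)

namespace FrobeniusPseudomonoid

lemma frobL_strL {X X' V : C} (c : El F.comul X (X', V)) (Y : C) :
    F.FrobL c (D.mElt (𝟙 (V ⊗ Y))) (D.mElt (𝟙 (X ⊗ Y))) (F.strL D.toMonDictData Y c) := by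
  rw [F.frobL_iff D.toMonDictData, D.m_mElt, D.m_mElt]
  rfl

lemma frobR_strR {Y Y' V : C} (c : El F.comul Y (V, Y')) (X : C) :
    F.FrobR c (D.mElt (𝟙 (X ⊗ V))) (D.mElt (𝟙 (X ⊗ Y))) (F.strR D.toMonDictData X c) := by
  rw [F.frobR_iff D.toMonDictData, D.m_mElt, D.m_mElt]
  rfl

/-- Half of a duality between `X` and `V`: the identity of `X` is lifted through the right counit,
moved to `d(⊥ ⅋ X; X, Q)` along the unitor, and then lifted through the left Frobenius 2-cell. The
conclusion is one snake equation; no second one is claimed. -/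
lemma exists_left_copairing (X : C) : ∃ (V : C) (κ : El F.comul (𝟙_ C) (X, V))
    (t : El F.counit (V ⊗ X) pt), F.corho (F.strL D.toMonDictData X κ) t = (λ_ X).inv := by
  obtain ⟨Q, b, t, h⟩ := F.exists_corho X
  obtain ⟨V, κ, f, e⟩ := F.exists_strL D.toMonDictData (act F.comul (λ_ X).inv (𝟙 (X, Q)) b)
  refine ⟨V, κ, act F.counit f (𝟙 pt) t, ?_⟩
  rw [← F.corho_slide, ← e]
  exact (F.corho_act b t (λ_ X).inv (𝟙 X)).trans (by simp [h])

lemma exists_right_copairing (X : C) : ∃ (V : C) (κ : El F.comul (𝟙_ C) (V, X))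
    (t : El F.counit (X ⊗ V) pt), F.colam (F.strR D.toMonDictData X κ) t = (ρ_ X).inv := by
  obtain ⟨Q, b, t, h⟩ := F.exists_colam X
  obtain ⟨V, κ, f, e⟩ := F.exists_strR D.toMonDictData (act F.comul (ρ_ X).inv (𝟙 (Q, X)) b)
  refine ⟨V, κ, act F.counit f (𝟙 pt) t, ?_⟩
  rw [← F.colam_slide, ← e]
  exact (F.colam_act b t (ρ_ X).inv (𝟙 X)).trans (by simp [h])

lemma act_strR_unit {X Y Z : C} (c : El F.comul Z (X, Y)) :
    act F.comul (λ_ Z).hom (𝟙 (𝟙_ C ⊗ X, Y)) (F.strR D.toMonDictData (𝟙_ C) c) =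
      act F.comul (𝟙 Z) (Prod.mkHom (λ_ X).hom (𝟙 Y)) c := by
  have h := F.R_unit (p := D.uElt (𝟙 (𝟙_ C))) (frobR_strR D c (𝟙_ C))
  rw [D.lam, D.lam] at h
  simpa using h.symm

/-- An element `c` of `d(Z; X, Y)` is transposed to a morphism `Y ⟶ V ⅋ Z` by the right strength and
`t`, and transposed back by `κ`. That the round trip is the identity is the snake equation `h`
combined with the compatibility of both Frobenius 2-cells with the coassociator. Consequently `d(-;
X, Y)` is a retract of `Hom(Y, V ⅋ -)`. -/
lemma act_strL_colam_strR {X Y Z V : C} (κ : El F.comul (𝟙_ C) (X, V))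
    (t : El F.counit (V ⊗ X) pt) (h : F.corho (F.strL D.toMonDictData X κ) t = (λ_ X).inv)
    (c : El F.comul Z (X, Y)) :
    act F.comul (λ_ Z).hom (Prod.mkHom (𝟙 X) (F.colam (F.strR D.toMonDictData V c) t))
      (F.strL D.toMonDictData Z κ) = c := by
  -- The coequation `LR_coassoc` needs a value of the coassociator with identity on the passive
  -- wire; any representative is brought to that form by sliding `f`.
  obtain ⟨⟨X₁, N⟩, s', ⟨(f : X ⟶ X₁), (q' : El F.comul N (V ⊗ X, Y))⟩, e⟩ :=
    exists_glue (app₂ F.coassoc.hom (a := 𝟙_ C ⊗ Z) (b := ((X, V ⊗ X), Y))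
      (glue (F.strR D.toMonDictData (𝟙_ C) c)
        (pair (F.strL D.toMonDictData X κ) (wire (𝟙 Y)))))
  have e₁ : (pair (wire f) q' : El (tens (idP C) F.comul) (X₁, N) (X, (V ⊗ X, Y))) =
      act (tens (idP C) F.comul) (Prod.mkHom f (𝟙 N)) (𝟙 (X, (V ⊗ X, Y)))
        (pair (wire (𝟙 X)) q') := by
    rw [act_pair]
    exact congrArg₂ Prod.mk ((by simp : f = 𝟙 X ≫ 𝟙 X ≫ f).trans (act_wire _ _ _).symm)
      (act_id F.comul q').symm
  have e₂ : F.Coassoc (F.strR D.toMonDictData (𝟙_ C) c) (F.strL D.toMonDictData X κ)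
      (act F.comul (𝟙 (𝟙_ C ⊗ Z)) (Prod.mkHom f (𝟙 N)) s') q' :=
    e.trans ((congrArg (fun z => glue s' z) e₁).trans (glue_slide _ _ _).symm)
  -- Both factors of the multiplication are comultiplied: `⊥` by `κ` and `Z` by `c`, with the inner
  -- outputs `V` and `X` multiplied to `V ⅋ X`.
  have h₁ := F.LR_coassoc (frobL_strL D κ X)
    (r := D.mElt (𝟙 _)) (s := F.strR D.toMonDictData (𝟙_ C) c)
    (frobR_strR D c (𝟙_ C))
    e₂ (frobR_strR D c V) (frobL_strL D κ Z)
  have h₂ := (glue_eq_iff_rep D.mul _ _ _ _).1 h₁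
  have h₃ : val D.mul (D.mElt (𝟙 (𝟙_ C ⊗ Z))) = 𝟙 _ := D.m_mElt _
  rw [h₃] at h₂
  -- The middle output `V ⅋ X` is now closed by `t`. On one side this gives the double transpose; on
  -- the other the cotriangle turns it into the snake `corho (strL κ) t`, which is an inverse unitor
  -- by `h`.
  have h₄ := F.act_colam_congr t (((act_id _ _).symm.trans h₂).trans (act_id _ _))
  have h₅ := F.cotriangle (t := t) e₂
  have h₆ := (h₅.trans h₄).symm
  have h₇ := congrArg (act F.comul (λ_ Z).hom (𝟙 (X, Y))) h₆
  rw [act_act, h] at h₇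
  simp only [Category.id_comp] at h₇
  refine h₇.trans ?_
  rw [act_act]
  have h₈ := congrArg (act F.comul (𝟙 Z) (Prod.mkHom (λ_ X).inv (𝟙 Y))) (act_strR_unit D c)
  rw [act_act, act_act] at h₈
  simp only [Category.id_comp, Category.comp_id] at h₈ ⊢
  refine h₈.trans ?_
  have h₉ : Prod.mkHom (λ_ X).inv (𝟙 Y) ≫ Prod.mkHom (λ_ X).hom (𝟙 Y) = 𝟙 (X, Y) :=
    Prod.ext (by simp) (by simp)
  rw [h₉, act_id]

end FrobeniusPseudomonoid

end Frobenius

/-! ### The functors `e(W ⅋ -)` as retracts of corepresentables -/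

section Frobenius

variable {C : Type u} [SmallCategory C] {F : FrobeniusPseudomonoid C} {T : MonoidalCategory C}
  (D : MonDict F.toPseudomonoidData T)

namespace FrobeniusPseudomonoid

/-- Naturality in `Z` of the contraction of `z` against `κ`; it serves as the naturality of the
section in the retracts below. -/
lemma corho_strL_act {V W Z Z' : C} (κ : El F.comul (𝟙_ C) (V, W)) (z : El F.counit (W ⊗ Z) pt)
    (g : Z ⟶ Z') :
    F.corho (F.strL D.toMonDictData Z' κ) (act F.counit (W ◁ g) (𝟙 pt) z) ≫ (λ_ Z').hom =
      (F.corho (F.strL D.toMonDictData Z κ) z ≫ (λ_ Z).hom) ≫ g := by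
  rw [← F.corho_slide, ← F.strL_natural D.toMonDictData κ g]
  have := F.corho_act (F.strL D.toMonDictData Z κ) z (𝟙_ C ◁ g) (𝟙 V)
  rw [Category.id_comp] at this
  refine (congrArg (· ≫ (λ_ Z').hom) this).trans ?_
  simp

/-- The two strengths commute: this is `LR_assoc` at universal elements, with `⊥` as the middle
factor. -/
lemma strL_strR {V W Z : C} (κ : El F.comul (𝟙_ C) (V, W)) (X : C) :
    act F.comul (α_ X (𝟙_ C) Z).hom (𝟙 (X ⊗ V, W ⊗ Z))
      (F.strL D.toMonDictData Z (F.strR D.toMonDictData X κ)) =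
    F.strR D.toMonDictData X (F.strL D.toMonDictData Z κ) := by
  have hA : F.Assoc (D.mElt (𝟙 (X ⊗ 𝟙_ C))) (D.mElt (𝟙 ((X ⊗ 𝟙_ C) ⊗ Z)))
      (D.mElt (𝟙 (𝟙_ C ⊗ Z))) (D.mElt (α_ X (𝟙_ C) Z).hom) := by
    rw [D.assoc_iff]
    simp
  have h := F.LR_assoc (frobR_strR D κ X) (frobL_strL D _ Z) hA (frobL_strL D κ Z)
    (frobR_strR D _ X)
  let ψ := compIso (tensIso idIso D.mul) D.mul
  have h₁ := (glue_eq_iff_rep (tensIso idIso D.mul) (a := (X, (𝟙_ C, Z))) (b := (X, 𝟙_ C ⊗ Z))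
    (b' := (X, 𝟙_ C ⊗ Z)) _ _ _ _).1 h
  have h₂ : val (tensIso idIso D.mul) (a := (X, (𝟙_ C, Z))) (b := (X, 𝟙_ C ⊗ Z))
    (pair (wire (𝟙 X)) (D.mElt (𝟙 (𝟙_ C ⊗ Z)))) = 𝟙 (X, 𝟙_ C ⊗ Z) :=
    congrArg₂ Prod.mk rfl (D.m_mElt (𝟙 (𝟙_ C ⊗ Z)))
  have h₃ := ((congrArg (fun z => act (comp F.mul F.comul) z (𝟙 (X ⊗ V, W ⊗ Z)) _) h₂).symm.trans
    (h₁.trans (congrArg (fun z => act (comp F.mul F.comul) z (𝟙 (X ⊗ V, W ⊗ Z)) _) h₂)))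
  have h₄ := (glue_eq_iff_rep D.mul _ _ _ _).1
    ((act_id _ _).symm.trans (h₃.trans (act_id _ _)))
  have h₅ : val D.mul (D.mElt (α_ X (𝟙_ C) Z).hom) = (α_ X (𝟙_ C) Z).hom := D.m_mElt _
  have h₆ : val D.mul (D.mElt (𝟙 (X ⊗ (𝟙_ C ⊗ Z)))) = 𝟙 _ := D.m_mElt _
  rw [h₅, h₆] at h₄
  exact h₄.trans (act_id _ _)

/-- The compatibility of the left Frobenius 2-cell with the counit, read at universal elements of
the multiplication. -/
lemma colam_strL {X V Y P : C} (t : El F.counit P pt) (c : El F.comul X (P, V)) :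
    F.colam (F.strL D.toMonDictData Y c) t = F.colam c t ▷ Y := by
  have h := congrArg D.m (F.L_counit (t := t) (frobL_strL D c Y))
  rw [D.m_act, D.m_act] at h
  simpa using h.symm

lemma corho_strR {X V Y P : C} (t : El F.counit P pt) (c : El F.comul Y (V, P)) :
    F.corho (F.strR D.toMonDictData X c) t = X ◁ F.corho c t := by
  have h := congrArg D.m (F.R_counit (t := t) (frobR_strR D c X))
  rw [D.m_act, D.m_act] at h
  simpa using h.symm

/-- The functor `e(W ⅋ -)` is a retract of a corepresentable one. -/
lemma exists_retract_counit (W : C) : ∃ (V : C) (κ : El F.comul (𝟙_ C) (V, W))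
    (t : El F.counit (W ⊗ V) pt), ∀ {Z : C} (z : El F.counit (W ⊗ Z) pt),
      act F.counit (W ◁ (F.corho (F.strL D.toMonDictData Z κ) z ≫ (λ_ Z).hom)) (𝟙 pt) t = z := by
  obtain ⟨V, κ, t, h⟩ := exists_right_copairing D W
  -- Contracting `κ` with both `t` and `z` can start with either. Starting with `t` leaves `z`, by
  -- the snake equation; starting with `z` gives the desired factorisation through `V`. The twist
  -- mediates between the two orders.
  obtain ⟨t₀, h₀⟩ := F.exists_twist t
  refine ⟨V, κ, t₀, fun {Z} z => ?_⟩
  have h₁ := h₀ (F.strR D.toMonDictData W (F.strL D.toMonDictData Z κ)) z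
  rw [corho_strR] at h₁
  -- Commuting the strengths exposes `strR W κ`, to which the snake equation `h` applies; only
  -- unitors remain.
  have h₂ : F.colam (F.strR D.toMonDictData W (F.strL D.toMonDictData Z κ)) t =
      W ◁ (λ_ Z).inv := by
    rw [← strL_strR]
    have := F.colam_act (F.strL D.toMonDictData Z (F.strR D.toMonDictData W κ)) t
      (α_ W (𝟙_ C) Z).hom (𝟙 (W ⊗ Z))
    refine this.trans ?_
    rw [colam_strL, h]
    simp
  rw [h₂] at h₁
  have h₃ := congrArg (act F.counit (W ◁ (λ_ Z).hom) (𝟙 pt)) h₁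
  rw [act_act, act_act, ← MonoidalCategory.whiskerLeft_comp, Iso.inv_hom_id,
    ← MonoidalCategory.whiskerLeft_comp, MonoidalCategory.whiskerLeft_id] at h₃
  simp only [Category.comp_id, act_id] at h₃
  exact h₃.symm

end FrobeniusPseudomonoid

end Frobenius

/-! ### Corepresentability of the counit and of the comultiplication -/

namespace FrobeniusPseudomonoid

/-- Since `e(Z)` is isomorphic to `e(⊥ ⅋ Z)`, the case `W = ⊥` of `exists_retract_counit` presents
`e` as a retract of `Hom(V, -)`, and the idempotent splits. -/
lemma exists_corepresenting_counit {C : Type u} [SmallCategory C] [IsIdempotentComplete C]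
    {F : FrobeniusPseudomonoid C} {T : MonoidalCategory C} (D : MonDict F.toPseudomonoidData T) :
    ∃ un : C, Nonempty (F.counit ≅ (Functor.fromPUnit.{u} un).toProfunctorRev) := by
  obtain ⟨V, κ, t, h⟩ := exists_retract_counit D (𝟙_ C)
  obtain ⟨o, x, hx⟩ := exists_couniversal_of_retract F.counit pt V
    (act F.counit (λ_ V).hom (𝟙 pt) t)
    (fun Z z => F.corho (F.strL D.toMonDictData Z κ) (act F.counit (λ_ Z).inv (𝟙 pt) z) ≫
      (λ_ Z).hom) (by
      intro Z Z' g z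
      rw [← corho_strL_act, act_act, act_act]
      simp) (by
      intro Z z
      have h₁ := congrArg (act F.counit (λ_ Z).hom (𝟙 pt)) (h (act F.counit (λ_ Z).inv (𝟙 pt) z))
      rw [act_act, act_act] at h₁
      rw [act_act]
      simp only [Category.comp_id, Iso.inv_hom_id, act_id] at h₁ ⊢
      refine Eq.trans ?_ h₁
      congr 1
      simp)
  obtain ⟨G, ⟨φ⟩⟩ := exists_corepresenting_of_universal F.counit (fun _ => o)
    (fun b => x) (fun b a y => hx a y)
  -- A functor on the terminal category is replaced by the constant functor at its value, the form
  -- required by the dictionaries.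
  let α : Functor.fromPUnit.{u} (G.obj pt) ≅ G :=
    NatIso.ofComponents (fun X => eqToIso (by cases X; rfl)) (by
      rintro ⟨⟨⟩⟩ ⟨⟨⟩⟩ ⟨⟨⟨⟩⟩⟩
      simp)
  exact ⟨G.obj pt, ⟨φ ≪≫ toProfunctorRevIso α⟩⟩

/-- Three retractions are composed. `d(Z; X, Y)` is a retract of `Hom(Y, VX ⅋ Z)` by transposition;
the latter is a retract of `e(VY ⅋ (VX ⅋ Z))` by taking names; and `e((VY ⅋ VX) ⅋ Z)` is a retract
of `Hom(V, Z)`. All maps are natural in `Z`, so the splitting criterion applies. -/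
lemma exists_corepresenting_comul {C : Type u} [SmallCategory C] [IsIdempotentComplete C]
    {F : FrobeniusPseudomonoid C} {T : MonoidalCategory C} (D : MonDict F.toPseudomonoidData T) :
    ∃ ten : C × C ⥤ C, Nonempty (F.comul ≅ ten.toProfunctorRev) := by
  have H : ∀ b : C × C, ∃ (o : C) (x : El F.comul o b), ∀ (a : C) (y : El F.comul a b),
      ∃! f : o ⟶ a, act F.comul f (𝟙 b) x = y := by
    rintro ⟨X, Y⟩
    obtain ⟨VX, κX, tX, hX⟩ := exists_left_copairing D X
    obtain ⟨VY, κY, tY, hY⟩ := exists_left_copairing D Y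
    obtain ⟨V, κ, t, h⟩ := exists_retract_counit D (VY ⊗ VX)
    -- Sections: `cur` (transpose), `nm` (name of a morphism), `sec`. Retractions: `unc`, `back` and
    -- the transport of `t`. Only the composites retraction after section are the identity.
    let cur : ∀ Z, El F.comul Z (X, Y) → (Y ⟶ VX ⊗ Z) := fun Z c =>
      F.colam (F.strR D.toMonDictData VX c) tX
    let nm : ∀ Z, (Y ⟶ VX ⊗ Z) → El F.counit ((VY ⊗ VX) ⊗ Z) pt := fun Z f =>
      act F.counit (VY ◁ f ≫ (α_ VY VX Z).inv) (𝟙 pt) tY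
    let sec : ∀ Z, El F.counit ((VY ⊗ VX) ⊗ Z) pt → (V ⟶ Z) := fun Z z =>
      F.corho (F.strL D.toMonDictData Z κ) z ≫ (λ_ Z).hom
    let back : ∀ Z, El F.counit ((VY ⊗ VX) ⊗ Z) pt → (Y ⟶ VX ⊗ Z) := fun Z z =>
      F.corho (F.strL D.toMonDictData (VX ⊗ Z) κY) (act F.counit (α_ VY VX Z).hom (𝟙 pt) z) ≫
        (λ_ (VX ⊗ Z)).hom
    let unc : ∀ Z, (Y ⟶ VX ⊗ Z) → El F.comul Z (X, Y) := fun Z f =>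
      act F.comul (λ_ Z).hom (Prod.mkHom (𝟙 X) f) (F.strL D.toMonDictData Z κX)
    have cur_nat : ∀ {Z Z'} (g : Z ⟶ Z') (c), cur Z' (act F.comul g (𝟙 (X, Y)) c) =
        cur Z c ≫ VX ◁ g := by
      intro Z Z' g c
      dsimp only [cur]
      rw [F.strR_natural]
      exact (F.colam_act _ _ _ (𝟙 Y)).trans (Category.id_comp _)
    have nm_nat : ∀ {Z Z'} (g : Z ⟶ Z') (f), nm Z' (f ≫ VX ◁ g) =
        act F.counit (_ ◁ g) (𝟙 pt) (nm Z f) := by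
      intro Z Z' g f
      dsimp only [nm]
      rw [act_act]
      simp
    have back_nat : ∀ {Z Z'} (g : Z ⟶ Z') (z), back Z' (act F.counit (_ ◁ g) (𝟙 pt) z) =
        back Z z ≫ VX ◁ g := by
      intro Z Z' g z
      dsimp only [back]
      rw [← corho_strL_act, act_act, act_act]
      simp
    have unc_nat : ∀ {Z Z'} (g : Z ⟶ Z') (f), unc Z' (f ≫ VX ◁ g) =
        act F.comul g (𝟙 (X, Y)) (unc Z f) := by
      intro Z Z' g f
      dsimp only [unc]
      rw [act_act]
      have h₁ := congrArg (act F.comul (λ_ Z').hom (Prod.mkHom (𝟙 X) f))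
        (F.strL_natural D.toMonDictData κX g)
      rw [act_act, act_act] at h₁
      have e₁ : Prod.mkHom (𝟙 X) f ≫ Prod.mkHom (𝟙 X) (VX ◁ g) =
        Prod.mkHom (𝟙 X) (f ≫ VX ◁ g) := Prod.ext (by simp) (by simp)
      rw [e₁] at h₁
      simpa using h₁.symm
    have unc_cur : ∀ Z c, unc Z (cur Z c) = c := fun Z c =>
      act_strL_colam_strR D κX tX hX c
    have back_nm : ∀ Z f, back Z (nm Z f) = f := by
      intro Z f
      dsimp only [back, nm]
      rw [act_act]
      have e₁ := corho_strL_act D κY tY f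
      rw [hY] at e₁
      simpa using e₁
    have sec_eq : ∀ Z z, act F.counit (_ ◁ sec Z z) (𝟙 pt) t = z := fun Z z => h z
    refine exists_couniversal_of_retract F.comul (X, Y) V (unc V (back V t))
      (fun Z c => sec Z (nm Z (cur Z c))) ?_ ?_
    · intro Z Z' g c
      rw [cur_nat, nm_nat]
      exact corho_strL_act D κ _ g
    · intro Z c
      rw [← unc_nat, ← back_nat, sec_eq, back_nm, unc_cur]
  choose o x hx using H
  exact exists_corepresenting_of_universal F.comul o x hx

end FrobeniusPseudomonoid

/-! ### Whiskering calculus for two monoidal structures on one category -/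

namespace TwoMonoidal

section Calculus

variable {C : Type*} [Category* C] (S : TwoMonoidal C)

lemma tL_id (A B : C) : S.tL A (𝟙 B) = 𝟙 _ := @MonoidalCategory.whiskerLeft_id C _ S.tensor A B
lemma tR_id (A B : C) : S.tR (𝟙 A) B = 𝟙 _ := @MonoidalCategory.id_whiskerRight C _ S.tensor A B
lemma pL_id (A B : C) : S.pL A (𝟙 B) = 𝟙 _ := @MonoidalCategory.whiskerLeft_id C _ S.par A B
lemma pR_id (A B : C) : S.pR (𝟙 A) B = 𝟙 _ := @MonoidalCategory.id_whiskerRight C _ S.par A B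

lemma tL_comp (A : C) {X Y Z : C} (f : X ⟶ Y) (g : Y ⟶ Z) :
    S.tL A (f ≫ g) = S.tL A f ≫ S.tL A g := @MonoidalCategory.whiskerLeft_comp C _ S.tensor A _ _ _ f g
lemma tR_comp {X Y Z : C} (f : X ⟶ Y) (g : Y ⟶ Z) (A : C) :
    S.tR (f ≫ g) A = S.tR f A ≫ S.tR g A := @MonoidalCategory.comp_whiskerRight C _ S.tensor _ _ _ f g A
lemma pL_comp (A : C) {X Y Z : C} (f : X ⟶ Y) (g : Y ⟶ Z) :
    S.pL A (f ≫ g) = S.pL A f ≫ S.pL A g := @MonoidalCategory.whiskerLeft_comp C _ S.par A _ _ _ f g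
lemma pR_comp {X Y Z : C} (f : X ⟶ Y) (g : Y ⟶ Z) (A : C) :
    S.pR (f ≫ g) A = S.pR f A ≫ S.pR g A := @MonoidalCategory.comp_whiskerRight C _ S.par _ _ _ f g A

lemma tHom_def {A A' B B' : C} (f : A ⟶ A') (g : B ⟶ B') :
    S.tensor.tensorHom f g = S.tR f B ≫ S.tL A' g := @MonoidalCategory.tensorHom_def C _ S.tensor _ _ _ _ f g
lemma pHom_def {A A' B B' : C} (f : A ⟶ A') (g : B ⟶ B') :
    S.par.tensorHom f g = S.pR f B ≫ S.pL A' g := @MonoidalCategory.tensorHom_def C _ S.par _ _ _ _ f g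

lemma p_exchange {A A' B B' : C} (f : A ⟶ A') (g : B ⟶ B') :
    S.pL A g ≫ S.pR f B' = S.pR f B ≫ S.pL A' g := @MonoidalCategory.whisker_exchange C _ S.par _ _ _ _ f g
lemma t_exchange_assoc {A A' B B' Z : C} (f : A ⟶ A') (g : B ⟶ B') (h : S.t A' B' ⟶ Z) :
    S.tL A g ≫ S.tR f B' ≫ h = S.tR f B ≫ S.tL A' g ≫ h :=
  @MonoidalCategory.whisker_exchange_assoc C _ S.tensor _ _ _ _ f g _ h
lemma p_exchange_assoc {A A' B B' Z : C} (f : A ⟶ A') (g : B ⟶ B') (h : S.p A' B' ⟶ Z) :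
    S.pL A g ≫ S.pR f B' ≫ h = S.pR f B ≫ S.pL A' g ≫ h :=
  @MonoidalCategory.whisker_exchange_assoc C _ S.par _ _ _ _ f g _ h

lemma pa_left {A A' : C} (f : A ⟶ A') (B D : C) :
    S.pR (S.pR f B) D ≫ (S.pa A' B D).hom = (S.pa A B D).hom ≫ S.pR f (S.p B D) :=
  @MonoidalCategory.associator_naturality_left C _ S.par _ _ f B D
lemma pa_mid (A : C) {B B' : C} (f : B ⟶ B') (D : C) :
    S.pR (S.pL A f) D ≫ (S.pa A B' D).hom = (S.pa A B D).hom ≫ S.pL A (S.pR f D) :=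
  @MonoidalCategory.associator_naturality_middle C _ S.par A _ _ f D
lemma pa_right (A B : C) {D D' : C} (f : D ⟶ D') :
    S.pL (S.p A B) f ≫ (S.pa A B D').hom = (S.pa A B D).hom ≫ S.pL A (S.pL B f) :=
  @MonoidalCategory.associator_naturality_right C _ S.par A B _ _ f
lemma ta_left_assoc {A A' Z : C} (f : A ⟶ A') (B D : C) (h : S.t A' (S.t B D) ⟶ Z) :
    S.tR (S.tR f B) D ≫ (S.ta A' B D).hom ≫ h = (S.ta A B D).hom ≫ S.tR f (S.t B D) ≫ h :=
  @MonoidalCategory.associator_naturality_left_assoc C _ S.tensor _ _ f B D _ h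
lemma ta_mid_assoc (A : C) {B B' Z : C} (f : B ⟶ B') (D : C) (h : S.t A (S.t B' D) ⟶ Z) :
    S.tR (S.tL A f) D ≫ (S.ta A B' D).hom ≫ h = (S.ta A B D).hom ≫ S.tL A (S.tR f D) ≫ h :=
  @MonoidalCategory.associator_naturality_middle_assoc C _ S.tensor A _ _ f D _ h
lemma ta_right_assoc (A B : C) {D D' Z : C} (f : D ⟶ D') (h : S.t A (S.t B D') ⟶ Z) :
    S.tL (S.t A B) f ≫ (S.ta A B D').hom ≫ h = (S.ta A B D).hom ≫ S.tL A (S.tL B f) ≫ h :=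
  @MonoidalCategory.associator_naturality_right_assoc C _ S.tensor A B _ _ f _ h
lemma pa_left_assoc {A A' Z : C} (f : A ⟶ A') (B D : C) (h : S.p A' (S.p B D) ⟶ Z) :
    S.pR (S.pR f B) D ≫ (S.pa A' B D).hom ≫ h = (S.pa A B D).hom ≫ S.pR f (S.p B D) ≫ h :=
  @MonoidalCategory.associator_naturality_left_assoc C _ S.par _ _ f B D _ h
lemma pa_mid_assoc (A : C) {B B' Z : C} (f : B ⟶ B') (D : C) (h : S.p A (S.p B' D) ⟶ Z) :
    S.pR (S.pL A f) D ≫ (S.pa A B' D).hom ≫ h = (S.pa A B D).hom ≫ S.pL A (S.pR f D) ≫ h :=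
  @MonoidalCategory.associator_naturality_middle_assoc C _ S.par A _ _ f D _ h

lemma plam_nat {A B : C} (f : A ⟶ B) : S.pL S.bot f ≫ (S.plam B).hom = (S.plam A).hom ≫ f :=
  @MonoidalCategory.leftUnitor_naturality C _ S.par _ _ f
lemma prho_nat {A B : C} (f : A ⟶ B) : S.pR f S.bot ≫ (S.prho B).hom = (S.prho A).hom ≫ f :=
  @MonoidalCategory.rightUnitor_naturality C _ S.par _ _ f
lemma tlam_inv_nat_assoc {A B Z : C} (f : A ⟶ B) (h : S.t S.tI B ⟶ Z) :
    f ≫ (S.tlam B).inv ≫ h = (S.tlam A).inv ≫ S.tL S.tI f ≫ h :=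
  @MonoidalCategory.leftUnitor_inv_naturality_assoc C _ S.tensor _ _ f _ h
lemma trho_inv_nat_assoc {A B Z : C} (f : A ⟶ B) (h : S.t B S.tI ⟶ Z) :
    f ≫ (S.trho B).inv ≫ h = (S.trho A).inv ≫ S.tR f S.tI ≫ h :=
  @MonoidalCategory.rightUnitor_inv_naturality_assoc C _ S.tensor _ _ f _ h
lemma trho_nat_assoc {A B Z : C} (f : A ⟶ B) (h : B ⟶ Z) :
    S.tR f S.tI ≫ (S.trho B).hom ≫ h = (S.trho A).hom ≫ f ≫ h :=
  @MonoidalCategory.rightUnitor_naturality_assoc C _ S.tensor _ _ f _ h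

end Calculus

end TwoMonoidal

/-! ### Naturality of the strengths in all arguments -/

section Strength

variable {C : Type u} [SmallCategory C] (F : FrobeniusData C) {T : MonoidalCategory C}
  (D : MonDictData F.toPseudomonoidData T)

namespace FrobeniusData

lemma strL_act {X₁ X₂ X' X₁' V V' : C} (f : X₁ ⟶ X₂) (g : X₁' ⟶ X') (h : V' ⟶ V)
    (c : El F.comul X₁ (X', V)) (Y : C) :
    F.strL D Y (act F.comul f (Prod.mkHom g h) c) =
      act F.comul (f ▷ Y) (Prod.mkHom g (h ▷ Y)) (F.strL D Y c) := by
  have h₁ := compRep_act D.mul (Prod.mkHom f (𝟙 Y)) (Prod.mkHom g (h ▷ Y))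
    (app₂ F.frobL.hom (a := (X₁, Y)) (b := (X', V ⊗ Y))
    (F.frobLMk c (𝟙 Y) (𝟙 X') (D.mElt (𝟙 (V ⊗ Y)))))
  have h₂ : act F.comul (f ⊗ₘ 𝟙 Y) (Prod.mkHom g (h ▷ Y)) (F.strL D Y c) = _ := h₁.symm
  rw [tensorHom_id] at h₂
  rw [h₂, ← app₂_act]
  refine congrArg (fun z => compRep D.mul (app₂ F.frobL.hom z)) ?_
  refine Eq.trans ?_ (act_glue _ _ _ _).symm
  have e₁ : act (tens F.comul (idP C)) (Prod.mkHom f (𝟙 Y)) (𝟙 ((X', V), Y))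
      (pair c (wire (𝟙 Y))) = pair (act F.comul f (𝟙 (X', V)) c) (wire (𝟙 Y)) := by
    rw [act_pair]
    exact congrArg₂ Prod.mk rfl (act_id _ _)
  have e₂ : pair (act F.comul f (Prod.mkHom g h) c) (wire (𝟙 Y)) =
      act (tens F.comul (idP C)) (𝟙 (X₂, Y)) (Prod.mkHom (Prod.mkHom g h) (𝟙 Y))
        (pair (act F.comul f (𝟙 (X', V)) c) (wire (𝟙 Y))) := by
    rw [act_pair]
    refine congrArg₂ Prod.mk ?_ (act_id _ _).symm
    refine Eq.trans ?_ (act_act _ _ _ _ _ _).symm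
    simp
  have e₃ : D.mElt (h ▷ Y) = act F.mul (Prod.mkHom h (𝟙 Y)) (𝟙 (V' ⊗ Y)) (D.mElt (𝟙 (V' ⊗ Y))) :=
    D.m_injective (by rw [D.m_act, D.m_mElt, D.m_mElt]; simp)
  have e₄ : act (tens (idP C) F.mul) (𝟙 (X', (V, Y))) (Prod.mkHom g (h ▷ Y))
      (pair (wire (𝟙 X')) (D.mElt (𝟙 (V ⊗ Y)))) = pair (wire g) (D.mElt (h ▷ Y)) := by
    rw [act_pair]
    refine congrArg₂ Prod.mk (wire_act_right g) ?_
    exact D.m_injective ((D.m_act _ _ _).trans (by rw [D.m_mElt, D.m_mElt]; simp))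
  have e₅ : act (tens (idP C) F.mul) (Prod.mkHom g (Prod.mkHom h (𝟙 Y))) (𝟙 (X₁', V' ⊗ Y))
      (pair (wire (𝟙 X₁')) (D.mElt (𝟙 (V' ⊗ Y)))) = pair (wire g) (D.mElt (h ▷ Y)) := by
    rw [act_pair]
    exact congrArg₂ Prod.mk (wire_act_left g) e₃.symm
  refine (congrArg (fun z => glue (b := ((X₁', V'), Y)) z _) e₂).trans ?_
  refine (glue_slide (b := ((X₁', V'), Y)) (b' := ((X', V), Y))
    (Prod.mkHom (Prod.mkHom g h) (𝟙 Y)) _ _).trans ?_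
  refine congrArg₂ (glue (b := ((X', V), Y))) e₁.symm ?_
  exact e₅.trans e₄.symm

lemma strR_act {Y₁ Y₂ Y' Y₁' V V' : C} (f : Y₁ ⟶ Y₂) (h : V' ⟶ V) (g : Y₁' ⟶ Y')
    (c : El F.comul Y₁ (V, Y')) (X : C) :
    F.strR D X (act F.comul f (Prod.mkHom h g) c) =
      act F.comul (X ◁ f) (Prod.mkHom (X ◁ h) g) (F.strR D X c) := by
  have h₁ := compRep_act D.mul (Prod.mkHom (𝟙 X) f) (Prod.mkHom (X ◁ h) g)
    (app₂ F.frobR.hom (a := (X, Y₁)) (b := (X ⊗ V, Y'))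
    (F.frobRMk c (𝟙 X) (𝟙 Y') (D.mElt (𝟙 (X ⊗ V)))))
  have h₂ : act F.comul (𝟙 X ⊗ₘ f) (Prod.mkHom (X ◁ h) g) (F.strR D X c) = _ := h₁.symm
  rw [id_tensorHom] at h₂
  rw [h₂, ← app₂_act]
  refine congrArg (fun z => compRep D.mul (app₂ F.frobR.hom z)) ?_
  refine Eq.trans ?_ (act_glue _ _ _ _).symm
  have e₁ : act (tens (idP C) F.comul) (Prod.mkHom (𝟙 X) f) (𝟙 (X, (V, Y')))
      (pair (wire (𝟙 X)) c) = pair (wire (𝟙 X)) (act F.comul f (𝟙 (V, Y')) c) := by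
    rw [act_pair]
    exact congrArg₂ Prod.mk (act_id _ _) rfl
  have e₂ : pair (wire (𝟙 X)) (act F.comul f (Prod.mkHom h g) c) =
      act (tens (idP C) F.comul) (𝟙 (X, Y₂)) (Prod.mkHom (𝟙 X) (Prod.mkHom h g))
        (pair (wire (𝟙 X)) (act F.comul f (𝟙 (V, Y')) c)) := by
    rw [act_pair]
    refine congrArg₂ Prod.mk (act_id _ _).symm ?_
    refine Eq.trans ?_ (act_act _ _ _ _ _ _).symm
    simp
  have e₃ : D.mElt (X ◁ h) = act F.mul (Prod.mkHom (𝟙 X) h) (𝟙 (X ⊗ V')) (D.mElt (𝟙 (X ⊗ V'))) :=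
    D.m_injective (by rw [D.m_act, D.m_mElt, D.m_mElt]; simp)
  have e₄ : act (tens F.mul (idP C)) (𝟙 ((X, V), Y')) (Prod.mkHom (X ◁ h) g)
      (pair (D.mElt (𝟙 (X ⊗ V))) (wire (𝟙 Y'))) = pair (D.mElt (X ◁ h)) (wire g) := by
    rw [act_pair]
    refine congrArg₂ Prod.mk ?_ (wire_act_right g)
    exact D.m_injective ((D.m_act _ _ _).trans (by rw [D.m_mElt, D.m_mElt]; simp))
  have e₅ : act (tens F.mul (idP C)) (Prod.mkHom (Prod.mkHom (𝟙 X) h) g) (𝟙 (X ⊗ V', Y₁'))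
      (pair (D.mElt (𝟙 (X ⊗ V'))) (wire (𝟙 Y₁'))) = pair (D.mElt (X ◁ h)) (wire g) := by
    rw [act_pair]
    exact congrArg₂ Prod.mk e₃.symm (wire_act_left g)
  refine (congrArg (fun z => glue (b := (X, (V', Y₁'))) z _) e₂).trans ?_
  refine (glue_slide (b := (X, (V', Y₁'))) (b' := (X, (V, Y')))
    (Prod.mkHom (𝟙 X) (Prod.mkHom h g)) _ _).trans ?_
  refine congrArg₂ (glue (b := (X, (V, Y')))) e₁.symm ?_
  exact e₅.trans e₄.symm

end FrobeniusData

end Strength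

/-! ### Equality in mixed composites as equality of morphisms -/

section Mixed

variable {C : Type u} [SmallCategory C] {F : FrobeniusData C} {S : TwoMonoidal C}
  (M : MonDictData F.toPseudomonoidData S.par) (K : ComonDictData F.toPseudocomonoidData S.tensor)

lemma glue_mul_comul_iff {X Y X' Y' W W' : C} (r : El F.mul (X, Y) W) (s : El F.comul W (X', Y'))
    (r' : El F.mul (X, Y) W') (s' : El F.comul W' (X', Y')) :
    (glue r s : El (comp F.mul F.comul) (X, Y) (X', Y')) = glue r' s' ↔
      K.d s ≫ M.m r = K.d s' ≫ M.m r' :=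
  glue_eq_iff_mixed K.comul M.mul r s r' s'

/-- The outer multiplication is represented, so it is pushed into the inner one; then
`glue_mul_comul_iff` contracts the remaining intermediate object. -/
lemma glue_right_mul_comul_iff {X Y Z X' Y' R R' N N' : C} (p : El F.mul (Y, Z) N)
    (r : El F.mul (X, N) R) (s : El F.comul R (X', Y')) (p' : El F.mul (Y, Z) N')
    (r' : El F.mul (X, N') R') (s' : El F.comul R' (X', Y')) :
    (glue (pair (wire (𝟙 X)) p) (glue r s) :
      El (comp (tens (idP C) F.mul) (comp F.mul F.comul)) (X, (Y, Z)) (X', Y')) =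
    glue (pair (wire (𝟙 X)) p') (glue r' s') ↔
      K.d s ≫ M.m r ≫ S.pL X (M.m p) = K.d s' ≫ M.m r' ≫ S.pL X (M.m p') := by
  rw [glue_eq_iff_rep (tensIso idIso M.mul)]
  have e : ∀ {N R : C} (p : El F.mul (Y, Z) N) (r : El F.mul (X, N) R) (s : El F.comul R (X', Y')),
      act (comp F.mul F.comul) (val (tensIso idIso M.mul) (a := (X, (Y, Z))) (b := (X, N))
        (pair (wire (𝟙 X)) p)) (𝟙 (X', Y')) (glue r s) =
      glue (act F.mul (Prod.mkHom (𝟙 X) (M.m p)) (𝟙 R) r) s := by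
    intro N R p r s
    rw [act_glue, act_id]
    rfl
  refine (Iff.of_eq (congrArg₂ Eq (e p r s) (e p' r' s'))).trans ?_
  rw [glue_mul_comul_iff M K, M.m_act, M.m_act]
  have e₂ : ∀ {N R : C} (p : El F.mul (Y, Z) N) (r : El F.mul (X, N) R),
      𝟙 R ≫ M.m r ≫ S.par.tensorHom (𝟙 X) (M.m p) = M.m r ≫ S.pL X (M.m p) := by
    intro N R p r
    rw [Category.id_comp, S.pHom_def, S.pR_id, Category.id_comp]
  exact Iff.of_eq (congrArg₂ Eq (congrArg _ (e₂ p r)) (congrArg _ (e₂ p' r')))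

lemma glue_left_mul_comul_iff {X Y Z X' Y' R R' N N' : C} (p : El F.mul (X, Y) N)
    (r : El F.mul (N, Z) R) (s : El F.comul R (X', Y')) (p' : El F.mul (X, Y) N')
    (r' : El F.mul (N', Z) R') (s' : El F.comul R' (X', Y')) :
    (glue (pair p (wire (𝟙 Z))) (glue r s) :
      El (comp (tens F.mul (idP C)) (comp F.mul F.comul)) ((X, Y), Z) (X', Y')) =
    glue (pair p' (wire (𝟙 Z))) (glue r' s') ↔
      K.d s ≫ M.m r ≫ S.pR (M.m p) Z = K.d s' ≫ M.m r' ≫ S.pR (M.m p') Z := by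
  rw [glue_eq_iff_rep (tensIso M.mul idIso)]
  have e : ∀ {N R : C} (p : El F.mul (X, Y) N) (r : El F.mul (N, Z) R) (s : El F.comul R (X', Y')),
      act (comp F.mul F.comul) (val (tensIso M.mul idIso) (a := ((X, Y), Z)) (b := (N, Z))
        (pair p (wire (𝟙 Z)))) (𝟙 (X', Y')) (glue r s) =
      glue (act F.mul (Prod.mkHom (M.m p) (𝟙 Z)) (𝟙 R) r) s := by
    intro N R p r s
    rw [act_glue, act_id]
    rfl
  refine (Iff.of_eq (congrArg₂ Eq (e p r s) (e p' r' s'))).trans ?_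
  rw [glue_mul_comul_iff M K, M.m_act, M.m_act]
  have e₂ : ∀ {N R : C} (p : El F.mul (X, Y) N) (r : El F.mul (N, Z) R),
      𝟙 R ≫ M.m r ≫ S.par.tensorHom (M.m p) (𝟙 Z) = M.m r ≫ S.pR (M.m p) Z := by
    intro N R p r
    rw [Category.id_comp, S.pHom_def, S.pL_id, Category.comp_id]
  exact Iff.of_eq (congrArg₂ Eq (congrArg _ (e₂ p r)) (congrArg _ (e₂ p' r')))

lemma glue_mul_comul_right_iff {X Y X₁ X₂ Y' R R' N N' : C} (r : El F.mul (X, Y) R)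
    (s : El F.comul R (X₁, N)) (q : El F.comul N (X₂, Y')) (r' : El F.mul (X, Y) R')
    (s' : El F.comul R' (X₁, N')) (q' : El F.comul N' (X₂, Y')) :
    (glue r (glue s (pair (wire (𝟙 X₁)) q)) :
      El (comp F.mul (comp F.comul (tens (idP C) F.comul))) (X, Y) (X₁, (X₂, Y'))) =
    glue r' (glue s' (pair (wire (𝟙 X₁)) q')) ↔
      S.tL X₁ (K.d q) ≫ K.d s ≫ M.m r = S.tL X₁ (K.d q') ≫ K.d s' ≫ M.m r' := by
  let θ := compIsoRev K.comul (tensIsoRev idIsoRev K.comul)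
  rw [glue_eq_iff_mixed θ M.mul]
  have e : ∀ {N R : C} (s : El F.comul R (X₁, N)) (q : El F.comul N (X₂, Y')),
      coval θ (b := (X₁, (X₂, Y'))) (glue (b := (X₁, N)) s (pair (wire (𝟙 X₁)) q)) =
        S.tL X₁ (K.d q) ≫ K.d s := by
    intro N R s q
    refine (coval_compIsoRev_glue _ _ _ _).trans ?_
    have : S.tensor.tensorHom (𝟙 X₁) (K.d q) = S.tL X₁ (K.d q) := by
      rw [S.tHom_def, S.tR_id, Category.id_comp]
    exact congrArg (· ≫ K.d s) this
  refine (Iff.of_eq (congrArg₂ Eq (congrArg (· ≫ M.m r) (e s q))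
    (congrArg (· ≫ M.m r') (e s' q')))).trans ?_
  simp only [Category.assoc]

lemma glue_mul_comul_left_iff {X Y X' Y₁ Y₂ R R' N N' : C} (r : El F.mul (X, Y) R)
    (s : El F.comul R (N, Y₂)) (q : El F.comul N (X', Y₁)) (r' : El F.mul (X, Y) R')
    (s' : El F.comul R' (N', Y₂)) (q' : El F.comul N' (X', Y₁)) :
    (glue r (glue s (pair q (wire (𝟙 Y₂)))) :
      El (comp F.mul (comp F.comul (tens F.comul (idP C)))) (X, Y) ((X', Y₁), Y₂)) =
    glue r' (glue s' (pair q' (wire (𝟙 Y₂)))) ↔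
      S.tR (K.d q) Y₂ ≫ K.d s ≫ M.m r = S.tR (K.d q') Y₂ ≫ K.d s' ≫ M.m r' := by
  let θ := compIsoRev K.comul (tensIsoRev K.comul idIsoRev)
  rw [glue_eq_iff_mixed θ M.mul]
  have e : ∀ {N R : C} (s : El F.comul R (N, Y₂)) (q : El F.comul N (X', Y₁)),
      coval θ (b := ((X', Y₁), Y₂)) (glue (b := (N, Y₂)) s (pair q (wire (𝟙 Y₂)))) =
        S.tR (K.d q) Y₂ ≫ K.d s := by
    intro N R s q
    refine (coval_compIsoRev_glue _ _ _ _).trans ?_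
    have : S.tensor.tensorHom (K.d q) (𝟙 Y₂) = S.tR (K.d q) Y₂ := by
      rw [S.tHom_def, S.tL_id, Category.comp_id]
    exact congrArg (· ≫ K.d s) this
  refine (Iff.of_eq (congrArg₂ Eq (congrArg (· ≫ M.m r) (e s q))
    (congrArg (· ≫ M.m r') (e s' q')))).trans ?_
  simp only [Category.assoc]

end Mixed

section Strength

variable {C : Type u} [SmallCategory C] (F : FrobeniusData C) {T : MonoidalCategory C}
  (D : MonDictData F.toPseudomonoidData T)

/-- The right strength is natural in the added object. -/
lemma FrobeniusData.strR_natural_left {X X' Y Y' V : C} (c : El F.comul Y (V, Y')) (f : X ⟶ X') :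
    act F.comul (f ▷ Y) (𝟙 (X ⊗ V, Y')) (F.strR D X c) =
      act F.comul (𝟙 (X' ⊗ Y)) (Prod.mkHom (f ▷ V) (𝟙 Y')) (F.strR D X' c) := by
  have e : D.m (act F.mul (Prod.mkHom f (𝟙 V)) (𝟙 (X ⊗ V)) (D.mElt (𝟙 (X ⊗ V)))) = f ▷ V := by
    rw [D.m_act]; simp
  rw [← e, ← F.compRep_frobR D]
  have h₁ := compRep_act D.mul (Prod.mkHom f (𝟙 Y)) (𝟙 (X ⊗ V, Y'))
    (app₂ F.frobR.hom (a := (X, Y)) (b := (X ⊗ V, Y'))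
    (F.frobRMk c (𝟙 X) (𝟙 Y') (D.mElt (𝟙 (X ⊗ V)))))
  have h₂ : act F.comul (f ⊗ₘ 𝟙 Y) (𝟙 (X ⊗ V, Y')) (F.strR D X c) = _ := h₁.symm
  rw [tensorHom_id] at h₂
  rw [h₂, ← app₂_act]
  refine congrArg (fun z => compRep D.mul (app₂ F.frobR.hom z)) ?_
  refine (act_glue _ _ _ _).trans ?_
  have e₃ : act (tens (idP C) F.comul) (Prod.mkHom f (𝟙 Y)) (𝟙 (X, (V, Y')))
      (pair (wire (𝟙 X)) c) =
      act (tens (idP C) F.comul) (𝟙 (X', Y)) (Prod.mkHom f (𝟙 (V, Y')))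
      (pair (wire (𝟙 X')) c) := by
    rw [act_pair, act_pair]
    exact congrArg₂ Prod.mk ((FrobeniusData.wire_act_left f).trans (FrobeniusData.wire_act_right f).symm) rfl
  refine (congrArg (fun z => glue (b := (X, (V, Y'))) z _) e₃).trans ?_
  refine (glue_slide (b := (X, (V, Y'))) (b' := (X', (V, Y')))
      (Prod.mkHom f (𝟙 (V, Y'))) _ _).trans ?_
  refine congrArg (glue (b := (X', (V, Y'))) _) ?_
  refine (congrArg _ (act_id _ _)).trans ?_
  refine (act_pair (P := F.mul) (Q := idP C) (Prod.mkHom (Prod.mkHom f (𝟙 V)) (𝟙 Y'))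
    (𝟙 (X ⊗ V, Y')) (D.mElt (𝟙 (X ⊗ V))) (wire (𝟙 Y'))).trans ?_
  exact congrArg₂ Prod.mk rfl (act_id _ _)

end Strength

/-! ### The dictionary between Frobenius 2-cells and linear distributors -/

section

variable {C : Type u} [SmallCategory C]

/-- Identifications of Frobenius data in profunctors with two monoidal structures and linear
distributors. -/
structure FrobDict (F : FrobeniusData C) (S : TwoMonoidal C)
    (δL : ∀ A B D : C, S.t A (S.p B D) ⟶ S.p (S.t A B) D)
    (δR : ∀ A B D : C, S.t (S.p A B) D ⟶ S.p A (S.t B D)) where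
  par : MonDict F.toPseudomonoidData S.par
  tensor : ComonDict F.toPseudocomonoidData S.tensor
  frobL_iff : ∀ {X Y X' Y' V Q : C} {c : El F.comul X (X', V)} {a : El F.mul (V, Y) Y'}
    {r : El F.mul (X, Y) Q} {s : El F.comul Q (X', Y')}, F.FrobL c a r s ↔
    S.tL X' (par.m a) ≫ δL X' V Y ≫ S.pR (tensor.d c) Y = tensor.d s ≫ par.m r
  frobR_iff : ∀ {X Y X' Y' V Q : C} {c : El F.comul Y (V, Y')} {a : El F.mul (X, V) X'}
    {r : El F.mul (X, Y) Q} {s : El F.comul Q (X', Y')}, F.FrobR c a r s ↔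
    S.tR (par.m a) Y' ≫ δR X V Y' ≫ S.pL X (tensor.d c) = tensor.d s ≫ par.m r

namespace FrobDict

variable {F : FrobeniusData C} {S : TwoMonoidal C}
    {δL : ∀ A B D : C, S.t A (S.p B D) ⟶ S.p (S.t A B) D}
    {δR : ∀ A B D : C, S.t (S.p A B) D ⟶ S.p A (S.t B D)} (E : FrobDict F S δL δR)

/-- The morphism of an element of the multiplication. -/
def m {X Y Z : C} (a : El F.mul (X, Y) Z) : Z ⟶ S.p X Y := E.par.m a
/-- The morphism of an element of the unit. -/
def u {Z : C} (x : El F.one pt Z) : Z ⟶ S.bot := E.par.u x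
/-- The morphism of an element of the comultiplication. -/
def d {X Y Z : C} (c : El F.comul Z (X, Y)) : S.t X Y ⟶ Z := E.tensor.d c
/-- The morphism of an element of the counit. -/
def e {Z : C} (t : El F.counit Z pt) : S.tI ⟶ Z := E.tensor.e t
/-- The element of the multiplication with a given morphism. -/
def mElt {X Y Z : C} (f : Z ⟶ S.p X Y) : El F.mul (X, Y) Z := E.par.mElt f
/-- The element of the unit with a given morphism. -/
def uElt {Z : C} (f : Z ⟶ S.bot) : El F.one pt Z := E.par.uElt f
/-- The element of the comultiplication with a given morphism. -/
def dElt {X Y Z : C} (f : S.t X Y ⟶ Z) : El F.comul Z (X, Y) := E.tensor.dElt f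
/-- The element of the counit with a given morphism. -/
def eElt {Z : C} (f : S.tI ⟶ Z) : El F.counit Z pt := E.tensor.eElt f

@[simp] lemma m_mElt {X Y Z : C} (f : Z ⟶ S.p X Y) : E.m (E.mElt f) = f := E.par.m_mElt f
@[simp] lemma u_uElt {Z : C} (f : Z ⟶ S.bot) : E.u (E.uElt f) = f := E.par.u_uElt f
@[simp] lemma d_dElt {X Y Z : C} (f : S.t X Y ⟶ Z) : E.d (E.dElt f) = f := E.tensor.d_dElt f
@[simp] lemma e_eElt {Z : C} (f : S.tI ⟶ Z) : E.e (E.eElt f) = f := E.tensor.e_eElt f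

lemma m_injective {X Y Z : C} {a b : El F.mul (X, Y) Z} (h : E.m a = E.m b) : a = b :=
  E.par.m_injective h
lemma d_injective {X Y Z : C} {a b : El F.comul Z (X, Y)} (h : E.d a = E.d b) : a = b :=
  E.tensor.d_injective h

lemma m_act_left {X Y X' Z Z' : C} (f : X ⟶ X') (g : Z' ⟶ Z) (a : El F.mul (X, Y) Z) :
    E.m (act F.mul (Prod.mkHom f (𝟙 Y)) g a) = g ≫ E.m a ≫ S.pR f Y :=
  (E.par.m_act _ _ _).trans (congrArg (fun z => g ≫ E.m a ≫ z)
    (@MonoidalCategory.tensorHom_id C _ S.par _ _ f Y))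
lemma m_act_right {X Y Y' Z Z' : C} (f : Y ⟶ Y') (g : Z' ⟶ Z) (a : El F.mul (X, Y) Z) :
    E.m (act F.mul (Prod.mkHom (𝟙 X) f) g a) = g ≫ E.m a ≫ S.pL X f :=
  (E.par.m_act _ _ _).trans (congrArg (fun z => g ≫ E.m a ≫ z)
    (@MonoidalCategory.id_tensorHom C _ S.par X _ _ f))
lemma m_act_id {X Y Z Z' : C} (g : Z' ⟶ Z) (a : El F.mul (X, Y) Z) :
    E.m (act F.mul (𝟙 (X, Y)) g a) = g ≫ E.m a :=
  (E.m_act_left (𝟙 X) g a).trans (by rw [S.pR_id, Category.comp_id])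
lemma d_act_left {X Y X' Z Z' : C} (g : Z ⟶ Z') (f : X' ⟶ X) (a : El F.comul Z (X, Y)) :
    E.d (act F.comul g (Prod.mkHom f (𝟙 Y)) a) = S.tR f Y ≫ E.d a ≫ g :=
  (E.tensor.d_act _ _ _).trans (congrArg (fun z => z ≫ E.d a ≫ g)
    (@MonoidalCategory.tensorHom_id C _ S.tensor _ _ f Y))
lemma d_act_right {X Y Y' Z Z' : C} (g : Z ⟶ Z') (f : Y' ⟶ Y) (a : El F.comul Z (X, Y)) :
    E.d (act F.comul g (Prod.mkHom (𝟙 X) f) a) = S.tL X f ≫ E.d a ≫ g :=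
  (E.tensor.d_act _ _ _).trans (congrArg (fun z => z ≫ E.d a ≫ g)
    (@MonoidalCategory.id_tensorHom C _ S.tensor X _ _ f))
lemma d_act_id {X Y Z Z' : C} (g : Z ⟶ Z') (a : El F.comul Z (X, Y)) :
    E.d (act F.comul g (𝟙 (X, Y)) a) = E.d a ≫ g :=
  (E.d_act_left g (𝟙 X) a).trans (by rw [S.tR_id, Category.id_comp])
lemma u_act {Z Z' : C} (g : Z' ⟶ Z) (x : El F.one pt Z) :
    E.u (act F.one (𝟙 pt) g x) = g ≫ E.u x := E.par.u_act g x
lemma e_act {Z Z' : C} (f : Z ⟶ Z') (x : El F.counit Z pt) :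
    E.e (act F.counit f (𝟙 pt) x) = E.e x ≫ f := E.tensor.e_act f x

lemma assoc_iff {X Y Z V U W : C} {a : El F.mul (X, Y) V} {b : El F.mul (V, Z) W}
    {p : El F.mul (Y, Z) U} {q : El F.mul (X, U) W} : F.Assoc a b p q ↔
    E.m b ≫ S.pR (E.m a) Z ≫ (S.pa X Y Z).hom = E.m q ≫ S.pL X (E.m p) := E.par.assoc_iff
lemma coassoc_iff {X Y Z V U W : C} {a : El F.comul W (V, Z)} {b : El F.comul V (X, Y)}
    {p : El F.comul W (X, U)} {q : El F.comul U (Y, Z)} : F.Coassoc a b p q ↔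
    S.tR (E.d b) Z ≫ E.d a = (S.ta X Y Z).hom ≫ S.tL X (E.d q) ≫ E.d p := E.tensor.coassoc_iff
lemma lam {X W P : C} (p : El F.one pt P) (a : El F.mul (P, X) W) :
    F.lam p a = E.m a ≫ S.pR (E.u p) X ≫ (S.plam X).hom := E.par.lam p a
lemma rho {X W P : C} (p : El F.one pt P) (a : El F.mul (X, P) W) :
    F.rho p a = E.m a ≫ S.pL X (E.u p) ≫ (S.prho X).hom := E.par.rho p a
lemma colam {X W P : C} (a : El F.comul W (P, X)) (t : El F.counit P pt) :
    F.colam a t = (S.tlam X).inv ≫ S.tR (E.e t) X ≫ E.d a := E.tensor.colam a t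
lemma corho {X W P : C} (a : El F.comul W (X, P)) (t : El F.counit P pt) :
    F.corho a t = (S.trho X).inv ≫ S.tL X (E.e t) ≫ E.d a := E.tensor.corho a t

lemma frobL {X Y X' Y' V Q : C} {c : El F.comul X (X', V)} {a : El F.mul (V, Y) Y'}
    {r : El F.mul (X, Y) Q} {s : El F.comul Q (X', Y')} : F.FrobL c a r s ↔
    S.tL X' (E.m a) ≫ δL X' V Y ≫ S.pR (E.d c) Y = E.d s ≫ E.m r := E.frobL_iff
lemma frobR {X Y X' Y' V Q : C} {c : El F.comul Y (V, Y')} {a : El F.mul (X, V) X'}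
    {r : El F.mul (X, Y) Q} {s : El F.comul Q (X', Y')} : F.FrobR c a r s ↔
    S.tR (E.m a) Y' ≫ δR X V Y' ≫ S.pL X (E.d c) = E.d s ≫ E.m r := E.frobR_iff

lemma glue_right_mul_comul {X Y Z X' Y' R R' N N' : C} (p : El F.mul (Y, Z) N)
    (r : El F.mul (X, N) R) (s : El F.comul R (X', Y')) (p' : El F.mul (Y, Z) N')
    (r' : El F.mul (X, N') R') (s' : El F.comul R' (X', Y')) :
    (glue (pair (wire (𝟙 X)) p) (glue r s) :
      El (comp (tens (idP C) F.mul) (comp F.mul F.comul)) (X, (Y, Z)) (X', Y')) =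
    glue (pair (wire (𝟙 X)) p') (glue r' s') ↔
      E.d s ≫ E.m r ≫ S.pL X (E.m p) = E.d s' ≫ E.m r' ≫ S.pL X (E.m p') :=
  glue_right_mul_comul_iff E.par.toMonDictData E.tensor.toComonDictData p r s p' r' s'

lemma glue_left_mul_comul {X Y Z X' Y' R R' N N' : C} (p : El F.mul (X, Y) N)
    (r : El F.mul (N, Z) R) (s : El F.comul R (X', Y')) (p' : El F.mul (X, Y) N')
    (r' : El F.mul (N', Z) R') (s' : El F.comul R' (X', Y')) :
    (glue (pair p (wire (𝟙 Z))) (glue r s) :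
      El (comp (tens F.mul (idP C)) (comp F.mul F.comul)) ((X, Y), Z) (X', Y')) =
    glue (pair p' (wire (𝟙 Z))) (glue r' s') ↔
      E.d s ≫ E.m r ≫ S.pR (E.m p) Z = E.d s' ≫ E.m r' ≫ S.pR (E.m p') Z :=
  glue_left_mul_comul_iff E.par.toMonDictData E.tensor.toComonDictData p r s p' r' s'

lemma glue_mul_comul_right {X Y X₁ X₂ Y' R R' N N' : C} (r : El F.mul (X, Y) R)
    (s : El F.comul R (X₁, N)) (q : El F.comul N (X₂, Y')) (r' : El F.mul (X, Y) R')
    (s' : El F.comul R' (X₁, N')) (q' : El F.comul N' (X₂, Y')) :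
    (glue r (glue s (pair (wire (𝟙 X₁)) q)) :
      El (comp F.mul (comp F.comul (tens (idP C) F.comul))) (X, Y) (X₁, (X₂, Y'))) =
    glue r' (glue s' (pair (wire (𝟙 X₁)) q')) ↔
      S.tL X₁ (E.d q) ≫ E.d s ≫ E.m r = S.tL X₁ (E.d q') ≫ E.d s' ≫ E.m r' :=
  glue_mul_comul_right_iff E.par.toMonDictData E.tensor.toComonDictData r s q r' s' q'

lemma glue_mul_comul_left {X Y X' Y₁ Y₂ R R' N N' : C} (r : El F.mul (X, Y) R)
    (s : El F.comul R (N, Y₂)) (q : El F.comul N (X', Y₁)) (r' : El F.mul (X, Y) R')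
    (s' : El F.comul R' (N', Y₂)) (q' : El F.comul N' (X', Y₁)) :
    (glue r (glue s (pair q (wire (𝟙 Y₂)))) :
      El (comp F.mul (comp F.comul (tens F.comul (idP C)))) (X, Y) ((X', Y₁), Y₂)) =
    glue r' (glue s' (pair q' (wire (𝟙 Y₂)))) ↔
      S.tR (E.d q) Y₂ ≫ E.d s ≫ E.m r = S.tR (E.d q') Y₂ ≫ E.d s' ≫ E.m r' :=
  glue_mul_comul_left_iff E.par.toMonDictData E.tensor.toComonDictData r s q r' s' q'

end FrobDict

/-! ### Linear distributors as strengths of universal elements -/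

section Build

variable (F : FrobeniusData C) {S : TwoMonoidal C} (M : MonDict F.toPseudomonoidData S.par)
  (K : ComonDict F.toPseudocomonoidData S.tensor)

/-- Every `c` is the transport along `K.d c` of the universal element of `d(X' ⊗ V; X', V)`, so the
strength is known once it is known there; that universal value is the linear distributor. -/
lemma d_strL {X X' V : C} (c : El F.comul X (X', V)) (Y : C) :
    K.d (F.strL M.toMonDictData Y c) =
      K.d (F.strL M.toMonDictData Y (K.dElt (𝟙 (S.t X' V)))) ≫ S.pR (K.d c) Y := by
  have e : c = act F.comul (K.d c) (Prod.mkHom (𝟙 X') (𝟙 V)) (K.dElt (𝟙 (S.t X' V))) := by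
    apply K.d_injective
    rw [K.d_act, K.d_dElt]
    have : S.tensor.tensorHom (𝟙 X') (𝟙 V) = 𝟙 (S.t X' V) := by
      rw [S.tHom_def, S.tR_id, S.tL_id, Category.id_comp]
    refine Eq.symm ((congrArg (· ≫ 𝟙 _ ≫ K.d c) this).trans ?_)
    simp
  have e₁ := F.strL_act M.toMonDictData (K.d c) (𝟙 X') (𝟙 V) (K.dElt (𝟙 (S.t X' V))) Y
  have e₂ := congrArg K.d ((congrArg (F.strL M.toMonDictData Y) e).trans e₁)
  rw [K.d_act] at e₂
  refine e₂.trans ?_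
  have e₃ : ∀ (A B : C), S.tensor.tensorHom (𝟙 A) (S.pR (𝟙 B) Y) = 𝟙 (S.t A (S.p B Y)) := by
    intro A B
    rw [S.tHom_def, S.pR_id, S.tR_id, S.tL_id, Category.id_comp]
  exact (congrArg (· ≫ _) (e₃ X' V)).trans (Category.id_comp _)

lemma d_strR {Y Y' V : C} (c : El F.comul Y (V, Y')) (X : C) :
    K.d (F.strR M.toMonDictData X c) =
      K.d (F.strR M.toMonDictData X (K.dElt (𝟙 (S.t V Y')))) ≫ S.pL X (K.d c) := by
  have e : c = act F.comul (K.d c) (Prod.mkHom (𝟙 V) (𝟙 Y')) (K.dElt (𝟙 (S.t V Y'))) := by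
    apply K.d_injective
    rw [K.d_act, K.d_dElt]
    have : S.tensor.tensorHom (𝟙 V) (𝟙 Y') = 𝟙 (S.t V Y') := by
      rw [S.tHom_def, S.tR_id, S.tL_id, Category.id_comp]
    refine Eq.symm ((congrArg (· ≫ 𝟙 _ ≫ K.d c) this).trans ?_)
    simp
  have e₁ := F.strR_act M.toMonDictData (K.d c) (𝟙 V) (𝟙 Y') (K.dElt (𝟙 (S.t V Y'))) X
  have e₂ := congrArg K.d ((congrArg (F.strR M.toMonDictData X) e).trans e₁)
  rw [K.d_act] at e₂
  refine e₂.trans ?_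
  have e₃ : ∀ (A B : C), S.tensor.tensorHom (S.pL X (𝟙 A)) (𝟙 B) = 𝟙 (S.t (S.p X A) B) := by
    intro A B
    rw [S.tHom_def, S.pL_id, S.tR_id, S.tL_id, Category.id_comp]
  exact (congrArg (· ≫ _) (e₃ V Y')).trans (Category.id_comp _)

/-- The identifications of Frobenius data, with linear distributors given by the strengths. -/
noncomputable def frobDictOfDicts : FrobDict F S
    (fun A B D => K.d (F.strL M.toMonDictData D (K.dElt (𝟙 (S.t A B)))))
    (fun A B D => K.d (F.strR M.toMonDictData A (K.dElt (𝟙 (S.t B D))))) where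
  par := M
  tensor := K
  frobL_iff {X Y X' Y' V Q c a r s} := by
    rw [F.frobL_iff M.toMonDictData]
    have h₁ := K.d_act (𝟙 (S.p X Y)) (Prod.mkHom (𝟙 X') (M.m a)) (F.strL M.toMonDictData Y c)
    have h₂ := K.d_act (M.m r) (𝟙 (X', Y')) s
    have h₃ : S.tensor.tensorHom (𝟙 X') (M.m a) = S.tL X' (M.m a) := by
      rw [S.tHom_def, S.tR_id, Category.id_comp]
    have h₄ : S.tensor.tensorHom (𝟙 X') (𝟙 Y') = 𝟙 (S.t X' Y') := by
      rw [S.tHom_def, S.tR_id, S.tL_id, Category.id_comp]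
    have h₅ : K.d (act F.comul (𝟙 (S.p X Y)) (Prod.mkHom (𝟙 X') (M.m a))
        (F.strL M.toMonDictData Y c)) = S.tL X' (M.m a) ≫ K.d (F.strL M.toMonDictData Y c) :=
      h₁.trans (congrArg₂ (· ≫ ·) h₃ (Category.comp_id _))
    have h₆ : K.d (act F.comul (M.m r) (𝟙 (X', Y')) s) = K.d s ≫ M.m r :=
      h₂.trans ((congrArg (· ≫ K.d s ≫ M.m r) h₄).trans (Category.id_comp _))
    rw [← d_strL, ← h₅, ← h₆]
    exact ⟨congrArg K.d, fun h => K.d_injective h⟩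
  frobR_iff {X Y X' Y' V Q c a r s} := by
    rw [F.frobR_iff M.toMonDictData]
    have h₁ := K.d_act (𝟙 (S.p X Y)) (Prod.mkHom (M.m a) (𝟙 Y')) (F.strR M.toMonDictData X c)
    have h₂ := K.d_act (M.m r) (𝟙 (X', Y')) s
    have h₃ : S.tensor.tensorHom (M.m a) (𝟙 Y') = S.tR (M.m a) Y' := by
      rw [S.tHom_def, S.tL_id, Category.comp_id]
    have h₄ : S.tensor.tensorHom (𝟙 X') (𝟙 Y') = 𝟙 (S.t X' Y') := by
      rw [S.tHom_def, S.tR_id, S.tL_id, Category.id_comp]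
    have h₅ : K.d (act F.comul (𝟙 (S.p X Y)) (Prod.mkHom (M.m a) (𝟙 Y'))
        (F.strR M.toMonDictData X c)) = S.tR (M.m a) Y' ≫ K.d (F.strR M.toMonDictData X c) :=
      h₁.trans (congrArg₂ (· ≫ ·) h₃ (Category.comp_id _))
    have h₆ : K.d (act F.comul (M.m r) (𝟙 (X', Y')) s) = K.d s ≫ M.m r :=
      h₂.trans ((congrArg (· ≫ K.d s ≫ M.m r) h₄).trans (Category.id_comp _))
    rw [← d_strR, ← h₅, ← h₆]
    exact ⟨congrArg K.d, fun h => K.d_injective h⟩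

/-- Naturality in the two tensor factors is that of the strength in its argument, naturality in the
third variable is that of the strength in the added object; the two are combined through the
interchange law. -/
lemma strL_distributor_natural {A A' B B' E E' : C} (f : A ⟶ A') (g : B ⟶ B') (h : E ⟶ E') :
    S.tensor.tensorHom f (S.par.tensorHom g h) ≫
        K.d (F.strL M.toMonDictData E' (K.dElt (𝟙 (S.t A' B')))) =
      K.d (F.strL M.toMonDictData E (K.dElt (𝟙 (S.t A B)))) ≫
        S.par.tensorHom (S.tensor.tensorHom f g) h := by
  -- Restricting the universal element at `(A', B')` along `f` and `g` is the same as transporting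
  -- the one at `(A, B)` along `f ⊗ g`.
  have e : act F.comul (𝟙 (S.t A' B')) (Prod.mkHom f g) (K.dElt (𝟙 (S.t A' B'))) =
      act F.comul (S.tensor.tensorHom f g) (Prod.mkHom (𝟙 A) (𝟙 B)) (K.dElt (𝟙 (S.t A B))) := by
    apply K.d_injective
    rw [K.d_act, K.d_act, K.d_dElt, K.d_dElt]
    have : S.tensor.tensorHom (𝟙 A) (𝟙 B) = 𝟙 (S.t A B) := by
      rw [S.tHom_def, S.tR_id, S.tL_id, Category.id_comp]
    refine Eq.trans ?_ (congrArg (· ≫ 𝟙 _ ≫ S.tensor.tensorHom f g) this).symm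
    simp
  have e₁ := congrArg (F.strL M.toMonDictData E) e
  rw [F.strL_act, F.strL_act] at e₁
  have e₂ := congrArg (act F.comul (S.pL (S.t A' B') h) (𝟙 (A, S.p B E))) e₁
  rw [act_act, act_act] at e₂
  have e₃ := congrArg (act F.comul (𝟙 (S.p (S.t A' B') E')) (Prod.mkHom f (S.pR g E)))
    (F.strL_natural M.toMonDictData (K.dElt (𝟙 (S.t A' B'))) h)
  rw [act_act, act_act] at e₃
  have e₄ : act F.comul (S.pL (S.t A' B') h) (Prod.mkHom f (S.pR g E))
      (F.strL M.toMonDictData E (K.dElt (𝟙 (S.t A' B')))) =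
      act F.comul (𝟙 (S.p (S.t A' B') E')) (Prod.mkHom f (S.pR g E ≫ S.pL B' h))
      (F.strL M.toMonDictData E' (K.dElt (𝟙 (S.t A' B')))) := by
    refine Eq.trans ?_ (e₃.trans ?_)
    · congr 1
      · exact (Category.comp_id _).symm
      · exact (Category.comp_id _).symm
    · congr 1
      · exact Category.comp_id _
      · exact Prod.ext (Category.comp_id _) rfl
  have e₅ : act F.comul (S.pL (S.t A' B') h) (Prod.mkHom f (S.pR g E))
      (F.strL M.toMonDictData E (K.dElt (𝟙 (S.t A' B')))) =
      act F.comul (S.pR (S.tensor.tensorHom f g) E ≫ S.pL (S.t A' B') h) (𝟙 (A, S.p B E))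
      (F.strL M.toMonDictData E (K.dElt (𝟙 (S.t A B)))) := by
    refine Eq.trans ?_ (e₂.trans ?_)
    · congr 1
      · exact ((congrArg (· ≫ S.pL (S.t A' B') h) (S.pR_id _ _)).trans (Category.id_comp _)).symm
      · exact (Category.id_comp _).symm
    · congr 1
      exact (Category.id_comp _).trans (Prod.ext rfl (S.pR_id _ _))
  have e₆ := congrArg K.d (e₄.symm.trans e₅)
  rw [K.d_act, K.d_act] at e₆
  have : S.tensor.tensorHom (𝟙 A) (𝟙 (S.p B E)) = 𝟙 _ := by
    rw [S.tHom_def, S.tR_id, S.tL_id, Category.id_comp]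
  have e₇ := e₆.trans ((congrArg (· ≫ _) this).trans (Category.id_comp _))
  rw [Category.comp_id] at e₇
  rw [S.pHom_def, S.pHom_def]
  exact e₇

lemma strR_distributor_natural {A A' B B' E E' : C} (f : A ⟶ A') (g : B ⟶ B') (h : E ⟶ E') :
    S.tensor.tensorHom (S.par.tensorHom f g) h ≫
        K.d (F.strR M.toMonDictData A' (K.dElt (𝟙 (S.t B' E')))) =
      K.d (F.strR M.toMonDictData A (K.dElt (𝟙 (S.t B E)))) ≫
        S.par.tensorHom f (S.tensor.tensorHom g h) := by
  have e : act F.comul (𝟙 (S.t B' E')) (Prod.mkHom g h) (K.dElt (𝟙 (S.t B' E'))) =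
      act F.comul (S.tensor.tensorHom g h) (Prod.mkHom (𝟙 B) (𝟙 E)) (K.dElt (𝟙 (S.t B E))) := by
    apply K.d_injective
    rw [K.d_act, K.d_act, K.d_dElt, K.d_dElt]
    have : S.tensor.tensorHom (𝟙 B) (𝟙 E) = 𝟙 (S.t B E) := by
      rw [S.tHom_def, S.tR_id, S.tL_id, Category.id_comp]
    refine Eq.trans ?_ (congrArg (· ≫ 𝟙 _ ≫ S.tensor.tensorHom g h) this).symm
    simp
  have e₁ := congrArg (F.strR M.toMonDictData A) e
  rw [F.strR_act, F.strR_act] at e₁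
  have e₂ := congrArg (act F.comul (S.pR f (S.t B' E')) (𝟙 (S.p A B, E))) e₁
  rw [act_act, act_act] at e₂
  have e₃ := congrArg (act F.comul (𝟙 (S.p A' (S.t B' E'))) (Prod.mkHom (S.pL A g) h))
    (F.strR_natural_left M.toMonDictData (K.dElt (𝟙 (S.t B' E'))) f)
  rw [act_act, act_act] at e₃
  have e₄ : act F.comul (S.pR f (S.t B' E')) (Prod.mkHom (S.pL A g) h)
      (F.strR M.toMonDictData A (K.dElt (𝟙 (S.t B' E')))) =
      act F.comul (𝟙 (S.p A' (S.t B' E'))) (Prod.mkHom (S.pL A g ≫ S.pR f B') h)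
      (F.strR M.toMonDictData A' (K.dElt (𝟙 (S.t B' E')))) := by
    refine Eq.trans ?_ (e₃.trans ?_)
    · congr 1
      · exact (Category.comp_id _).symm
      · exact (Category.comp_id _).symm
    · congr 1
      · exact Category.comp_id _
      · exact Prod.ext rfl (Category.comp_id _)
  have e₅ : act F.comul (S.pR f (S.t B' E')) (Prod.mkHom (S.pL A g) h)
      (F.strR M.toMonDictData A (K.dElt (𝟙 (S.t B' E')))) =
      act F.comul (S.pL A (S.tensor.tensorHom g h) ≫ S.pR f (S.t B' E')) (𝟙 (S.p A B, E))
      (F.strR M.toMonDictData A (K.dElt (𝟙 (S.t B E)))) := by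
    refine Eq.trans ?_ (e₂.trans ?_)
    · congr 1
      · exact ((congrArg (· ≫ S.pR f (S.t B' E')) (S.pL_id _ _)).trans (Category.id_comp _)).symm
      · exact (Category.id_comp _).symm
    · congr 1
      exact (Category.id_comp _).trans (Prod.ext (S.pL_id _ _) rfl)
  have e₆ := congrArg K.d (e₄.symm.trans e₅)
  rw [K.d_act, K.d_act] at e₆
  have : S.tensor.tensorHom (𝟙 (S.p A B)) (𝟙 E) = 𝟙 _ := by
    rw [S.tHom_def, S.tR_id, S.tL_id, Category.id_comp]
  have e₇ := e₆.trans ((congrArg (· ≫ _) this).trans (Category.id_comp _))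
  rw [Category.comp_id, S.p_exchange, S.p_exchange] at e₇
  rw [S.pHom_def, S.pHom_def]
  exact e₇

end Build

end

/-! ### The linearly distributive category of a Frobenius pseudomonoid -/

section

variable {C : Type u} [SmallCategory C] {F : FrobeniusPseudomonoid C} {S : TwoMonoidal C}
    {δL : ∀ A B D : C, S.t A (S.p B D) ⟶ S.p (S.t A B) D}
    {δR : ∀ A B D : C, S.t (S.p A B) D ⟶ S.p A (S.t B D)}

/-- The linearly distributive category of a Frobenius pseudomonoid in profunctors whose 1-cells are
identified with those of two monoidal structures. -/
def FrobDict.toLinearlyDistributive (E : FrobDict F.toFrobeniusData S δL δR)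
    (hL : ∀ {A A' B B' D D' : C} (f : A ⟶ A') (g : B ⟶ B') (h : D ⟶ D'),
      S.tensor.tensorHom f (S.par.tensorHom g h) ≫ δL A' B' D' =
      δL A B D ≫ S.par.tensorHom (S.tensor.tensorHom f g) h)
    (hR : ∀ {A A' B B' D D' : C} (f : A ⟶ A') (g : B ⟶ B') (h : D ⟶ D'),
      S.tensor.tensorHom (S.par.tensorHom f g) h ≫ δR A' B' D' =
      δR A B D ≫ S.par.tensorHom f (S.tensor.tensorHom g h)) : LinearlyDistributive C where
  toTwoMonoidal := S
  δL := δL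
  δR := δR
  δL_natural := hL
  δR_natural := hR
  δL_tensor_unit A B := by
    -- Here and in the other fields, the corresponding Frobenius equation is instantiated at
    -- universal elements, with the remaining elements determined by the distributors and structural
    -- isomorphisms so that the hypotheses hold by `E.frobL`, `E.frobR`, `E.assoc_iff` and
    -- `E.coassoc_iff`.
    have h := congrArg E.m (F.L_counit (t := E.eElt (𝟙 _)) (c := E.dElt (𝟙 (S.t S.tI A)))
      (a := E.mElt (𝟙 (S.p A B))) (r := E.mElt (𝟙 _)) (s := E.dElt (δL S.tI A B))
      (E.frobL.2 (by simp [S.tL_id, S.pR_id])))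
    rw [E.colam, E.colam] at h
    have h' := (E.m_act_left _ _ _).symm.trans (h.trans (E.m_act_id _ _))
    simp only [E.m_mElt, E.d_dElt, E.e_eElt, S.tR_id, Category.id_comp, Category.comp_id] at h'
    rw [Iso.eq_inv_comp] at h'
    rw [← h', Category.assoc, ← S.pR_comp, Iso.inv_hom_id, S.pR_id, Category.comp_id]
  δR_tensor_unit A B := by
    have h := congrArg E.m (F.R_counit (t := E.eElt (𝟙 _)) (c := E.dElt (𝟙 (S.t B S.tI)))
      (a := E.mElt (𝟙 (S.p A B))) (r := E.mElt (𝟙 _)) (s := E.dElt (δR A B S.tI))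
      (E.frobR.2 (by simp [S.tR_id, S.pL_id])))
    rw [E.corho, E.corho] at h
    have h' := (E.m_act_right _ _ _).symm.trans (h.trans (E.m_act_id _ _))
    simp only [E.m_mElt, E.d_dElt, E.e_eElt, S.tL_id, Category.id_comp, Category.comp_id] at h'
    rw [Iso.eq_inv_comp] at h'
    rw [← h', Category.assoc, ← S.pL_comp, Iso.inv_hom_id, S.pL_id, Category.comp_id]
  δL_par_unit A B := by
    have h := congrArg E.d (F.L_unit (p := E.uElt (𝟙 _)) (c := E.dElt (𝟙 (S.t A B)))
      (a := E.mElt (𝟙 (S.p B S.bot))) (r := E.mElt (𝟙 _)) (s := E.dElt (δL A B S.bot))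
      (E.frobL.2 (by simp [S.tL_id, S.pR_id])))
    rw [E.rho, E.rho] at h
    have h' := (E.d_act_right _ _ _).symm.trans (h.trans (E.d_act_id _ _))
    simp only [E.m_mElt, E.d_dElt, E.u_uElt, S.pL_id, Category.id_comp, Category.comp_id] at h'
    exact h'.symm
  δR_par_unit A B := by
    have h := congrArg E.d (F.R_unit (p := E.uElt (𝟙 _)) (c := E.dElt (𝟙 (S.t A B)))
      (a := E.mElt (𝟙 (S.p S.bot A))) (r := E.mElt (𝟙 _)) (s := E.dElt (δR S.bot A B))
      (E.frobR.2 (by simp [S.tR_id, S.pL_id])))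
    rw [E.lam, E.lam] at h
    have h' := (E.d_act_left _ _ _).symm.trans (h.trans (E.d_act_id _ _))
    simp only [E.m_mElt, E.d_dElt, E.u_uElt, S.pR_id, Category.id_comp, Category.comp_id] at h'
    exact h'.symm
  δL_tensor_assoc A B D Z := by
    have h := (E.glue_mul_comul_right _ _ _ _ _ _).1 (F.L_coassoc
      (f' := E.dElt (𝟙 (S.t A B))) (f := E.dElt (𝟙 (S.t (S.t A B) D)))
      (c' := E.dElt (𝟙 (S.t B D))) (c := E.dElt (S.ta A B D).inv)
      (a := E.mElt (𝟙 (S.p D Z))) (p := E.mElt (𝟙 _)) (q := E.dElt (δL B D Z))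
      (r := E.mElt (𝟙 _)) (s := E.dElt (δL A (S.t B D) Z ≫ S.pR (S.ta A B D).inv Z))
      (r' := E.mElt (𝟙 _)) (s' := E.dElt (δL (S.t A B) D Z))
      (q' := E.dElt (𝟙 _)) (t := E.dElt ((S.ta A B (S.p D Z)).inv ≫ δL (S.t A B) D Z))
      (E.frobL.2 (by simp [S.tL_id, S.pR_id])) (E.frobL.2 (by simp [S.tL_id]))
      (E.coassoc_iff.2 (by simp [S.tL_id, S.tR_id])) (E.frobL.2 (by simp [S.tL_id, S.pR_id]))
      (E.coassoc_iff.2 (by simp [S.tL_id, S.tR_id])))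
    simp only [E.m_mElt, E.d_dElt, S.tL_id, Category.id_comp, Category.comp_id] at h
    have e : S.pR (S.ta A B D).inv Z ≫ S.pR (S.ta A B D).hom Z = 𝟙 _ := by
      rw [← S.pR_comp, Iso.inv_hom_id, S.pR_id]
    have h' := congrArg (fun z => (S.ta A B (S.p D Z)).hom ≫ z ≫ S.pR (S.ta A B D).hom Z) h
    simp only [Category.assoc, e, Category.comp_id, Iso.hom_inv_id_assoc] at h'
    exact h'
  δR_tensor_assoc A B D Z := by
    have h := (E.glue_mul_comul_left _ _ _ _ _ _).1 (F.R_coassoc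
      (a := E.mElt (𝟙 (S.p A B))) (c' := E.dElt (𝟙 (S.t B D))) (c := E.dElt (S.ta B D Z).hom)
      (f := E.dElt (𝟙 (S.t B (S.t D Z)))) (f' := E.dElt (𝟙 (S.t D Z)))
      (p := E.mElt (𝟙 _)) (q := E.dElt (δR A B D)) (r := E.mElt (𝟙 _))
      (s := E.dElt (δR A (S.t B D) Z ≫ S.pL A (S.ta B D Z).hom))
      (r' := E.mElt (𝟙 _)) (s' := E.dElt (δR A B (S.t D Z))) (q' := E.dElt (𝟙 _))
      (t := E.dElt ((S.ta (S.p A B) D Z).hom ≫ δR A B (S.t D Z)))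
      (E.frobR.2 (by simp [S.tR_id, S.pL_id])) (E.frobR.2 (by simp [S.tR_id]))
      (E.coassoc_iff.2 (by simp [S.tL_id, S.tR_id])) (E.frobR.2 (by simp [S.tR_id, S.pL_id]))
      (E.coassoc_iff.2 (by simp [S.tL_id, S.tR_id])))
    simp only [E.m_mElt, E.d_dElt, S.tR_id, Category.id_comp, Category.comp_id] at h
    exact h
  δL_par_assoc A B D Z := by
    have h := (E.glue_right_mul_comul _ _ _ _ _ _).1 (F.L_assoc
      (c := E.dElt (𝟙 (S.t A B))) (a := E.mElt (𝟙 (S.p B D))) (b := E.mElt (𝟙 (S.p (S.p B D) Z)))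
      (p := E.mElt (𝟙 _)) (q := E.dElt (δL A B D)) (r := E.mElt (𝟙 _))
      (s := E.dElt (δL A (S.p B D) Z ≫ S.pR (δL A B D) Z)) (p' := E.mElt (𝟙 (S.p D Z)))
      (r' := E.mElt (S.pa _ _ _).hom) (a' := E.mElt (𝟙 (S.p D Z))) (b' := E.mElt (S.pa B D Z).hom)
      (t := E.mElt (𝟙 _)) (s' := E.dElt (S.tL A (S.pa B D Z).hom ≫ δL A B (S.p D Z)))
      (E.frobL.2 (by simp [S.tL_id, S.pR_id])) (E.frobL.2 (by simp [S.tL_id]))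
      (E.assoc_iff.2 (by simp [S.pL_id, S.pR_id])) (E.assoc_iff.2 (by simp [S.pL_id, S.pR_id]))
      (E.frobL.2 (by simp [S.pR_id])))
    simp only [E.m_mElt, E.d_dElt, S.pL_id, Category.id_comp, Category.comp_id,
      Category.assoc] at h
    exact h
  δR_par_assoc A B D Z := by
    have h := (E.glue_left_mul_comul _ _ _ _ _ _).1 (F.R_assoc
      (c := E.dElt (𝟙 (S.t D Z))) (a := E.mElt (𝟙 (S.p B D))) (b := E.mElt (S.pa A B D).hom)
      (p := E.mElt (𝟙 _)) (q := E.dElt (δR B D Z)) (r := E.mElt (S.pa A B (S.t D Z)).hom)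
      (s := E.dElt (S.tR (S.pa A B D).hom Z ≫ δR A (S.p B D) Z ≫ S.pL A (δR B D Z) ≫
        (S.pa A B (S.t D Z)).inv))
      (p' := E.mElt (𝟙 _)) (r' := E.mElt (𝟙 _)) (a' := E.mElt (𝟙 _)) (b' := E.mElt (𝟙 _))
      (t := E.mElt (𝟙 _)) (s' := E.dElt (δR (S.p A B) D Z))
      (E.frobR.2 (by simp [S.tR_id, S.pL_id])) (E.frobR.2 (by simp))
      (E.assoc_iff.2 (by simp [S.pL_id, S.pR_id])) (E.assoc_iff.2 (by simp [S.pL_id, S.pR_id]))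
      (E.frobR.2 (by simp [S.tR_id, S.pL_id])))
    simp only [E.m_mElt, E.d_dElt, S.pR_id, Category.id_comp, Category.comp_id,
      Category.assoc] at h
    have h' := congrArg (· ≫ (S.pa A B (S.t D Z)).hom) h
    simp only [Category.assoc, Iso.inv_hom_id, Category.comp_id] at h'
    exact h'.symm
  δ_tensor_assoc A B D Z := by
    have h := (E.glue_mul_comul_right _ _ _ _ _ _).1 (F.LR_coassoc
      (c := E.dElt (𝟙 (S.t A B))) (f := E.dElt (𝟙 (S.t D Z))) (a := E.mElt (𝟙 (S.p B D)))
      (p := E.mElt (𝟙 _)) (q := E.dElt (δL A B D)) (r := E.mElt (𝟙 _))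
      (s := E.dElt (δR (S.t A B) D Z)) (q' := E.dElt (𝟙 (S.t (S.p B D) Z)))
      (s' := E.dElt ((S.ta A (S.p B D) Z).inv ≫ S.tR (δL A B D) Z ≫ δR (S.t A B) D Z))
      (p' := E.mElt (𝟙 _)) (g := E.dElt (δR B D Z)) (r' := E.mElt (𝟙 _))
      (t := E.dElt (δL A B (S.t D Z)))
      (E.frobL.2 (by simp [S.tL_id, S.pR_id])) (E.frobR.2 (by simp [S.tR_id, S.pL_id]))
      (E.coassoc_iff.2 (by simp [S.tL_id])) (E.frobR.2 (by simp [S.tR_id, S.pL_id]))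
      (E.frobL.2 (by simp [S.tL_id, S.pR_id])))
    simp only [E.m_mElt, E.d_dElt, S.tL_id, Category.id_comp, Category.comp_id] at h
    rw [← h]
    simp
  δ_par_assoc A B D Z := by
    have h := (E.glue_right_mul_comul _ _ _ _ _ _).1 (F.LR_assoc
      (c := E.dElt (𝟙 (S.t B D))) (a := E.mElt (𝟙 (S.p A B))) (b := E.mElt (𝟙 (S.p D Z)))
      (p := E.mElt (𝟙 _)) (q := E.dElt (δR A B D)) (r := E.mElt (𝟙 _))
      (s := E.dElt (δL (S.p A B) D Z ≫ S.pR (δR A B D) Z)) (p' := E.mElt (𝟙 _))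
      (r' := E.mElt (S.pa _ _ _).hom) (a' := E.mElt (𝟙 _)) (q' := E.dElt (δL B D Z))
      (t := E.mElt (𝟙 _)) (s' := E.dElt (δR A B (S.p D Z) ≫ S.pL A (δL B D Z)))
      (E.frobR.2 (by simp [S.tR_id, S.pL_id])) (E.frobL.2 (by simp [S.tL_id]))
      (E.assoc_iff.2 (by simp [S.pL_id, S.pR_id])) (E.frobL.2 (by simp [S.tL_id, S.pR_id]))
      (E.frobR.2 (by simp [S.tR_id])))
    simp only [E.m_mElt, E.d_dElt, S.pL_id, Category.id_comp, Category.comp_id,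
      Category.assoc] at h
    exact h

end

/-! ### Naturality of the distributors in each variable -/

namespace LinearlyDistributive

variable {C : Type*} [Category* C] (S : LinearlyDistributive C)

lemma δL_left {A A' : C} (f : A ⟶ A') (B D : C) :
    S.tR f (S.p B D) ≫ S.δL A' B D = S.δL A B D ≫ S.pR (S.tR f B) D := by
  have h := S.δL_natural f (𝟙 B) (𝟙 D)
  simpa only [S.tHom_def, S.pHom_def, S.tL_id, S.tR_id, S.pL_id, S.pR_id, Category.comp_id,
    Category.id_comp] using h

lemma δL_mid (A : C) {B B' : C} (f : B ⟶ B') (D : C) :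
    S.tL A (S.pR f D) ≫ S.δL A B' D = S.δL A B D ≫ S.pR (S.tL A f) D := by
  have h := S.δL_natural (𝟙 A) f (𝟙 D)
  simpa only [S.tHom_def, S.pHom_def, S.tL_id, S.tR_id, S.pL_id, S.pR_id, Category.comp_id,
    Category.id_comp] using h

lemma δL_right (A B : C) {D D' : C} (f : D ⟶ D') :
    S.tL A (S.pL B f) ≫ S.δL A B D' = S.δL A B D ≫ S.pL (S.t A B) f := by
  have h := S.δL_natural (𝟙 A) (𝟙 B) f
  simpa only [S.tHom_def, S.pHom_def, S.tL_id, S.tR_id, S.pL_id, S.pR_id, Category.comp_id,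
    Category.id_comp] using h

lemma δR_left {A A' : C} (f : A ⟶ A') (B D : C) :
    S.tR (S.pR f B) D ≫ S.δR A' B D = S.δR A B D ≫ S.pR f (S.t B D) := by
  have h := S.δR_natural f (𝟙 B) (𝟙 D)
  simpa only [S.tHom_def, S.pHom_def, S.tL_id, S.tR_id, S.pL_id, S.pR_id, Category.comp_id,
    Category.id_comp] using h

lemma δR_mid (A : C) {B B' : C} (f : B ⟶ B') (D : C) :
    S.tR (S.pL A f) D ≫ S.δR A B' D = S.δR A B D ≫ S.pL A (S.tR f D) := by
  have h := S.δR_natural (𝟙 A) f (𝟙 D)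
  simpa only [S.tHom_def, S.pHom_def, S.tL_id, S.tR_id, S.pL_id, S.pR_id, Category.comp_id,
    Category.id_comp] using h

lemma δR_right (A B : C) {D D' : C} (f : D ⟶ D') :
    S.tL (S.p A B) f ≫ S.δR A B D' = S.δR A B D ≫ S.pL A (S.tL B f) := by
  have h := S.δR_natural (𝟙 A) (𝟙 B) f
  simpa only [S.tHom_def, S.pHom_def, S.tL_id, S.tR_id, S.pL_id, S.pR_id, Category.comp_id,
    Category.id_comp] using h

lemma δL_left_assoc {A A' Z : C} (f : A ⟶ A') (B D : C) (h : S.p (S.t A' B) D ⟶ Z) :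
    S.tR f (S.p B D) ≫ S.δL A' B D ≫ h = S.δL A B D ≫ S.pR (S.tR f B) D ≫ h := by
  rw [reassoc_of% S.δL_left f B D]

lemma δL_mid_assoc (A : C) {B B' Z : C} (f : B ⟶ B') (D : C) (h : S.p (S.t A B') D ⟶ Z) :
    S.tL A (S.pR f D) ≫ S.δL A B' D ≫ h = S.δL A B D ≫ S.pR (S.tL A f) D ≫ h := by
  rw [reassoc_of% S.δL_mid A f D]

lemma δL_right_assoc (A B : C) {D D' Z : C} (f : D ⟶ D') (h : S.p (S.t A B) D' ⟶ Z) :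
    S.tL A (S.pL B f) ≫ S.δL A B D' ≫ h = S.δL A B D ≫ S.pL (S.t A B) f ≫ h := by
  rw [reassoc_of% S.δL_right A B f]

lemma δR_left_assoc {A A' Z : C} (f : A ⟶ A') (B D : C) (h : S.p A' (S.t B D) ⟶ Z) :
    S.tR (S.pR f B) D ≫ S.δR A' B D ≫ h = S.δR A B D ≫ S.pR f (S.t B D) ≫ h := by
  rw [reassoc_of% S.δR_left f B D]

lemma δR_mid_assoc (A : C) {B B' Z : C} (f : B ⟶ B') (D : C) (h : S.p A (S.t B' D) ⟶ Z) :
    S.tR (S.pL A f) D ≫ S.δR A B' D ≫ h = S.δR A B D ≫ S.pL A (S.tR f D) ≫ h := by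
  rw [reassoc_of% S.δR_mid A f D]

lemma δR_right_assoc (A B : C) {D D' Z : C} (f : D ⟶ D') (h : S.p A (S.t B D') ⟶ Z) :
    S.tL (S.p A B) f ≫ S.δR A B D' ≫ h = S.δR A B D ≫ S.pL A (S.tL B f) ≫ h := by
  rw [reassoc_of% S.δR_right A B f]

end LinearlyDistributive

/-! ### Frobenius coherence from the axioms of the distributors -/

section

variable {C : Type u} [SmallCategory C] {F : FrobeniusData C} {S : LinearlyDistributive C}

namespace FrobDict

/-- Here the elements are arbitrary rather than universal. After translation into morphisms,
naturality gathers the distributors and the associator into one side of `δL_par_assoc`; the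
remaining coherence equations are proved in the same manner from the axiom of the same shape. -/
lemma L_assoc (E : FrobDict F S.toTwoMonoidal S.δL S.δR) {X Y Z X' Y' V W R Q N M Q' : C} {c : El F.comul X (X', V)} {a : El F.mul (V, Y) W}
    {b : El F.mul (W, Z) Y'} {p : El F.mul (X, Y) R} {q : El F.comul R (X', W)}
    {r : El F.mul (R, Z) Q} {s : El F.comul Q (X', Y')} {p' : El F.mul (Y, Z) N}
    {r' : El F.mul (X, N) Q} {a' : El F.mul (Y, Z) M} {b' : El F.mul (V, M) Y'}
    {t : El F.mul (X, M) Q'} {s' : El F.comul Q' (X', Y')}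
    (h₁ : F.FrobL c a p q) (h₂ : F.FrobL q b r s) (h₃ : F.Assoc p r p' r')
    (h₄ : F.Assoc a b a' b') (h₅ : F.FrobL c b' t s') :
    (glue (pair (wire (𝟙 X)) p') (glue r' s) :
      El (comp (tens (idP C) F.mul) (comp F.mul F.comul)) (X, (Y, Z)) (X', Y')) =
    glue (pair (wire (𝟙 X)) a') (glue t s') := by
  rw [E.frobL] at h₁ h₂ h₅
  rw [E.assoc_iff] at h₃ h₄
  rw [E.glue_right_mul_comul]
  calc E.d s ≫ E.m r' ≫ S.pL X (E.m p')
      = (E.d s ≫ E.m r) ≫ S.pR (E.m p) Z ≫ (S.pa X Y Z).hom := by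
        rw [← h₃, Category.assoc]
    _ = S.tL X' (E.m b) ≫ S.δL X' W Z ≫ S.pR (E.d q ≫ E.m p) Z ≫ (S.pa X Y Z).hom := by
        rw [← h₂]; simp only [S.pR_comp, Category.assoc]
    _ = S.tL X' (E.m b ≫ S.pR (E.m a) Z) ≫ (S.δL X' (S.p V Y) Z ≫ S.pR (S.δL X' V Y) Z ≫
          (S.pa (S.t X' V) Y Z).hom) ≫ S.pR (E.d c) (S.p Y Z) := by
        rw [← h₁]
        simp only [S.pR_comp, S.tL_comp, Category.assoc, S.pa_left, S.δL_mid_assoc]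
    _ = S.tL X' (E.m b ≫ S.pR (E.m a) Z ≫ (S.pa V Y Z).hom) ≫ S.δL X' V (S.p Y Z) ≫
          S.pR (E.d c) (S.p Y Z) := by
        rw [S.δL_par_assoc]; simp only [S.tL_comp, Category.assoc]
    _ = (S.tL X' (E.m b') ≫ S.δL X' V M ≫ S.pR (E.d c) M) ≫ S.pL X (E.m a') := by
        rw [h₄]
        simp only [S.tL_comp, Category.assoc, S.δL_right_assoc, S.p_exchange]
    _ = E.d s' ≫ E.m t ≫ S.pL X (E.m a') := by rw [h₅, Category.assoc]

lemma R_assoc (E : FrobDict F S.toTwoMonoidal S.δL S.δR) {X Y Z X' Y' V W R Q N M Q' : C} {c : El F.comul Z (V, Y')} {a : El F.mul (Y, V) W}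
    {b : El F.mul (X, W) X'} {p : El F.mul (Y, Z) R} {q : El F.comul R (W, Y')}
    {r : El F.mul (X, R) Q} {s : El F.comul Q (X', Y')} {p' : El F.mul (X, Y) N}
    {r' : El F.mul (N, Z) Q} {a' : El F.mul (X, Y) M} {b' : El F.mul (M, V) X'}
    {t : El F.mul (M, Z) Q'} {s' : El F.comul Q' (X', Y')}
    (h₁ : F.FrobR c a p q) (h₂ : F.FrobR q b r s) (h₃ : F.Assoc p' r' p r)
    (h₄ : F.Assoc a' b' a b) (h₅ : F.FrobR c b' t s') :
    (glue (pair p' (wire (𝟙 Z))) (glue r' s) :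
      El (comp (tens F.mul (idP C)) (comp F.mul F.comul)) ((X, Y), Z) (X', Y')) =
    glue (pair a' (wire (𝟙 Z))) (glue t s') := by
  rw [E.frobR] at h₁ h₂ h₅
  rw [E.assoc_iff] at h₃ h₄
  rw [E.glue_left_mul_comul, ← cancel_mono (S.pa X Y Z).hom]
  calc (E.d s ≫ E.m r' ≫ S.pR (E.m p') Z) ≫ (S.pa X Y Z).hom
      = (E.d s ≫ E.m r) ≫ S.pL X (E.m p) := by
        simp only [Category.assoc]; rw [h₃]
    _ = S.tR (E.m b) Y' ≫ S.δR X W Y' ≫ S.pL X (E.d q ≫ E.m p) := by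
        rw [← h₂]; simp only [S.pL_comp, Category.assoc]
    _ = S.tR (E.m b ≫ S.pL X (E.m a)) Y' ≫ S.δR X (S.p Y V) Y' ≫ S.pL X (S.δR Y V Y') ≫
          S.pL X (S.pL Y (E.d c)) := by
        rw [← h₁]
        simp only [S.pL_comp, S.tR_comp, Category.assoc, S.δR_mid_assoc]
    _ = S.tR (E.m b') Y' ≫ S.tR (S.pR (E.m a') V) Y' ≫ (S.tR (S.pa X Y V).hom Y' ≫
          S.δR X (S.p Y V) Y' ≫ S.pL X (S.δR Y V Y')) ≫ S.pL X (S.pL Y (E.d c)) := by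
        rw [← h₄]; simp only [S.tR_comp, Category.assoc]
    _ = (S.tR (E.m b') Y' ≫ S.δR M V Y' ≫ S.pL M (E.d c)) ≫ S.pR (E.m a') Z ≫
          (S.pa X Y Z).hom := by
        rw [← S.δR_par_assoc]
        simp only [Category.assoc, S.δR_left_assoc, S.p_exchange_assoc, S.pa_right]
    _ = _ := by rw [h₅]; simp only [Category.assoc]

lemma LR_assoc (E : FrobDict F S.toTwoMonoidal S.δL S.δR) {X Y Z X' Y' U V R Q N N' Q' : C} {c : El F.comul Y (U, V)}
    {a : El F.mul (X, U) X'}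
    {b : El F.mul (V, Z) Y'} {p : El F.mul (X, Y) R} {q : El F.comul R (X', V)}
    {r : El F.mul (R, Z) Q} {s : El F.comul Q (X', Y')} {p' : El F.mul (Y, Z) N}
    {r' : El F.mul (X, N) Q} {a' : El F.mul (Y, Z) N'} {q' : El F.comul N' (U, Y')}
    {t : El F.mul (X, N') Q'} {s' : El F.comul Q' (X', Y')}
    (h₁ : F.FrobR c a p q) (h₂ : F.FrobL q b r s) (h₃ : F.Assoc p r p' r')
    (h₄ : F.FrobL c b a' q') (h₅ : F.FrobR q' a t s') :
    (glue (pair (wire (𝟙 X)) p') (glue r' s) :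
      El (comp (tens (idP C) F.mul) (comp F.mul F.comul)) (X, (Y, Z)) (X', Y')) =
    glue (pair (wire (𝟙 X)) a') (glue t s') := by
  rw [E.frobL] at h₂ h₄
  rw [E.frobR] at h₁ h₅
  rw [E.assoc_iff] at h₃
  rw [E.glue_right_mul_comul]
  calc E.d s ≫ E.m r' ≫ S.pL X (E.m p')
      = (E.d s ≫ E.m r) ≫ S.pR (E.m p) Z ≫ (S.pa X Y Z).hom := by
        rw [← h₃, Category.assoc]
    _ = S.tL X' (E.m b) ≫ S.δL X' V Z ≫ S.pR (E.d q ≫ E.m p) Z ≫ (S.pa X Y Z).hom := by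
        rw [← h₂]; simp only [S.pR_comp, Category.assoc]
    _ = S.tR (E.m a) (Y') ≫ S.tL (S.p X U) (E.m b) ≫ (S.δL (S.p X U) V Z ≫
          S.pR (S.δR X U V) Z ≫ (S.pa X (S.t U V) Z).hom) ≫ S.pL X (S.pR (E.d c) Z) := by
        rw [← h₁, ← S.t_exchange_assoc]
        simp only [S.pR_comp, Category.assoc, S.pa_mid, S.δL_left_assoc]
    _ = S.tR (E.m a) (Y') ≫ S.δR X U Y' ≫ S.pL X (S.tL U (E.m b) ≫ S.δL U V Z ≫
          S.pR (E.d c) Z) := by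
        rw [S.δ_par_assoc]
        simp only [S.pL_comp, Category.assoc, S.δR_right_assoc]
    _ = (S.tR (E.m a) (Y') ≫ S.δR X U Y' ≫ S.pL X (E.d q')) ≫ S.pL X (E.m a') := by
        rw [h₄]; simp only [S.pL_comp, Category.assoc]
    _ = _ := by rw [h₅, Category.assoc]

lemma L_coassoc (E : FrobDict F S.toTwoMonoidal S.δL S.δR) {X Y X₁ X₂ Y' U V R Q T Q' R' : C} {c : El F.comul X (X₁, U)}
    {c' : El F.comul U (X₂, V)} {a : El F.mul (V, Y) Y'} {p : El F.mul (U, Y) R}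
    {q : El F.comul R (X₂, Y')} {r : El F.mul (X, Y) Q} {s : El F.comul Q (X₁, R)}
    {f : El F.comul X (T, V)} {f' : El F.comul T (X₁, X₂)} {r' : El F.mul (X, Y) Q'}
    {s' : El F.comul Q' (T, Y')} {t : El F.comul Q' (X₁, R')} {q' : El F.comul R' (X₂, Y')}
    (h₁ : F.FrobL c' a p q) (h₂ : F.FrobL c p r s) (h₃ : F.Coassoc f f' c c')
    (h₄ : F.FrobL f a r' s') (h₅ : F.Coassoc s' f' t q') :
    (glue r (glue s (pair (wire (𝟙 X₁)) q)) :
      El (comp F.mul (comp F.comul (tens (idP C) F.comul))) (X, Y) (X₁, (X₂, Y'))) =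
    glue r' (glue t (pair (wire (𝟙 X₁)) q')) := by
  rw [E.frobL] at h₁ h₂ h₄
  rw [E.coassoc_iff] at h₃ h₅
  rw [E.glue_mul_comul_right, ← cancel_epi (S.ta X₁ X₂ Y').hom]
  symm
  calc (S.ta X₁ X₂ Y').hom ≫ S.tL X₁ (E.d q') ≫ E.d t ≫ E.m r'
      = S.tR (E.d f') Y' ≫ E.d s' ≫ E.m r' := by rw [← reassoc_of% h₅]
    _ = S.tL (S.t X₁ X₂) (E.m a) ≫ S.δL (S.t X₁ X₂) V Y ≫ S.pR (S.tR (E.d f') V ≫ E.d f) Y := by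
        rw [← h₄, ← S.t_exchange_assoc]
        simp only [S.pR_comp, S.δL_left_assoc]
    _ = S.tL (S.t X₁ X₂) (E.m a) ≫ (S.δL (S.t X₁ X₂) V Y ≫ S.pR (S.ta X₁ X₂ V).hom Y) ≫
          S.pR (S.tL X₁ (E.d c')) Y ≫ S.pR (E.d c) Y := by
        rw [h₃]; simp only [S.pR_comp, Category.assoc]
    _ = (S.ta X₁ X₂ Y').hom ≫ S.tL X₁ (S.tL X₂ (E.m a) ≫ S.δL X₂ V Y ≫ S.pR (E.d c') Y) ≫
          S.δL X₁ U Y ≫ S.pR (E.d c) Y := by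
        rw [← S.δL_tensor_assoc]
        simp only [S.tL_comp, Category.assoc, S.ta_right_assoc, S.δL_mid_assoc]
    _ = _ := by rw [h₁, ← h₂]; simp only [S.tL_comp, Category.assoc]

lemma R_coassoc (E : FrobDict F S.toTwoMonoidal S.δL S.δR) {X Y Y₁ Y₂ X' U V R Q T Q' R' : C} {c : El F.comul Y (U, Y₂)}
    {c' : El F.comul U (V, Y₁)} {a : El F.mul (X, V) X'} {p : El F.mul (X, U) R}
    {q : El F.comul R (X', Y₁)} {r : El F.mul (X, Y) Q} {s : El F.comul Q (R, Y₂)}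
    {f : El F.comul Y (V, T)} {f' : El F.comul T (Y₁, Y₂)} {r' : El F.mul (X, Y) Q'}
    {s' : El F.comul Q' (X', T)} {t : El F.comul Q' (R', Y₂)} {q' : El F.comul R' (X', Y₁)}
    (h₁ : F.FrobR c' a p q) (h₂ : F.FrobR c p r s) (h₃ : F.Coassoc c c' f f')
    (h₄ : F.FrobR f a r' s') (h₅ : F.Coassoc t q' s' f') :
    (glue r (glue s (pair q (wire (𝟙 Y₂)))) :
      El (comp F.mul (comp F.comul (tens F.comul (idP C)))) (X, Y) ((X', Y₁), Y₂)) =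
    glue r' (glue t (pair q' (wire (𝟙 Y₂)))) := by
  rw [E.frobR] at h₁ h₂ h₄
  rw [E.coassoc_iff] at h₃ h₅
  rw [E.glue_mul_comul_left]
  symm
  calc S.tR (E.d q') Y₂ ≫ E.d t ≫ E.m r'
      = (S.ta X' Y₁ Y₂).hom ≫ S.tL X' (E.d f') ≫ E.d s' ≫ E.m r' := by rw [reassoc_of% h₅]
    _ = (S.ta X' Y₁ Y₂).hom ≫ S.tR (E.m a) (S.t Y₁ Y₂) ≫ S.δR X V (S.t Y₁ Y₂) ≫
          S.pL X (S.tL V (E.d f') ≫ E.d f) := by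
        rw [← h₄, S.t_exchange_assoc]
        simp only [S.pL_comp, S.δR_right_assoc]
    _ = S.tR (S.tR (E.m a) Y₁) Y₂ ≫ ((S.ta (S.p X V) Y₁ Y₂).hom ≫ S.δR X V (S.t Y₁ Y₂)) ≫
          S.pL X (S.tL V (E.d f') ≫ E.d f) := by
        rw [← S.ta_left_assoc]; simp only [Category.assoc]
    _ = S.tR (S.tR (E.m a) Y₁) Y₂ ≫ S.tR (S.δR X V Y₁) Y₂ ≫ S.δR X (S.t V Y₁) Y₂ ≫
          S.pL X (S.tR (E.d c') Y₂ ≫ E.d c) := by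
        rw [← S.δR_tensor_assoc, h₃]; simp only [S.pL_comp, Category.assoc]
    _ = S.tR (S.tR (E.m a) Y₁ ≫ S.δR X V Y₁ ≫ S.pL X (E.d c')) Y₂ ≫ S.δR X U Y₂ ≫
          S.pL X (E.d c) := by
        simp only [S.tR_comp, S.pL_comp, Category.assoc, S.δR_mid_assoc]
    _ = _ := by rw [h₁, ← h₂]; simp only [S.tR_comp, Category.assoc]

lemma LR_coassoc (E : FrobDict F S.toTwoMonoidal S.δL S.δR) {X Y X' Y' V W M R Q N N' Q' : C} {c : El F.comul X (X', V)}
    {f : El F.comul Y (W, Y')}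
    {a : El F.mul (V, W) M} {p : El F.mul (X, W) R} {q : El F.comul R (X', M)}
    {r : El F.mul (X, Y) Q} {s : El F.comul Q (R, Y')} {s' : El F.comul Q (X', N)}
    {q' : El F.comul N (M, Y')} {p' : El F.mul (V, Y) N'} {g : El F.comul N' (M, Y')}
    {r' : El F.mul (X, Y) Q'} {t : El F.comul Q' (X', N')}
    (h₁ : F.FrobL c a p q) (h₂ : F.FrobR f p r s) (h₃ : F.Coassoc s q s' q')
    (h₄ : F.FrobR f a p' g) (h₅ : F.FrobL c p' r' t) :
    (glue r (glue s' (pair (wire (𝟙 X')) q')) :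
      El (comp F.mul (comp F.comul (tens (idP C) F.comul))) (X, Y) (X', (M, Y'))) =
    glue r' (glue t (pair (wire (𝟙 X')) g)) := by
  rw [E.frobL] at h₁ h₅
  rw [E.frobR] at h₂ h₄
  rw [E.coassoc_iff] at h₃
  rw [E.glue_mul_comul_right, ← cancel_epi (S.ta X' M Y').hom]
  calc (S.ta X' M Y').hom ≫ S.tL X' (E.d q') ≫ E.d s' ≫ E.m r
      = S.tR (E.d q) Y' ≫ E.d s ≫ E.m r := by rw [← reassoc_of% h₃]
    _ = S.tR (E.d q ≫ E.m p) Y' ≫ S.δR X W Y' ≫ S.pL X (E.d f) := by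
        rw [← h₂]; simp only [S.tR_comp, Category.assoc]
    _ = S.tR (S.tL X' (E.m a)) Y' ≫ (S.tR (S.δL X' V W) Y' ≫ S.δR (S.t X' V) W Y') ≫
          S.pR (E.d c) (S.t W Y') ≫ S.pL X (E.d f) := by
        rw [← h₁]; simp only [S.tR_comp, Category.assoc, S.δR_left_assoc]
    _ = (S.ta X' M Y').hom ≫ S.tL X' (S.tR (E.m a) Y' ≫ S.δR V W Y' ≫ S.pL V (E.d f)) ≫
          S.δL X' V Y ≫ S.pR (E.d c) Y := by
        rw [S.δ_tensor_assoc, ← S.p_exchange]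
        simp only [S.tL_comp, Category.assoc, S.ta_mid_assoc, S.δL_right_assoc]
    _ = _ := by rw [h₄, ← h₅]; simp only [S.tL_comp, Category.assoc]

lemma L_unit (E : FrobDict F S.toTwoMonoidal S.δL S.δR) {X X' Y' V P Q : C} {p : El F.one pt P} {c : El F.comul X (X', V)}
    {a : El F.mul (V, P) Y'} {r : El F.mul (X, P) Q} {s : El F.comul Q (X', Y')}
    (h : F.FrobL c a r s) :
    act F.comul (𝟙 X) (Prod.mkHom (𝟙 X') (F.rho p a)) c =
      act F.comul (F.rho p r) (𝟙 (X', Y')) s := by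
  rw [E.frobL] at h
  apply E.d_injective
  rw [E.d_act_right, E.d_act_id, E.rho, E.rho, ← reassoc_of% h, Category.comp_id]
  rw [← S.p_exchange_assoc, S.prho_nat, ← S.δL_right_assoc]
  rw [← reassoc_of% (S.δL_par_unit X' V).symm]
  simp only [S.tL_comp, Category.assoc]

lemma R_unit (E : FrobDict F S.toTwoMonoidal S.δL S.δR) {Y X' Y' V P Q : C} {p : El F.one pt P} {c : El F.comul Y (V, Y')}
    {a : El F.mul (P, V) X'} {r : El F.mul (P, Y) Q} {s : El F.comul Q (X', Y')}
    (h : F.FrobR c a r s) :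
    act F.comul (𝟙 Y) (Prod.mkHom (F.lam p a) (𝟙 Y')) c =
      act F.comul (F.lam p r) (𝟙 (X', Y')) s := by
  rw [E.frobR] at h
  apply E.d_injective
  rw [E.d_act_left, E.d_act_id, E.lam, E.lam, ← reassoc_of% h, Category.comp_id]
  rw [S.p_exchange_assoc, S.plam_nat, ← S.δR_left_assoc]
  rw [← reassoc_of% (S.δR_par_unit V Y').symm]
  simp only [S.tR_comp, Category.assoc]

lemma L_counit (E : FrobDict F S.toTwoMonoidal S.δL S.δR) {X Y Y' V P Q : C} {t : El F.counit P pt} {c : El F.comul X (P, V)}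
    {a : El F.mul (V, Y) Y'} {r : El F.mul (X, Y) Q} {s : El F.comul Q (P, Y')}
    (h : F.FrobL c a r s) :
    act F.mul (Prod.mkHom (F.colam c t) (𝟙 Y)) (𝟙 Y') a =
      act F.mul (𝟙 (X, Y)) (F.colam s t) r := by
  rw [E.frobL] at h
  apply E.m_injective
  rw [E.m_act_left, E.m_act_id, E.colam, E.colam, Category.id_comp, Category.assoc, Category.assoc,
    ← h, ← S.t_exchange_assoc, S.δL_left_assoc, ← S.tlam_inv_nat_assoc]
  have e : (S.tlam (S.p V Y)).inv ≫ S.δL S.tI V Y = S.pR (S.tlam V).inv Y := by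
    rw [Iso.inv_comp_eq, ← S.δL_tensor_unit, Category.assoc, ← S.pR_comp, Iso.hom_inv_id, S.pR_id,
      Category.comp_id]
  rw [reassoc_of% e]
  simp only [S.pR_comp]

lemma R_counit (E : FrobDict F S.toTwoMonoidal S.δL S.δR) {X Y X' V P Q : C} {t : El F.counit P pt} {c : El F.comul Y (V, P)}
    {a : El F.mul (X, V) X'} {r : El F.mul (X, Y) Q} {s : El F.comul Q (X', P)}
    (h : F.FrobR c a r s) :
    act F.mul (Prod.mkHom (𝟙 X) (F.corho c t)) (𝟙 X') a =
      act F.mul (𝟙 (X, Y)) (F.corho s t) r := by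
  rw [E.frobR] at h
  apply E.m_injective
  rw [E.m_act_right, E.m_act_id, E.corho, E.corho, Category.id_comp, Category.assoc, Category.assoc,
    ← h, S.t_exchange_assoc, S.δR_right_assoc, ← S.trho_inv_nat_assoc]
  have e : (S.trho (S.p X V)).inv ≫ S.δR X V S.tI = S.pL X (S.trho V).inv := by
    rw [Iso.inv_comp_eq, ← S.δR_tensor_unit, Category.assoc, ← S.pL_comp, Iso.hom_inv_id, S.pL_id,
      Category.comp_id]
  rw [reassoc_of% e]
  simp only [S.pL_comp]

end FrobDict

end

/-! ### Snakes, transposition, and splitting of half-dualities -/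

namespace LinearlyDistributive

variable {C : Type*} [Category* C] (S : LinearlyDistributive C)

lemma δL_tensor_unit_inv (A B : C) :
    (S.tlam (S.p A B)).inv ≫ S.δL S.tI A B = S.pR (S.tlam A).inv B := by
  rw [Iso.inv_comp_eq, ← S.δL_tensor_unit, Category.assoc, ← S.pR_comp, Iso.hom_inv_id, S.pR_id,
    Category.comp_id]

lemma δR_tensor_unit_inv (A B : C) :
    (S.trho (S.p A B)).inv ≫ S.δR A B S.tI = S.pL A (S.trho B).inv := by
  rw [Iso.inv_comp_eq, ← S.δR_tensor_unit, Category.assoc, ← S.pL_comp, Iso.hom_inv_id, S.pL_id,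
    Category.comp_id]

lemma t_triangle (A B : C) :
    S.tL A (S.tlam B).inv = S.tR (S.trho A).inv B ≫ (S.ta A S.tI B).hom := by
  have h := @MonoidalCategory.triangle C _ S.tensor A B
  have h' : (S.ta A S.tI B).hom ≫ S.tL A (S.tlam B).hom = S.tR (S.trho A).hom B := h
  rw [← cancel_epi (S.tR (S.trho A).hom B), ← Category.assoc, ← S.tR_comp, Iso.hom_inv_id,
    S.tR_id, Category.id_comp, ← h', Category.assoc, ← S.tL_comp, Iso.hom_inv_id, S.tL_id,
    Category.comp_id]

lemma p_triangle (A B : C) :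
    (S.pa A S.bot B).hom ≫ S.pL A (S.plam B).hom = S.pR (S.prho A).hom B :=
  @MonoidalCategory.triangle C _ S.par A B

lemma t_unitors : (S.tlam S.tI).inv = (S.trho S.tI).inv := by
  have h := @MonoidalCategory.unitors_inv_equal C _ S.tensor
  exact h

/-- The contraction `A ⟶ A'` of a pairing `A ⊗ B ⟶ ⊥` with a copairing `I ⟶ B ⅋ A'`. -/
def snake {A B A' : C} (τ : S.t A B ⟶ S.bot) (γ : S.tI ⟶ S.p B A') : A ⟶ A' :=
  (S.trho A).inv ≫ S.tL A γ ≫ S.δL A B A' ≫ S.pR τ A' ≫ (S.plam A').hom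

/-- The contraction `B' ⟶ B` of a copairing `I ⟶ B ⅋ A` with a pairing `A ⊗ B' ⟶ ⊥`. -/
def cosnake {B A B' : C} (γ : S.tI ⟶ S.p B A) (τ : S.t A B' ⟶ S.bot) : B' ⟶ B :=
  (S.tlam B').inv ≫ S.tR γ B' ≫ S.δR B A B' ≫ S.pL B τ ≫ (S.prho B).hom

lemma snake_tR {A A₀ B A' : C} (f : A₀ ⟶ A) (τ : S.t A B ⟶ S.bot) (γ : S.tI ⟶ S.p B A') :
    S.snake (S.tR f B ≫ τ) γ = f ≫ S.snake τ γ := by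
  simp only [snake, S.pR_comp, Category.assoc, S.trho_inv_nat_assoc]
  rw [← S.δL_left_assoc, S.t_exchange_assoc]

lemma snake_pL {A B A' A₁ : C} (τ : S.t A B ⟶ S.bot) (γ : S.tI ⟶ S.p B A') (f : A' ⟶ A₁) :
    S.snake τ (γ ≫ S.pL B f) = S.snake τ γ ≫ f := by
  simp only [snake, S.tL_comp, Category.assoc, S.δL_right_assoc]
  rw [S.p_exchange_assoc, S.plam_nat]

lemma snake_slide {A B B₀ A' : C} (τ : S.t A B ⟶ S.bot) (f : B₀ ⟶ B) (γ : S.tI ⟶ S.p B₀ A') :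
    S.snake (S.tL A f ≫ τ) γ = S.snake τ (γ ≫ S.pR f A') := by
  simp only [snake, S.tL_comp, S.pR_comp, Category.assoc, S.δL_mid_assoc]

lemma cosnake_tL {B A B' B₀ : C} (γ : S.tI ⟶ S.p B A) (f : B₀ ⟶ B') (τ : S.t A B' ⟶ S.bot) :
    S.cosnake γ (S.tL A f ≫ τ) = f ≫ S.cosnake γ τ := by
  simp only [cosnake, S.pL_comp, Category.assoc, S.tlam_inv_nat_assoc]
  rw [← S.δR_right_assoc, ← S.t_exchange_assoc]

lemma cosnake_pR {B B₁ A B' : C} (γ : S.tI ⟶ S.p B A) (f : B ⟶ B₁) (τ : S.t A B' ⟶ S.bot) :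
    S.cosnake (γ ≫ S.pR f A) τ = S.cosnake γ τ ≫ f := by
  simp only [cosnake, S.tR_comp, Category.assoc, S.δR_left_assoc]
  rw [← S.p_exchange_assoc, S.prho_nat]

lemma cosnake_slide {B A A₁ B' : C} (γ : S.tI ⟶ S.p B A) (f : A ⟶ A₁) (τ : S.t A₁ B' ⟶ S.bot) :
    S.cosnake (γ ≫ S.pL B f) τ = S.cosnake γ (S.tR f B' ≫ τ) := by
  simp only [cosnake, S.tR_comp, S.pL_comp, Category.assoc, S.δR_mid_assoc]

/-- Transposition along a copairing on the left. -/
def curryL {B A V X : C} (γ : S.tI ⟶ S.p B A) (c : S.t A V ⟶ X) : V ⟶ S.p B X :=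
  (S.tlam V).inv ≫ S.tR γ V ≫ S.δR B A V ≫ S.pL B c

/-- Transposition along a pairing on the left. -/
def uncurryL {A B V X : C} (τ : S.t A B ⟶ S.bot) (κ : V ⟶ S.p B X) : S.t A V ⟶ X :=
  S.tL A κ ≫ S.δL A B X ≫ S.pR τ X ≫ (S.plam X).hom

/-- Transposition along a copairing on the right. -/
def curryR {A B V X : C} (γ : S.tI ⟶ S.p A B) (c : S.t V A ⟶ X) : V ⟶ S.p X B :=
  (S.trho V).inv ≫ S.tL V γ ≫ S.δL V A B ≫ S.pR c B

/-- Transposition along a pairing on the right. -/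
def uncurryR {B A V X : C} (τ : S.t B A ⟶ S.bot) (κ : V ⟶ S.p X B) : S.t V A ⟶ X :=
  S.tR κ A ≫ S.δR X B A ≫ S.pL X τ ≫ (S.prho X).hom

/-- No snake equation is assumed for `τ` and `γ`: the two round trips of transposition act by the
`snake` and by the `cosnake` respectively. This generality is what makes half-dualities usable. -/
lemma uncurryL_curryL {A B A' V X : C} (τ : S.t A B ⟶ S.bot) (γ : S.tI ⟶ S.p B A')
    (c : S.t A' V ⟶ X) : S.uncurryL τ (S.curryL γ c) = S.tR (S.snake τ γ) V ≫ c := by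
  have h : S.tL A (S.tlam V).inv ≫ S.tL A (S.tR γ V) ≫ S.tL A (S.δR B A' V) ≫
      S.δL A B (S.t A' V) = S.tR ((S.trho A).inv ≫ S.tL A γ ≫ S.δL A B A') V ≫
      S.δR (S.t A B) A' V := by
    simp only [S.tR_comp, Category.assoc]
    rw [S.δ_tensor_assoc, S.ta_mid_assoc, S.t_triangle, Category.assoc]
  simp only [uncurryL, curryL, S.tL_comp, Category.assoc, S.δL_right_assoc]
  rw [reassoc_of% h, snake]
  simp only [S.tR_comp, Category.assoc]
  rw [← reassoc_of% (S.δR_par_unit A' V), S.p_exchange_assoc, S.plam_nat, S.δR_left_assoc]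

lemma curryL_uncurryL {B A B' V X : C} (γ : S.tI ⟶ S.p B A) (τ : S.t A B' ⟶ S.bot)
    (κ : V ⟶ S.p B' X) : S.curryL γ (S.uncurryL τ κ) = κ ≫ S.pR (S.cosnake γ τ) X := by
  simp only [uncurryL, curryL, S.pL_comp, ← S.δR_right_assoc]
  rw [← reassoc_of% (S.δ_par_assoc B A B' X), ← S.t_exchange_assoc, ← S.tlam_inv_nat_assoc,
    S.δL_left_assoc, reassoc_of% (S.δL_tensor_unit_inv B' X), cosnake]
  simp only [S.pR_comp, Category.assoc]
  rw [← S.p_triangle, S.pa_mid_assoc]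

lemma uncurryR_curryR {A B A' V X : C} (γ : S.tI ⟶ S.p A' B) (τ : S.t B A ⟶ S.bot)
    (c : S.t V A' ⟶ X) : S.uncurryR τ (S.curryR γ c) = S.tL V (S.cosnake γ τ) ≫ c := by
  have h : S.tR (S.trho V).inv A ≫ S.tR (S.tL V γ) A ≫ S.tR (S.δL V A' B) A ≫
      S.δR (S.t V A') B A = S.tL V ((S.tlam A).inv ≫ S.tR γ A ≫ S.δR A' B A) ≫
      S.δL V A' (S.t B A) := by
    simp only [S.tL_comp, Category.assoc]
    rw [S.δ_tensor_assoc, S.ta_mid_assoc, S.t_triangle, Category.assoc]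
  simp only [uncurryR, curryR, S.tR_comp, Category.assoc, S.δR_left_assoc]
  rw [reassoc_of% h, cosnake]
  simp only [S.tL_comp, Category.assoc]
  rw [← reassoc_of% (S.δL_par_unit V A'), ← S.p_exchange_assoc, S.prho_nat, S.δL_right_assoc]

lemma curryR_uncurryR {A B B' V X : C} (τ : S.t B' A ⟶ S.bot) (γ : S.tI ⟶ S.p A B)
    (κ : V ⟶ S.p X B') : S.curryR γ (S.uncurryR τ κ) = κ ≫ S.pL X (S.snake τ γ) := by
  simp only [uncurryR, curryR, S.pR_comp, ← S.δL_left_assoc]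
  have h := S.δ_par_assoc X B' A B
  rw [← S.p_triangle, S.pa_mid_assoc]
  rw [S.t_exchange_assoc, ← S.trho_inv_nat_assoc, reassoc_of% h, S.δR_right_assoc,
    reassoc_of% (S.δR_tensor_unit_inv X B'), snake]
  simp only [S.pL_comp, Category.assoc]

/-- Transposition of a Frobenius composite along a copairing on the left. -/
lemma curryL_frob {B A V X Y Y' : C} (γ : S.tI ⟶ S.p B A) (c : S.t A V ⟶ X) (a : Y' ⟶ S.p V Y) :
    S.curryL γ (S.tL A a ≫ S.δL A V Y ≫ S.pR c Y) =
      a ≫ S.pR (S.curryL γ c) Y ≫ (S.pa B X Y).hom := by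
  simp only [curryL, S.pL_comp, S.pR_comp, Category.assoc]
  rw [← S.δR_right_assoc, S.pa_mid, ← reassoc_of% (S.δ_par_assoc B A V Y),
    ← S.t_exchange_assoc, ← S.tlam_inv_nat_assoc, S.δL_left_assoc,
    reassoc_of% (S.δL_tensor_unit_inv V Y)]

/-- Transposition of a Frobenius composite along a copairing on the right. -/
lemma curryR_frob {A B V X X' Y : C} (γ : S.tI ⟶ S.p A B) (c : S.t V A ⟶ Y) (a : X' ⟶ S.p X V) :
    S.curryR γ (S.tR a A ≫ S.δR X V A ≫ S.pL X c) ≫ (S.pa X Y B).hom =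
      a ≫ S.pL X (S.curryR γ c) := by
  simp only [curryR, S.pL_comp, S.pR_comp, Category.assoc]
  rw [← S.δL_left_assoc, S.pa_mid, reassoc_of% (S.δ_par_assoc X V A B),
    S.t_exchange_assoc, ← S.trho_inv_nat_assoc, S.δR_right_assoc,
    reassoc_of% (S.δR_tensor_unit_inv X V)]

/-- Both sides are the contraction of the two copairings `γ` and `γ'` by the single pairing `τ`. The
equality of the two unitors at `I` identifies the two ways of inserting the tensor unit. -/
lemma copairing_cosnake {B A B' A' : C} (γ : S.tI ⟶ S.p B A) (τ : S.t A B' ⟶ S.bot)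
    (γ' : S.tI ⟶ S.p B' A') :
    γ' ≫ S.pR (S.cosnake γ τ) A' = γ ≫ S.pL B (S.snake τ γ') := by
  have h : S.uncurryL τ γ' = (S.trho A).hom ≫ S.snake τ γ' := by
    rw [snake, Iso.hom_inv_id_assoc, uncurryL]
  rw [← S.curryL_uncurryL, h, curryL, S.pL_comp, reassoc_of% (S.δR_tensor_unit B A),
    S.trho_nat_assoc, S.t_unitors, Iso.inv_hom_id_assoc]

/-- The dual statement: two pairings joined by one copairing may be contracted from either side. It
follows by transposing `τ'`, since transposition followed by its inverse is precomposition with the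
snake. -/
lemma snake_pairing {A B A' B' : C} (τ : S.t A B ⟶ S.bot) (γ : S.tI ⟶ S.p B A')
    (τ' : S.t A' B' ⟶ S.bot) :
    S.tR (S.snake τ γ) B' ≫ τ' = S.tL A (S.cosnake γ τ') ≫ τ := by
  have h : S.curryL γ τ' = S.cosnake γ τ' ≫ (S.prho B).inv := by
    simp only [cosnake, curryL, Category.assoc, Iso.hom_inv_id, Category.comp_id]
  have h' : S.tL A (S.prho B).inv ≫ S.δL A B S.bot = (S.prho (S.t A B)).inv := by
    rw [← cancel_mono (S.prho (S.t A B)).hom, Category.assoc, S.δL_par_unit, ← S.tL_comp,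
      Iso.inv_hom_id, S.tL_id, Iso.inv_hom_id]
  have hu : (S.plam S.bot).hom = (S.prho S.bot).hom := @MonoidalCategory.unitors_equal C _ S.par
  rw [← S.uncurryL_curryL, h, uncurryL, S.tL_comp, Category.assoc, reassoc_of% h', hu, S.prho_nat,
    Iso.inv_hom_id_assoc]

variable [IsIdempotentComplete C]

/-- One snake equation makes the other composite idempotent on `B`. The summand of `B` split off by
this idempotent is a genuine dual of `A`, with the restricted pairing and copairing. -/
lemma exists_isLinearDual_of_snake {A B : C} (τ : S.t A B ⟶ S.bot) (γ : S.tI ⟶ S.p B A)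
    (h : S.snake τ γ = 𝟙 A) : ∃ B', S.IsLinearDual A B' := by
  have h₁ : γ ≫ S.pR (S.cosnake γ τ) A = γ := by
    rw [S.copairing_cosnake, h, S.pL_id, Category.comp_id]
  -- The copairing is invariant under the cosnake by `h₁`, and postcomposition on the copairing
  -- becomes postcomposition on the cosnake.
  have h₂ : S.cosnake γ τ ≫ S.cosnake γ τ = S.cosnake γ τ := by
    rw [← S.cosnake_pR, h₁]
  obtain ⟨B', i, q, hi, hq⟩ := IsIdempotentComplete.idempotents_split B _ h₂
  refine ⟨B', S.tL A i ≫ τ, γ ≫ S.pR q A, ?_, ?_⟩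
  · refine (S.snake_slide _ _ _).trans ?_
    rw [Category.assoc, ← S.pR_comp, hq, h₁, h]
  · refine (S.cosnake_tL _ _ _).trans ?_
    rw [S.cosnake_pR, ← hq, Category.assoc, hi, Category.comp_id, hi]

lemma exists_isLinearDual_of_cosnake {A B : C} (τ : S.t A B ⟶ S.bot) (γ : S.tI ⟶ S.p B A)
    (h : S.cosnake γ τ = 𝟙 B) : ∃ A', S.IsLinearDual A' B := by
  have h₁ : γ ≫ S.pL B (S.snake τ γ) = γ := by
    rw [← S.copairing_cosnake, h, S.pR_id, Category.comp_id]
  have h₂ : S.snake τ γ ≫ S.snake τ γ = S.snake τ γ := by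
    rw [← S.snake_pL, h₁]
  obtain ⟨A', i, q, hi, hq⟩ := IsIdempotentComplete.idempotents_split A _ h₂
  refine ⟨A', S.tR i B ≫ τ, γ ≫ S.pL B q, ?_, ?_⟩
  · refine (S.snake_tR _ _ _).trans ?_
    rw [S.snake_pL, ← hq, Category.assoc, hi, Category.comp_id, hi]
  · refine (S.cosnake_slide _ _ _).trans ?_
    rw [← Category.assoc, ← S.tR_comp, hq, ← S.cosnake_slide, h₁, h]

end LinearlyDistributive

/-! ### Negations from the surjectivity of the Frobenius 2-cells -/

section

variable {C : Type u} [SmallCategory C] {F : FrobeniusData C} {S : LinearlyDistributive C}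

namespace FrobDict

/-- `exists_strL` in terms of morphisms: every morphism `X' ⊗ Y' ⟶ X ⅋ Y` factors through a
distributor. -/
lemma exists_frobL_eq (E : FrobDict F S.toTwoMonoidal S.δL S.δR) {X Y X' Y' : C}
    (h : S.t X' Y' ⟶ S.p X Y) : ∃ (V : C) (c : S.t X' V ⟶ X) (a : Y' ⟶ S.p V Y),
      S.tL X' a ≫ S.δL X' V Y ≫ S.pR c Y = h := by
  obtain ⟨V, c, f, e⟩ := F.exists_strL E.par.toMonDictData (X := X) (Y := Y) (E.dElt h)
  refine ⟨V, E.d c, f, ?_⟩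
  have h₁ : F.FrobL c (E.mElt f) (E.mElt (𝟙 (S.p X Y))) (E.dElt h) := by
    refine (F.frobL_iff E.par.toMonDictData).2 ?_
    have h₂ : E.par.m (E.mElt f) = f := E.m_mElt f
    have h₃ : E.par.m (E.mElt (𝟙 (S.p X Y))) = 𝟙 _ := E.m_mElt _
    rw [h₂, h₃, ← e]
    exact (act_id _ _).symm
  rw [E.frobL] at h₁
  simpa using h₁

lemma exists_frobR_eq (E : FrobDict F S.toTwoMonoidal S.δL S.δR) {X Y X' Y' : C}
    (h : S.t X' Y' ⟶ S.p X Y) : ∃ (V : C) (c : S.t V Y' ⟶ Y) (a : X' ⟶ S.p X V),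
      S.tR a Y' ≫ S.δR X V Y' ≫ S.pL X c = h := by
  obtain ⟨V, c, f, e⟩ := F.exists_strR E.par.toMonDictData (X := X) (Y := Y) (E.dElt h)
  refine ⟨V, E.d c, f, ?_⟩
  have h₁ : F.FrobR c (E.mElt f) (E.mElt (𝟙 (S.p X Y))) (E.dElt h) := by
    refine (F.frobR_iff E.par.toMonDictData).2 ?_
    have h₂ : E.par.m (E.mElt f) = f := E.m_mElt f
    have h₃ : E.par.m (E.mElt (𝟙 (S.p X Y))) = 𝟙 _ := E.m_mElt _
    rw [h₂, h₃, ← e]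
    exact (act_id _ _).symm
  rw [E.frobR] at h₁
  simpa using h₁

variable [IsIdempotentComplete C]

/-- The `*`-autonomous category of a Frobenius pseudomonoid. -/
def toStarAutonomous (E : FrobDict F S.toTwoMonoidal S.δL S.δR) : StarAutonomous C where
  toLinearlyDistributive := S
  exists_right_dual A := by
    -- The morphism `A ⊗ I ⟶ ⊥ ⅋ A` composed of unitors is the bent identity; its factorisation is a
    -- pairing and a copairing whose snake is the identity of `A`.
    obtain ⟨V, c, a, h⟩ := E.exists_frobL_eq ((S.trho A).hom ≫ (S.plam A).inv)
    refine S.exists_isLinearDual_of_snake c a ?_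
    rw [LinearlyDistributive.snake, reassoc_of% h]
    simp
  exists_left_dual B := by
    obtain ⟨V, c, a, h⟩ := E.exists_frobR_eq ((S.tlam B).hom ≫ (S.prho B).inv)
    refine S.exists_isLinearDual_of_cosnake c a ?_
    rw [LinearlyDistributive.cosnake, reassoc_of% h]
    simp

end FrobDict

end

namespace TwoMonoidal

variable {C : Type*} [Category* C] (S : TwoMonoidal C)

lemma tHom_comp {X Y Z X' Y' Z' : C} (f : X ⟶ Y) (g : Y ⟶ Z) (f' : X' ⟶ Y') (g' : Y' ⟶ Z') :
    S.tensor.tensorHom (f ≫ g) (f' ≫ g') = S.tensor.tensorHom f f' ≫ S.tensor.tensorHom g g' :=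
  (@MonoidalCategory.tensorHom_comp_tensorHom C _ S.tensor _ _ _ _ _ _ f f' g g').symm

lemma pHom_comp {X Y Z X' Y' Z' : C} (f : X ⟶ Y) (g : Y ⟶ Z) (f' : X' ⟶ Y') (g' : Y' ⟶ Z') :
    S.par.tensorHom (f ≫ g) (f' ≫ g') = S.par.tensorHom f f' ≫ S.par.tensorHom g g' :=
  (@MonoidalCategory.tensorHom_comp_tensorHom C _ S.par _ _ _ _ _ _ f f' g g').symm

lemma pHom_id (X Y : C) : S.par.tensorHom (𝟙 X) (𝟙 Y) = 𝟙 (S.p X Y) := by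
  rw [S.pHom_def, S.pR_id, S.pL_id, Category.comp_id]

lemma tHom_left {X X' : C} (f : X ⟶ X') (Y : C) : S.tensor.tensorHom f (𝟙 Y) = S.tR f Y := by
  rw [S.tHom_def, S.tL_id, Category.comp_id]

lemma tHom_right (X : C) {Y Y' : C} (f : Y ⟶ Y') : S.tensor.tensorHom (𝟙 X) f = S.tL X f := by
  rw [S.tHom_def, S.tR_id, Category.id_comp]

lemma pHom_left {X X' : C} (f : X ⟶ X') (Y : C) : S.par.tensorHom f (𝟙 Y) = S.pR f Y := by
  rw [S.pHom_def, S.pL_id, Category.comp_id]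

lemma pHom_right (X : C) {Y Y' : C} (f : Y ⟶ Y') : S.par.tensorHom (𝟙 X) f = S.pL X f := by
  rw [S.pHom_def, S.pR_id, Category.id_comp]

end TwoMonoidal

/-! ### Representatives of elements of the sources of the Frobenius 2-cells -/

section Cells

variable {C : Type u} [SmallCategory C] (m : Profunctor.{u} (C × C) C)
  (d : Profunctor.{u} C (C × C))

/-- "Comultiply the left wire, then multiply with the right wire." -/
abbrev leftFrobCell : Profunctor.{u} (C × C) (C × C) :=
  comp (tens d (idP C))
    ((tens (idP C) m).whiskerLeft₂ (prod.associator C C C) (𝟭 (C × C)))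

/-- "Comultiply the right wire, then multiply with the left wire." -/
abbrev rightFrobCell : Profunctor.{u} (C × C) (C × C) :=
  comp (tens (idP C) d)
    ((tens m (idP C)).whiskerLeft₂ (prod.inverseAssociator C C C) (𝟭 (C × C)))

variable {m d}

section

variable {A B : Type u} [SmallCategory A] [SmallCategory B] {P : Profunctor.{u} A B}

lemma act_pair_wire_right {a : A} {b b' : B} {X Y Y' : C} (r : b' ⟶ b) (q : Y' ⟶ Y) (x : El P a b)
    (g : Y ⟶ X) : act (tens P (idP C)) (𝟙 (a, X)) (Prod.mkHom r q) (pair x (wire g)) =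
      pair (act P (𝟙 a) r x) (wire (q ≫ g)) :=
  (act_pair (𝟙 (a, X)) (Prod.mkHom r q) x (wire g)).trans
    (congrArg (Prod.mk _) ((act_wire _ _ _).trans (congrArg (q ≫ ·) (Category.comp_id g))))

lemma act_pair_wire_left {a : A} {b b' : B} {X Y Y' : C} (r : b' ⟶ b) (q : Y' ⟶ Y) (x : El P a b)
    (g : Y ⟶ X) : act (tens (idP C) P) (𝟙 (X, a)) (Prod.mkHom q r) (pair (wire g) x) =
      pair (wire (q ≫ g)) (act P (𝟙 a) r x) :=
  (act_pair (𝟙 (X, a)) (Prod.mkHom q r) (wire g) x).trans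
    (congrArg (fun z => Prod.mk z _) ((act_wire _ _ _).trans
      (congrArg (q ≫ ·) (Category.comp_id g))))

lemma coact_pair_wire_right {a a' : A} {b : B} {X Y Y' : C} (r : a ⟶ a') (q : Y ⟶ Y') (x : El P a b)
    (g : X ⟶ Y) : act (tens P (idP C)) (Prod.mkHom r q) (𝟙 (b, X)) (pair x (wire g)) =
      pair (act P r (𝟙 b) x) (wire (g ≫ q)) :=
  (act_pair (Prod.mkHom r q) (𝟙 (b, X)) x (wire g)).trans
    (congrArg (Prod.mk _) ((act_wire _ _ _).trans (Category.id_comp _)))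

lemma coact_pair_wire_left {a a' : A} {b : B} {X Y Y' : C} (r : a ⟶ a') (q : Y ⟶ Y') (x : El P a b)
    (g : X ⟶ Y) : act (tens (idP C) P) (Prod.mkHom q r) (𝟙 (X, b)) (pair (wire g) x) =
      pair (wire (g ≫ q)) (act P r (𝟙 b) x) :=
  (act_pair (Prod.mkHom q r) (𝟙 (X, b)) (wire g) x).trans
    (congrArg (fun z => Prod.mk z _) ((act_wire _ _ _).trans (Category.id_comp _)))

end

/-- An element of the source of the left Frobenius 2-cell. -/
def leftFrobMk {X Y X' Y' X₁ Y₁ V : C} (c : El d X (X₁, V)) (g : Y₁ ⟶ Y) (f : X' ⟶ X₁)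
    (a : El m (V, Y₁) Y') : El (leftFrobCell m d) (X, Y) (X', Y') :=
  glue (b := ((X₁, V), Y₁)) (pair c (wire g)) (pair (wire f) a)

/-- An element of the source of the right Frobenius 2-cell. -/
def rightFrobMk {X Y X' Y' X₁ Y₁ V : C} (c : El d Y (V, Y₁)) (g : X₁ ⟶ X) (f : Y' ⟶ Y₁)
    (a : El m (X₁, V) X') : El (rightFrobCell m d) (X, Y) (X', Y') :=
  glue (b := (X₁, (V, Y₁))) (pair (wire g) c) (pair a (wire f))

lemma exists_leftFrobMk {X Y X' Y' : C} (z : El (leftFrobCell m d) (X, Y) (X', Y')) :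
    ∃ (X₁ V Y₁ : C) (c : El d X (X₁, V)) (g : Y₁ ⟶ Y) (f : X' ⟶ X₁) (a : El m (V, Y₁) Y'),
      z = leftFrobMk c g f a := by
  obtain ⟨⟨⟨X₁, V⟩, Y₁⟩, ⟨c, g⟩, ⟨f, a⟩, e⟩ := exists_glue z
  exact ⟨X₁, V, Y₁, c, g, f, a, e⟩

lemma exists_rightFrobMk {X Y X' Y' : C} (z : El (rightFrobCell m d) (X, Y) (X', Y')) :
    ∃ (X₁ V Y₁ : C) (c : El d Y (V, Y₁)) (g : X₁ ⟶ X) (f : Y' ⟶ Y₁) (a : El m (X₁, V) X'),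
      z = rightFrobMk c g f a := by
  obtain ⟨⟨X₁, ⟨V, Y₁⟩⟩, ⟨g, c⟩, ⟨a, f⟩, e⟩ := exists_glue z
  exact ⟨X₁, V, Y₁, c, g, f, a, e⟩

lemma act_leftFrobMk {X Y X' Y' X₁ Y₁ V X₂ Y₂ X₃ Y₃ : C} (p : X ⟶ X₂) (q : Y ⟶ Y₂) (r : X₃ ⟶ X')
    (s : Y₃ ⟶ Y') (c : El d X (X₁, V)) (g : Y₁ ⟶ Y) (f : X' ⟶ X₁) (a : El m (V, Y₁) Y') :
    act (leftFrobCell m d) (Prod.mkHom p q) (Prod.mkHom r s) (leftFrobMk c g f a) =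
      leftFrobMk (act d p (𝟙 (X₁, V)) c) (g ≫ q) (r ≫ f) (act m (𝟙 (V, Y₁)) s a) := by
  refine (act_glue _ _ _ _).trans ?_
  refine congrArg₂ glue ?_ ?_
  · refine (act_pair (Prod.mkHom p q) (𝟙 ((X₁, V), Y₁)) c (wire g)).trans ?_
    exact congrArg (Prod.mk _) ((act_wire _ _ _).trans (Category.id_comp _))
  · refine (act_pair (P := idP C) (Q := m) (𝟙 (X₁, (V, Y₁))) (Prod.mkHom r s) (wire f) a).trans ?_
    exact congrArg (fun z => Prod.mk z _) ((act_wire _ _ _).trans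
      (congrArg (r ≫ ·) (Category.comp_id f)))

lemma act_rightFrobMk {X Y X' Y' X₁ Y₁ V X₂ Y₂ X₃ Y₃ : C} (p : X ⟶ X₂) (q : Y ⟶ Y₂) (r : X₃ ⟶ X')
    (s : Y₃ ⟶ Y') (c : El d Y (V, Y₁)) (g : X₁ ⟶ X) (f : Y' ⟶ Y₁) (a : El m (X₁, V) X') :
    act (rightFrobCell m d) (Prod.mkHom p q) (Prod.mkHom r s) (rightFrobMk c g f a) =
      rightFrobMk (act d q (𝟙 (V, Y₁)) c) (g ≫ p) (s ≫ f) (act m (𝟙 (X₁, V)) r a) := by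
  refine (act_glue _ _ _ _).trans ?_
  refine congrArg₂ glue ?_ ?_
  · refine (act_pair (Prod.mkHom p q) (𝟙 (X₁, (V, Y₁))) (wire g) c).trans ?_
    exact congrArg (fun z => Prod.mk z _) ((act_wire _ _ _).trans (Category.id_comp _))
  · refine (act_pair (P := m) (Q := idP C) (𝟙 ((X₁, V), Y₁)) (Prod.mkHom r s) a (wire f)).trans ?_
    exact congrArg (Prod.mk _) ((act_wire _ _ _).trans
      (congrArg (s ≫ ·) (Category.comp_id f)))

lemma leftFrobMk_slide {X Y X' Y' X₁ Y₁ V X₂ Y₂ V₂ : C} (p : X₁ ⟶ X₂) (v : V ⟶ V₂) (q : Y₁ ⟶ Y₂)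
    (c : El d X (X₂, V₂)) (g : Y₂ ⟶ Y) (f : X' ⟶ X₁) (a : El m (V, Y₁) Y') :
    leftFrobMk (act d (𝟙 X) (Prod.mkHom p v) c) (q ≫ g) f a =
      leftFrobMk c g (f ≫ p) (act m (Prod.mkHom v q) (𝟙 Y') a) := by
  have h := glue_slide (P := tens d (idP C))
    (Q := ((tens (idP C) m).whiskerLeft₂ (prod.associator C C C) (𝟭 (C × C))))
    (a := (X, Y)) (b := ((X₁, V), Y₁)) (b' := ((X₂, V₂), Y₂)) (e := (X', Y'))
    (Prod.mkHom (Prod.mkHom p v) q) (pair c (wire g)) (pair (wire f) a)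
  have h₁ := act_pair_wire_right (Prod.mkHom p v) q c g
  have h₂ := coact_pair_wire_left (Prod.mkHom v q) p a f
  exact (congrArg (fun z => glue (b := ((X₁, V), Y₁)) z _) h₁).symm.trans
    (h.trans (congrArg (glue (b := ((X₂, V₂), Y₂)) _) h₂))

lemma rightFrobMk_slide {X Y X' Y' X₁ Y₁ V X₂ Y₂ V₂ : C} (p : X₁ ⟶ X₂) (v : V ⟶ V₂) (q : Y₁ ⟶ Y₂)
    (c : El d Y (V₂, Y₂)) (g : X₂ ⟶ X) (f : Y' ⟶ Y₁) (a : El m (X₁, V) X') :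
    rightFrobMk (act d (𝟙 Y) (Prod.mkHom v q) c) (p ≫ g) f a =
      rightFrobMk c g (f ≫ q) (act m (Prod.mkHom p v) (𝟙 X') a) := by
  have h := glue_slide (P := tens (idP C) d)
    (Q := ((tens m (idP C)).whiskerLeft₂ (prod.inverseAssociator C C C) (𝟭 (C × C))))
    (a := (X, Y)) (b := (X₁, (V, Y₁))) (b' := (X₂, (V₂, Y₂))) (e := (X', Y'))
    (Prod.mkHom p (Prod.mkHom v q)) (pair (wire g) c) (pair a (wire f))
  have h₁ := act_pair_wire_left (Prod.mkHom v q) p c g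
  have h₂ := coact_pair_wire_right (Prod.mkHom p v) q a f
  exact (congrArg (fun z => glue (b := (X₁, (V, Y₁))) z _) h₁).symm.trans
    (h.trans (congrArg (glue (b := (X₂, (V₂, Y₂))) _) h₂))

end Cells

/-! ### The profunctor `Hom(X' ⊗ Y', X ⅋ Y)` as a model of `m d` -/

section

variable {C : Type u} [SmallCategory C] (S : TwoMonoidal C)

/-- The profunctor `((X, Y), (X', Y')) ↦ Hom(X' ⊗ Y', X ⅋ Y)`. -/
abbrev TwoMonoidal.homCell : Profunctor.{u} (C × C) (C × C) :=
  (@MonoidalCategory.tensor C _ S.tensor).toProfunctorRev.whiskerLeft₂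
    (@MonoidalCategory.tensor C _ S.par) (𝟭 (C × C))

/-- An element of `homCell`. -/
def TwoMonoidal.homMk {X Y X' Y' : C} (h : S.t X' Y' ⟶ S.p X Y) : El S.homCell (X, Y) (X', Y') := h

lemma TwoMonoidal.act_homMk {X Y X' Y' X₂ Y₂ X₃ Y₃ : C} (p : X ⟶ X₂) (q : Y ⟶ Y₂) (r : X₃ ⟶ X')
    (s : Y₃ ⟶ Y') (h : S.t X' Y' ⟶ S.p X Y) :
    act S.homCell (Prod.mkHom p q) (Prod.mkHom r s) (S.homMk h) =
      S.homMk (S.tensor.tensorHom r s ≫ h ≫ S.par.tensorHom p q) :=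
  act_toProfunctorRev (@MonoidalCategory.tensor C _ S.tensor)
    (S.par.tensorHom p q) (Prod.mkHom r s) h

variable {M : PseudomonoidData C} {K : PseudocomonoidData C}

lemma MonDictData.m_act_id {T : MonoidalCategory C} (D : MonDictData M T) {X Y Z Z' : C}
    (g : Z' ⟶ Z) (a : El M.mul (X, Y) Z) : D.m (act M.mul (𝟙 (X, Y)) g a) = g ≫ D.m a :=
  (D.m_act _ _ _).trans (by
    have h : (𝟙 X ⊗ₘ 𝟙 Y) = 𝟙 (X ⊗ Y) := by simp
    exact congrArg (g ≫ ·) ((congrArg (D.m a ≫ ·) h).trans (Category.comp_id _)))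

lemma ComonDictData.d_act_id {T : MonoidalCategory C} (D : ComonDictData K T) {X Y Z Z' : C}
    (g : Z ⟶ Z') (a : El K.comul Z (X, Y)) : D.d (act K.comul g (𝟙 (X, Y)) a) = D.d a ≫ g :=
  (D.d_act _ _ _).trans (by
    have h : (𝟙 X ⊗ₘ 𝟙 Y) = 𝟙 (X ⊗ Y) := by simp
    exact (congrArg (· ≫ D.d a ≫ g) h).trans (Category.id_comp _))

namespace TwoMonoidal

variable (D : MonDictData M S.par) (D' : ComonDictData K S.tensor)

/-- The morphism of an element of "multiply, then comultiply". -/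
def mulComulVal (a b : C × C) (z : El (comp M.mul K.comul) a b) : El S.homCell a b :=
  compLift (fun _ x y => D'.d (X := b.1) (Y := b.2) y ≫ D.m (X := a.1) (Y := a.2) x) (by
    intro b' b'' g x y
    have h₁ := D.m_act_id (X := a.1) (Y := a.2) g x
    have h₂ := D'.d_act_id (X := b.1) (Y := b.2) g y
    exact (congrArg (D'.d (X := b.1) (Y := b.2) y ≫ ·) h₁).trans ((Category.assoc _ _ _).symm.trans
      (congrArg (· ≫ D.m (X := a.1) (Y := a.2) x) h₂.symm))) z

lemma mulComulVal_glue {X Y Z X' Y' : C} (r : El M.mul (X, Y) Z)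
    (s : El K.comul Z (X', Y')) :
    S.mulComulVal D D' (X, Y) (X', Y') (glue r s) = S.homMk (D'.d s ≫ D.m r) := rfl

/-- The profunctor "multiply, then comultiply". -/
noncomputable def mulComulIso : comp M.mul K.comul ≅ S.homCell :=
  mkIso _ _ (S.mulComulVal D D') (by
    rintro ⟨X, Y⟩ ⟨X₂, Y₂⟩ ⟨X', Y'⟩ ⟨X₃, Y₃⟩ ⟨p, q⟩ ⟨r, s⟩ z
    obtain ⟨b, x, y, rfl⟩ := exists_glue z
    refine (congrArg (S.mulComulVal D D' (X₂, Y₂) (X₃, Y₃))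
      (act_glue (Prod.mkHom p q) (Prod.mkHom r s) x y)).trans ?_
    refine Eq.trans ?_ (S.act_homMk p q r s (D'.d y ≫ D.m x)).symm
    refine (S.mulComulVal_glue D D' _ _).trans (congrArg S.homMk ?_)
    rw [D.m_act, D'.d_act]
    simp) (by
    rintro ⟨X, Y⟩ ⟨X', Y'⟩
    constructor
    · intro z z' h
      obtain ⟨b, x, y, rfl⟩ := exists_glue z
      obtain ⟨b', x', y', rfl⟩ := exists_glue z'
      refine (glue_eq_iff_rep D.mul x y x' y').2 (D'.d_injective ?_)
      refine (D'.d_act_id _ _).trans (Eq.trans ?_ (D'.d_act_id _ _).symm)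
      exact h
    · intro h
      refine ⟨glue (D.mElt (𝟙 _)) (D'.dElt h), ?_⟩
      refine (S.mulComulVal_glue D D' _ _).trans ?_
      exact (congrArg₂ (fun f g => S.homMk (f ≫ g)) (D'.d_dElt h) (D.m_mElt (𝟙 (S.p X Y)))).trans
        (congrArg S.homMk (Category.comp_id (Y := S.p X Y) h)))

end TwoMonoidal

end

/-! ### The Frobenius pseudomonoid of a `*`-autonomous category -/

section

variable {C : Type u} [SmallCategory C] (S : StarAutonomous C)
  {M : PseudomonoidData C} {K : PseudocomonoidData C}
  (D : MonDictData M S.par) (D' : ComonDictData K S.tensor)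

namespace StarAutonomous

/-- The coend relation on representatives corresponds exactly to naturality of `δL`, so the value of
a representative descends to the coend. -/
lemma leftFrob_slide {X Y X' Y' X₁ Y₁ V X₂ Y₂ V₂ : C} (p : X₁ ⟶ X₂) (v : V ⟶ V₂) (q : Y₁ ⟶ Y₂)
    (c : El K.comul X (X₂, V₂)) (g : Y₂ ⟶ Y) (f : X' ⟶ X₁) (a : El M.mul (V, Y₁) Y') :
    S.tensor.tensorHom f (D.m a) ≫ S.δL X₁ V Y₁ ≫
        S.par.tensorHom (D'.d (act K.comul (𝟙 X) (Prod.mkHom p v) c)) (q ≫ g) =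
      S.tensor.tensorHom (f ≫ p) (D.m (act M.mul (Prod.mkHom v q) (𝟙 Y') a)) ≫ S.δL X₂ V₂ Y₂ ≫
        S.par.tensorHom (D'.d c) g := by
  have h₁ : D'.d (act K.comul (𝟙 X) (Prod.mkHom p v) c) = S.tensor.tensorHom p v ≫ D'.d c :=
    (D'.d_act _ _ _).trans (congrArg (S.tensor.tensorHom p v ≫ ·) (Category.comp_id _))
  have h₂ : D.m (act M.mul (Prod.mkHom v q) (𝟙 Y') a) = D.m a ≫ S.par.tensorHom v q :=
    (D.m_act _ _ _).trans (Category.id_comp _)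
  rw [h₁, h₂, S.tHom_comp, S.pHom_comp, Category.assoc, reassoc_of% (S.δL_natural p v q)]

lemma rightFrob_slide {X Y X' Y' X₁ Y₁ V X₂ Y₂ V₂ : C} (p : X₁ ⟶ X₂) (v : V ⟶ V₂) (q : Y₁ ⟶ Y₂)
    (c : El K.comul Y (V₂, Y₂)) (g : X₂ ⟶ X) (f : Y' ⟶ Y₁) (a : El M.mul (X₁, V) X') :
    S.tensor.tensorHom (D.m a) f ≫ S.δR X₁ V Y₁ ≫
        S.par.tensorHom (p ≫ g) (D'.d (act K.comul (𝟙 Y) (Prod.mkHom v q) c)) =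
      S.tensor.tensorHom (D.m (act M.mul (Prod.mkHom p v) (𝟙 X') a)) (f ≫ q) ≫ S.δR X₂ V₂ Y₂ ≫
        S.par.tensorHom g (D'.d c) := by
  have h₁ : D'.d (act K.comul (𝟙 Y) (Prod.mkHom v q) c) = S.tensor.tensorHom v q ≫ D'.d c :=
    (D'.d_act _ _ _).trans (congrArg (S.tensor.tensorHom v q ≫ ·) (Category.comp_id _))
  have h₂ : D.m (act M.mul (Prod.mkHom p v) (𝟙 X') a) = D.m a ≫ S.par.tensorHom p v :=
    (D.m_act _ _ _).trans (Category.id_comp _)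
  rw [h₁, h₂, S.tHom_comp, S.pHom_comp, Category.assoc, reassoc_of% (S.δR_natural p v q)]

/-- The morphism of a representative of an element of the source of the left Frobenius 2-cell. -/
def leftFrobFun (a b : C × C) (i : (C × C) × C) (x : El (tens K.comul (idP C)) a i)
    (y : El (tens (idP C) M.mul) (i.1.1, (i.1.2, i.2)) b) : El S.homCell a b :=
  S.homMk (S.tensor.tensorHom (Y₁ := i.1.1) y.1 (D.m (X := i.1.2) (Y := i.2) y.2) ≫
    S.δL i.1.1 i.1.2 i.2 ≫
    S.par.tensorHom (Y₂ := a.2) (D'.d (X := i.1.1) (Y := i.1.2) x.1) x.2)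

/-- The morphism of an element of the source of the left Frobenius 2-cell. -/
def leftFrobVal (a b : C × C) (z : El (leftFrobCell M.mul K.comul) a b) : El S.homCell a b :=
  compLift (S.leftFrobFun D D' a b) (by
    obtain ⟨X, Y⟩ := a
    obtain ⟨X', Y'⟩ := b
    rintro ⟨⟨X₁, V⟩, Y₁⟩ ⟨⟨X₂, V₂⟩, Y₂⟩ ⟨⟨p, v⟩, q⟩ ⟨c, g⟩ ⟨f, a'⟩
    refine (congrArg (fun z => S.leftFrobFun D D' (X, Y) (X', Y') ((X₁, V), Y₁) z
      (pair (wire f) a')) (act_pair_wire_right (Prod.mkHom p v) q c g)).trans ?_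
    refine Eq.trans ?_ (congrArg (S.leftFrobFun D D' (X, Y) (X', Y') ((X₂, V₂), Y₂)
      (pair c (wire g))) (coact_pair_wire_left (Prod.mkHom v q) p a' f)).symm
    refine congrArg S.homMk ?_
    exact S.leftFrob_slide D D' p v q c g f a') z

lemma leftFrobVal_mk {X Y X' Y' X₁ Y₁ V : C} (c : El K.comul X (X₁, V)) (g : Y₁ ⟶ Y) (f : X' ⟶ X₁)
    (a : El M.mul (V, Y₁) Y') :
    S.leftFrobVal D D' (X, Y) (X', Y') (leftFrobMk c g f a) =
      S.homMk (S.tensor.tensorHom f (D.m a) ≫ S.δL X₁ V Y₁ ≫ S.par.tensorHom (D'.d c) g) := rfl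

/-- The morphism of a representative of an element of the source of the right Frobenius 2-cell. -/
def rightFrobFun (a b : C × C) (i : C × (C × C)) (x : El (tens (idP C) K.comul) a i)
    (y : El (tens M.mul (idP C)) ((i.1, i.2.1), i.2.2) b) : El S.homCell a b :=
  S.homMk (S.tensor.tensorHom (Y₂ := i.2.2) (D.m (X := i.1) (Y := i.2.1) y.1) y.2 ≫
    S.δR i.1 i.2.1 i.2.2 ≫
    S.par.tensorHom (Y₁ := a.1) x.1 (D'.d (X := i.2.1) (Y := i.2.2) x.2))

/-- The morphism of an element of the source of the right Frobenius 2-cell. -/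
def rightFrobVal (a b : C × C) (z : El (rightFrobCell M.mul K.comul) a b) : El S.homCell a b :=
  compLift (S.rightFrobFun D D' a b) (by
    obtain ⟨X, Y⟩ := a
    obtain ⟨X', Y'⟩ := b
    rintro ⟨X₁, ⟨V, Y₁⟩⟩ ⟨X₂, ⟨V₂, Y₂⟩⟩ ⟨p, ⟨v, q⟩⟩ ⟨g, c⟩ ⟨a', f⟩
    refine (congrArg (fun z => S.rightFrobFun D D' (X, Y) (X', Y') (X₁, (V, Y₁)) z
      (pair a' (wire f))) (act_pair_wire_left (Prod.mkHom v q) p c g)).trans ?_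
    refine Eq.trans ?_ (congrArg (S.rightFrobFun D D' (X, Y) (X', Y') (X₂, (V₂, Y₂))
      (pair (wire g) c)) (coact_pair_wire_right (Prod.mkHom p v) q a' f)).symm
    refine congrArg S.homMk ?_
    exact S.rightFrob_slide D D' p v q c g f a') z

lemma rightFrobVal_mk {X Y X' Y' X₁ Y₁ V : C} (c : El K.comul Y (V, Y₁)) (g : X₁ ⟶ X)
    (f : Y' ⟶ Y₁) (a : El M.mul (X₁, V) X') :
    S.rightFrobVal D D' (X, Y) (X', Y') (rightFrobMk c g f a) =
      S.homMk (S.tensor.tensorHom (D.m a) f ≫ S.δR X₁ V Y₁ ≫ S.par.tensorHom g (D'.d c)) := rfl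

/-- The passive wires can be taken to be identities, by sliding their morphisms into the two active
elements. -/
lemma leftFrobMk_eq {X Y X' Y' X₁ Y₁ V : C} (c : El K.comul X (X₁, V)) (g : Y₁ ⟶ Y)
    (f : X' ⟶ X₁) (a : El M.mul (V, Y₁) Y') :
    leftFrobMk c g f a =
      leftFrobMk (D'.dElt (S.tR f V ≫ D'.d c)) (𝟙 Y) (𝟙 X') (D.mElt (D.m a ≫ S.pL V g)) := by
  have h₁ : act K.comul (𝟙 X) (Prod.mkHom f (𝟙 V)) c = D'.dElt (S.tR f V ≫ D'.d c) :=
    D'.d_injective ((D'.d_act _ _ _).trans (Eq.trans (congrArg₂ (· ≫ ·) (S.tHom_left f V)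
      (Category.comp_id _)) (D'.d_dElt _).symm))
  have h₂ : act M.mul (Prod.mkHom (𝟙 V) g) (𝟙 Y') a = D.mElt (D.m a ≫ S.pL V g) :=
    D.m_injective ((D.m_act _ _ _).trans ((Category.id_comp _).trans (Eq.trans
      (congrArg (D.m a ≫ ·) (S.pHom_right V g)) (D.m_mElt _).symm)))
  rw [← h₁, ← h₂]
  have e₁ := leftFrobMk_slide f (𝟙 V) (𝟙 Y₁) c g (𝟙 X') a
  have e₂ := leftFrobMk_slide (𝟙 X') (𝟙 V) g (act K.comul (𝟙 X) (Prod.mkHom f (𝟙 V)) c) (𝟙 Y)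
    (𝟙 X') a
  rw [Category.id_comp, Category.id_comp] at e₁
  rw [Category.comp_id, Category.comp_id] at e₂
  have e₃ : act M.mul (Prod.mkHom (𝟙 V) (𝟙 Y₁)) (𝟙 Y') a = a := act_id _ _
  have e₄ : ∀ c' : El K.comul X (X', V),
    act K.comul (𝟙 X) (Prod.mkHom (𝟙 X') (𝟙 V)) c' = c' := fun c' => act_id _ _
  rw [e₃] at e₁
  rw [e₄] at e₂
  rw [← e₁, e₂]

/-- Normal form. The transpose `curryL γ c` slides along the internal wire, so that the
comultiplication element becomes the fixed evaluation at `B`; by `curryL_frob` the multiplication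
element becomes the transpose of the total morphism. Hence the class depends only on its value. -/
lemma leftFrobMk_curry {X Y X' Y' B V : C} {τ : S.t X' B ⟶ S.bot} {γ : S.tI ⟶ S.p B X'}
    (h : S.snake τ γ = 𝟙 X') (c : S.t X' V ⟶ X) (a : Y' ⟶ S.p V Y) :
    leftFrobMk (D'.dElt c) (𝟙 Y) (𝟙 X') (D.mElt a) =
      leftFrobMk (D'.dElt (S.uncurryL τ (𝟙 (S.p B X)))) (𝟙 Y) (𝟙 X')
        (D.mElt (S.curryL γ (S.tL X' a ≫ S.δL X' V Y ≫ S.pR c Y) ≫ (S.pa B X Y).inv)) := by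
  have e₁ := leftFrobMk_slide (𝟙 X') (S.curryL γ c) (𝟙 Y) (D'.dElt (S.uncurryL τ (𝟙 (S.p B X))))
    (𝟙 Y) (𝟙 X') (D.mElt a)
  rw [Category.id_comp, Category.id_comp] at e₁
  have h₁ : act K.comul (𝟙 X) (Prod.mkHom (𝟙 X') (S.curryL γ c))
      (D'.dElt (S.uncurryL τ (𝟙 (S.p B X)))) = D'.dElt c := by
    refine D'.d_injective ((D'.d_act _ _ _).trans (Eq.trans (congrArg₂ (· ≫ ·)
      (S.tHom_right X' (S.curryL γ c)) ((Category.comp_id _).trans (D'.d_dElt _))) ?_))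
    have e : S.uncurryL τ (S.curryL γ c) = c := by
      rw [S.uncurryL_curryL, h, S.tR_id, Category.id_comp]
    refine Eq.trans ?_ (D'.d_dElt _).symm
    conv_rhs => rw [← e]
    rw [LinearlyDistributive.uncurryL, S.tL_id, Category.id_comp, LinearlyDistributive.uncurryL]
  have h₂ : act M.mul (Prod.mkHom (S.curryL γ c) (𝟙 Y)) (𝟙 Y') (D.mElt a) =
      D.mElt (S.curryL γ (S.tL X' a ≫ S.δL X' V Y ≫ S.pR c Y) ≫ (S.pa B X Y).inv) := by
    refine D.m_injective ((D.m_act _ _ _).trans ((Category.id_comp _).trans (Eq.trans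
      (congrArg₂ (· ≫ ·) (D.m_mElt _) (S.pHom_left (S.curryL γ c) Y)) ?_)))
    refine Eq.trans ?_ (D.m_mElt _).symm
    rw [S.curryL_frob, Category.assoc, Category.assoc, Iso.hom_inv_id, Category.comp_id]
  rw [h₁, h₂] at e₁
  exact e₁

/-- The left Frobenius isomorphism of a `*`-autonomous category. -/
noncomputable def leftFrobIso : leftFrobCell M.mul K.comul ≅ S.homCell :=
  mkIso _ _ (S.leftFrobVal D D') (by
    rintro ⟨X, Y⟩ ⟨X₂, Y₂⟩ ⟨X', Y'⟩ ⟨X₃, Y₃⟩ ⟨p, q⟩ ⟨r, s⟩ z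
    obtain ⟨X₁, V, Y₁, c, g, f, a, rfl⟩ := exists_leftFrobMk z
    refine (congrArg (S.leftFrobVal D D' (X₂, Y₂) (X₃, Y₃))
      (act_leftFrobMk p q r s c g f a)).trans ?_
    refine Eq.trans ?_ (S.act_homMk p q r s (S.tensor.tensorHom f (D.m a) ≫ S.δL X₁ V Y₁ ≫
      S.par.tensorHom (D'.d c) g)).symm
    refine (S.leftFrobVal_mk D D' _ _ _ _).trans (congrArg S.homMk ?_)
    rw [D.m_act_id, D'.d_act_id, S.tHom_comp, S.pHom_comp]
    simp only [Category.assoc]) (by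
    rintro ⟨X, Y⟩ ⟨X', Y'⟩
    -- The comultiplied wire has output `X'`, and a right dual of `X'` transposes `Hom(X' ⊗ Y', X ⅋
    -- Y)` to `Hom(Y', B ⅋ (X ⅋ Y))`.
    obtain ⟨B, τ, γ, h₁, h₂⟩ := S.exists_right_dual X'
    have key : ∀ {V : C} (c : S.t X' V ⟶ X) (a : Y' ⟶ S.p V Y),
        S.leftFrobVal D D' (X, Y) (X', Y') (leftFrobMk (D'.dElt c) (𝟙 Y) (𝟙 X') (D.mElt a)) =
          S.homMk (S.tL X' a ≫ S.δL X' V Y ≫ S.pR c Y) := by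
      intro V c a
      rw [S.leftFrobVal_mk, D.m_mElt, D'.d_dElt]
      exact congrArg S.homMk (congrArg₂ (fun f g => f ≫ S.δL X' V Y ≫ g) (S.tHom_right X' a)
        (S.pHom_left c Y))
    constructor
    · intro z z' h
      obtain ⟨X₁, V, Y₁, c, g, f, a, rfl⟩ := exists_leftFrobMk z
      obtain ⟨X₁', V', Y₁', c', g', f', a', rfl⟩ := exists_leftFrobMk z'
      rw [S.leftFrobMk_eq D D' c g f a, S.leftFrobMk_eq D D' c' g' f' a', key, key] at h
      rw [S.leftFrobMk_eq D D' c g f a, S.leftFrobMk_eq D D' c' g' f' a',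
        S.leftFrobMk_curry D D' h₁, S.leftFrobMk_curry D D' h₁ (S.tR f' V' ≫ D'.d c')]
      exact congrArg (fun h => leftFrobMk (D'.dElt (S.uncurryL τ (𝟙 (S.p B X)))) (𝟙 Y) (𝟙 X')
        (D.mElt (S.curryL γ h ≫ (S.pa B X Y).inv))) h
    -- The preimage is the normal form itself. The equation is checked after transposition, where
    -- both snake equations are used.
    · intro (h : S.t X' Y' ⟶ S.p X Y)
      refine ⟨leftFrobMk (D'.dElt (S.uncurryL τ (𝟙 (S.p B X)))) (𝟙 Y) (𝟙 X')
        (D.mElt (S.curryL γ h ≫ (S.pa B X Y).inv)), (key _ _).trans (congrArg S.homMk ?_)⟩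
      have e : ∀ k : S.t X' Y' ⟶ S.p X Y, S.uncurryL τ (S.curryL γ k) = k := by
        intro k
        rw [S.uncurryL_curryL, LinearlyDistributive.snake, h₁, S.tR_id, Category.id_comp]
      rw [← e (S.tL X' _ ≫ _), S.curryL_frob, S.curryL_uncurryL,
        show S.cosnake γ τ = 𝟙 B from h₂, S.pR_id, Category.comp_id, S.pR_id, Category.id_comp,
        Category.assoc, Iso.inv_hom_id, Category.comp_id, e])

lemma rightFrobMk_eq {X Y X' Y' X₁ Y₁ V : C} (c : El K.comul Y (V, Y₁)) (g : X₁ ⟶ X)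
    (f : Y' ⟶ Y₁) (a : El M.mul (X₁, V) X') :
    rightFrobMk c g f a =
      rightFrobMk (D'.dElt (S.tL V f ≫ D'.d c)) (𝟙 X) (𝟙 Y') (D.mElt (D.m a ≫ S.pR g V)) := by
  have h₁ : act K.comul (𝟙 Y) (Prod.mkHom (𝟙 V) f) c = D'.dElt (S.tL V f ≫ D'.d c) :=
    D'.d_injective ((D'.d_act _ _ _).trans (Eq.trans (congrArg₂ (· ≫ ·) (S.tHom_right V f)
      (Category.comp_id _)) (D'.d_dElt _).symm))
  have h₂ : act M.mul (Prod.mkHom g (𝟙 V)) (𝟙 X') a = D.mElt (D.m a ≫ S.pR g V) :=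
    D.m_injective ((D.m_act _ _ _).trans ((Category.id_comp _).trans (Eq.trans
      (congrArg (D.m a ≫ ·) (S.pHom_left g V)) (D.m_mElt _).symm)))
  rw [← h₁, ← h₂]
  have e₁ := rightFrobMk_slide (𝟙 X₁) (𝟙 V) f c g (𝟙 Y') a
  have e₂ := rightFrobMk_slide g (𝟙 V) (𝟙 Y') (act K.comul (𝟙 Y) (Prod.mkHom (𝟙 V) f) c) (𝟙 X)
    (𝟙 Y') a
  rw [Category.id_comp, Category.id_comp] at e₁
  rw [Category.comp_id, Category.comp_id] at e₂
  have e₃ : act M.mul (Prod.mkHom (𝟙 X₁) (𝟙 V)) (𝟙 X') a = a := act_id _ _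
  have e₄ : ∀ c' : El K.comul Y (V, Y'),
    act K.comul (𝟙 Y) (Prod.mkHom (𝟙 V) (𝟙 Y')) c' = c' := fun c' => act_id _ _
  rw [e₃] at e₁
  rw [e₄] at e₂
  rw [← e₁, e₂]

lemma rightFrobMk_curry {X Y X' Y' B V : C} {τ : S.t B Y' ⟶ S.bot} {γ : S.tI ⟶ S.p Y' B}
    (h : S.cosnake γ τ = 𝟙 Y') (c : S.t V Y' ⟶ Y) (a : X' ⟶ S.p X V) :
    rightFrobMk (D'.dElt c) (𝟙 X) (𝟙 Y') (D.mElt a) =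
      rightFrobMk (D'.dElt (S.uncurryR τ (𝟙 (S.p Y B)))) (𝟙 X) (𝟙 Y')
        (D.mElt (S.curryR γ (S.tR a Y' ≫ S.δR X V Y' ≫ S.pL X c) ≫ (S.pa X Y B).hom)) := by
  have e₁ := rightFrobMk_slide (𝟙 X) (S.curryR γ c) (𝟙 Y') (D'.dElt (S.uncurryR τ (𝟙 (S.p Y B))))
    (𝟙 X) (𝟙 Y') (D.mElt a)
  rw [Category.id_comp, Category.id_comp] at e₁
  have h₁ : act K.comul (𝟙 Y) (Prod.mkHom (S.curryR γ c) (𝟙 Y'))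
      (D'.dElt (S.uncurryR τ (𝟙 (S.p Y B)))) = D'.dElt c := by
    refine D'.d_injective ((D'.d_act _ _ _).trans (Eq.trans (congrArg₂ (· ≫ ·)
      (S.tHom_left (S.curryR γ c) Y') ((Category.comp_id _).trans (D'.d_dElt _))) ?_))
    have e : S.uncurryR τ (S.curryR γ c) = c := by
      rw [S.uncurryR_curryR, h, S.tL_id, Category.id_comp]
    refine Eq.trans ?_ (D'.d_dElt _).symm
    conv_rhs => rw [← e]
    rw [LinearlyDistributive.uncurryR, S.tR_id, Category.id_comp, LinearlyDistributive.uncurryR]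
  have h₂ : act M.mul (Prod.mkHom (𝟙 X) (S.curryR γ c)) (𝟙 X') (D.mElt a) =
      D.mElt (S.curryR γ (S.tR a Y' ≫ S.δR X V Y' ≫ S.pL X c) ≫ (S.pa X Y B).hom) := by
    refine D.m_injective ((D.m_act _ _ _).trans ((Category.id_comp _).trans (Eq.trans
      (congrArg₂ (· ≫ ·) (D.m_mElt _) (S.pHom_right X (S.curryR γ c))) ?_)))
    refine Eq.trans ?_ (D.m_mElt _).symm
    rw [S.curryR_frob]
  rw [h₁, h₂] at e₁
  exact e₁

/-- The right Frobenius isomorphism of a `*`-autonomous category. -/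
noncomputable def rightFrobIso : rightFrobCell M.mul K.comul ≅ S.homCell :=
  mkIso _ _ (S.rightFrobVal D D') (by
    rintro ⟨X, Y⟩ ⟨X₂, Y₂⟩ ⟨X', Y'⟩ ⟨X₃, Y₃⟩ ⟨p, q⟩ ⟨r, s⟩ z
    obtain ⟨X₁, V, Y₁, c, g, f, a, rfl⟩ := exists_rightFrobMk z
    refine (congrArg (S.rightFrobVal D D' (X₂, Y₂) (X₃, Y₃))
      (act_rightFrobMk p q r s c g f a)).trans ?_
    refine Eq.trans ?_ (S.act_homMk p q r s (S.tensor.tensorHom (D.m a) f ≫ S.δR X₁ V Y₁ ≫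
      S.par.tensorHom g (D'.d c))).symm
    refine (S.rightFrobVal_mk D D' _ _ _ _).trans (congrArg S.homMk ?_)
    rw [D.m_act_id, D'.d_act_id, S.tHom_comp, S.pHom_comp]
    simp only [Category.assoc]) (by
    rintro ⟨X, Y⟩ ⟨X', Y'⟩
    obtain ⟨B, τ, γ, h₁, h₂⟩ := S.exists_left_dual Y'
    have key : ∀ {V : C} (c : S.t V Y' ⟶ Y) (a : X' ⟶ S.p X V),
        S.rightFrobVal D D' (X, Y) (X', Y') (rightFrobMk (D'.dElt c) (𝟙 X) (𝟙 Y') (D.mElt a)) =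
          S.homMk (S.tR a Y' ≫ S.δR X V Y' ≫ S.pL X c) := by
      intro V c a
      rw [S.rightFrobVal_mk, D.m_mElt, D'.d_dElt]
      exact congrArg S.homMk (congrArg₂ (fun f g => f ≫ S.δR X V Y' ≫ g) (S.tHom_left a Y')
        (S.pHom_right X c))
    constructor
    · intro z z' h
      obtain ⟨X₁, V, Y₁, c, g, f, a, rfl⟩ := exists_rightFrobMk z
      obtain ⟨X₁', V', Y₁', c', g', f', a', rfl⟩ := exists_rightFrobMk z'
      rw [S.rightFrobMk_eq D D' c g f a, S.rightFrobMk_eq D D' c' g' f' a', key, key] at h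
      rw [S.rightFrobMk_eq D D' c g f a, S.rightFrobMk_eq D D' c' g' f' a',
        S.rightFrobMk_curry D D' h₂, S.rightFrobMk_curry D D' h₂ (S.tL V' f' ≫ D'.d c')]
      exact congrArg (fun h => rightFrobMk (D'.dElt (S.uncurryR τ (𝟙 (S.p Y B)))) (𝟙 X) (𝟙 Y')
        (D.mElt (S.curryR γ h ≫ (S.pa X Y B).hom))) h
    · intro (h : S.t X' Y' ⟶ S.p X Y)
      refine ⟨rightFrobMk (D'.dElt (S.uncurryR τ (𝟙 (S.p Y B)))) (𝟙 X) (𝟙 Y')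
        (D.mElt (S.curryR γ h ≫ (S.pa X Y B).hom)), (key _ _).trans (congrArg S.homMk ?_)⟩
      have e : ∀ k : S.t X' Y' ⟶ S.p X Y, S.uncurryR τ (S.curryR γ k) = k := by
        intro k
        rw [S.uncurryR_curryR, LinearlyDistributive.cosnake, h₂, S.tL_id, Category.id_comp]
      have e' : S.curryR γ (S.tR (S.curryR γ h ≫ (S.pa X Y B).hom) Y' ≫ S.δR X (S.p Y B) Y' ≫
          S.pL X (S.uncurryR τ (𝟙 (S.p Y B)))) = S.curryR γ h := by
        rw [← cancel_mono (S.pa X Y B).hom, S.curryR_frob, S.curryR_uncurryR,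
          show S.snake τ γ = 𝟙 B from h₁, S.pL_id, Category.comp_id, S.pL_id, Category.comp_id]
      rw [← e (S.tR _ Y' ≫ _), e', e])

/-- The Frobenius data in profunctors of a `*`-autonomous category. -/
noncomputable def frobeniusData : FrobeniusData C where
  toPseudomonoidData := monData C S.par
  pentagon := (monDict C S.par).pentagon
  triangle := (monDict C S.par).triangle
  toPseudocomonoidData := comonData C S.tensor
  copentagon := (comonDict C S.tensor).copentagon
  cotriangle := (comonDict C S.tensor).cotriangle
  frobL := S.leftFrobIso (monDict C S.par).toMonDictData (comonDict C S.tensor).toComonDictData ≪≫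
    (S.mulComulIso (monDict C S.par).toMonDictData (comonDict C S.tensor).toComonDictData).symm
  frobR := S.rightFrobIso (monDict C S.par).toMonDictData (comonDict C S.tensor).toComonDictData ≪≫
    (S.mulComulIso (monDict C S.par).toMonDictData (comonDict C S.tensor).toComonDictData).symm

lemma trans_symm_iff {A B : Type u} [SmallCategory A] [SmallCategory B] {P Q H : Profunctor.{u} A B}
    (φ : P ≅ H) (ψ : Q ≅ H) {a : A} {b : B} (x : El P a b) (y : El Q a b) :
    app₂ (φ ≪≫ ψ.symm).hom x = y ↔ app₂ φ.hom x = app₂ ψ.hom y := by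
  change app₂ ψ.inv (app₂ φ.hom x) = y ↔ _
  constructor
  · rintro rfl
    simp
  · intro h
    rw [h]
    simp

/-- The identifications of the Frobenius data of a `*`-autonomous category. -/
noncomputable def frobDict : FrobDict S.frobeniusData S.toTwoMonoidal S.δL S.δR where
  par := monDict C S.par
  tensor := comonDict C S.tensor
  frobL_iff {X Y X' Y' V Q c a r s} := by
    refine (trans_symm_iff _ _ _ _).trans (Iff.of_eq ?_)
    refine congrArg₂ (fun f g : S.t X' Y' ⟶ S.p X Y => f = g) ?_ rfl
    exact (S.leftFrobVal_mk _ _ c (𝟙 Y) (𝟙 X') a).trans (congrArg₂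
      (fun f g => f ≫ S.δL X' V Y ≫ g) (S.tHom_right X' _) (S.pHom_left _ Y))
  frobR_iff {X Y X' Y' V Q c a r s} := by
    refine (trans_symm_iff _ _ _ _).trans (Iff.of_eq ?_)
    refine congrArg₂ (fun f g : S.t X' Y' ⟶ S.p X Y => f = g) ?_ rfl
    exact (S.rightFrobVal_mk _ _ c (𝟙 X) (𝟙 Y') a).trans (congrArg₂
      (fun f g => f ≫ S.δR X V Y' ≫ g) (S.tHom_left _ Y') (S.pHom_right X _))

/-- The Frobenius pseudomonoid in profunctors of a `*`-autonomous category. -/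
noncomputable def frobeniusPseudomonoid : FrobeniusPseudomonoid C where
  toFrobeniusData := S.frobeniusData
  L_assoc := S.frobDict.L_assoc
  R_assoc := S.frobDict.R_assoc
  LR_assoc := S.frobDict.LR_assoc
  L_coassoc := S.frobDict.L_coassoc
  R_coassoc := S.frobDict.R_coassoc
  LR_coassoc := S.frobDict.LR_coassoc
  L_unit := S.frobDict.L_unit
  R_unit := S.frobDict.R_unit
  L_counit := S.frobDict.L_counit
  R_counit := S.frobDict.R_counit

end StarAutonomous

end

/-! ### The adjunction carried by a functor -/

section

variable {A B : Type u} [SmallCategory A] [SmallCategory B]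

/-- A represented profunctor is left adjoint to the corepresented profunctor of the same functor. -/
noncomputable def RightAdjoint.ofRep {P : Profunctor.{u} A B} {Q : Profunctor.{u} B A} {F : A ⥤ B}
    (φ : P ≅ F.toProfunctor) (ψ : Q ≅ F.toProfunctorRev) : RightAdjoint P where
  R := Q
  η := mkHom _ _ (fun a b f => glue (elt φ (𝟙 _)) (coelt ψ (F.map (X := b) (Y := a) f))) (by
    intro a a' b b' f g x
    refine Eq.trans ?_ (act_glue f g _ _).symm
    refine (glue_eq_iff_mixed ψ φ _ _ _ _).2 ?_
    refine (congrArg₂ (· ≫ ·) (coval_coelt ψ _) (val_elt φ _)).trans ?_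
    refine Eq.trans ?_ (congrArg₂ (· ≫ ·) (coval_act ψ _ _ _) (val_act φ _ _ _)).symm
    rw [coval_coelt, val_elt]
    have e : act (idP A) f g x = g ≫ x ≫ f := act_wire f g x
    refine (congrArg (fun z => F.map z ≫ 𝟙 _) e).trans ?_
    have key : ∀ x : b ⟶ a, F.map (g ≫ x ≫ f) ≫ 𝟙 _ =
        (F.map g ≫ F.map x ≫ 𝟙 _) ≫ 𝟙 _ ≫ 𝟙 _ ≫ F.map f := by simp
    exact key x)
  ε := mkHom _ _ (fun b b' => compLift (fun _ y x => (val φ x ≫ coval ψ y : b' ⟶ b)) (by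
      intro a a' g y x
      rw [coval_act, val_act]
      simp
      rfl)) (by
    intro b b₁ b' b₁' f g z
    obtain ⟨a, y, x, rfl⟩ := exists_glue z
    refine (congrArg (compLift _ _) (act_glue f g y x)).trans ?_
    refine Eq.trans ?_ (act_wire f g (val φ x ≫ coval ψ y)).symm
    refine (congrArg₂ (· ≫ ·) (val_act φ _ _ _) (coval_act ψ _ _ _)).trans ?_
    simp)
  triangle_left {a b b'} x p r h := by
    have h₁ := (glue_eq_iff_mixed ψ φ _ _ _ _).1 h
    rw [coval_coelt, val_elt] at h₁
    have h₂ : 𝟙 (F.obj a) = coval ψ r ≫ val φ p := by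
      refine Eq.trans ?_ h₁
      exact ((Category.comp_id _).trans (F.map_id a)).symm
    apply val_injective φ
    rw [val_act, F.map_id, Category.comp_id]
    change (val φ x ≫ coval ψ r) ≫ val φ p = val φ x
    rw [Category.assoc, ← h₂, Category.comp_id]
  triangle_right {a b b'} y p r h := by
    have h₁ := (glue_eq_iff_mixed ψ φ _ _ _ _).1 h
    rw [coval_coelt, val_elt] at h₁
    have h₂ : 𝟙 (F.obj a) = coval ψ r ≫ val φ p := by
      refine Eq.trans ?_ h₁
      exact ((Category.comp_id _).trans (F.map_id a)).symm
    apply coval_injective ψ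
    rw [coval_act, F.map_id, Category.id_comp]
    change coval ψ r ≫ val φ p ≫ coval ψ y = coval ψ y
    rw [← Category.assoc, ← h₂, Category.id_comp]

end

/-! ### Elements of the loop 1-cell -/

section LoopCell

variable {C : Type u} [SmallCategory C] (F : RightAdjointFrobenius C)

namespace RightAdjointFrobenius

/-- A representative of an element of the source of the trace, with all wires displayed. -/
def loopEl {X X' Y Y₂ Y₃ A A₁ B B₁ Z : C} (x : El F.copairing pt (X, Y)) (b : B₁ ⟶ B) (y₂ : Y₂ ⟶ Y)
    (v : El F.mul (X, B₁) Z) (y₃ : Y₃ ⟶ Y₂) (w : El F.mulAdj.R Z (X', A₁))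
    (z : El F.pairing (Y₃, X') pt) (a : A ⟶ A₁) : El F.loopCell B A :=
  glue (P := tens F.copairing (idP C)) (a := (pt, B)) (b := ((X, Y), B₁)) (e := (pt, A))
    (pair x (wire b))
    (glue (b := (Y₂, Z)) (pair (wire y₂) v)
      (glue (b := (Y₃, (X', A₁))) (pair (wire y₃) w) (pair (P := F.pairing) z (wire a))))

variable {F} in
/-- The element of the copairing of a loop. -/
def Loop.copair {X X' : C} (ℓ : F.Loop X X') : El F.copairing pt (X, ℓ.Y) :=
  glue (P := F.one) (Q := F.comul) ℓ.p ℓ.c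

variable {F} in
/-- The element of the pairing of a loop. -/
def Loop.pairElt {X X' : C} (ℓ : F.Loop X X') : El F.pairing (ℓ.Y, X') pt :=
  glue (P := F.mul) (Q := F.counit) ℓ.s ℓ.t

lemma loopMk_eq {X X' A B Z : C} (ℓ : F.Loop X X') (v : El F.mul (X, B) Z)
    (w : El F.mulAdj.R Z (X', A)) : F.loopMk ℓ v w =
      F.loopEl ℓ.copair (𝟙 B) (𝟙 ℓ.Y) v (𝟙 ℓ.Y) w ℓ.pairElt (𝟙 A) := rfl

lemma act_loopEl {X X' Y Y₂ Y₃ A A₁ A' B B₁ B' Z : C} (x : El F.copairing pt (X, Y)) (b : B₁ ⟶ B)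
    (y₂ : Y₂ ⟶ Y) (v : El F.mul (X, B₁) Z) (y₃ : Y₃ ⟶ Y₂) (w : El F.mulAdj.R Z (X', A₁))
    (z : El F.pairing (Y₃, X') pt) (a : A ⟶ A₁) (g : B ⟶ B') (f : A' ⟶ A) :
    act F.loopCell g f (F.loopEl x b y₂ v y₃ w z a) =
      F.loopEl x (b ≫ g) y₂ v y₃ w z (f ≫ a) := by
  refine (act_glue (a := (pt, B)) (a' := (pt, B')) (e := (pt, A)) (e' := (pt, A'))
    (Prod.mkHom (𝟙 pt) g) (Prod.mkHom (𝟙 pt) f) _ _).trans ?_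
  refine congrArg₂ (glue (P := tens F.copairing (idP C)) (a := (pt, B')) (b := ((X, Y), B₁))
    (e := (pt, A'))) ?_ ?_
  · exact (coact_pair_wire_right (𝟙 pt) g x b).trans (congrArg (pair · _) (act_id _ _))
  refine (act_glue (a := ((X, Y), B₁)) (e := (pt, A)) (e' := (pt, A'))
    (𝟙 ((X, Y), B₁)) (Prod.mkHom (𝟙 pt) f) _ _).trans ?_
  refine congrArg₂ (glue (b := (Y₂, Z))) (act_id _ _) ?_
  refine (act_glue (a := (Y₂, Z)) (e := (pt, A)) (e' := (pt, A'))
    (𝟙 (Y₂, Z)) (Prod.mkHom (𝟙 pt) f) _ _).trans ?_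
  refine congrArg₂ (glue (b := (Y₃, (X', A₁)))) (act_id _ _) ?_
  exact (act_pair_wire_right (P := F.pairing) (𝟙 pt) f z a).trans
    (congrArg (pair · _) (act_id _ _))

lemma loopEl_slide_left {X X₂ X' Y Y₁ Y₂ Y₃ A A₁ B B₁ B₂ Z : C} (f : X ⟶ X₂) (g : Y ⟶ Y₁)
    (h : B₁ ⟶ B₂) (x : El F.copairing pt (X₂, Y₁)) (b : B₂ ⟶ B)
    (y₂ : Y₂ ⟶ Y) (v : El F.mul (X, B₁) Z) (y₃ : Y₃ ⟶ Y₂) (w : El F.mulAdj.R Z (X', A₁))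
    (z : El F.pairing (Y₃, X') pt) (a : A ⟶ A₁) :
    F.loopEl (act F.copairing (𝟙 pt) (Prod.mkHom f g) x) (h ≫ b) y₂ v y₃ w z a =
      F.loopEl x b (y₂ ≫ g) (act F.mul (Prod.mkHom f h) (𝟙 Z) v) y₃ w z a := by
  have h₁ := act_pair_wire_right (P := F.copairing) (Prod.mkHom f g) h x b
  have h₂ := coact_pair_wire_left (Prod.mkHom f h) g v y₂
  refine (congrArg (fun t => glue (P := tens F.copairing (idP C)) (a := (pt, B))
    (b := ((X, Y), B₁)) (e := (pt, A)) t _) h₁).symm.trans ?_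
  refine (glue_slide (a := (pt, B)) (b := ((X, Y), B₁)) (b' := ((X₂, Y₁), B₂)) (e := (pt, A))
    (Prod.mkHom (Prod.mkHom f g) h) _ _).trans ?_
  refine congrArg (glue (P := tens F.copairing (idP C)) (a := (pt, B)) (b := ((X₂, Y₁), B₂))
    (e := (pt, A)) _) ?_
  refine (act_glue (a := ((X, Y), B₁)) (a' := ((X₂, Y₁), B₂)) (e := (pt, A)) (e' := (pt, A))
    (Prod.mkHom (Prod.mkHom f g) h) (𝟙 (pt, A)) _ _).trans ?_
  exact congrArg₂ (glue (b := (Y₂, Z))) h₂ (act_id _ _)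

lemma loopEl_slide_mid {X X' Y Y₁ Y₂ Y₃ A A₁ B B₁ Z Z₁ : C} (g : Y₁ ⟶ Y₂)
    (h : Z₁ ⟶ Z) (x : El F.copairing pt (X, Y)) (b : B₁ ⟶ B)
    (y₂ : Y₂ ⟶ Y) (v : El F.mul (X, B₁) Z) (y₃ : Y₃ ⟶ Y₁) (w : El F.mulAdj.R Z₁ (X', A₁))
    (z : El F.pairing (Y₃, X') pt) (a : A ⟶ A₁) :
    F.loopEl x b (g ≫ y₂) (act F.mul (𝟙 (X, B₁)) h v) y₃ w z a =
      F.loopEl x b y₂ v (y₃ ≫ g) (act F.mulAdj.R h (𝟙 (X', A₁)) w) z a := by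
  have h₁ := act_pair_wire_left h g v y₂
  have h₂ := coact_pair_wire_left h g w y₃
  refine congrArg (glue (P := tens F.copairing (idP C)) (a := (pt, B)) (b := ((X, Y), B₁))
    (e := (pt, A)) _) ?_
  refine (congrArg (fun t => glue (P := (tens (idP C) F.mul).whiskerLeft₂ (reorder C)
    (𝟭 (C × C))) (a := ((X, Y), B₁)) (b := (Y₁, Z₁)) (e := (pt, A)) t _) h₁).symm.trans ?_
  refine (glue_slide (b := (Y₁, Z₁)) (b' := (Y₂, Z)) (e := (pt, A)) (Prod.mkHom g h) _ _).trans ?_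
  refine congrArg (glue (b := (Y₂, Z)) _) ?_
  refine (act_glue (a := (Y₁, Z₁)) (a' := (Y₂, Z)) (e := (pt, A)) (e' := (pt, A))
    (Prod.mkHom g h) (𝟙 (pt, A)) _ _).trans ?_
  exact congrArg₂ (glue (b := (Y₃, (X', A₁)))) h₂ (act_id _ _)

lemma loopEl_slide_right {X X' X₁ Y Y₂ Y₃ Y₄ A A₁ A₂ B B₁ Z : C} (g : Y₄ ⟶ Y₃) (f : X₁ ⟶ X')
    (h : A₂ ⟶ A₁) (x : El F.copairing pt (X, Y)) (b : B₁ ⟶ B)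
    (y₂ : Y₂ ⟶ Y) (v : El F.mul (X, B₁) Z) (y₃ : Y₃ ⟶ Y₂) (w : El F.mulAdj.R Z (X', A₁))
    (z : El F.pairing (Y₄, X₁) pt) (a : A ⟶ A₂) :
    F.loopEl x b y₂ v (g ≫ y₃) (act F.mulAdj.R (𝟙 Z) (Prod.mkHom f h) w) z a =
      F.loopEl x b y₂ v y₃ w (act F.pairing (Prod.mkHom g f) (𝟙 pt) z) (a ≫ h) := by
  have h₁ := act_pair_wire_left (Prod.mkHom f h) g w y₃
  have h₂ := coact_pair_wire_right (P := F.pairing) (Prod.mkHom g f) h z a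
  refine congrArg (glue (P := tens F.copairing (idP C)) (a := (pt, B)) (b := ((X, Y), B₁))
    (e := (pt, A)) _) ?_
  refine congrArg (glue (b := (Y₂, Z)) _) ?_
  refine (congrArg (fun t => glue (P := tens (idP C) F.mulAdj.R) (a := (Y₂, Z))
    (b := (Y₄, (X₁, A₂))) (e := (pt, A)) t _) h₁).symm.trans ?_
  refine (glue_slide (b := (Y₄, (X₁, A₂))) (b' := (Y₃, (X', A₁))) (e := (pt, A))
    (Prod.mkHom g (Prod.mkHom f h)) _ _).trans ?_
  exact congrArg (glue (b := (Y₃, (X', A₁))) _) h₂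

lemma exists_loopEl {A B : C} (q : El F.loopCell B A) :
    ∃ (X X' Y Y₂ Y₃ A₁ B₁ Z : C) (x : El F.copairing pt (X, Y)) (b : B₁ ⟶ B) (y₂ : Y₂ ⟶ Y)
      (v : El F.mul (X, B₁) Z) (y₃ : Y₃ ⟶ Y₂) (w : El F.mulAdj.R Z (X', A₁))
      (z : El F.pairing (Y₃, X') pt) (a : A ⟶ A₁), q = F.loopEl x b y₂ v y₃ w z a := by
  obtain ⟨⟨⟨X, Y⟩, B₁⟩, ⟨x, b⟩, q₂, rfl⟩ := exists_glue (a := (pt, B)) (e := (pt, A)) q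
  obtain ⟨⟨Y₂, Z⟩, ⟨y₂, v⟩, q₃, rfl⟩ := exists_glue q₂
  obtain ⟨⟨Y₃, ⟨X', A₁⟩⟩, ⟨y₃, w⟩, ⟨z, a⟩, rfl⟩ := exists_glue q₃
  exact ⟨X, X', Y, Y₂, Y₃, A₁, B₁, Z, x, b, y₂, v, y₃, w, z, a, rfl⟩

lemma loopMk_slide_mid {X X' A B Z Z₁ : C} (ℓ : F.Loop X X') (h : Z₁ ⟶ Z)
    (v : El F.mul (X, B) Z) (w : El F.mulAdj.R Z₁ (X', A)) :
    F.loopMk ℓ (act F.mul (𝟙 (X, B)) h v) w =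
      F.loopMk ℓ v (act F.mulAdj.R h (𝟙 (X', A)) w) := by
  have e₁ := F.loopEl_slide_mid (𝟙 ℓ.Y) h ℓ.copair (𝟙 B) (𝟙 ℓ.Y) v (𝟙 ℓ.Y) w ℓ.pairElt (𝟙 A)
  simp only [Category.comp_id] at e₁
  exact e₁

lemma act_loopMk {X X' A B A' B' Z : C} (ℓ : F.Loop X X') (v : El F.mul (X, B) Z)
    (w : El F.mulAdj.R Z (X', A)) (g : B ⟶ B') (f : A' ⟶ A) :
    act F.loopCell g f (F.loopMk ℓ v w) =
      F.loopMk ℓ (act F.mul (Prod.mkHom (𝟙 X) g) (𝟙 Z) v)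
        (act F.mulAdj.R (𝟙 Z) (Prod.mkHom (𝟙 X') f) w) := by
  rw [F.loopMk_eq, F.act_loopEl, F.loopMk_eq]
  have e₁ := F.loopEl_slide_left (𝟙 X) (𝟙 ℓ.Y) g ℓ.copair (𝟙 B') (𝟙 ℓ.Y) v (𝟙 ℓ.Y) w
    ℓ.pairElt (f ≫ 𝟙 A)
  have e₂ := F.loopEl_slide_right (𝟙 ℓ.Y) (𝟙 X') f ℓ.copair (𝟙 B') (𝟙 ℓ.Y)
    (act F.mul (Prod.mkHom (𝟙 X) g) (𝟙 Z) v) (𝟙 ℓ.Y) w ℓ.pairElt (𝟙 A')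
  have i₁ : act F.copairing (𝟙 pt) (Prod.mkHom (𝟙 X) (𝟙 ℓ.Y)) ℓ.copair = ℓ.copair :=
    act_id _ _
  have i₂ : act F.pairing (Prod.mkHom (𝟙 ℓ.Y) (𝟙 X')) (𝟙 pt) ℓ.pairElt = ℓ.pairElt :=
    act_id _ _
  simp only [Category.comp_id, Category.id_comp, i₁] at e₁
  simp only [Category.comp_id, Category.id_comp, i₂] at e₂
  simp only [Category.comp_id, Category.id_comp]
  rw [e₁, e₂]

end RightAdjointFrobenius

end LoopCell

/-! ### Adjoints and loops in terms of morphisms -/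

section

variable {A B : Type u} [SmallCategory A] [SmallCategory B]

/-- The unit has some representing pair, for which the equation holds; any other pair satisfying it
has the same composite value and hence the same class. -/
lemma RightAdjoint.isUnit_iff {P : Profunctor.{u} A B} (h : RightAdjoint P) {F : A ⥤ B}
    (φ : P ≅ F.toProfunctor) {a : A} {b : B} {p : El P a b} {r : El h.R b a} :
    h.IsUnit p r ↔ coval (h.corep φ) r ≫ val φ p = 𝟙 _ := by
  refine ⟨h.isUnit_eq φ, fun e => ?_⟩
  obtain ⟨b', p', r', e'⟩ := exists_glue (app₂ h.η (wire (𝟙 a)))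
  refine e'.trans ((glue_eq_iff_mixed (h.corep φ) φ _ _ _ _).2 ?_)
  rw [e, h.isUnit_eq φ e']

end

namespace FrobDict

variable {C : Type u} [SmallCategory C] {F : RightAdjointFrobenius C} {S : LinearlyDistributive C}
  (E : FrobDict F.toFrobeniusData S.toTwoMonoidal S.δL S.δR)

/-- The morphism of an element of the right adjoint of the multiplication. -/
noncomputable def mR {X Y Z : C} (w : El F.mulAdj.R Z (X, Y)) : S.p X Y ⟶ Z :=
  coval (F.mulAdj.corep E.par.mul) w

/-- The element of the right adjoint of the multiplication with a given morphism. -/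
noncomputable def mRElt {X Y Z : C} (f : S.p X Y ⟶ Z) : El F.mulAdj.R Z (X, Y) :=
  coelt (F.mulAdj.corep E.par.mul) (b := (X, Y)) f

/-- The morphism of an element of the right adjoint of the unit. -/
noncomputable def uR {Z : C} (y : El F.oneAdj.R Z pt) : S.bot ⟶ Z :=
  coval (F.oneAdj.corep E.par.one) y

/-- The element of the right adjoint of the unit with a given morphism. -/
noncomputable def uRElt {Z : C} (f : S.bot ⟶ Z) : El F.oneAdj.R Z pt :=
  coelt (F.oneAdj.corep E.par.one) (b := pt) f

@[simp] lemma mR_mRElt {X Y Z : C} (f : S.p X Y ⟶ Z) : E.mR (E.mRElt f) = f :=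
  coval_coelt (F.mulAdj.corep E.par.mul) (b := (X, Y)) f
@[simp] lemma uR_uRElt {Z : C} (f : S.bot ⟶ Z) : E.uR (E.uRElt f) = f :=
  coval_coelt (F.oneAdj.corep E.par.one) (b := pt) f

lemma mR_injective {X Y Z : C} {w w' : El F.mulAdj.R Z (X, Y)} (h : E.mR w = E.mR w') : w = w' :=
  coval_injective (F.mulAdj.corep E.par.mul) h

lemma m_act {X Y X' Y' Z Z' : C} (f : X ⟶ X') (h : Y ⟶ Y') (g : Z' ⟶ Z) (a : El F.mul (X, Y) Z) :
    E.m (act F.mul (Prod.mkHom f h) g a) = g ≫ E.m a ≫ S.par.tensorHom f h :=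
  E.par.m_act _ _ _

lemma mR_act {X Y X' Y' Z Z' : C} (g : Z ⟶ Z') (f : X' ⟶ X) (h : Y' ⟶ Y)
    (w : El F.mulAdj.R Z (X, Y)) :
    E.mR (act F.mulAdj.R g (Prod.mkHom f h) w) = S.par.tensorHom f h ≫ E.mR w ≫ g :=
  coval_act (F.mulAdj.corep E.par.mul) g (Prod.mkHom f h) w

lemma mR_act_id {X Y Z Z' : C} (g : Z ⟶ Z') (w : El F.mulAdj.R Z (X, Y)) :
    E.mR (act F.mulAdj.R g (𝟙 (X, Y)) w) = E.mR w ≫ g :=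
  (E.mR_act g (𝟙 X) (𝟙 Y) w).trans (by rw [S.pHom_id, Category.id_comp])

lemma mR_act_left {X Y X' Z : C} (f : X' ⟶ X) (w : El F.mulAdj.R Z (X, Y)) :
    E.mR (act F.mulAdj.R (𝟙 Z) (Prod.mkHom f (𝟙 Y)) w) = S.pR f Y ≫ E.mR w :=
  (E.mR_act (𝟙 Z) f (𝟙 Y) w).trans (by rw [S.pHom_left, Category.comp_id])

lemma mR_act_right {X Y Y' Z : C} (f : Y' ⟶ Y) (w : El F.mulAdj.R Z (X, Y)) :
    E.mR (act F.mulAdj.R (𝟙 Z) (Prod.mkHom (𝟙 X) f) w) = S.pL X f ≫ E.mR w :=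
  (E.mR_act (𝟙 Z) (𝟙 X) f w).trans (by rw [S.pHom_right, Category.comp_id])

lemma mul_counit {X Y Z Z' : C} (w : El F.mulAdj.R Z (X, Y)) (v : El F.mul (X, Y) Z') :
    F.mulAdj.counit w v = E.m v ≫ E.mR w := F.mulAdj.counit_eq E.par.mul w v

lemma one_counit {Z Z' : C} (y : El F.oneAdj.R Z pt) (x : El F.one pt Z') :
    F.oneAdj.counit y x = E.u x ≫ E.uR y := F.oneAdj.counit_eq E.par.one y x

lemma mul_isUnit_iff {X Y Z : C} {a : El F.mul (X, Y) Z} {q : El F.mulAdj.R Z (X, Y)} :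
    F.mulAdj.IsUnit a q ↔ E.mR q ≫ E.m a = 𝟙 (S.p X Y) := F.mulAdj.isUnit_iff E.par.mul

lemma one_isUnit_iff {Z : C} {x : El F.one pt Z} {y : El F.oneAdj.R Z pt} :
    F.oneAdj.IsUnit x y ↔ E.uR y ≫ E.u x = 𝟙 S.bot := F.oneAdj.isUnit_iff E.par.one

/-- The morphism of an element of the copairing. -/
def copairVal {X Y : C} (x : El F.copairing pt (X, Y)) : S.t X Y ⟶ S.bot :=
  compLift (P := F.one) (Q := F.comul) (fun _ p c => E.d c ≫ E.u p) (by
    intro b b' g p c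
    have h₁ := E.d_act_id g c
    exact ((congrArg (E.d c ≫ ·) (E.u_act g p)).trans (Category.assoc _ _ _).symm).trans
      (congrArg (· ≫ E.u p) h₁.symm)) x

lemma copairVal_glue {X Y P : C} (p : El F.one pt P) (c : El F.comul P (X, Y)) :
    E.copairVal (glue p c : El (comp F.one F.comul) pt (X, Y)) = E.d c ≫ E.u p := rfl

lemma copairVal_act {X Y X' Y' : C} (f : X' ⟶ X) (g : Y' ⟶ Y) (x : El F.copairing pt (X, Y)) :
    E.copairVal (act F.copairing (𝟙 pt) (Prod.mkHom f g) x) =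
      S.tensor.tensorHom f g ≫ E.copairVal x := by
  obtain ⟨P, p, c, rfl⟩ := exists_glue (P := F.one) (Q := F.comul) x
  refine (congrArg E.copairVal (act_glue (P := F.one) (Q := F.comul) (𝟙 pt) (Prod.mkHom f g)
    p c)).trans ?_
  refine (E.copairVal_glue _ _).trans ?_
  refine (congrArg₂ (· ≫ ·) (E.tensor.d_act (𝟙 P) (Prod.mkHom f g) c) (E.u_act (𝟙 P) p)).trans ?_
  refine Eq.trans ?_ (congrArg (S.tensor.tensorHom f g ≫ ·) (E.copairVal_glue p c).symm)
  refine (congrArg₂ (· ≫ ·) (congrArg (S.tensor.tensorHom f g ≫ ·) (Category.comp_id (E.d c)))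
    (Category.id_comp (E.u p))).trans (Category.assoc _ _ _)

/-- The morphism of an element of the pairing. -/
def pairVal {X Y : C} (x : El F.pairing (X, Y) pt) : S.tI ⟶ S.p X Y :=
  compLift (P := F.mul) (Q := F.counit) (fun _ s t => E.e t ≫ E.m s) (by
    intro b b' g s t
    have h₁ := E.m_act_id g s
    exact ((congrArg (E.e t ≫ ·) h₁).trans (Category.assoc _ _ _).symm).trans
      (congrArg (· ≫ E.m s) (E.e_act g t).symm)) x

lemma pairVal_glue {X Y Q : C} (s : El F.mul (X, Y) Q) (t : El F.counit Q pt) :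
    E.pairVal (glue s t : El (comp F.mul F.counit) (X, Y) pt) = E.e t ≫ E.m s := rfl

lemma pairVal_act {X Y X' Y' : C} (f : X ⟶ X') (g : Y ⟶ Y') (x : El F.pairing (X, Y) pt) :
    E.pairVal (act F.pairing (Prod.mkHom f g) (𝟙 pt) x) =
      E.pairVal x ≫ S.par.tensorHom f g := by
  obtain ⟨Q, s, t, rfl⟩ := exists_glue (P := F.mul) (Q := F.counit) x
  refine (congrArg E.pairVal (act_glue (P := F.mul) (Q := F.counit) (Prod.mkHom f g) (𝟙 pt)
    s t)).trans ?_
  refine (E.pairVal_glue _ _).trans ?_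
  refine (congrArg₂ (· ≫ ·) (E.e_act (𝟙 Q) t) (E.m_act f g (𝟙 Q) s)).trans ?_
  refine Eq.trans ?_ (congrArg (· ≫ S.par.tensorHom f g) (E.pairVal_glue s t).symm)
  refine (congrArg₂ (· ≫ ·) (Category.comp_id (E.e t)) (Category.id_comp _)).trans
    (Category.assoc _ _ _).symm

lemma copairVal_injective {X Y : C} {x y : El F.copairing pt (X, Y)}
    (h : E.copairVal x = E.copairVal y) : x = y := by
  obtain ⟨P, p, c, rfl⟩ := exists_glue (P := F.one) (Q := F.comul) x
  obtain ⟨P', p', c', rfl⟩ := exists_glue (P := F.one) (Q := F.comul) y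
  exact (glue_eq_iff_mixed E.tensor.comul E.par.one _ _ _ _).2 h

lemma pairVal_injective {X Y : C} {x y : El F.pairing (X, Y) pt}
    (h : E.pairVal x = E.pairVal y) : x = y := by
  obtain ⟨P, p, c, rfl⟩ := exists_glue (P := F.mul) (Q := F.counit) x
  obtain ⟨P', p', c', rfl⟩ := exists_glue (P := F.mul) (Q := F.counit) y
  exact (glue_eq_iff_mixed E.tensor.counit E.par.mul _ _ _ _).2 h

/-- The morphism to which the snake isomorphism straightens a loop. -/
def loopHom {X X' : C} (ℓ : F.Loop X X') : X ⟶ X' :=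
  S.snake (E.d ℓ.c ≫ E.u ℓ.p) (E.e ℓ.t ≫ E.m ℓ.s)

/-- The loop with a given copairing and a given pairing. -/
def loop {X Y X' : C} (τ : S.t X Y ⟶ S.bot) (γ : S.tI ⟶ S.p Y X') : F.Loop X X' where
  p := E.uElt (𝟙 S.bot)
  c := E.dElt τ
  s := E.mElt γ
  t := E.eElt (𝟙 S.tI)

lemma loopHom_loop {X Y X' : C} (τ : S.t X Y ⟶ S.bot) (γ : S.tI ⟶ S.p Y X') :
    E.loopHom (E.loop τ γ) = S.snake τ γ := by
  simp [loopHom, loop]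

/-- The distributor equation for the Frobenius 2-cell shows that every choice of the intermediate
elements gives the same contraction, and such elements exist because the 2-cell always has a value.
-/
lemma snake_iff {X X' : C} (ℓ : F.Loop X X') (h : X ⟶ X') : ℓ.Snake h ↔ h = E.loopHom ℓ := by
  have key : ∀ {R : C} (a : El F.mul (ℓ.P, X') R) (b : El F.comul R (X, ℓ.Q)),
      F.FrobL ℓ.c ℓ.s a b → F.corho b ℓ.t ≫ F.lam ℓ.p a = E.loopHom ℓ := by
    intro R a b hab
    rw [E.frobL] at hab
    rw [E.corho, E.lam, loopHom, LinearlyDistributive.snake]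
    simp only [Category.assoc]
    rw [← reassoc_of% hab]
    simp only [S.tL_comp, S.pR_comp, Category.assoc]
  constructor
  · rintro ⟨R, a, b, hab, rfl⟩
    exact key a b hab
  · rintro rfl
    -- The definition of straightening asks for a representative of the Frobenius 2-cell; any
    -- representative will do.
    obtain ⟨R, a, b, hab⟩ := exists_glue (app₂ F.frobL.hom (a := (ℓ.P, X')) (b := (X, ℓ.Q))
      (glue (b := ((X, ℓ.Y), X')) (pair ℓ.c (wire (𝟙 X'))) (pair (wire (𝟙 X)) ℓ.s)))
    exact ⟨R, a, b, hab, (key a b hab).symm⟩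

/-- The element of the copairing with a given morphism. -/
def copair {X Y : C} (τ : S.t X Y ⟶ S.bot) : El F.copairing pt (X, Y) :=
  glue (P := F.one) (Q := F.comul) (E.uElt (𝟙 S.bot)) (E.dElt τ)

/-- The element of the pairing with a given morphism. -/
def pairElt {X Y : C} (γ : S.tI ⟶ S.p X Y) : El F.pairing (X, Y) pt :=
  glue (P := F.mul) (Q := F.counit) (E.mElt γ) (E.eElt (𝟙 S.tI))

@[simp] lemma copairVal_copair {X Y : C} (τ : S.t X Y ⟶ S.bot) : E.copairVal (E.copair τ) = τ :=
  (E.copairVal_glue _ _).trans (by simp)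

@[simp] lemma pairVal_pairElt {X Y : C} (γ : S.tI ⟶ S.p X Y) : E.pairVal (E.pairElt γ) = γ :=
  (E.pairVal_glue _ _).trans (by simp)

lemma copair_copairVal {X Y : C} (x : El F.copairing pt (X, Y)) : E.copair (E.copairVal x) = x :=
  E.copairVal_injective (E.copairVal_copair _)

lemma pairElt_pairVal {X Y : C} (x : El F.pairing (X, Y) pt) : E.pairElt (E.pairVal x) = x :=
  E.pairVal_injective (E.pairVal_pairElt _)

lemma loopMk_loop {X Y X' A B Z : C} (τ : S.t X Y ⟶ S.bot) (γ : S.tI ⟶ S.p Y X')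
    (v : El F.mul (X, B) Z) (w : El F.mulAdj.R Z (X', A)) :
    F.loopMk (E.loop τ γ) v w = F.loopEl (E.copair τ) (𝟙 B) (𝟙 Y) v (𝟙 Y) w (E.pairElt γ) (𝟙 A) :=
  rfl

/-- The copairing and the pairing are themselves composites, whose classes are given by one morphism
each. So the intermediate objects `P` and `Q` of a loop can be taken to be `⊥` and `I`. -/
lemma loopMk_eq_loop {X X' A B Z : C} (ℓ : F.Loop X X') (v : El F.mul (X, B) Z)
    (w : El F.mulAdj.R Z (X', A)) :
    F.loopMk ℓ v w = F.loopMk (E.loop (E.d ℓ.c ≫ E.u ℓ.p) (E.e ℓ.t ≫ E.m ℓ.s)) v w := by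
  have h₁ := E.copair_copairVal (glue (P := F.one) (Q := F.comul) ℓ.p ℓ.c)
  have h₂ := E.pairElt_pairVal (glue (P := F.mul) (Q := F.counit) ℓ.s ℓ.t)
  refine (F.loopMk_eq ℓ v w).trans ?_
  refine Eq.trans ?_ (E.loopMk_loop _ _ v w).symm
  exact congrArg₂ (fun x z => F.loopEl x (𝟙 B) (𝟙 ℓ.Y) v (𝟙 ℓ.Y) w z (𝟙 A)) h₁.symm h₂.symm

/-- The return wire of the loop crosses two layers between the copairing and the pairing, so a
morphism travels along it by three coend relations. -/
lemma loopMk_slide {X Y Y₁ X' A B Z : C} (g : Y ⟶ Y₁) (τ : S.t X Y₁ ⟶ S.bot)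
    (γ : S.tI ⟶ S.p Y X') (v : El F.mul (X, B) Z) (w : El F.mulAdj.R Z (X', A)) :
    F.loopMk (E.loop (S.tL X g ≫ τ) γ) v w = F.loopMk (E.loop τ (γ ≫ S.pR g X')) v w := by
  have h₁ : E.copair (S.tL X g ≫ τ) =
      act F.copairing (𝟙 pt) (Prod.mkHom (𝟙 X) g) (E.copair τ) :=
    E.copairVal_injective (by rw [E.copairVal_act, E.copairVal_copair, E.copairVal_copair,
      S.tHom_right])
  have h₂ : E.pairElt (γ ≫ S.pR g X') =
      act F.pairing (Prod.mkHom g (𝟙 X')) (𝟙 pt) (E.pairElt γ) :=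
    E.pairVal_injective (by rw [E.pairVal_act, E.pairVal_pairElt, E.pairVal_pairElt, S.pHom_left])
  rw [E.loopMk_loop, E.loopMk_loop, h₁, h₂]
  have e₁ := F.loopEl_slide_left (𝟙 X) g (𝟙 B) (E.copair τ) (𝟙 B) (𝟙 Y) v (𝟙 Y) w (E.pairElt γ)
    (𝟙 A)
  have e₂ := F.loopEl_slide_mid g (𝟙 Z) (E.copair τ) (𝟙 B) (𝟙 Y₁) v (𝟙 Y) w (E.pairElt γ) (𝟙 A)
  have e₃ := F.loopEl_slide_right g (𝟙 X') (𝟙 A) (E.copair τ) (𝟙 B) (𝟙 Y₁) v (𝟙 Y₁) w (E.pairElt γ)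
    (𝟙 A)
  have i₁ : act F.mul (Prod.mkHom (𝟙 X) (𝟙 B)) (𝟙 Z) v = v := act_id _ _
  have i₂ : act F.mul (𝟙 (X, B)) (𝟙 Z) v = v := act_id _ _
  have i₃ : act F.mulAdj.R (𝟙 Z) (𝟙 (X', A)) w = w := act_id _ _
  have i₄ : act F.mulAdj.R (𝟙 Z) (Prod.mkHom (𝟙 X') (𝟙 A)) w = w := act_id _ _
  simp only [Category.comp_id, Category.id_comp, i₁] at e₁
  simp only [Category.comp_id, Category.id_comp, i₂, i₃] at e₂
  simp only [Category.comp_id, i₄] at e₃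
  rw [e₁, e₂, e₃]

lemma loopMk_slide_left {X₁ X Y X' A B Z : C} (f : X₁ ⟶ X) (τ : S.t X Y ⟶ S.bot)
    (γ : S.tI ⟶ S.p Y X') (v : El F.mul (X₁, B) Z) (w : El F.mulAdj.R Z (X', A)) :
    F.loopMk (E.loop (S.tR f Y ≫ τ) γ) v w =
      F.loopMk (E.loop τ γ) (act F.mul (Prod.mkHom f (𝟙 B)) (𝟙 Z) v) w := by
  have h₁ : E.copair (S.tR f Y ≫ τ) =
      act F.copairing (𝟙 pt) (Prod.mkHom f (𝟙 Y)) (E.copair τ) :=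
    E.copairVal_injective (by rw [E.copairVal_act, E.copairVal_copair, E.copairVal_copair,
      S.tHom_left])
  rw [E.loopMk_loop, E.loopMk_loop, h₁]
  have e₁ := F.loopEl_slide_left f (𝟙 Y) (𝟙 B) (E.copair τ) (𝟙 B) (𝟙 Y) v (𝟙 Y) w (E.pairElt γ)
    (𝟙 A)
  simpa only [Category.comp_id] using e₁

lemma loopMk_slide_right {X Y X₁ X' A B Z : C} (f : X₁ ⟶ X') (τ : S.t X Y ⟶ S.bot)
    (γ : S.tI ⟶ S.p Y X₁) (v : El F.mul (X, B) Z) (w : El F.mulAdj.R Z (X', A)) :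
    F.loopMk (E.loop τ (γ ≫ S.pL Y f)) v w =
      F.loopMk (E.loop τ γ) v (act F.mulAdj.R (𝟙 Z) (Prod.mkHom f (𝟙 A)) w) := by
  have h₁ : E.pairElt (γ ≫ S.pL Y f) =
      act F.pairing (Prod.mkHom (𝟙 Y) f) (𝟙 pt) (E.pairElt γ) :=
    E.pairVal_injective (by rw [E.pairVal_act, E.pairVal_pairElt, E.pairVal_pairElt, S.pHom_right])
  rw [E.loopMk_loop, E.loopMk_loop, h₁]
  have e₁ := F.loopEl_slide_right (𝟙 Y) f (𝟙 A) (E.copair τ) (𝟙 B) (𝟙 Y) v (𝟙 Y) w (E.pairElt γ)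
    (𝟙 A)
  simp only [Category.comp_id] at e₁
  exact e₁.symm

/-- An element of the source of the trace depends on the loop only through its straightening. -/
lemma loopMk_eq_of_dual {X X' B A Z D : C} {τ : S.t X D ⟶ S.bot} {γ : S.tI ⟶ S.p D X}
    (h : S.snake τ γ = 𝟙 X) (ℓ : F.Loop X X') (v : El F.mul (X, B) Z)
    (w : El F.mulAdj.R Z (X', A)) :
    F.loopMk ℓ v w = F.loopMk (E.loop τ γ) (E.mElt (S.pR (E.loopHom ℓ) A ≫ E.mR w ≫ E.m v))
      (E.mRElt (𝟙 (S.p X A))) := by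
  -- The copairing of the loop factors through the evaluation `τ` of the dual by its transpose.
  -- Sliding that transpose to the other end turns the pairing of the loop into `γ` followed by the
  -- straightening, which then leaves the loop.
  have h₁ := S.snake_pairing τ γ (E.d ℓ.c ≫ E.u ℓ.p)
  have h₂ := S.copairing_cosnake γ (E.d ℓ.c ≫ E.u ℓ.p) (E.e ℓ.t ≫ E.m ℓ.s)
  rw [h, S.tR_id, Category.id_comp] at h₁
  rw [E.loopMk_eq_loop, h₁, E.loopMk_slide, h₂, E.loopMk_slide_right]
  -- The element of the right adjoint is a transport of the universal one, and the transporting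
  -- morphism slides across `Z` into the multiplication.
  have e₁ : act F.mulAdj.R (𝟙 Z) (Prod.mkHom (E.loopHom ℓ) (𝟙 A)) w =
      act F.mulAdj.R (S.pR (E.loopHom ℓ) A ≫ E.mR w) (𝟙 (X, A)) (E.mRElt (𝟙 (S.p X A))) :=
    E.mR_injective (by rw [E.mR_act_left, E.mR_act_id, E.mR_mRElt, Category.id_comp])
  have e₂ : E.mElt (S.pR (E.loopHom ℓ) A ≫ E.mR w ≫ E.m v) =
      act F.mul (𝟙 (X, B)) (S.pR (E.loopHom ℓ) A ≫ E.mR w) v :=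
    E.m_injective (by rw [E.m_mElt]; exact ((E.m_act_id _ _).trans (Category.assoc _ _ _)).symm)
  rw [e₂, F.loopMk_slide_mid, ← e₁]
  rfl

end FrobDict

/-! ### The trace of an interpretation -/

section

variable {C : Type u} [SmallCategory C]

/-- A dual of `X` bends any morphism into a loop. In particular, the equations for the trace can be
tested with loops that straighten to identities. -/
lemma FrobDict.exists_loop {F : RightAdjointFrobenius C} {S : StarAutonomous C}
    (E : FrobDict F.toFrobeniusData S.toTwoMonoidal S.δL S.δR) {X X' : C} (h : X ⟶ X') :
    ∃ ℓ : F.Loop X X', E.loopHom ℓ = h := by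
  obtain ⟨D, τ, γ, h₁, -⟩ := S.exists_right_dual X
  refine ⟨E.loop τ (γ ≫ S.pL D h), ?_⟩
  rw [E.loopHom_loop, S.snake_pL, LinearlyDistributive.snake, h₁, Category.id_comp]

namespace Interpretation

variable (I : Interpretation C) {S : StarAutonomous C}
  (E : FrobDict I.toFrobeniusData S.toTwoMonoidal S.δL S.δR)

/-- The trace of an interpretation, on the morphisms of a `*`-autonomous category. -/
noncomputable def traceFun (X : C) {A B : C} (f : S.p X A ⟶ S.p X B) : A ⟶ B :=
  trVal I.trace
    (E.loop (S.exists_right_dual X).choose_spec.choose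
      (S.exists_right_dual X).choose_spec.choose_spec.choose)
    (E.mElt f) (E.mRElt (𝟙 (S.p X A)))

/-- The trace 2-cell is recovered from the functions `traceFun`, because its argument is equal to
one with the chosen dual and universal element of the right adjoint. -/
lemma trVal_eq {A B X X' Z : C} (ℓ : I.Loop X X') (v : El I.mul (X, B) Z)
    (w : El I.mulAdj.R Z (X', A)) :
    trVal I.trace ℓ v w = I.traceFun E X (S.pR (E.loopHom ℓ) A ≫ E.mR w ≫ E.m v) :=
  congrArg (fun z => (app₂ I.trace z : A ⟶ B))
    (E.loopMk_eq_of_dual (S.exists_right_dual X).choose_spec.choose_spec.choose_spec.1 ℓ v w)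

/-- Independence of the chosen dual: any loop straightening to the identity computes the same trace.
-/
lemma traceFun_eq {X A B : C} (ℓ : I.Loop X X) (h : E.loopHom ℓ = 𝟙 X)
    (f : S.p X A ⟶ S.p X B) :
    I.traceFun E X f = trVal I.trace ℓ (E.mElt f) (E.mRElt (𝟙 (S.p X A))) := by
  rw [I.trVal_eq E, h, S.pR_id, E.mR_mRElt, E.m_mElt, Category.id_comp, Category.id_comp]

lemma traceFun_naturality (X : C) {A A' B B' : C} (g : A' ⟶ A) (f : S.p X A ⟶ S.p X B)
    (h : B ⟶ B') : I.traceFun E X (S.pL X g ≫ f ≫ S.pL X h) = g ≫ I.traceFun E X f ≫ h := by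
  obtain ⟨ℓ, hℓ⟩ := E.exists_loop (𝟙 X)
  rw [I.traceFun_eq E ℓ hℓ f]
  have e₁ := app₂_act I.trace h g (I.loopMk ℓ (E.mElt f) (E.mRElt (𝟙 (S.p X A))))
  rw [I.act_loopMk] at e₁
  have e₂ : g ≫ trVal I.trace ℓ (E.mElt f) (E.mRElt (𝟙 (S.p X A))) ≫ h =
      trVal I.trace ℓ (act I.mul (Prod.mkHom (𝟙 X) h) (𝟙 (S.p X A)) (E.mElt f))
        (act I.mulAdj.R (𝟙 (S.p X A)) (Prod.mkHom (𝟙 X) g) (E.mRElt (𝟙 (S.p X A)))) :=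
    (act_wire h g _).symm.trans e₁.symm
  rw [e₂, I.trVal_eq E, hℓ, S.pR_id, Category.id_comp, E.mR_act_right, E.m_act_right]
  simp

/-- Dinaturality is the coend relation at the wire `X`: the morphism `k` leaves the multiplication
for the copairing of the loop, and the modified loop straightens to `k`, which reappears in front of
`f`. -/
lemma traceFun_sliding {X X' A B : C} (k : X' ⟶ X) (f : S.p X A ⟶ S.p X' B) :
    I.traceFun E X (f ≫ S.pR k B) = I.traceFun E X' (S.pR k A ≫ f) := by
  obtain ⟨D, τ, γ, h₁, -⟩ := S.exists_right_dual X
  rw [I.traceFun_eq E (E.loop τ γ) ((E.loopHom_loop τ γ).trans h₁)]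
  have e₁ : E.mElt (f ≫ S.pR k B) = act I.mul (Prod.mkHom k (𝟙 B)) (𝟙 (S.p X A)) (E.mElt f) :=
    E.m_injective (by rw [E.m_act_left, E.m_mElt, E.m_mElt, Category.id_comp])
  have e₂ := E.loopMk_slide_left k τ γ (E.mElt f) (E.mRElt (𝟙 (S.p X A)))
  rw [e₁]
  refine (congrArg (fun z => (app₂ I.trace z : A ⟶ B)) e₂.symm).trans ?_
  refine (I.trVal_eq E _ _ _).trans ?_
  rw [E.loopHom_loop, S.snake_tR, LinearlyDistributive.snake, h₁, Category.comp_id, E.mR_mRElt,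
    E.m_mElt, Category.id_comp]

lemma traceFun_vanishing_unit {A B : C} (f : S.p S.bot A ⟶ S.p S.bot B) :
    I.traceFun E S.bot f = (S.plam A).inv ≫ f ≫ (S.plam B).hom := by
  obtain ⟨ℓ, hℓ⟩ := E.exists_loop (𝟙 S.bot)
  -- All elements are universal ones, so that the composites `u ≫ uR` are identities and the loop
  -- over `⊥` is required to straighten to the identity.
  have h := I.vanishing_unit (E.uElt (𝟙 S.bot)) (E.uRElt (𝟙 S.bot)) (E.mElt f)
    (E.mRElt (𝟙 (S.p S.bot A))) ℓ (E.uElt (𝟙 S.bot)) (E.mElt (S.plam A).inv)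
    ((E.snake_iff _ _).2 (by rw [hℓ, E.one_counit]; simp))
    (by rw [E.lam]; simp [S.pR_id])
  rw [I.traceFun_eq E ℓ hℓ, h, E.mul_counit, E.lam]
  have e := E.m_act_left (E.u (E.uElt (𝟙 S.bot)) ≫ E.uR (E.uRElt (𝟙 S.bot))) (𝟙 A)
    (E.mElt (S.plam A).inv)
  rw [← E.one_counit] at e
  refine (congrArg (fun z => (z ≫ E.mR (E.mRElt (𝟙 (S.p S.bot A)))) ≫ _) e).trans ?_
  rw [E.one_counit]
  simp [S.pR_id]

lemma traceFun_vanishing_par (X Y : C) {A B : C} (f : S.p (S.p X Y) A ⟶ S.p (S.p X Y) B) :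
    I.traceFun E (S.p X Y) f =
      I.traceFun E Y (I.traceFun E X ((S.pa X Y A).inv ≫ f ≫ (S.pa X Y B).hom)) := by
  obtain ⟨ℓX, hX⟩ := E.exists_loop (𝟙 X)
  obtain ⟨ℓY, hY⟩ := E.exists_loop (𝟙 Y)
  obtain ⟨ℓV, hV⟩ := E.exists_loop (𝟙 (S.p X Y))
  have e₁ : I.mulAdj.counit (E.mRElt (𝟙 (S.p X Y)))
      (act I.mul (Prod.mkHom (𝟙 X) (𝟙 Y)) (𝟙 (S.p X Y)) (E.mElt (𝟙 (S.p X Y)))) =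
        𝟙 (S.p X Y) := by
    rw [E.mul_counit, E.m_act_left]; simp [S.pR_id]
  have e₂ : I.mulAdj.counit (E.mRElt (𝟙 (S.p Y A))) (E.mElt (𝟙 (S.p Y A))) = 𝟙 (S.p Y A) := by
    rw [E.mul_counit]; simp
  have e₃ : I.mulAdj.counit (E.mRElt (𝟙 (S.p X (S.p Y A))))
      (act I.mul (Prod.mkHom (𝟙 X) (𝟙 (S.p Y A))) (𝟙 (S.p (S.p X Y) A))
        (E.mElt (S.pa X Y A).hom)) = (S.pa X Y A).hom := by
    rw [E.mul_counit, E.m_act_right]; simp [S.pL_id]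
  -- The elements are chosen so that all adjunction units and counits become identities or
  -- associators; `r` and `v₂` differ by the associator at `B`, as `k₁`-type compatibility demands,
  -- and carry the morphism `f`.
  have h := I.vanishing_mul (hX := 𝟙 X) (hY := 𝟙 Y) (ℓX := ℓX) (ℓY := ℓY) (ℓV := ℓV)
    (v₁ := E.mElt (𝟙 (S.p Y B))) (v₂ := E.mElt ((S.pa X Y A).inv ≫ f ≫ (S.pa X Y B).hom))
    (w₂ := E.mRElt (𝟙 (S.p X (S.p Y A)))) (w₁ := E.mRElt (𝟙 (S.p Y A)))
    (q := E.mElt (𝟙 (S.p X Y))) (r := E.mElt ((S.pa X Y A).inv ≫ f))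
    (a := E.mElt (𝟙 (S.p X Y))) (q' := E.mRElt (𝟙 (S.p X Y)))
    (b := E.mElt (𝟙 (S.p (S.p X Y) A))) (r₀ := E.mRElt (𝟙 (S.p (S.p X Y) A)))
    (b' := E.mElt (𝟙 (S.p Y A))) (a' := E.mElt (S.pa X Y A).hom)
    ((E.snake_iff _ _).2 hX.symm) ((E.snake_iff _ _).2 hY.symm)
    (E.assoc_iff.2 (by simp [S.pR_id, S.pL_id]))
    (E.mul_isUnit_iff.2 (by simp)) (E.mul_isUnit_iff.2 (by simp))
    (E.assoc_iff.2 (by simp [S.pR_id, S.pL_id]))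
    ((E.snake_iff _ _).2 (by rw [hV]; exact e₁))
  rw [e₂] at h
  have h' := (congrArg (fun z => trVal I.trace ℓV (E.mElt ((S.pa X Y A).inv ≫ f))
    (act I.mulAdj.R z (𝟙 (S.p X Y, A)) (E.mRElt (𝟙 (S.p (S.p X Y) A))))) e₃).symm.trans h
  rw [I.trVal_eq E, I.trVal_eq E ℓX, I.trVal_eq E ℓY, hX, hY, hV, E.m_act_id, E.mR_act_id] at h'
  simpa [S.pR_id] using h'

lemma traceFun_superposing (X : C) {A B : C} (D : C) (f : S.p X A ⟶ S.p X B) :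
    I.traceFun E X ((S.pa X A D).inv ≫ S.pR f D ≫ (S.pa X B D).hom) =
      S.pR (I.traceFun E X f) D := by
  obtain ⟨ℓ, hℓ⟩ := E.exists_loop (𝟙 X)
  have e₁ : I.mulAdj.counit (E.mRElt (𝟙 (S.p X A))) (E.mElt (𝟙 (S.p X A))) = 𝟙 (S.p X A) := by
    rw [E.mul_counit]; simp
  have e₃ : I.mulAdj.counit (E.mRElt (𝟙 (S.p (S.p X A) D)))
      (act I.mul (Prod.mkHom (𝟙 (S.p X A)) (𝟙 D)) (𝟙 (S.p X (S.p A D)))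
        (E.mElt (S.pa X A D).inv)) = (S.pa X A D).inv := by
    rw [E.mul_counit, E.m_act_left]; simp [S.pR_id]
  -- Universal elements again; `v` carries `f`, while `v'` is forced by the associator condition to
  -- carry `f ⅋ D` followed by an associator.
  have h := I.superposing (ℓ := ℓ) (v := E.mElt f) (w := E.mRElt (𝟙 (S.p X A)))
    (g := E.mElt (𝟙 (S.p A D))) (k := E.mElt (𝟙 (S.p (S.p X A) D)))
    (k' := E.mRElt (𝟙 (S.p (S.p X A) D))) (n := E.mElt (𝟙 (S.p B D)))
    (v' := E.mElt (S.pR f D ≫ (S.pa X B D).hom)) (b := E.mElt (𝟙 (S.p X (S.p A D))))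
    (r₀ := E.mRElt (𝟙 (S.p X (S.p A D)))) (a := E.mElt (𝟙 (S.p X A)))
    (b' := E.mElt (S.pa X A D).inv)
    (E.mul_isUnit_iff.2 (by simp)) (E.assoc_iff.2 (by simp [S.pL_id]))
    (E.mul_isUnit_iff.2 (by simp)) (E.assoc_iff.2 (by simp [S.pR_id, S.pL_id]))
  rw [e₁] at h
  have h' := congrArg E.m ((congrArg (fun z => act I.mul (𝟙 (B, D)) (trVal I.trace ℓ
    (E.mElt (S.pR f D ≫ (S.pa X B D).hom)) (act I.mulAdj.R z (𝟙 (X, S.p A D))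
      (E.mRElt (𝟙 (S.p X (S.p A D)))))) (E.mElt (𝟙 (S.p B D)))) e₃).symm.trans h)
  rw [E.m_act_id] at h'
  have h'' := h'.trans (E.m_act_left _ _ _)
  rw [I.trVal_eq E, I.trVal_eq E ℓ, hℓ, E.mR_act_id] at h''
  simpa [S.pR_id] using h''

/-- The left trace of an interpretation. -/
noncomputable def leftTrace : @LeftTrace C _ S.par :=
  letI := S.par
  { tr := fun X _ _ f => I.traceFun E X f
    naturality := I.traceFun_naturality E
    sliding := I.traceFun_sliding E
    vanishing_unit := I.traceFun_vanishing_unit E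
    vanishing_tensor := I.traceFun_vanishing_par E
    superposing := I.traceFun_superposing E }

/-- The traced `*`-autonomous category of an interpretation. -/
noncomputable def tracedStarAutonomous : TracedStarAutonomous C where
  toStarAutonomous := S
  trace := I.leftTrace E

/-- The interpretation is represented by its traced `*`-autonomous category. -/
noncomputable def represents : Represents I (I.tracedStarAutonomous E) where
  mul := E.par.mul
  one := E.par.one
  comul := E.tensor.comul
  counit := E.tensor.counit
  mulR := I.mulAdj.corep E.par.mul
  oneR := I.oneAdj.corep E.par.one
  assoc h := E.assoc_iff.1 h
  lam p a := E.lam p a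
  rho p a := E.rho p a
  coassoc h := E.coassoc_iff.1 h
  colam a t := E.colam a t
  corho a t := E.corho a t
  frobL h := E.frobL.1 h
  frobR h := E.frobR.1 h
  mul_unit h := E.mul_isUnit_iff.1 h
  mul_counit w v := E.mul_counit w v
  one_unit h := E.one_isUnit_iff.1 h
  one_counit y x := E.one_counit y x
  trace ℓ v w := I.trVal_eq E ℓ v w

end Interpretation

end

/-! ### Every interpretation is represented -/

section

variable {C : Type u} [SmallCategory C] [IsIdempotentComplete C]

/-- Every interpretation on a Cauchy complete category is represented by a traced `*`-autonomous
structure. -/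
theorem Interpretation.exists_represents (I : Interpretation C) :
    ∃ S : TracedStarAutonomous C, Nonempty (Represents I S) := by
  -- The multiplication and the unit are the 1-cells with given right adjoints; their
  -- representability has to come first, since the arguments for `d` and `e` use the monoidal
  -- structure `⅋`.
  obtain ⟨par, ⟨φ⟩⟩ := I.mulAdj.exists_representing
  obtain ⟨G, ⟨ψ⟩⟩ := I.oneAdj.exists_representing
  let α : G ≅ Functor.fromPUnit.{u} (G.obj pt) :=
    NatIso.ofComponents (fun X => eqToIso (by cases X; rfl)) (by
      rintro ⟨⟨⟩⟩ ⟨⟨⟩⟩ ⟨⟨⟨⟩⟩⟩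
      simp)
  obtain ⟨P, ⟨M⟩⟩ := exists_monDict_of_pseudomonoid I.toPseudomonoid φ (ψ ≪≫ toProfunctorIso α)
  obtain ⟨un, ⟨ψ'⟩⟩ := FrobeniusPseudomonoid.exists_corepresenting_counit
    (F := I.toFrobeniusPseudomonoid) M
  obtain ⟨ten, ⟨φ'⟩⟩ := FrobeniusPseudomonoid.exists_corepresenting_comul
    (F := I.toFrobeniusPseudomonoid) M
  obtain ⟨T, ⟨K⟩⟩ := exists_comonDict_of_pseudocomonoid I.toPseudocomonoid φ' ψ'
  let E := frobDictOfDicts (S := ⟨T, P⟩) I.toFrobeniusData M K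
  let D := E.toLinearlyDistributive (F := I.toFrobeniusPseudomonoid)
    (fun f g h => strL_distributor_natural (S := ⟨T, P⟩) I.toFrobeniusData M K f g h)
    (fun f g h => strR_distributor_natural (S := ⟨T, P⟩) I.toFrobeniusData M K f g h)
  -- The same dictionary is retyped along the successive enrichments of the structure, which do not
  -- change the underlying operations and distributors.
  let E' : FrobDict I.toFrobeniusData D.toTwoMonoidal D.δL D.δR := E
  let E'' : FrobDict I.toFrobeniusData E'.toStarAutonomous.toTwoMonoidal E'.toStarAutonomous.δL
    E'.toStarAutonomous.δR := E
  exact ⟨_, ⟨I.represents E''⟩⟩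

end

/-! ### Calculus of traces along loops -/

namespace TracedStarAutonomous

variable {C : Type*} [Category* C] (S : TracedStarAutonomous C)

lemma tr_naturality (X : C) {A A' B B' : C} (g : A' ⟶ A) (f : S.p X A ⟶ S.p X B) (h : B ⟶ B') :
    S.tr X (S.pL X g ≫ f ≫ S.pL X h) = g ≫ S.tr X f ≫ h :=
  @LeftTrace.naturality C _ S.par S.trace X A A' B B' g f h

lemma tr_left (X : C) {A A' B : C} (g : A' ⟶ A) (f : S.p X A ⟶ S.p X B) :
    S.tr X (S.pL X g ≫ f) = g ≫ S.tr X f := by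
  simpa [S.pL_id] using S.tr_naturality X g f (𝟙 B)

lemma tr_right (X : C) {A B B' : C} (f : S.p X A ⟶ S.p X B) (h : B ⟶ B') :
    S.tr X (f ≫ S.pL X h) = S.tr X f ≫ h := by
  simpa [S.pL_id] using S.tr_naturality X (𝟙 A) f h

lemma tr_sliding {X X' A B : C} (k : X' ⟶ X) (f : S.p X A ⟶ S.p X' B) :
    S.tr X (f ≫ S.pR k B) = S.tr X' (S.pR k A ≫ f) :=
  @LeftTrace.sliding C _ S.par S.trace X X' A B k f

lemma tr_bot {A B : C} (f : S.p S.bot A ⟶ S.p S.bot B) :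
    S.tr S.bot f = (S.plam A).inv ≫ f ≫ (S.plam B).hom :=
  @LeftTrace.vanishing_unit C _ S.par S.trace A B f

lemma tr_par (X Y : C) {A B : C} (f : S.p (S.p X Y) A ⟶ S.p (S.p X Y) B) :
    S.tr (S.p X Y) f = S.tr Y (S.tr X ((S.pa X Y A).inv ≫ f ≫ (S.pa X Y B).hom)) :=
  @LeftTrace.vanishing_tensor C _ S.par S.trace X Y A B f

lemma tr_superposing (X : C) {A B : C} (D : C) (f : S.p X A ⟶ S.p X B) :
    S.tr X ((S.pa X A D).inv ≫ S.pR f D ≫ (S.pa X B D).hom) = S.pR (S.tr X f) D :=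
  @LeftTrace.superposing C _ S.par S.trace X A B D f

/-- The trace of the composite of the straightening of a loop, `w` and `v`. -/
def loopTr {X Y X' A Z B : C} (τ : S.t X Y ⟶ S.bot) (γ : S.tI ⟶ S.p Y X') (w : S.p X' A ⟶ Z)
    (v : Z ⟶ S.p X B) : A ⟶ B :=
  S.tr X (S.pR (S.snake τ γ) A ≫ w ≫ v)

/-- The coend relation between the right adjoint of the multiplication and the pairing: the loop
morphisms `g` and `f` are absorbed into the straightening, and `h` leaves the trace by naturality.
-/
lemma loopTr_right {X Y Y₁ X' X₁ A A₁ Z B : C} (τ : S.t X Y₁ ⟶ S.bot) (γ : S.tI ⟶ S.p Y X₁)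
    (w : S.p X' A₁ ⟶ Z) (v : Z ⟶ S.p X B) (g : Y ⟶ Y₁) (f : X₁ ⟶ X') (h : A ⟶ A₁) :
    S.loopTr (S.tL X g ≫ τ) γ (S.par.tensorHom f h ≫ w) v =
      h ≫ S.loopTr τ (γ ≫ S.par.tensorHom g f) w v := by
  have e : S.snake τ (γ ≫ S.par.tensorHom g f) = S.snake (S.tL X g ≫ τ) γ ≫ f := by
    rw [S.pHom_def, ← Category.assoc, S.snake_pL, S.snake_slide]
  rw [loopTr, loopTr, ← S.tr_left, e, S.pHom_def, S.pR_comp]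
  simp only [Category.assoc]
  rw [S.p_exchange_assoc, S.p_exchange_assoc]

/-- The coend relation at the copairing: `f` enters the straightening and is carried around the loop
by dinaturality of the trace, while `h` is naturality. -/
lemma loopTr_left {X X₂ Y X' A Z B B₂ : C} (τ : S.t X₂ Y ⟶ S.bot) (γ : S.tI ⟶ S.p Y X')
    (w : S.p X' A ⟶ Z) (v : Z ⟶ S.p X B) (f : X ⟶ X₂) (h : B ⟶ B₂) :
    S.loopTr (S.tR f Y ≫ τ) γ w v ≫ h = S.loopTr τ γ w (v ≫ S.par.tensorHom f h) := by
  have e₁ := S.tr_sliding f (S.pR (S.snake τ γ) A ≫ w ≫ v)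
  have e₂ := S.tr_right X₂ ((S.pR (S.snake τ γ) A ≫ w ≫ v) ≫ S.pR f B) h
  rw [loopTr, loopTr, S.snake_tR, S.pHom_def, S.pR_comp]
  simp only [Category.assoc] at e₁ e₂ ⊢
  rw [e₂, e₁]

lemma loopTr_mid {X Y X' A Z Z₁ B : C} (τ : S.t X Y ⟶ S.bot) (γ : S.tI ⟶ S.p Y X')
    (w : S.p X' A ⟶ Z₁) (v : Z ⟶ S.p X B) (h : Z₁ ⟶ Z) :
    S.loopTr τ γ w (h ≫ v) = S.loopTr τ γ (w ≫ h) v := by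
  simp only [loopTr, Category.assoc]

end TracedStarAutonomous

/-! ### The 2-cell given by a trace -/

namespace RightAdjointFrobenius

variable {C : Type u} [SmallCategory C] (F : RightAdjointFrobenius C)

/-- The part of the source of the trace after the multiplication. -/
abbrev loopTail : Profunctor.{u} (C × C) (Unit₀.{u} × C) :=
  comp (tens (idP C) F.mulAdj.R)
    ((tens F.pairing (idP C)).whiskerLeft₂ (prod.inverseAssociator C C C) (𝟭 (Unit₀.{u} × C)))

/-- The part of the source of the trace after the copairing. -/
abbrev loopBody : Profunctor.{u} ((C × C) × C) (Unit₀.{u} × C) :=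
  comp ((tens (idP C) F.mul).whiskerLeft₂ (reorder C) (𝟭 (C × C))) F.loopTail

end RightAdjointFrobenius

namespace FrobDict

variable {C : Type u} [SmallCategory C] {F : RightAdjointFrobenius C} {S : TracedStarAutonomous C}
  (E : FrobDict F.toFrobeniusData S.toTwoMonoidal S.δL S.δR)

/-- The trace of an element of the part of the source after the multiplication. -/
noncomputable def tailTr {X Y Z A B : C} (τ : S.t X Y ⟶ S.bot) (v : Z ⟶ S.p X B) :
    El F.loopTail (Y, Z) (pt, A) → (A ⟶ B) :=
  compLift (fun i x y =>
    (show A ⟶ i.2.2 from y.2) ≫ S.loopTr (S.tL X (show i.1 ⟶ Y from x.1) ≫ τ)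
      (E.pairVal (X := i.1) (Y := i.2.1) y.1) (E.mR (X := i.2.1) (Y := i.2.2) x.2) v) (by
    -- Invariance under the innermost coend relation is `loopTr_right`. The two outer coends are
    -- treated likewise, by `loopTr_mid` and `loopTr_left`.
    rintro ⟨Y₄, ⟨X₁, A₂⟩⟩ ⟨Y₃, ⟨X', A₁⟩⟩ ⟨g, ⟨f, h⟩⟩ ⟨y₃, w⟩ ⟨z, a⟩
    have h₁ := act_pair_wire_left (Prod.mkHom f h) g w y₃
    have h₂ := coact_pair_wire_right (P := F.pairing) (Prod.mkHom g f) h z a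
    refine (congrArg (fun t : El (tens (idP C) F.mulAdj.R) (Y, Z) (Y₄, (X₁, A₂)) =>
      (show A ⟶ A₂ from a) ≫ S.loopTr (S.tL X (show Y₄ ⟶ Y from t.1) ≫ τ)
        (E.pairVal (X := Y₄) (Y := X₁) z) (E.mR (X := X₁) (Y := A₂) t.2) v) h₁).trans ?_
    refine Eq.trans ?_ (congrArg (fun t : El (tens F.pairing (idP C)) ((Y₃, X'), A₁) (pt, A) =>
      (show A ⟶ A₁ from t.2) ≫ S.loopTr (S.tL X (show Y₃ ⟶ Y from y₃) ≫ τ)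
        (E.pairVal (X := Y₃) (Y := X') t.1) (E.mR (X := X') (Y := A₁) w) v) h₂).symm
    refine (congrArg₂ (fun (s : Y₄ ⟶ Y) t => (show A ⟶ A₂ from a) ≫ S.loopTr (S.tL X s ≫ τ)
      (E.pairVal (X := Y₄) (Y := X₁) z) t v) rfl (E.mR_act (𝟙 Z) f h w)).trans ?_
    refine Eq.trans ?_ (congrArg (fun t => (show A ⟶ A₁ from (show A ⟶ A₂ from a) ≫ h) ≫
      S.loopTr (S.tL X (show Y₃ ⟶ Y from y₃) ≫ τ) t (E.mR (X := X') (Y := A₁) w) v)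
      (E.pairVal_act g f z)).symm
    refine (congrArg₂ (fun s t => (show A ⟶ A₂ from a) ≫ S.loopTr s
      (E.pairVal (X := Y₄) (Y := X₁) z) (S.par.tensorHom f h ≫ t) v)
      ((congrArg (· ≫ τ) (S.tL_comp X g y₃)).trans (Category.assoc _ _ _))
      (Category.comp_id (E.mR w))).trans ?_
    refine (congrArg ((show A ⟶ A₂ from a) ≫ ·) (S.loopTr_right _ _ _ _ _ _ _)).trans ?_
    exact (Category.assoc _ _ _).symm)

lemma tailTr_act {X Y Y' Z Z' A B : C} (τ : S.t X Y' ⟶ S.bot) (v : Z' ⟶ S.p X B) (g : Y ⟶ Y')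
    (h : Z ⟶ Z') (q : El F.loopTail (Y, Z) (pt, A)) :
    E.tailTr τ v (act F.loopTail (Prod.mkHom g h) (𝟙 (pt, A)) q) =
      E.tailTr (S.tL X g ≫ τ) (h ≫ v) q := by
  obtain ⟨⟨Y₃, ⟨X', A₁⟩⟩, ⟨y₃, w⟩, ⟨z, a⟩, rfl⟩ := exists_glue q
  refine (congrArg (E.tailTr τ v) ((act_glue (a := (Y, Z)) (a' := (Y', Z')) (e := (pt, A))
    (e' := (pt, A)) (Prod.mkHom g h) (𝟙 (pt, A)) (b := (Y₃, (X', A₁))) _ _).trans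
    (congrArg₂ (glue (b := (Y₃, (X', A₁)))) (coact_pair_wire_left h g w y₃) (act_id _ _)))).trans ?_
  refine (congrArg₂ (fun s t => (show A ⟶ A₁ from a) ≫ S.loopTr s
    (E.pairVal (X := Y₃) (Y := X') z) t v)
    ((congrArg (· ≫ τ) (S.tL_comp X (show Y₃ ⟶ Y from y₃) g)).trans (Category.assoc _ _ _))
    (E.mR_act_id h w)).trans ?_
  exact congrArg ((show A ⟶ A₁ from a) ≫ ·) (S.loopTr_mid _ _ _ _ _).symm

lemma tailTr_left {X X₂ Y Z A B B₂ : C} (τ : S.t X₂ Y ⟶ S.bot) (v : Z ⟶ S.p X B) (f : X ⟶ X₂)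
    (h : B ⟶ B₂) (q : El F.loopTail (Y, Z) (pt, A)) :
    E.tailTr (S.tR f Y ≫ τ) v q ≫ h = E.tailTr τ (v ≫ S.par.tensorHom f h) q := by
  obtain ⟨⟨Y₃, ⟨X', A₁⟩⟩, ⟨y₃, w⟩, ⟨z, a⟩, rfl⟩ := exists_glue q
  refine (Category.assoc _ _ _).trans (congrArg ((show A ⟶ A₁ from a) ≫ ·) ?_)
  refine (congrArg (fun s => S.loopTr s (E.pairVal (X := Y₃) (Y := X') z) (E.mR w) v ≫ h)
    (S.t_exchange_assoc f (show Y₃ ⟶ Y from y₃) τ)).trans ?_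
  exact S.loopTr_left _ _ _ _ _ _

/-- The trace of an element of the part of the source after the copairing. -/
noncomputable def bodyTr {X Y A B : C} (τ : S.t X Y ⟶ S.bot) :
    El F.loopBody ((X, Y), B) (pt, A) → (A ⟶ B) :=
  compLift (fun i x q => E.tailTr (S.tL X (show i.1 ⟶ Y from x.1) ≫ τ)
    (E.m (X := X) (Y := B) (Z := i.2) x.2) q) (by
    rintro ⟨Y₁, Z₁⟩ ⟨Y₂, Z⟩ ⟨g, h⟩ ⟨y₂, v⟩ q
    refine (congrArg (fun t : El (tens (idP C) F.mul) (Y, (X, B)) (Y₁, Z₁) =>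
      E.tailTr (S.tL X (show Y₁ ⟶ Y from t.1) ≫ τ) (E.m (X := X) (Y := B) (Z := Z₁) t.2) q)
      (act_pair_wire_left h g v y₂)).trans ?_
    refine Eq.trans ?_ (E.tailTr_act _ _ g h q).symm
    exact congrArg₂ (fun s t => E.tailTr s t q) ((congrArg (· ≫ τ)
      (S.tL_comp X g (show Y₂ ⟶ Y from y₂))).trans (Category.assoc _ _ _)) (E.m_act_id h v))

lemma bodyTr_act {X Y X' Y' A B B' : C} (τ : S.t X' Y' ⟶ S.bot) (f : X ⟶ X') (g : Y ⟶ Y')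
    (h : B ⟶ B') (q : El F.loopBody ((X, Y), B) (pt, A)) :
    E.bodyTr τ (act F.loopBody (Prod.mkHom (Prod.mkHom f g) h) (𝟙 (pt, A)) q) =
      E.bodyTr (S.tensor.tensorHom f g ≫ τ) q ≫ h := by
  obtain ⟨⟨Y₂, Z⟩, ⟨y₂, v⟩, q, rfl⟩ := exists_glue q
  refine (congrArg (E.bodyTr τ) ((act_glue (a := ((X, Y), B)) (a' := ((X', Y'), B'))
    (e := (pt, A)) (e' := (pt, A)) (Prod.mkHom (Prod.mkHom f g) h) (𝟙 (pt, A)) (b := (Y₂, Z))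
    _ _).trans (congrArg₂ (glue (b := (Y₂, Z)))
      (coact_pair_wire_left (Prod.mkHom f h) g v y₂) (act_id _ _)))).trans ?_
  refine (congrArg (fun t => E.tailTr (S.tL X' ((show Y₂ ⟶ Y from y₂) ≫ g) ≫ τ) t q)
    ((E.m_act f h (𝟙 Z) v).trans (Category.id_comp _))).trans ?_
  refine (E.tailTr_left _ _ f h q).symm.trans (congrArg (fun t => E.tailTr t (E.m v) q ≫ h) ?_)
  have key : ∀ y : Y₂ ⟶ Y, S.tR f Y₂ ≫ S.tL X' (y ≫ g) ≫ τ =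
      S.tL X y ≫ S.tensor.tensorHom f g ≫ τ := by
    intro y
    rw [S.tL_comp, S.tHom_def, Category.assoc, Category.assoc, S.t_exchange_assoc]
  exact key y₂

/-- The trace of an element of the source of the trace. -/
noncomputable def cellTr {A B : C} : El F.loopCell B A → (A ⟶ B) :=
  compLift (P := tens F.copairing (idP C)) (Q := F.loopBody) (a := (pt, B))
    (e := (pt, A)) (fun i x q => (E.bodyTr (E.copairVal (X := i.1.1) (Y := i.1.2) x.1) q ≫
      (show i.2 ⟶ B from x.2) : A ⟶ B)) (by
    rintro ⟨⟨X, Y⟩, B₁⟩ ⟨⟨X₂, Y₁⟩, B₂⟩ ⟨⟨f, g⟩, h⟩ ⟨x, b⟩ q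
    refine (congrArg (fun t : El (tens F.copairing (idP C)) (pt, B) ((X, Y), B₁) =>
      E.bodyTr (E.copairVal (X := X) (Y := Y) t.1) q ≫ (show B₁ ⟶ B from t.2))
      (act_pair_wire_right (P := F.copairing) (Prod.mkHom f g) h x b)).trans ?_
    refine Eq.trans ?_ (congrArg (· ≫ (show B₂ ⟶ B from b)) (E.bodyTr_act _ f g h q).symm)
    refine Eq.trans ?_ (Category.assoc _ _ _).symm
    exact congrArg (fun t => E.bodyTr t q ≫ h ≫ (show B₂ ⟶ B from b)) (E.copairVal_act f g x))

lemma cellTr_loopEl {X X' Y Y₂ Y₃ A A₁ B B₁ Z : C} (x : El F.copairing pt (X, Y)) (b : B₁ ⟶ B)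
    (y₂ : Y₂ ⟶ Y) (v : El F.mul (X, B₁) Z) (y₃ : Y₃ ⟶ Y₂) (w : El F.mulAdj.R Z (X', A₁))
    (z : El F.pairing (Y₃, X') pt) (a : A ⟶ A₁) :
    E.cellTr (F.loopEl x b y₂ v y₃ w z a) =
      (a ≫ S.loopTr (S.tL X y₃ ≫ S.tL X y₂ ≫ E.copairVal x) (E.pairVal z) (E.mR w) (E.m v)) ≫ b :=
  rfl

/-- The 2-cell from the loop 1-cell to the identity which is given by a trace. -/
noncomputable def traceCell : F.loopCell ⟶ idP C :=
  mkHom _ _ (fun _ _ q => E.cellTr q) (by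
    intro B B' A A' g f q
    obtain ⟨X, X', Y, Y₂, Y₃, A₁, B₁, Z, x, b, y₂, v, y₃, w, z, a, rfl⟩ := F.exists_loopEl q
    -- Naturality needs no property of the trace: the action only composes with the morphisms on the
    -- two external wires, and these enter the value by composition.
    rw [F.act_loopEl]
    refine (E.cellTr_loopEl _ _ _ _ _ _ _ _).trans ?_
    refine Eq.trans ?_ ((act_wire g f _).trans
      (congrArg (fun t => f ≫ t ≫ g) (E.cellTr_loopEl _ _ _ _ _ _ _ _))).symm
    simp only [Category.assoc])

lemma trVal_traceCell {A B X X' Z : C} (ℓ : F.Loop X X') (v : El F.mul (X, B) Z)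
    (w : El F.mulAdj.R Z (X', A)) : trVal E.traceCell ℓ v w =
      S.tr X (S.pR (E.loopHom ℓ) A ≫ E.mR w ≫ E.m v) := by
  refine (E.cellTr_loopEl ℓ.copair (𝟙 B) (𝟙 ℓ.Y) v (𝟙 ℓ.Y) w ℓ.pairElt (𝟙 A)).trans ?_
  rw [S.tL_id, Category.comp_id, Category.id_comp, Category.id_comp, Category.id_comp]
  rfl

/-- The loop straightens to a composite `X ⟶ ⊥ ⟶ X'`. Carrying its first half around the loop turns
the trace over `X` into one over `⊥`, where the vanishing axiom applies; the hypothesis on `x₀` and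
`a₀` identifies the inverse unitor. -/
lemma trVal_traceCell_vanishing_unit {A B X X' Z X₀ : C} (x : El F.one pt X)
    (y : El F.oneAdj.R X' pt) (v : El F.mul (X, B) Z) (w : El F.mulAdj.R Z (X', A))
    (ℓ : F.Loop X X') (x₀ : El F.one pt X₀) (a₀ : El F.mul (X₀, A) A)
    (hℓ : ℓ.Snake (F.oneAdj.counit y x)) (h₀ : F.lam x₀ a₀ = 𝟙 A) :
    trVal E.traceCell ℓ v w = F.mulAdj.counit w
        (act F.mul (Prod.mkHom (F.oneAdj.counit y x₀) (𝟙 A)) (𝟙 A) a₀) ≫ F.lam x v := by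
  rw [E.snake_iff, E.one_counit] at hℓ
  rw [E.lam] at h₀
  rw [E.trVal_traceCell, ← hℓ, E.mul_counit, E.m_act_left, E.one_counit, E.lam, S.pR_comp,
    Category.assoc, ← S.tr_sliding, S.tr_bot]
  have h₁ : E.m a₀ ≫ S.pR (E.u x₀) A = (S.plam A).inv := by
    rw [← cancel_mono (S.plam A).hom, Category.assoc, h₀, Iso.inv_hom_id]
  simp only [S.pR_comp, Category.assoc, Category.id_comp]
  rw [reassoc_of% h₁]

lemma trVal_traceCell_vanishing_mul {A B X X' Y Y' A₁ Z₁ Z₂ V V' U U' : C}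
    {hX : X ⟶ X'} {hY : Y ⟶ Y'} {ℓX : F.Loop X X'} {ℓY : F.Loop Y Y'} {ℓV : F.Loop V V'}
    {v₁ : El F.mul (Y, B) Z₁} {v₂ : El F.mul (X, Z₁) Z₂}
    {w₂ : El F.mulAdj.R Z₂ (X', A₁)} {w₁ : El F.mulAdj.R A₁ (Y', A)}
    {q : El F.mul (X, Y) V} {r : El F.mul (V, B) Z₂}
    {a : El F.mul (X', Y') V'} {q' : El F.mulAdj.R V' (X', Y')}
    {b : El F.mul (V', A) U} {r₀ : El F.mulAdj.R U (V', A)}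
    {b' : El F.mul (Y', A) U'} {a' : El F.mul (X', U') U}
    (kX : ℓX.Snake hX) (kY : ℓY.Snake hY) (k₁ : F.Assoc q r v₁ v₂)
    (k₂ : F.mulAdj.IsUnit a q') (k₃ : F.mulAdj.IsUnit b r₀) (k₄ : F.Assoc a b b' a')
    (kV : ℓV.Snake (F.mulAdj.counit q' (act F.mul (Prod.mkHom hX hY) (𝟙 V) q))) :
    trVal E.traceCell ℓV r (act F.mulAdj.R (F.mulAdj.counit w₂ (act F.mul
        (Prod.mkHom (𝟙 X') (F.mulAdj.counit w₁ b')) (𝟙 U) a')) (𝟙 (V', A)) r₀) =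
      trVal E.traceCell ℓY (act F.mul (𝟙 (Y, B)) (trVal E.traceCell ℓX v₂ w₂) v₁) w₁ := by
  rw [E.snake_iff] at kX kY kV
  rw [E.assoc_iff] at k₁ k₄
  rw [E.mul_isUnit_iff] at k₂ k₃
  rw [E.mul_counit, E.m_act, Category.id_comp] at kV
  rw [E.trVal_traceCell, E.trVal_traceCell, E.trVal_traceCell, E.m_act_id, E.mR_act_id,
    E.mul_counit, E.mul_counit, E.m_act_right, ← kX, ← kY, ← kV]
  simp only [S.pR_comp, S.pL_comp, Category.assoc, Category.id_comp]
  -- The morphism `E.m q : V ⟶ X ⅋ Y` is carried around the loop, so that the trace over `V` becomes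
  -- one over `X ⅋ Y` and can be split. On the other side all factors of the outer trace are pulled
  -- into the inner one.
  rw [← S.tr_sliding, ← S.tr_right, ← Category.assoc (S.pR hY A), ← S.tr_left]
  simp only [Category.assoc]
  rw [← k₁, S.tr_par]
  have h₁ : E.mR r₀ ≫ E.m a' ≫ S.pL X' (E.m b') = S.pR (E.m a) A ≫ (S.pa X' Y' A).hom := by
    rw [← k₄, reassoc_of% k₃]
  have h₂ : S.pR (E.mR q') A ≫ S.pR (E.m a) A = 𝟙 _ := by
    rw [← S.pR_comp, k₂, S.pR_id]
  rw [reassoc_of% h₁, reassoc_of% h₂]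
  have h₃ : S.pR (S.par.tensorHom hX hY) A ≫ (S.pa X' Y' A).hom =
      (S.pa X Y A).hom ≫ S.pL X (S.pR hY A) ≫ S.pR hX (S.p Y' A) := by
    rw [S.pHom_def, S.pR_comp, Category.assoc, S.pa_mid, S.pa_left_assoc, S.p_exchange]
  simp only [Category.assoc, S.pL_comp]
  rw [reassoc_of% h₃, Iso.inv_hom_id_assoc, ← S.p_exchange_assoc hX (E.mR w₁)]

lemma trVal_traceCell_superposing {A B D K K' X X' Z Z' U V : C} {ℓ : F.Loop X X'}
    {v : El F.mul (X, B) Z} {w : El F.mulAdj.R Z (X', A)} {g : El F.mul (A, D) K}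
    {k : El F.mul (Z, D) Z'} {k' : El F.mulAdj.R Z' (Z, D)}
    {n : El F.mul (B, D) K'} {v' : El F.mul (X, K') Z'}
    {b : El F.mul (X', K) U} {r₀ : El F.mulAdj.R U (X', K)}
    {a : El F.mul (X', A) V} {b' : El F.mul (V, D) U}
    (k₁ : F.mulAdj.IsUnit k k') (k₂ : F.Assoc v k n v')
    (k₃ : F.mulAdj.IsUnit b r₀) (k₄ : F.Assoc a b' g b) :
    act F.mul (𝟙 (B, D)) (trVal E.traceCell ℓ v' (act F.mulAdj.R (F.mulAdj.counit k'
        (act F.mul (Prod.mkHom (F.mulAdj.counit w a) (𝟙 D)) (𝟙 U) b')) (𝟙 (X', K)) r₀)) n =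
      act F.mul (Prod.mkHom (trVal E.traceCell ℓ v w) (𝟙 D)) (𝟙 K) g := by
  rw [E.assoc_iff] at k₂ k₄
  rw [E.mul_isUnit_iff] at k₁ k₃
  apply E.m_injective
  rw [E.m_act_id, E.m_act_left, E.trVal_traceCell, E.trVal_traceCell, E.mR_act_id, E.mul_counit,
    E.mul_counit, E.m_act_left]
  simp only [S.pR_comp, Category.assoc, Category.id_comp]
  -- The right-hand side becomes a single trace over `X`; what is left is to compare the traced
  -- morphisms, using the two associator hypotheses and the units of the adjunctions.
  rw [← S.tr_superposing, ← S.tr_left, ← S.tr_right]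
  simp only [Category.assoc]
  have h₁ : E.mR r₀ ≫ E.m b' ≫ S.pR (E.m a) D = S.pL X' (E.m g) ≫ (S.pa X' A D).inv := by
    rw [Iso.eq_comp_inv, Category.assoc, Category.assoc, k₄, reassoc_of% k₃]
  rw [← k₂, reassoc_of% h₁, reassoc_of% k₁]
  have h₂ : S.pR (E.loopHom ℓ) (S.p A D) ≫ (S.pa X' A D).inv =
      (S.pa X A D).inv ≫ S.pR (S.pR (E.loopHom ℓ) A) D := by
    rw [Iso.eq_inv_comp, ← S.pa_left_assoc, Iso.hom_inv_id, Category.comp_id]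
  rw [← S.p_exchange_assoc, reassoc_of% h₂]
  simp only [S.pR_comp, Category.assoc]

/-- The interpretation which is given by a trace. -/
noncomputable def interpretation : Interpretation C where
  toRightAdjointFrobenius := F
  trace := E.traceCell
  vanishing_unit := E.trVal_traceCell_vanishing_unit
  vanishing_mul := E.trVal_traceCell_vanishing_mul
  superposing := E.trVal_traceCell_superposing

/-- The interpretation is represented by the traced `*`-autonomous category. -/
noncomputable def represents : Represents E.interpretation S where
  mul := E.par.mul
  one := E.par.one
  comul := E.tensor.comul
  counit := E.tensor.counit
  mulR := F.mulAdj.corep E.par.mul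
  oneR := F.oneAdj.corep E.par.one
  assoc h := E.assoc_iff.1 h
  lam p a := E.lam p a
  rho p a := E.rho p a
  coassoc h := E.coassoc_iff.1 h
  colam a t := E.colam a t
  corho a t := E.corho a t
  frobL h := E.frobL.1 h
  frobR h := E.frobR.1 h
  mul_unit h := E.mul_isUnit_iff.1 h
  mul_counit w v := E.mul_counit w v
  one_unit h := E.one_isUnit_iff.1 h
  one_counit y x := E.one_counit y x
  trace ℓ v w := E.trVal_traceCell ℓ v w

end FrobDict

/-! ### Every traced `*`-autonomous structure represents an interpretation -/

section

variable {C : Type u} [SmallCategory C] (S : TracedStarAutonomous C)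

/-- The right-adjoint Frobenius pseudomonoid of a `*`-autonomous category. -/
noncomputable def StarAutonomous.rightAdjointFrobenius (S : StarAutonomous C) :
    RightAdjointFrobenius C where
  toFrobeniusPseudomonoid := S.frobeniusPseudomonoid
  mulAdj := RightAdjoint.ofRep S.frobDict.par.mul (Iso.refl _)
  oneAdj := RightAdjoint.ofRep S.frobDict.par.one (Iso.refl _)

/-- Every traced `*`-autonomous structure represents an interpretation. -/
theorem TracedStarAutonomous.exists_represents :
    ∃ I : Interpretation C, Nonempty (Represents I S) := by
  -- Adding the right adjoints does not change the Frobenius data, so the dictionary already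
  -- constructed has the required type.
  let E : FrobDict S.rightAdjointFrobenius.toFrobeniusData S.toTwoMonoidal S.δL S.δR := S.frobDict
  exact ⟨_, ⟨E.represents⟩⟩

end

/-! ### Compatible isomorphisms of 1-cells and of operations -/

section

variable {C : Type u} [SmallCategory C]

namespace Represents

variable {I : Interpretation C} {S : TracedStarAutonomous C} (R : Represents I S)

/-- The identifications of a representation, as identifications of Frobenius data. -/
def frobDict : FrobDict I.toFrobeniusData S.toTwoMonoidal S.δL S.δR where
  par :=
    { mul := R.mul
      one := R.one
      assoc := R.assoc
      lam := R.lam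
      rho := R.rho }
  tensor :=
    { comul := R.comul
      counit := R.counit
      coassoc := R.coassoc
      colam := R.colam
      corho := R.corho }
  frobL_iff {X Y X' Y' V Q c a r s} := by
    refine ⟨R.frobL, fun h => ?_⟩
    -- A representation gives only the forward implication. The 2-cell has some value, its composite
    -- is known, and composites determine elements of `m d`.
    obtain ⟨Q', r', s', e⟩ := exists_glue (app₂ I.frobL.hom (a := (X, Y)) (b := (X', Y'))
      (glue (b := ((X', V), Y)) (pair c (wire (𝟙 Y))) (pair (wire (𝟙 X')) a)))
    exact e.trans ((glue_eq_iff_mixed R.comul R.mul _ _ _ _).2 ((R.frobL e).symm.trans h))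
  frobR_iff {X Y X' Y' V Q c a r s} := by
    refine ⟨R.frobR, fun h => ?_⟩
    obtain ⟨Q', r', s', e⟩ := exists_glue (app₂ I.frobR.hom (a := (X, Y)) (b := (X', Y'))
      (glue (b := (X, (V, Y'))) (pair (wire (𝟙 X)) c) (pair a (wire (𝟙 Y')))))
    exact e.trans ((glue_eq_iff_mixed R.comul R.mul _ _ _ _).2 ((R.frobR e).symm.trans h))

/-- The identification of the right adjoint is not a free choice: the counit against the universal
element computes it, so the given one agrees with the one obtained from the adjunction. -/
lemma mR_eq {X Y Z : C} (w : El I.mulAdj.R Z (X, Y)) : R.frobDict.mR w = R.mR w := by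
  have h₁ := R.frobDict.mul_counit w (R.frobDict.mElt (𝟙 (S.p X Y)))
  have h₂ : _ = R.frobDict.m (R.frobDict.mElt (𝟙 (S.p X Y))) ≫ R.mR w := R.mul_counit w _
  rw [h₂, R.frobDict.m_mElt, Category.id_comp, Category.id_comp] at h₁
  exact h₁.symm

lemma uR_eq {Z : C} (y : El I.oneAdj.R Z pt) : R.frobDict.uR y = R.uR y := by
  have h₁ := R.frobDict.one_counit y (R.frobDict.uElt (𝟙 S.bot))
  have h₂ : _ = R.frobDict.u (R.frobDict.uElt (𝟙 S.bot)) ≫ R.uR y := R.one_counit y _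
  rw [h₂, R.frobDict.u_uElt, Category.id_comp, Category.id_comp] at h₁
  exact h₁.symm

lemma trVal_eq {A B X X' Z : C} (ℓ : I.Loop X X') (v : El I.mul (X, B) Z)
    (w : El I.mulAdj.R Z (X', A)) : trVal I.trace ℓ v w =
      S.tr X (S.pR (R.frobDict.loopHom ℓ) A ≫ R.frobDict.mR w ≫ R.frobDict.m v) := by
  rw [mR_eq]
  exact R.trace ℓ v w

end Represents

/-- Isomorphisms of the generating 1-cells of two interpretations, and isomorphisms of the
operations of two traced `*`-autonomous structures, which agree under given representations. -/
structure CompatibleIso {I I' : Interpretation C} {S S' : TracedStarAutonomous C}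
    (E : FrobDict I.toFrobeniusData S.toTwoMonoidal S.δL S.δR)
    (E' : FrobDict I'.toFrobeniusData S'.toTwoMonoidal S'.δL S'.δR) where
  mul : I.mul ≅ I'.mul
  one : I.one ≅ I'.one
  comul : I.comul ≅ I'.comul
  counit : I.counit ≅ I'.counit
  mulR : I.mulAdj.R ≅ I'.mulAdj.R
  oneR : I.oneAdj.R ≅ I'.oneAdj.R
  t : ∀ A B : C, S.t A B ≅ S'.t A B
  tI : S.tI ≅ S'.tI
  p : ∀ A B : C, S.p A B ≅ S'.p A B
  bot : S.bot ≅ S'.bot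
  t_natural : ∀ {A A' B B' : C} (f : A ⟶ A') (g : B ⟶ B'),
    S.tensor.tensorHom f g ≫ (t A' B').hom = (t A B).hom ≫ S'.tensor.tensorHom f g
  p_natural : ∀ {A A' B B' : C} (f : A ⟶ A') (g : B ⟶ B'),
    S.par.tensorHom f g ≫ (p A' B').hom = (p A B).hom ≫ S'.par.tensorHom f g
  m_mul : ∀ {X Y Z : C} (a : El I.mul (X, Y) Z), E'.m (app₂ mul.hom a) = E.m a ≫ (p X Y).hom
  u_one : ∀ {Z : C} (x : El I.one pt Z), E'.u (app₂ one.hom x) = E.u x ≫ bot.hom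
  d_comul : ∀ {X Y Z : C} (c : El I.comul Z (X, Y)),
    E'.d (app₂ comul.hom c) = (t X Y).inv ≫ E.d c
  e_counit : ∀ {Z : C} (x : El I.counit Z pt), E'.e (app₂ counit.hom x) = tI.inv ≫ E.e x
  mR_mulR : ∀ {X Y Z : C} (w : El I.mulAdj.R Z (X, Y)),
    E'.mR (app₂ mulR.hom w) = (p X Y).inv ≫ E.mR w
  uR_oneR : ∀ {Z : C} (y : El I.oneAdj.R Z pt), E'.uR (app₂ oneR.hom y) = bot.inv ≫ E.uR y

namespace CompatibleIso

variable {I I' : Interpretation C} {S S' : TracedStarAutonomous C}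

section

variable {E : FrobDict I.toFrobeniusData S.toTwoMonoidal S.δL S.δR}
  {E' : FrobDict I'.toFrobeniusData S'.toTwoMonoidal S'.δL S'.δR} (D : CompatibleIso E E')

lemma pR_p {A A' : C} (f : A ⟶ A') (B : C) :
    S.pR f B ≫ (D.p A' B).hom = (D.p A B).hom ≫ S'.pR f B := by
  rw [← S.pHom_left, D.p_natural, S'.pHom_left]

lemma pL_p (A : C) {B B' : C} (f : B ⟶ B') :
    S.pL A f ≫ (D.p A B').hom = (D.p A B).hom ≫ S'.pL A f := by
  rw [← S.pHom_right, D.p_natural, S'.pHom_right]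

lemma tR_t {A A' : C} (f : A ⟶ A') (B : C) :
    S.tR f B ≫ (D.t A' B).hom = (D.t A B).hom ≫ S'.tR f B := by
  rw [← S.tHom_left, D.t_natural, S'.tHom_left]

lemma tL_t (A : C) {B B' : C} (f : B ⟶ B') :
    S.tL A f ≫ (D.t A B').hom = (D.t A B).hom ≫ S'.tL A f := by
  rw [← S.tHom_right, D.t_natural, S'.tHom_right]

lemma tR_t_inv {A A' : C} (f : A ⟶ A') (B : C) :
    S'.tR f B ≫ (D.t A' B).inv = (D.t A B).inv ≫ S.tR f B := by
  rw [Iso.comp_inv_eq, Category.assoc, D.tR_t, Iso.inv_hom_id_assoc]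

lemma tL_t_inv (A : C) {B B' : C} (f : B ⟶ B') :
    S'.tL A f ≫ (D.t A B').inv = (D.t A B).inv ≫ S.tL A f := by
  rw [Iso.comp_inv_eq, Category.assoc, D.tL_t, Iso.inv_hom_id_assoc]

lemma tR_t_hom_inv (A B X : C) : S'.tR (D.t A B).hom X ≫ S'.tR (D.t A B).inv X = 𝟙 _ := by
  rw [← S'.tR_comp, Iso.hom_inv_id, S'.tR_id]

lemma tL_t_hom_inv (X A B : C) : S'.tL X (D.t A B).hom ≫ S'.tL X (D.t A B).inv = 𝟙 _ := by
  rw [← S'.tL_comp, Iso.hom_inv_id, S'.tL_id]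

lemma tL_t_inv_hom (X A B : C) : S'.tL X (D.t A B).inv ≫ S'.tL X (D.t A B).hom = 𝟙 _ := by
  rw [← S'.tL_comp, Iso.inv_hom_id, S'.tL_id]

lemma pR_t_hom_inv (A B X : C) : S'.pR (D.t A B).hom X ≫ S'.pR (D.t A B).inv X = 𝟙 _ := by
  rw [← S'.pR_comp, Iso.hom_inv_id, S'.pR_id]

lemma pR_t_inv_hom (A B X : C) : S'.pR (D.t A B).inv X ≫ S'.pR (D.t A B).hom X = 𝟙 _ := by
  rw [← S'.pR_comp, Iso.inv_hom_id, S'.pR_id]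

lemma pL_t_hom_inv (X A B : C) : S'.pL X (D.t A B).hom ≫ S'.pL X (D.t A B).inv = 𝟙 _ := by
  rw [← S'.pL_comp, Iso.hom_inv_id, S'.pL_id]

lemma pL_t_inv_hom (X A B : C) : S'.pL X (D.t A B).inv ≫ S'.pL X (D.t A B).hom = 𝟙 _ := by
  rw [← S'.pL_comp, Iso.inv_hom_id, S'.pL_id]

lemma tR_tI_hom_inv (X : C) : S'.tR D.tI.hom X ≫ S'.tR D.tI.inv X = 𝟙 _ := by
  rw [← S'.tR_comp, Iso.hom_inv_id, S'.tR_id]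

lemma tL_tI_hom_inv (X : C) : S'.tL X D.tI.hom ≫ S'.tL X D.tI.inv = 𝟙 _ := by
  rw [← S'.tL_comp, Iso.hom_inv_id, S'.tL_id]

/-- In this and the following pairs, a condition on an isomorphism of structures implies the
condition on 2-cells by computing with morphisms of arbitrary elements and naturality of the
components. -/
lemma assoc_of (H : ∀ A B K : C, (S.pa A B K).hom ≫ (D.p A (S.p B K)).hom ≫ S'.pL A (D.p B K).hom =
      (D.p (S.p A B) K).hom ≫ S'.pR (D.p A B).hom K ≫ (S'.pa A B K).hom)
    {X Y Z V U W : C} {a : El I.mul (X, Y) V} {b : El I.mul (V, Z) W}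
    {p : El I.mul (Y, Z) U} {q : El I.mul (X, U) W} (h : I.Assoc a b p q) :
    I'.Assoc (app₂ D.mul.hom a) (app₂ D.mul.hom b) (app₂ D.mul.hom p) (app₂ D.mul.hom q) := by
  rw [E.assoc_iff] at h
  rw [E'.assoc_iff, D.m_mul, D.m_mul, D.m_mul, D.m_mul, S'.pR_comp, S'.pL_comp]
  simp only [Category.assoc]
  rw [← reassoc_of% D.pR_p, ← reassoc_of% D.pL_p, ← H, reassoc_of% h]

/-- The converse direction tests the condition on 2-cells at universal elements, whose morphisms are
identities or structural isomorphisms. -/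
lemma p_assoc_of (H : ∀ {X Y Z V U W : C} {a : El I.mul (X, Y) V} {b : El I.mul (V, Z) W}
    {p : El I.mul (Y, Z) U} {q : El I.mul (X, U) W}, I.Assoc a b p q →
    I'.Assoc (app₂ D.mul.hom a) (app₂ D.mul.hom b) (app₂ D.mul.hom p) (app₂ D.mul.hom q))
    (X Y Z : C) : (S.pa X Y Z).hom ≫ (D.p X (S.p Y Z)).hom ≫ S'.pL X (D.p Y Z).hom =
      (D.p (S.p X Y) Z).hom ≫ S'.pR (D.p X Y).hom Z ≫ (S'.pa X Y Z).hom := by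
  have h := E'.assoc_iff.1 (H (a := E.mElt (𝟙 (S.p X Y))) (b := E.mElt (𝟙 (S.p (S.p X Y) Z)))
    (p := E.mElt (𝟙 (S.p Y Z))) (q := E.mElt (S.pa X Y Z).hom)
    (E.assoc_iff.2 (by simp [S.pR_id, S.pL_id])))
  simpa [D.m_mul] using h.symm

lemma lam_of (H : ∀ A : C,
      (D.p S.bot A).hom ≫ S'.pR D.bot.hom A ≫ (S'.plam A).hom = (S.plam A).hom)
    {X W P : C} (p : El I.one pt P) (a : El I.mul (P, X) W) :
    I'.lam (app₂ D.one.hom p) (app₂ D.mul.hom a) = I.lam p a := by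
  rw [E.lam, E'.lam, D.m_mul, D.u_one, S'.pR_comp]
  simp only [Category.assoc]
  rw [← reassoc_of% D.pR_p, H]

lemma p_left_of (H : ∀ {X W P : C} (p : El I.one pt P) (a : El I.mul (P, X) W),
      I'.lam (app₂ D.one.hom p) (app₂ D.mul.hom a) = I.lam p a) (A : C) :
    (D.p S.bot A).hom ≫ S'.pR D.bot.hom A ≫ (S'.plam A).hom = (S.plam A).hom := by
  have h := H (E.uElt (𝟙 S.bot)) (E.mElt (𝟙 (S.p S.bot A)))
  rw [E.lam, E'.lam, D.m_mul, D.u_one] at h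
  simpa [S.pR_id] using h

lemma rho_of (H : ∀ A : C,
      (D.p A S.bot).hom ≫ S'.pL A D.bot.hom ≫ (S'.prho A).hom = (S.prho A).hom)
    {X W P : C} (p : El I.one pt P) (a : El I.mul (X, P) W) :
    I'.rho (app₂ D.one.hom p) (app₂ D.mul.hom a) = I.rho p a := by
  rw [E.rho, E'.rho, D.m_mul, D.u_one, S'.pL_comp]
  simp only [Category.assoc]
  rw [← reassoc_of% D.pL_p, H]

lemma p_right_of (H : ∀ {X W P : C} (p : El I.one pt P) (a : El I.mul (X, P) W),
      I'.rho (app₂ D.one.hom p) (app₂ D.mul.hom a) = I.rho p a) (A : C) :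
    (D.p A S.bot).hom ≫ S'.pL A D.bot.hom ≫ (S'.prho A).hom = (S.prho A).hom := by
  have h := H (E.uElt (𝟙 S.bot)) (E.mElt (𝟙 (S.p A S.bot)))
  rw [E.rho, E'.rho, D.m_mul, D.u_one] at h
  simpa [S.pL_id] using h

lemma coassoc_of (H : ∀ A B K : C,
      (S.ta A B K).hom ≫ (D.t A (S.t B K)).hom ≫ S'.tL A (D.t B K).hom =
      (D.t (S.t A B) K).hom ≫ S'.tR (D.t A B).hom K ≫ (S'.ta A B K).hom)
    {X Y Z V U W : C} {a : El I.comul W (V, Z)} {b : El I.comul V (X, Y)}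
    {p : El I.comul W (X, U)} {q : El I.comul U (Y, Z)} (h : I.Coassoc a b p q) :
    I'.Coassoc (app₂ D.comul.hom a) (app₂ D.comul.hom b) (app₂ D.comul.hom p)
      (app₂ D.comul.hom q) := by
  rw [E.coassoc_iff] at h
  rw [E'.coassoc_iff, D.d_comul, D.d_comul, D.d_comul, D.d_comul, S'.tR_comp, S'.tL_comp]
  simp only [Category.assoc]
  rw [reassoc_of% D.tR_t_inv, reassoc_of% D.tL_t_inv, h,
    ← cancel_epi ((D.t (S.t X Y) Z).hom ≫ S'.tR (D.t X Y).hom Z)]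
  simp only [Category.assoc]
  rw [← reassoc_of% H, reassoc_of% D.tR_t_hom_inv, reassoc_of% D.tL_t_hom_inv]
  simp

lemma t_assoc_of (H : ∀ {X Y Z V U W : C} {a : El I.comul W (V, Z)} {b : El I.comul V (X, Y)}
    {p : El I.comul W (X, U)} {q : El I.comul U (Y, Z)}, I.Coassoc a b p q →
    I'.Coassoc (app₂ D.comul.hom a) (app₂ D.comul.hom b) (app₂ D.comul.hom p)
      (app₂ D.comul.hom q)) (X Y Z : C) :
    (S.ta X Y Z).hom ≫ (D.t X (S.t Y Z)).hom ≫ S'.tL X (D.t Y Z).hom =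
      (D.t (S.t X Y) Z).hom ≫ S'.tR (D.t X Y).hom Z ≫ (S'.ta X Y Z).hom := by
  have h := E'.coassoc_iff.1 (H (a := E.dElt (S.ta X Y Z).hom) (b := E.dElt (𝟙 (S.t X Y)))
    (p := E.dElt (𝟙 (S.t X (S.t Y Z)))) (q := E.dElt (𝟙 (S.t Y Z)))
    (E.coassoc_iff.2 (by simp [S.tR_id, S.tL_id])))
  rw [D.d_comul, D.d_comul, D.d_comul, D.d_comul] at h
  simp only [E.d_dElt, Category.comp_id] at h
  have e : (S.ta X Y Z).hom = (D.t (S.t X Y) Z).hom ≫ S'.tR (D.t X Y).hom Z ≫ (S'.ta X Y Z).hom ≫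
      S'.tL X (D.t Y Z).inv ≫ (D.t X (S.t Y Z)).inv := by
    rw [← h, reassoc_of% D.tR_t_hom_inv, Iso.hom_inv_id_assoc]
  rw [e]
  simp only [Category.assoc, Iso.inv_hom_id_assoc]
  rw [D.tL_t_inv_hom, Category.comp_id]

lemma colam_of (H : ∀ A : C,
      (D.t S.tI A).hom ≫ S'.tR D.tI.hom A ≫ (S'.tlam A).hom = (S.tlam A).hom)
    {X W P : C} (a : El I.comul W (P, X)) (x : El I.counit P pt) :
    I'.colam (app₂ D.comul.hom a) (app₂ D.counit.hom x) = I.colam a x := by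
  rw [E.colam, E'.colam, D.d_comul, D.e_counit, S'.tR_comp, ← cancel_epi (S.tlam X).hom, ← H]
  simp only [Category.assoc]
  rw [reassoc_of% D.tR_t_inv, Iso.hom_inv_id_assoc, reassoc_of% D.tR_tI_hom_inv,
    Iso.hom_inv_id_assoc, reassoc_of% H, Iso.hom_inv_id_assoc]

lemma t_left_of (H : ∀ {X W P : C} (a : El I.comul W (P, X)) (x : El I.counit P pt),
      I'.colam (app₂ D.comul.hom a) (app₂ D.counit.hom x) = I.colam a x) (A : C) :
    (D.t S.tI A).hom ≫ S'.tR D.tI.hom A ≫ (S'.tlam A).hom = (S.tlam A).hom := by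
  have h := H (E.dElt (𝟙 (S.t S.tI A))) (E.eElt (𝟙 S.tI))
  rw [E.colam, E'.colam, D.d_comul, D.e_counit] at h
  simp only [E.d_dElt, E.e_eElt, S.tR_id, Category.comp_id] at h
  rw [← cancel_mono (S.tlam A).inv, Iso.hom_inv_id, ← h]
  simp only [Category.assoc, Iso.hom_inv_id_assoc]
  rw [reassoc_of% D.tR_tI_hom_inv, Iso.hom_inv_id]

lemma corho_of (H : ∀ A : C,
      (D.t A S.tI).hom ≫ S'.tL A D.tI.hom ≫ (S'.trho A).hom = (S.trho A).hom)
    {X W P : C} (a : El I.comul W (X, P)) (x : El I.counit P pt) :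
    I'.corho (app₂ D.comul.hom a) (app₂ D.counit.hom x) = I.corho a x := by
  rw [E.corho, E'.corho, D.d_comul, D.e_counit, S'.tL_comp, ← cancel_epi (S.trho X).hom, ← H]
  simp only [Category.assoc]
  rw [reassoc_of% D.tL_t_inv, Iso.hom_inv_id_assoc, reassoc_of% D.tL_tI_hom_inv,
    Iso.hom_inv_id_assoc, reassoc_of% H, Iso.hom_inv_id_assoc]

lemma t_right_of (H : ∀ {X W P : C} (a : El I.comul W (X, P)) (x : El I.counit P pt),
      I'.corho (app₂ D.comul.hom a) (app₂ D.counit.hom x) = I.corho a x) (A : C) :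
    (D.t A S.tI).hom ≫ S'.tL A D.tI.hom ≫ (S'.trho A).hom = (S.trho A).hom := by
  have h := H (E.dElt (𝟙 (S.t A S.tI))) (E.eElt (𝟙 S.tI))
  rw [E.corho, E'.corho, D.d_comul, D.e_counit] at h
  simp only [E.d_dElt, E.e_eElt, S.tL_id, Category.comp_id] at h
  rw [← cancel_mono (S.trho A).inv, Iso.hom_inv_id, ← h]
  simp only [Category.assoc, Iso.hom_inv_id_assoc]
  rw [reassoc_of% D.tL_tI_hom_inv, Iso.hom_inv_id]

lemma frobL_of (H : ∀ A B K : C, S.δL A B K ≫ (D.p (S.t A B) K).hom ≫ S'.pR (D.t A B).hom K =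
      (D.t A (S.p B K)).hom ≫ S'.tL A (D.p B K).hom ≫ S'.δL A B K)
    {X Y X' Y' V Q : C} {c : El I.comul X (X', V)} {a : El I.mul (V, Y) Y'}
    {r : El I.mul (X, Y) Q} {s : El I.comul Q (X', Y')} (h : I.FrobL c a r s) :
    I'.FrobL (app₂ D.comul.hom c) (app₂ D.mul.hom a) (app₂ D.mul.hom r) (app₂ D.comul.hom s) := by
  rw [E.frobL] at h
  rw [E'.frobL, D.d_comul, D.d_comul, D.m_mul, D.m_mul, S'.pR_comp, S'.tL_comp]
  have H' := H X' V Y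
  rw [← Iso.inv_comp_eq] at H'
  simp only [Category.assoc]
  rw [← reassoc_of% h, ← reassoc_of% H', reassoc_of% D.tL_t_inv, reassoc_of% D.pR_t_hom_inv,
    D.pR_p]

lemma δL_of (H : ∀ {X Y X' Y' V Q : C} {c : El I.comul X (X', V)} {a : El I.mul (V, Y) Y'}
    {r : El I.mul (X, Y) Q} {s : El I.comul Q (X', Y')}, I.FrobL c a r s →
    I'.FrobL (app₂ D.comul.hom c) (app₂ D.mul.hom a) (app₂ D.mul.hom r) (app₂ D.comul.hom s))
    (A B K : C) : S.δL A B K ≫ (D.p (S.t A B) K).hom ≫ S'.pR (D.t A B).hom K =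
      (D.t A (S.p B K)).hom ≫ S'.tL A (D.p B K).hom ≫ S'.δL A B K := by
  have h := E'.frobL.1 (H (c := E.dElt (𝟙 (S.t A B))) (a := E.mElt (𝟙 (S.p B K)))
    (r := E.mElt (𝟙 (S.p (S.t A B) K))) (s := E.dElt (S.δL A B K))
    (E.frobL.2 (by simp [S.tL_id, S.pR_id])))
  rw [D.d_comul, D.d_comul, D.m_mul, D.m_mul] at h
  simp only [E.d_dElt, E.m_mElt, Category.comp_id, Category.id_comp, Category.assoc] at h
  rw [← Iso.inv_comp_eq, ← reassoc_of% h, D.pR_t_inv_hom, Category.comp_id]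

lemma frobR_of (H : ∀ A B K : C, S.δR A B K ≫ (D.p A (S.t B K)).hom ≫ S'.pL A (D.t B K).hom =
      (D.t (S.p A B) K).hom ≫ S'.tR (D.p A B).hom K ≫ S'.δR A B K)
    {X Y X' Y' V Q : C} {c : El I.comul Y (V, Y')} {a : El I.mul (X, V) X'}
    {r : El I.mul (X, Y) Q} {s : El I.comul Q (X', Y')} (h : I.FrobR c a r s) :
    I'.FrobR (app₂ D.comul.hom c) (app₂ D.mul.hom a) (app₂ D.mul.hom r) (app₂ D.comul.hom s) := by
  rw [E.frobR] at h
  rw [E'.frobR, D.d_comul, D.d_comul, D.m_mul, D.m_mul, S'.pL_comp, S'.tR_comp]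
  have H' := H X V Y'
  rw [← Iso.inv_comp_eq] at H'
  simp only [Category.assoc]
  rw [← reassoc_of% h, ← reassoc_of% H', reassoc_of% D.tR_t_inv, reassoc_of% D.pL_t_hom_inv,
    D.pL_p]

lemma δR_of (H : ∀ {X Y X' Y' V Q : C} {c : El I.comul Y (V, Y')} {a : El I.mul (X, V) X'}
    {r : El I.mul (X, Y) Q} {s : El I.comul Q (X', Y')}, I.FrobR c a r s →
    I'.FrobR (app₂ D.comul.hom c) (app₂ D.mul.hom a) (app₂ D.mul.hom r) (app₂ D.comul.hom s))
    (A B K : C) : S.δR A B K ≫ (D.p A (S.t B K)).hom ≫ S'.pL A (D.t B K).hom =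
      (D.t (S.p A B) K).hom ≫ S'.tR (D.p A B).hom K ≫ S'.δR A B K := by
  have h := E'.frobR.1 (H (c := E.dElt (𝟙 (S.t B K))) (a := E.mElt (𝟙 (S.p A B)))
    (r := E.mElt (𝟙 (S.p A (S.t B K)))) (s := E.dElt (S.δR A B K))
    (E.frobR.2 (by simp [S.tR_id, S.pL_id])))
  rw [D.d_comul, D.d_comul, D.m_mul, D.m_mul] at h
  simp only [E.d_dElt, E.m_mElt, Category.comp_id, Category.id_comp, Category.assoc] at h
  rw [← Iso.inv_comp_eq, ← reassoc_of% h, D.pL_t_inv_hom, Category.comp_id]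

lemma mul_isUnit {X Y Z : C} {a : El I.mul (X, Y) Z} {q : El I.mulAdj.R Z (X, Y)}
    (h : I.mulAdj.IsUnit a q) : I'.mulAdj.IsUnit (app₂ D.mul.hom a) (app₂ D.mulR.hom q) := by
  rw [E.mul_isUnit_iff] at h
  rw [E'.mul_isUnit_iff, D.m_mul, D.mR_mulR, Category.assoc, reassoc_of% h, Iso.inv_hom_id]

lemma mul_counit {X Y Z Z' : C} (w : El I.mulAdj.R Z (X, Y)) (v : El I.mul (X, Y) Z') :
    I'.mulAdj.counit (app₂ D.mulR.hom w) (app₂ D.mul.hom v) = I.mulAdj.counit w v := by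
  rw [E.mul_counit, E'.mul_counit, D.m_mul, D.mR_mulR, Category.assoc, Iso.hom_inv_id_assoc]

lemma one_isUnit {Z : C} {x : El I.one pt Z} {y : El I.oneAdj.R Z pt}
    (h : I.oneAdj.IsUnit x y) : I'.oneAdj.IsUnit (app₂ D.one.hom x) (app₂ D.oneR.hom y) := by
  rw [E.one_isUnit_iff] at h
  rw [E'.one_isUnit_iff, D.u_one, D.uR_oneR, Category.assoc, reassoc_of% h, Iso.inv_hom_id]

lemma one_counit {Z Z' : C} (y : El I.oneAdj.R Z pt) (x : El I.one pt Z') :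
    I'.oneAdj.counit (app₂ D.oneR.hom y) (app₂ D.one.hom x) = I.oneAdj.counit y x := by
  rw [E.one_counit, E'.one_counit, D.u_one, D.uR_oneR, Category.assoc, Iso.hom_inv_id_assoc]

/-- The image of a loop. -/
def mapLoop {X X' : C} (ℓ : I.Loop X X') : I'.Loop X X' :=
  ⟨app₂ D.one.hom ℓ.p, app₂ D.comul.hom ℓ.c, app₂ D.mul.hom ℓ.s, app₂ D.counit.hom ℓ.t⟩

/-- Straightening is defined from the left Frobenius 2-cell, the right counit and the left unit, so
a transformation preserving these three preserves it. -/
lemma loopHom_mapLoop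
    (hL : ∀ {X Y X' Y' V Q : C} {c : El I.comul X (X', V)} {a : El I.mul (V, Y) Y'}
      {r : El I.mul (X, Y) Q} {s : El I.comul Q (X', Y')}, I.FrobL c a r s →
      I'.FrobL (app₂ D.comul.hom c) (app₂ D.mul.hom a) (app₂ D.mul.hom r) (app₂ D.comul.hom s))
    (hl : ∀ {X W P : C} (p : El I.one pt P) (a : El I.mul (P, X) W),
      I'.lam (app₂ D.one.hom p) (app₂ D.mul.hom a) = I.lam p a)
    (hr : ∀ {X W P : C} (a : El I.comul W (X, P)) (x : El I.counit P pt),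
      I'.corho (app₂ D.comul.hom a) (app₂ D.counit.hom x) = I.corho a x)
    {X X' : C} (ℓ : I.Loop X X') : E'.loopHom (D.mapLoop ℓ) = E.loopHom ℓ := by
  obtain ⟨K, a, b, hab, h⟩ := (E.snake_iff ℓ _).2 rfl
  refine ((E'.snake_iff (D.mapLoop ℓ) _).1 ⟨K, app₂ D.mul.hom a, app₂ D.comul.hom b, hL hab, ?_⟩).symm
  exact h.trans (congrArg₂ (· ≫ ·) (hr b ℓ.t) (hl ℓ.p a)).symm

end

section

variable {R : Represents I S} {R' : Represents I' S'} (D : CompatibleIso R.frobDict R'.frobDict)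

lemma trVal_of (H : ∀ (X : C) {A B : C} (f : S.p X A ⟶ S.p X B),
      S'.tr X ((D.p X A).inv ≫ f ≫ (D.p X B).hom) = S.tr X f)
    {A B X X' Z : C} (ℓ : I.Loop X X')
    (hℓ : R'.frobDict.loopHom (D.mapLoop ℓ) = R.frobDict.loopHom ℓ) (v : El I.mul (X, B) Z)
    (w : El I.mulAdj.R Z (X', A)) :
    trVal I'.trace (D.mapLoop ℓ) (app₂ D.mul.hom v) (app₂ D.mulR.hom w) = trVal I.trace ℓ v w := by
  rw [R.trVal_eq, R'.trVal_eq, hℓ, D.m_mul, D.mR_mulR, ← H]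
  have e := D.pR_p (R.frobDict.loopHom ℓ) A
  rw [← Iso.inv_comp_eq] at e
  simp only [Category.assoc]
  rw [← e]
  simp only [Category.assoc, Iso.hom_inv_id_assoc]

/-- A loop straightening to the identity turns the condition on the trace 2-cell into the condition
on the trace functions. -/
lemma tr_of (H : ∀ {A B X X' Z : C} (ℓ : I.Loop X X') (v : El I.mul (X, B) Z)
      (w : El I.mulAdj.R Z (X', A)),
      trVal I'.trace (D.mapLoop ℓ) (app₂ D.mul.hom v) (app₂ D.mulR.hom w) = trVal I.trace ℓ v w)
    (hℓ : ∀ {X X' : C} (ℓ : I.Loop X X'),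
      R'.frobDict.loopHom (D.mapLoop ℓ) = R.frobDict.loopHom ℓ)
    (X : C) {A B : C} (f : S.p X A ⟶ S.p X B) :
    S'.tr X ((D.p X A).inv ≫ f ≫ (D.p X B).hom) = S.tr X f := by
  obtain ⟨ℓ, h⟩ := R.frobDict.exists_loop (S := S.toStarAutonomous) (𝟙 X)
  have e := H ℓ (R.frobDict.mElt f) (R.frobDict.mRElt (𝟙 (S.p X A)))
  rw [R.trVal_eq, R'.trVal_eq, hℓ, D.m_mul, D.mR_mulR] at e
  have h' : R.frobDict.loopHom ℓ = 𝟙 X := h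
  rw [h'] at e
  simpa [S.pR_id, S'.pR_id] using e

end

section

variable (R : Represents I S) (R' : Represents I' S')

/-- The isomorphisms of the operations which are induced by an isomorphism of interpretations. -/
def ofInterpretationIso (f : InterpretationIso I I') :
    CompatibleIso R.frobDict R'.frobDict where
  mul := f.mul
  one := f.one
  comul := f.comul
  counit := f.counit
  mulR := f.mulR
  oneR := f.oneR
  -- For corepresented profunctors a 2-cell induces a transformation in the opposite direction,
  -- hence the inversion here and for the unit `I`.
  t A B := ((natIsoOfCellRev R.comul R'.comul f.comul).app (A, B)).symm
  tI := ((natIsoOfCellRev R.counit R'.counit f.counit).app pt).symm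
  p A B := (natIsoOfCell R.mul R'.mul f.mul).app (A, B)
  bot := (natIsoOfCell R.one R'.one f.one).app pt
  t_natural {A A' B B'} k h :=
    (natIsoOfCellRev R.comul R'.comul f.comul).inv.naturality (Prod.mkHom k h)
  p_natural {A A' B B'} k h :=
    (natIsoOfCell R.mul R'.mul f.mul).hom.naturality (Prod.mkHom k h)
  m_mul a := val_app₂_iso R.mul R'.mul f.mul a
  u_one x := val_app₂_iso R.one R'.one f.one x
  d_comul c := coval_app₂_iso R.comul R'.comul f.comul c
  e_counit x := coval_app₂_iso R.counit R'.counit f.counit x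
  mR_mulR {X Y Z} w := by
    -- Preservation of the counit, tested at the universal element, determines the component at the
    -- right adjoint from the one at the multiplication.
    have h := f.mul_counit w (R.frobDict.mElt (𝟙 (S.p X Y)))
    rw [R.frobDict.mul_counit, R'.frobDict.mul_counit] at h
    have e : R'.frobDict.m (app₂ f.mul.hom (R.frobDict.mElt (𝟙 (S.p X Y)))) =
      R.frobDict.m (R.frobDict.mElt (𝟙 (S.p X Y))) ≫
        ((natIsoOfCell R.mul R'.mul f.mul).app (X, Y)).hom := val_app₂_iso R.mul R'.mul f.mul _
    rw [e, R.frobDict.m_mElt, Category.id_comp, Category.id_comp] at h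
    exact (Iso.eq_inv_comp _).2 h
  uR_oneR {Z} y := by
    have h := f.one_counit y (R.frobDict.uElt (𝟙 S.bot))
    rw [R.frobDict.one_counit, R'.frobDict.one_counit] at h
    have e : R'.frobDict.u (app₂ f.one.hom (R.frobDict.uElt (𝟙 S.bot))) =
      R.frobDict.u (R.frobDict.uElt (𝟙 S.bot)) ≫
        ((natIsoOfCell R.one R'.one f.one).app pt).hom := val_app₂_iso R.one R'.one f.one _
    rw [e, R.frobDict.u_uElt, Category.id_comp, Category.id_comp] at h
    exact (Iso.eq_inv_comp _).2 h

/-- The isomorphisms of the generating 1-cells which are induced by an isomorphism of traced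
`*`-autonomous structures. -/
noncomputable def ofStructureIso (g : StructureIso S S') : CompatibleIso R.frobDict R'.frobDict :=
  let α : @MonoidalCategory.tensor C _ S.par ≅ @MonoidalCategory.tensor C _ S'.par :=
    NatIso.ofComponents (fun X => g.p X.1 X.2) (fun f => g.p_natural f.1 f.2)
  let β : @MonoidalCategory.tensor C _ S.tensor ≅ @MonoidalCategory.tensor C _ S'.tensor :=
    NatIso.ofComponents (fun X => g.t X.1 X.2) (fun f => g.t_natural f.1 f.2)
  let α₀ : Functor.fromPUnit.{u} S.bot ≅ Functor.fromPUnit.{u} S'.bot :=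
    NatIso.ofComponents (fun _ => g.bot) (by simp)
  let β₀ : Functor.fromPUnit.{u} S.tI ≅ Functor.fromPUnit.{u} S'.tI :=
    NatIso.ofComponents (fun _ => g.tI) (by simp)
  -- The identifications coming from the adjunctions are used for the right adjoints, because
  -- `FrobDict.mR` and `FrobDict.uR` are defined by them; they agree with those of `R` and `R'` by
  -- `mR_eq` and `uR_eq`.
  let ρ := I.mulAdj.corep R.mul
  let ρ' := I'.mulAdj.corep R'.mul
  let σ := I.oneAdj.corep R.one
  let σ' := I'.oneAdj.corep R'.one
  { mul := R.mul ≪≫ toProfunctorIso α ≪≫ R'.mul.symm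
    one := R.one ≪≫ toProfunctorIso α₀ ≪≫ R'.one.symm
    comul := R.comul ≪≫ toProfunctorRevIso β.symm ≪≫ R'.comul.symm
    counit := R.counit ≪≫ toProfunctorRevIso β₀.symm ≪≫ R'.counit.symm
    mulR := ρ ≪≫ toProfunctorRevIso α.symm ≪≫ ρ'.symm
    oneR := σ ≪≫ toProfunctorRevIso α₀.symm ≪≫ σ'.symm
    t := g.t
    tI := g.tI
    p := g.p
    bot := g.bot
    t_natural := g.t_natural
    p_natural := g.p_natural
    m_mul := fun a => val_toProfunctorIso R.mul R'.mul α a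
    u_one := fun x => val_toProfunctorIso R.one R'.one α₀ x
    d_comul := fun c => coval_toProfunctorRevIso R.comul R'.comul β.symm c
    e_counit := fun x => coval_toProfunctorRevIso R.counit R'.counit β₀.symm x
    mR_mulR := fun w => coval_toProfunctorRevIso ρ ρ' α.symm w
    uR_oneR := fun y => coval_toProfunctorRevIso σ σ' α₀.symm y }

end

end CompatibleIso

/-! ### The bijection between the two kinds of isomorphisms -/

section

variable {I I' : Interpretation C} {S S' : TracedStarAutonomous C} (R : Represents I S)
  (R' : Represents I' S')

/-- The isomorphism of traced `*`-autonomous structures which is induced by an isomorphism of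
interpretations. -/
def InterpretationIso.toStructureIso (f : InterpretationIso I I') : StructureIso S S' :=
  let D := CompatibleIso.ofInterpretationIso R R' f
  { t := D.t
    tI := D.tI
    p := D.p
    bot := D.bot
    t_natural := D.t_natural
    p_natural := D.p_natural
    t_assoc := D.t_assoc_of f.coassoc
    p_assoc := D.p_assoc_of f.assoc
    t_left := D.t_left_of f.colam
    t_right := D.t_right_of f.corho
    p_left := D.p_left_of f.lam
    p_right := D.p_right_of f.rho
    δL := D.δL_of f.frobL
    δR := D.δR_of f.frobR
    trace := D.tr_of f.trace (D.loopHom_mapLoop f.frobL f.lam f.corho) }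

/-- The isomorphism of interpretations which is induced by an isomorphism of traced `*`-autonomous
structures. -/
noncomputable def StructureIso.toInterpretationIso (g : StructureIso S S') : InterpretationIso I I' :=
  let D := CompatibleIso.ofStructureIso R R' g
  { mul := D.mul
    one := D.one
    comul := D.comul
    counit := D.counit
    mulR := D.mulR
    oneR := D.oneR
    assoc := D.assoc_of g.p_assoc
    lam := D.lam_of g.p_left
    rho := D.rho_of g.p_right
    coassoc := D.coassoc_of g.t_assoc
    colam := D.colam_of g.t_left
    corho := D.corho_of g.t_right
    frobL := D.frobL_of g.δL
    frobR := D.frobR_of g.δR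
    mul_unit := D.mul_isUnit
    mul_counit := D.mul_counit
    one_unit := D.one_isUnit
    one_counit := D.one_counit
    trace := fun ℓ v w => D.trVal_of g.trace ℓ (D.loopHom_mapLoop (D.frobL_of g.δL)
      (D.lam_of g.p_left) (D.corho_of g.t_right) ℓ) v w }

lemma CompatibleIso.compatible (D : CompatibleIso R.frobDict R'.frobDict)
    {f : InterpretationIso I I'} {g : StructureIso S S'} (h₁ : f.mul = D.mul) (h₂ : f.one = D.one)
    (h₃ : f.comul = D.comul) (h₄ : f.counit = D.counit) (h₅ : f.mulR = D.mulR)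
    (h₆ : f.oneR = D.oneR) (k₁ : g.p = D.p) (k₂ : g.bot = D.bot) (k₃ : g.t = D.t)
    (k₄ : g.tI = D.tI) : Compatible R R' f g where
  mul a := by rw [h₁, k₁]; exact D.m_mul a
  one x := by rw [h₂, k₂]; exact D.u_one x
  comul c := by rw [h₃, k₃]; exact D.d_comul c
  counit x := by rw [h₄, k₄]; exact D.e_counit x
  mulR w := by
    rw [h₅, k₁, ← R.mR_eq, ← R'.mR_eq]
    exact D.mR_mulR w
  oneR y := by
    rw [h₆, k₂, ← R.uR_eq, ← R'.uR_eq]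
    exact D.uR_oneR y

/-- All other fields are propositions. The tensor components are compared through their inverses
because these are what compatibility with a corepresented 1-cell determines. -/
lemma StructureIso.ext_of_components {g g' : StructureIso S S'} (h₁ : ∀ A B, (g.t A B).inv = (g'.t A B).inv)
    (h₂ : g.tI.inv = g'.tI.inv) (h₃ : ∀ A B, (g.p A B).hom = (g'.p A B).hom)
    (h₄ : g.bot.hom = g'.bot.hom) : g = g' := by
  have k₁ : g.t = g'.t := funext fun A => funext fun B => Iso.ext_inv (h₁ A B)
  have k₂ : g.tI = g'.tI := Iso.ext_inv h₂
  have k₃ : g.p = g'.p := funext fun A => funext fun B => Iso.ext (h₃ A B)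
  have k₄ : g.bot = g'.bot := Iso.ext h₄
  cases g
  cases g'
  cases k₁
  cases k₂
  cases k₃
  cases k₄
  rfl

lemma InterpretationIso.ext_of_components {f f' : InterpretationIso I I'} (h₁ : f.mul = f'.mul)
    (h₂ : f.one = f'.one) (h₃ : f.comul = f'.comul) (h₄ : f.counit = f'.counit)
    (h₅ : f.mulR = f'.mulR) (h₆ : f.oneR = f'.oneR) : f = f' := by
  cases f
  cases f'
  cases h₁
  cases h₂
  cases h₃
  cases h₄
  cases h₅
  cases h₆
  rfl

/-- Uniqueness is Yoneda: compatibility at the universal element, whose morphism is an identity,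
computes each component of `g` from `f`. -/
theorem existsUnique_structureIso (f : InterpretationIso I I') :
    ∃! g : StructureIso S S', Compatible R R' f g := by
  refine ⟨f.toStructureIso R R', (CompatibleIso.ofInterpretationIso R R' f).compatible R R' rfl rfl
    rfl rfl rfl rfl rfl rfl rfl rfl, fun g hg => ?_⟩
  have hf : Compatible R R' f (f.toStructureIso R R') :=
    (CompatibleIso.ofInterpretationIso R R' f).compatible R R' rfl rfl rfl rfl rfl rfl rfl rfl
      rfl rfl
  refine StructureIso.ext_of_components (fun A B => ?_) ?_ (fun A B => ?_) ?_
  · have h := (hg.comul (R.frobDict.dElt (𝟙 (S.t A B)))).symm.trans (hf.comul _)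
    have e : R.d (R.frobDict.dElt (𝟙 (S.t A B))) = 𝟙 _ := R.frobDict.d_dElt _
    simpa only [e, Category.comp_id] using h
  · have h := (hg.counit (R.frobDict.eElt (𝟙 S.tI))).symm.trans (hf.counit _)
    have e : R.e (R.frobDict.eElt (𝟙 S.tI)) = 𝟙 _ := R.frobDict.e_eElt _
    simpa only [e, Category.comp_id] using h
  · have h := (hg.mul (R.frobDict.mElt (𝟙 (S.p A B)))).symm.trans (hf.mul _)
    have e : R.m (R.frobDict.mElt (𝟙 (S.p A B))) = 𝟙 _ := R.frobDict.m_mElt _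
    simpa only [e, Category.id_comp] using h
  · have h := (hg.one (R.frobDict.uElt (𝟙 S.bot))).symm.trans (hf.one _)
    have e : R.u (R.frobDict.uElt (𝟙 S.bot)) = 𝟙 _ := R.frobDict.u_uElt _
    simpa only [e, Category.id_comp] using h

/-- Compatibility prescribes the morphism of the image of every element, and the identifications of
`R'` are injective, so each 2-cell of `f` is determined by `g`. -/
theorem existsUnique_interpretationIso (g : StructureIso S S') :
    ∃! f : InterpretationIso I I', Compatible R R' f g := by
  refine ⟨g.toInterpretationIso R R', (CompatibleIso.ofStructureIso R R' g).compatible R R' rfl rfl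
    rfl rfl rfl rfl rfl rfl rfl rfl, fun f hf => ?_⟩
  have hg : Compatible R R' (g.toInterpretationIso R R') g :=
    (CompatibleIso.ofStructureIso R R' g).compatible R R' rfl rfl rfl rfl rfl rfl rfl rfl rfl rfl
  exact InterpretationIso.ext_of_components
    (Iso.ext (hom_ext₂ fun _ _ a => app₂_injective R'.mul ((hf.mul a).trans (hg.mul a).symm)))
    (Iso.ext (hom_ext₂ fun _ _ a => app₂_injective R'.one ((hf.one a).trans (hg.one a).symm)))
    (Iso.ext (hom_ext₂ fun _ _ a => app₂_injective R'.comul ((hf.comul a).trans (hg.comul a).symm)))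
    (Iso.ext (hom_ext₂ fun _ _ a =>
      app₂_injective R'.counit ((hf.counit a).trans (hg.counit a).symm)))
    (Iso.ext (hom_ext₂ fun _ _ a => app₂_injective R'.mulR ((hf.mulR a).trans (hg.mulR a).symm)))
    (Iso.ext (hom_ext₂ fun _ _ a => app₂_injective R'.oneR ((hf.oneR a).trans (hg.oneR a).symm)))

end

end

end TracedStar

theorem proposition3 (C : Type u) [SmallCategory C] [IsIdempotentComplete C] :
    (∀ I : TracedStar.Interpretation C,
      ∃ S : TracedStar.TracedStarAutonomous C, Nonempty (TracedStar.Represents I S)) ∧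
    (∀ S : TracedStar.TracedStarAutonomous C,
      ∃ I : TracedStar.Interpretation C, Nonempty (TracedStar.Represents I S)) ∧
    (∀ (I I' : TracedStar.Interpretation C) (S S' : TracedStar.TracedStarAutonomous C)
      (R : TracedStar.Represents I S) (R' : TracedStar.Represents I' S'),
      (∀ f : TracedStar.InterpretationIso I I',
        ∃! g : TracedStar.StructureIso S S', TracedStar.Compatible R R' f g) ∧
      (∀ g : TracedStar.StructureIso S S',
        ∃! f : TracedStar.InterpretationIso I I', TracedStar.Compatible R R' f g)) := by
  exact ⟨fun I => I.exists_represents, fun S => S.exists_represents, fun _ _ _ _ R R' =>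
    ⟨TracedStar.existsUnique_structureIso R R', TracedStar.existsUnique_interpretationIso R R'⟩⟩
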